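/- Let $H^1(\mathbb R)$ denote the usual Sobolev space; its members are identified with their locally absolutely continuous representatives, and $H^1_{\mathrm{loc}}(\mathbb R)$ and $H^1_{\mathrm c}(\mathbb R)$ denote its local version and its subspace of compactly supported functions. Let $u\in H^1(\mathbb R)$ be real-valued and let $\mu$ be a non-negative finite Borel measure on $\mathbb R$ such that $$\mu(B)\ \ge\ \int_B u(x)^2+u'(x)^2\,dx\qquad\text{for every Borel set } B\subseteq\mathbb R .$$ Let $\upsilon$ be the non-negative finite Borel measure determined by $\mu(B)=\int_B u^2+u'^2\,dx+\upsilon(B)$ for all Borel sets $B$, and let $\omega=u-u''$, that is, $\omega(h)=\int_{\mathbb R}uh\,dx+\int_{\mathbb R}u'h'\,dx$. Assume that $(u,\mu)$ belongs to the class $\mathcal E$, i.e., that for both choices of the sign $$\int_{\mathbb R}e^{\pm x}\bigl(u'(x)\mp u(x)\bigr)^2dx+\int_{\mathbb R}e^{\pm x}\,d\upsilon(x)<\infty .$$ A solution of $-f''+\frac14 f=z\,\omega f+z^2\upsilon f$ with $z\in\mathbb C$ is a complex-valued function $f\in H^1_{\mathrm{loc}}(\mathbb R)$ such that $$\int_{\mathbb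 R}f'h'\,dx+\frac14\int_{\mathbb R}fh\,dx=z\,\omega(fh)+z^2\int_{\mathbb R}fh\,d\upsilon$$ for every $h\in H^1_{\mathrm c}(\mathbb R)$. The spectrum $\sigma$ is the set of all $z\in\mathbb C$ for which this equation has a nontrivial solution in $H^1(\mathbb R)$. Then $\sigma$ consists of nonzero real numbers and has only finitely many elements in every bounded set, $u$ is integrable over $\mathbb R$, the limit and the series below converge, and $$\lim_{r\to\infty}\ \sum_{\lambda\in\sigma,\ |\lambda|\le r}\frac1\lambda=\int_{\mathbb R}u(x)\,dx,\qquad \frac12\sum_{\lambda\in\sigma}\frac1{\lambda^2}=\mu(\mathbb R).$$ -/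

import Mathlib

open MeasureTheory Filter Topology

noncomputable section

namespace CamassaHolm

/-- `f ∈ H¹(ℝ)`. Members of `H¹(ℝ)` are identified with their locally absolutely continuous
representatives, whose weak derivative is the almost everywhere classical derivative. -/
structure MemH1 {F : Type*} [NormedAddCommGroup F] [NormedSpace ℝ F] (f : ℝ → F) : Prop where
  absCont : ∀ a b : ℝ, AbsolutelyContinuousOnInterval f a b
  memLp : MemLp f 2 volume
  memLp_deriv : MemLp (deriv f) 2 volume

/-- `f ∈ H¹_loc(ℝ)`, for the locally absolutely continuous representative
(`f` is continuous, hence automatically locally square integrable). -/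
structure MemH1loc {F : Type*} [NormedAddCommGroup F] [NormedSpace ℝ F] (f : ℝ → F) : Prop where
  absCont : ∀ a b : ℝ, AbsolutelyContinuousOnInterval f a b
  memLp_deriv : ∀ a b : ℝ, MemLp (deriv f) 2 (volume.restrict (Set.Icc a b))

/-- The functions in `H¹(ℝ)` with compact support. -/
def MemH1c {F : Type*} [NormedAddCommGroup F] [NormedSpace ℝ F] (f : ℝ → F) : Prop :=
  MemH1 f ∧ HasCompactSupport f

/-- The Borel measure with Lebesgue density `u² + u'²`. -/
def energyMeasure (u : ℝ → ℝ) : Measure ℝ :=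
  volume.withDensity fun x => ENNReal.ofReal (u x ^ 2 + deriv u x ^ 2)

/-- The set `𝓓` of all pairs `(u, μ)` with `u ∈ H¹(ℝ)` real-valued and `μ` a finite Borel measure
such that `∫_B u² + u'² dx ≤ μ(B)` for every Borel set `B`. -/
def classD : Set ((ℝ → ℝ) × Measure ℝ) :=
  {p | MemH1 p.1 ∧ IsFiniteMeasure p.2 ∧
    ∀ B : Set ℝ, MeasurableSet B →
      ∫⁻ x in B, ENNReal.ofReal (p.1 x ^ 2 + deriv p.1 x ^ 2) ≤ p.2 B}

/-- The measure `υ`, determined by `μ(B) = ∫_B u² + u'² dx + υ(B)`;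
see `CamassaHolm.measure_eq_lintegral_add_upsilon`. -/
def upsilon (u : ℝ → ℝ) (μ : Measure ℝ) : Measure ℝ :=
  μ - energyMeasure u

theorem measure_eq_lintegral_add_upsilon {u : ℝ → ℝ} {μ : Measure ℝ} (h : (u, μ) ∈ classD)
    {B : Set ℝ} (hB : MeasurableSet B) :
    μ B = (∫⁻ x in B, ENNReal.ofReal (u x ^ 2 + deriv u x ^ 2)) + upsilon u μ B := by
  obtain ⟨-, hfin, hle⟩ := h
  have hle' : energyMeasure u ≤ μ := by
    refine Measure.le_iff.2 fun s hs => ?_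
    rw [energyMeasure, withDensity_apply _ hs]
    exact hle s hs
  have hfin' : IsFiniteMeasure μ := hfin
  have : IsFiniteMeasure (energyMeasure u) := isFiniteMeasure_of_le μ hle'
  have key : upsilon u μ + energyMeasure u = μ := Measure.sub_add_cancel_of_le hle'
  calc μ B = (upsilon u μ + energyMeasure u) B := by rw [key]
    _ = _ := by rw [Measure.add_apply, add_comm, energyMeasure, withDensity_apply _ hB]

/-- The growth restriction
`∫ e^{s x} (u'(x) - s u(x))² dx + ∫ e^{s x} dυ(x) < ∞`, used with the signs `s = 1` and `s = -1`. -/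
def GrowthCondition (s : ℝ) (u : ℝ → ℝ) (μ : Measure ℝ) : Prop :=
  (∫⁻ x, ENNReal.ofReal (Real.exp (s * x) * (deriv u x - s * u x) ^ 2)) +
    (∫⁻ x, ENNReal.ofReal (Real.exp (s * x)) ∂(upsilon u μ)) < ⊤

/-- The set `𝓔₊`. -/
def classEPlus : Set ((ℝ → ℝ) × Measure ℝ) :=
  {p | p ∈ classD ∧ GrowthCondition 1 p.1 p.2}

/-- The set `𝓔₋`. -/
def classEMinus : Set ((ℝ → ℝ) × Measure ℝ) :=
  {p | p ∈ classD ∧ GrowthCondition (-1) p.1 p.2}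

/-- The set `𝓔 = 𝓔₊ ∩ 𝓔₋`. -/
def classE : Set ((ℝ → ℝ) × Measure ℝ) :=
  classEPlus ∩ classEMinus

/-- The distribution `ω = u - u''`, acting by `ω(h) = ∫ u h dx + ∫ u' h' dx`. -/
def omega (u : ℝ → ℝ) (h : ℝ → ℂ) : ℂ :=
  (∫ x, (u x : ℂ) * h x) + ∫ x, ((deriv u x : ℝ) : ℂ) * deriv h x

/-- Solutions of `-f'' + f / 4 = z ω f + z² υ f`, in the weak sense. -/
def IsSolution (u : ℝ → ℝ) (μ : Measure ℝ) (z : ℂ) (f : ℝ → ℂ) : Prop :=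
  MemH1loc f ∧ ∀ h : ℝ → ℂ, MemH1c h →
    (∫ x, deriv f x * deriv h x) + (1 / 4 : ℂ) * (∫ x, f x * h x) =
      z * omega u (fun x => f x * h x) + z ^ 2 * ∫ x, f x * h x ∂(upsilon u μ)

/-- The spectrum `σ`: all `z ∈ ℂ` for which there is a nontrivial solution in `H¹(ℝ)`. -/
def spectrumSet (u : ℝ → ℝ) (μ : Measure ℝ) : Set ℂ :=
  {z | ∃ f : ℝ → ℂ, IsSolution u μ z f ∧ MemH1 f ∧ f ≠ 0}

/-- A discrete set of nonzero reals: no accumulation point in `ℂ`, that is, finitely many members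
in every bounded region, all of them real and nonzero. -/
def IsDiscreteNonzeroReal (σ : Set ℂ) : Prop :=
  (∀ z ∈ σ, z.im = 0 ∧ z ≠ 0) ∧ ∀ r : ℝ, {z ∈ σ | ‖z‖ ≤ r}.Finite

/-- The principal value sum of `1/λ` over `λ ∈ σ` exists and equals `S`:
the sums over `λ ∈ σ` with `|λ| ≤ r` converge to `S` as `r → ∞`.
(Meant for `σ` with finitely many members in every bounded region.) -/
def HasPrincipalSum (σ : Set ℂ) (S : ℂ) : Prop :=
  Tendsto (fun r : ℝ => ∑ᶠ z ∈ {z ∈ σ | ‖z‖ ≤ r}, 1 / z) atTop (𝓝 S)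

end CamassaHolm

end

/-!
The equation becomes an eigenvalue problem for a Hilbert–Schmidt operator `T` on the half-line.
Substitute `y = eˣ` and write `f(x) = e^{-x/2} F(eˣ)` with `F(y) = ∫₀^y φ`. Then `f ∈ H¹(ℝ)`
corresponds to `φ ∈ L²(0, ∞)`, the energy form `∫ f' h' + ¼ ∫ f h` becomes the inner product of
`L²(0, ∞)`, and the equation reads `φ = z (L + L*) φ + z² J* J φ`, where `L φ = κ F` with
`κ(y) = (u + u')(log y) / y`, and `J φ = F` as an element of `L²(ν)`, with `ν` the image of
`e^{-x} υ` under `exp`. This quadratic pencil is linearized by the symmetric block operator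
`T (φ, ψ) = (L φ + L* φ + J* ψ, J φ)` on `L²(0, ∞) ⊕ L²(ν)` (`HalfLineString.op`): the spectrum
consists of the reciprocals of its nonzero eigenvalues (`spectrumSet_eq`). These are simple, because
an eigenvector without constant term solves a homogeneous Volterra equation (`eigenvector_unique`),
so sums over the spectrum are sums over an eigenbasis.

*Sum of squares.* The kernel of `T` is explicit, and its squared Hilbert–Schmidt norm is
`2 (∫ y κ² dy + ∫ y dν) = 2 μ(ℝ)` (`HalfLineString.exists_eigenbasis`, `moment_stringOf`).

*Trace.* In general `T` is not of trace class, so only the principal value of the sum of its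
eigenvalues makes sense. Let `Γ (φ, ψ) = (φ, -ψ)`. The part of `T` which involves `J` is odd under
`Γ`, and the part `L + L*` has a form `φ ↦ 2 ∫ κ F F' dy` that is nearly invisible on functions `F`
vanishing at finitely many well chosen points: where `κ` is constant, the integral telescopes. Hence
for every `η > 0` there is a space of step functions, of dimension `O(1) + η / ε`, outside of which
the form of `κ` is at most `η ε`, and on which its trace is within `η` of `∫ κ = ∫ u`
(`HalfLineString.exists_finset_abs_inner_opL_le`). A min-max argument
(`abs_sum_sub_sum_inner_le`) compares the sum of the eigenvalues of modulus at least `ε` with that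
trace. Apart from quantities that tend to zero with `η` and `ε`, the error is `ε |n₊(ε) - n₋(ε)|`,
where `n₊` and `n₋` count the positive and the negative eigenvalues of modulus at least `ε`. It
remains to see that `n₊ - n₋ = o(1 / ε)`. This holds because `n₊` and `n₋` have the same Weyl
asymptotics: only the absolutely continuous part `b² dy` of `ν` matters, and both are
`(1 / (π ε)) ∫ b dy + o(1 / ε)`. The bounds come from approximating `b` by a step function
(`HalfLineString.exists_step_approx`), from the sharp Poincaré inequality on small cells for the
upper bound, and from cosine test functions for the lower bound
(`HalfLineString.exists_ncard_bounds`, `HalfLineString.exists_abs_ncard_sub_le`).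

The integrability of `u` follows from the growth conditions, which control `∫ e^{±x} u²`
(`lintegral_exp_mul_sq_le`).
-/

namespace CamassaHolm

/-! ### Finite-dimensional linear algebra -/

section LinearAlgebra

/-- Truncation of `t` to the interval `[-ε, ε]`. -/
noncomputable def clamp (ε t : ℝ) : ℝ := max (-ε) (min t ε)

theorem clamp_of_abs_le {ε t : ℝ} (h : |t| ≤ ε) : clamp ε t = t := by
  obtain ⟨h1, h2⟩ := abs_le.1 h
  unfold clamp
  rw [min_eq_left h2, max_eq_right h1]

theorem clamp_of_ge {ε t : ℝ} (hε : 0 ≤ ε) (h : ε ≤ t) : clamp ε t = ε := by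
  unfold clamp
  rw [min_eq_right h, max_eq_right (by linarith)]

theorem clamp_of_le {ε t : ℝ} (hε : 0 ≤ ε) (h : t ≤ -ε) : clamp ε t = -ε := by
  unfold clamp
  rw [min_eq_left (by linarith), max_eq_left h]

theorem clamp_neg {ε : ℝ} (hε : 0 ≤ ε) (t : ℝ) : clamp ε (-t) = -clamp ε t := by
  unfold clamp
  rcases le_total t ε with h1 | h1 <;> rcases le_total (-ε) t with h2 | h2 <;>
    simp only [min_def, max_def] <;> split_ifs <;> linarith

/-- Truncations are integrals of counting functions over the level `s`. -/
theorem integral_step_eq_clamp {ε : ℝ} (hε : 0 ≤ ε) (t : ℝ) :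
    ∫ s in (-ε)..ε, (if s < t then (1 : ℝ) else 0) = clamp ε t + ε := by
  rw [intervalIntegral.integral_of_le (by linarith)]
  have : (fun s : ℝ => if s < t then (1 : ℝ) else 0) = (Set.Iio t).indicator 1 := by
    ext s; simp [Set.indicator_apply]
  rw [this, integral_indicator_one measurableSet_Iio, measureReal_restrict_apply measurableSet_Iio]
  have h2 : (Set.Iio t ∩ Set.Ioc (-ε) ε : Set ℝ) =ᵐ[volume] (Set.Ioc (-ε) (min t ε) : Set ℝ) := by
    have h3 : (Set.Iio t : Set ℝ) =ᵐ[volume] (Set.Iic t : Set ℝ) := Iio_ae_eq_Iic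
    have h4 : (Set.Ioc (-ε) (min t ε) : Set ℝ) = Set.Iic t ∩ Set.Ioc (-ε) ε := by
      ext x; simp only [Set.mem_inter_iff, Set.mem_Iic, Set.mem_Ioc, le_min_iff]; tauto
    rw [h4]
    exact ae_eq_set_inter h3 (ae_eq_refl _)
  rw [measureReal_congr h2, Real.volume_real_Ioc]
  unfold clamp
  rcases le_total (min t ε) (-ε) with h | h
  · rw [max_eq_right (by linarith), max_eq_left h]; ring
  · rw [max_eq_left (by linarith), max_eq_right h]; ring

theorem clamp_add_le {ε δ : ℝ} (hδ : 0 ≤ δ) (t : ℝ) : clamp ε (t + δ) ≤ clamp ε t + δ := by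
  unfold clamp
  rcases le_total (t + δ) ε with h1 | h1 <;> rcases le_total t ε with h2 | h2 <;>
    simp only [min_def, max_def] <;> split_ifs <;> linarith

theorem intervalIntegrable_step (a b t : ℝ) :
    IntervalIntegrable (fun s : ℝ => if s < t then (1 : ℝ) else 0) volume a b := by
  have : (fun s : ℝ => if s < t then (1 : ℝ) else 0) = (Set.Iio t).indicator 1 := by
    ext s; simp [Set.indicator_apply]
  rw [this, intervalIntegrable_iff]
  have h : IntegrableOn (fun _ : ℝ => (1 : ℝ)) (Set.uIoc a b) volume :=
    integrableOn_const (by simp [Set.uIoc]) (by simp)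
  exact h.indicator measurableSet_Iio

/-- A comparison of counting functions, up to a shift `δ` of the level and a bounded error `M`,
yields a comparison of truncated traces: integrate the counting functions over `[-ε, ε]`. -/
theorem sum_clamp_le {ι : Type*} [Fintype ι] {a b : ι → ℝ} {ε δ M : ℝ} (hε : 0 ≤ ε) (hδ : 0 ≤ δ)
    (h : ∀ s : ℝ, ∑ i, (if s < a i then (1 : ℝ) else 0) ≤
      ∑ i, (if s < b i + δ then (1 : ℝ) else 0) + M) :
    ∑ i, clamp ε (a i) ≤ ∑ i, clamp ε (b i) + δ * Fintype.card ι + 2 * ε * M := by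
  have hI : ∀ c : ι → ℝ, IntervalIntegrable
      (fun s : ℝ => ∑ i, (if s < c i then (1 : ℝ) else 0)) volume (-ε) ε := by
    intro c
    rw [show (fun s : ℝ => ∑ i, (if s < c i then (1 : ℝ) else 0)) =
      ∑ i, fun s : ℝ => (if s < c i then (1 : ℝ) else 0) from by funext s; simp]
    exact IntervalIntegrable.sum Finset.univ fun i _ => intervalIntegrable_step (-ε) ε (c i)
  have h1 : ∫ s in (-ε)..ε, (∑ i, (if s < a i then (1 : ℝ) else 0)) ≤
      ∫ s in (-ε)..ε, (∑ i, (if s < b i + δ then (1 : ℝ) else 0) + M) := by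
    exact intervalIntegral.integral_mono_on (by linarith) (hI a)
      ((hI fun i => b i + δ).add intervalIntegrable_const) fun s _ => h s
  rw [intervalIntegral.integral_add (hI fun i => b i + δ) intervalIntegrable_const,
    intervalIntegral.integral_finsetSum fun i _ => intervalIntegrable_step _ _ _,
    intervalIntegral.integral_finsetSum fun i _ => intervalIntegrable_step _ _ _] at h1
  simp only [integral_step_eq_clamp hε, intervalIntegral.integral_const, smul_eq_mul] at h1
  have h2 : ∑ i, (clamp ε (b i + δ) + ε) ≤ ∑ i, (clamp ε (b i) + δ + ε) :=
    Finset.sum_le_sum fun i _ => by linarith [clamp_add_le (ε := ε) hδ (b i)]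
  simp only [Finset.sum_add_distrib, Finset.sum_const, Finset.card_univ, nsmul_eq_mul] at h1 h2
  linarith

/-- A finite-dimensional subspace contains a nonzero common zero of fewer than its dimension many
linear functionals. -/
theorem exists_ne_zero_forall_eq_zero {H : Type*} [AddCommGroup H] [Module ℝ H]
    {ι : Type*} [Fintype ι] (W : Submodule ℝ H) [FiniteDimensional ℝ W] (f : ι → H →ₗ[ℝ] ℝ)
    (h : Fintype.card ι < Module.finrank ℝ W) : ∃ x ∈ W, x ≠ 0 ∧ ∀ i, f i x = 0 := by
  let g : W →ₗ[ℝ] (ι → ℝ) := LinearMap.pi fun i => (f i).comp W.subtype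
  have hg : LinearMap.ker g ≠ ⊥ := by
    apply LinearMap.ker_ne_bot_of_finrank_lt
    simpa using h
  obtain ⟨x, hx, hx0⟩ := (Submodule.ne_bot_iff _).1 hg
  refine ⟨x, x.2, by simpa using hx0, fun i => ?_⟩
  exact congrFun (LinearMap.mem_ker.1 hx) i

variable {H : Type*} [NormedAddCommGroup H] [InnerProductSpace ℝ H]

local notation "⟪" x ", " y "⟫" => inner ℝ x y

theorem finrank_span_eq_card_of_orthonormal {ι : Type*} [Fintype ι] {b : ι → H}
    (hb : Orthonormal ℝ b) : Module.finrank ℝ (Submodule.span ℝ (Set.range b)) = Fintype.card ι :=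
  finrank_span_eq_card hb.linearIndependent

/-- The trace of the compression of `T` to a subspace does not depend on the orthonormal basis. -/
theorem sum_inner_eq_of_span_le {ι κ : Type*} [Fintype ι] [Fintype κ] {b : ι → H} {c : κ → H}
    (hb : Orthonormal ℝ b) (hc : Orthonormal ℝ c)
    (h : Submodule.span ℝ (Set.range b) = Submodule.span ℝ (Set.range c)) (T : H →ₗ[ℝ] H) :
    ∑ i, ⟪T (b i), b i⟫ = ∑ k, ⟪T (c k), c k⟫ := by
  have hbe : ∀ x ∈ Submodule.span ℝ (Set.range b), x = ∑ i, ⟪b i, x⟫ • b i := by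
    intro x hx
    obtain ⟨l, rfl⟩ := (Submodule.mem_span_range_iff_exists_fun ℝ).1 hx
    simp [hb.inner_right_fintype]
  have hce : ∀ x ∈ Submodule.span ℝ (Set.range c), x = ∑ i, ⟪c i, x⟫ • c i := by
    intro x hx
    obtain ⟨l, rfl⟩ := (Submodule.mem_span_range_iff_exists_fun ℝ).1 hx
    simp [hc.inner_right_fintype]
  have h1 : ∀ i, ⟪T (b i), b i⟫ = ∑ k, ⟪c k, b i⟫ * ⟪T (b i), c k⟫ := by
    intro i
    have hi := hce (b i) (h ▸ Submodule.subset_span ⟨i, rfl⟩)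
    conv_lhs => rw [hi, ← hi]
    conv_lhs => arg 3; rw [hi]
    rw [inner_sum]
    simp [inner_smul_right]
  have h2 : ∀ k, ⟪T (c k), c k⟫ = ∑ i, ⟪c k, b i⟫ * ⟪T (b i), c k⟫ := by
    intro k
    have hk := hbe (c k) (h.symm ▸ Submodule.subset_span ⟨k, rfl⟩)
    conv_lhs => arg 2; rw [hk]
    rw [map_sum, sum_inner]
    simp [inner_smul_left, real_inner_comm]
  simp_rw [h1, h2]
  exact Finset.sum_comm

/-- If no nonzero vector of `W ⊓ W'` is orthogonal to `V`, then `W ⊓ W'` embeds into `V` by orthogonal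
projection; this bounds the dimensions of two subspaces of `U`. -/
theorem finrank_add_finrank_le {U V W W' : Submodule ℝ H} [FiniteDimensional ℝ U]
    [FiniteDimensional ℝ V] (hW : W ≤ U) (hW' : W' ≤ U)
    (h : ∀ x ∈ W, x ∈ W' → x ∈ Vᗮ → x = 0) :
    Module.finrank ℝ W + Module.finrank ℝ W' ≤ Module.finrank ℝ U + Module.finrank ℝ V := by
  have : FiniteDimensional ℝ W := Submodule.finiteDimensional_of_le hW
  have : FiniteDimensional ℝ W' := Submodule.finiteDimensional_of_le hW'
  have h1 := Submodule.finrank_sup_add_finrank_inf_eq W W'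
  have h2 : Module.finrank ℝ ↥(W ⊔ W') ≤ Module.finrank ℝ U :=
    Submodule.finrank_mono (sup_le hW hW')
  have h3 : Module.finrank ℝ ↥(W ⊓ W') ≤ Module.finrank ℝ V := by
    refine LinearMap.finrank_le_finrank_of_injective
      (f := (V.orthogonalProjectionOnto : H →ₗ[ℝ] V).comp (W ⊓ W').subtype) ?_
    rw [← LinearMap.ker_eq_bot, LinearMap.ker_eq_bot']
    intro x hx
    have hx' : V.orthogonalProjectionOnto (x : H) = 0 := hx
    rw [Submodule.orthogonalProjectionOnto_eq_zero_iff] at hx'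
    exact Subtype.ext (h x x.2.1 x.2.2 hx')
  omega

end LinearAlgebra

section Mirror

variable {H : Type*} [NormedAddCommGroup H] [InnerProductSpace ℝ H]

local notation "⟪" x ", " y "⟫" => inner ℝ x y

theorem norm_sq_sum_smul {ι : Type*} [Fintype ι] {b : ι → H} (hb : Orthonormal ℝ b) (c : ι → ℝ) :
    ‖∑ i, c i • b i‖ ^ 2 = ∑ i, c i ^ 2 := by
  rw [← real_inner_self_eq_norm_sq, sum_inner]
  refine Finset.sum_congr rfl fun i _ => ?_
  rw [real_inner_smul_left, hb.inner_right_fintype]; ring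

theorem inner_map_sum_smul {ι : Type*} [Fintype ι] {b : ι → H} {T : H →ₗ[ℝ] H} {a : ι → ℝ}
    (ha : ∀ i, ⟪T (b i), b i⟫ = a i) (hd : ∀ i k, i ≠ k → ⟪T (b i), b k⟫ = 0) (c : ι → ℝ) :
    ⟪T (∑ i, c i • b i), ∑ i, c i • b i⟫ = ∑ i, a i * c i ^ 2 := by
  rw [map_sum, sum_inner]
  refine Finset.sum_congr rfl fun i _ => ?_
  rw [inner_sum, Finset.sum_eq_single i]
  · rw [map_smul, real_inner_smul_left, real_inner_smul_right, ha]; ring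
  · intro k _ hk
    rw [map_smul, real_inner_smul_left, real_inner_smul_right, hd i k hk.symm]; ring
  · simp

theorem lt_inner_of_mem_span {ι : Type*} [Fintype ι] {b : ι → H} (hb : Orthonormal ℝ b)
    {T : H →ₗ[ℝ] H} {a : ι → ℝ} (ha : ∀ i, ⟪T (b i), b i⟫ = a i)
    (hd : ∀ i k, i ≠ k → ⟪T (b i), b k⟫ = 0) {s : ℝ} (hs : ∀ i, s < a i) {x : H}
    (hx : x ∈ Submodule.span ℝ (Set.range b)) (hx0 : x ≠ 0) : s * ‖x‖ ^ 2 < ⟪T x, x⟫ := by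
  obtain ⟨c, rfl⟩ := (Submodule.mem_span_range_iff_exists_fun ℝ).1 hx
  rw [norm_sq_sum_smul hb, inner_map_sum_smul ha hd, Finset.mul_sum]
  have : ∃ i, c i ≠ 0 := by
    by_contra! h
    exact hx0 (by simp [h])
  obtain ⟨i, hi⟩ := this
  refine Finset.sum_lt_sum (fun i _ => mul_le_mul_of_nonneg_right (hs i).le (sq_nonneg _))
    ⟨i, Finset.mem_univ _, mul_lt_mul_of_pos_right (hs i) (by positivity)⟩

theorem le_inner_of_mem_span {ι : Type*} [Fintype ι] {b : ι → H} (hb : Orthonormal ℝ b)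
    {T : H →ₗ[ℝ] H} {a : ι → ℝ} (ha : ∀ i, ⟪T (b i), b i⟫ = a i)
    (hd : ∀ i k, i ≠ k → ⟪T (b i), b k⟫ = 0) {s : ℝ} (hs : ∀ i, s ≤ a i) {x : H}
    (hx : x ∈ Submodule.span ℝ (Set.range b)) : s * ‖x‖ ^ 2 ≤ ⟪T x, x⟫ := by
  obtain ⟨c, rfl⟩ := (Submodule.mem_span_range_iff_exists_fun ℝ).1 hx
  rw [norm_sq_sum_smul hb, inner_map_sum_smul ha hd, Finset.mul_sum]
  exact Finset.sum_le_sum fun i _ => mul_le_mul_of_nonneg_right (hs i) (sq_nonneg _)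

theorem span_range_coe_orthonormalBasis {ι : Type*} [Fintype ι] {Y : Submodule ℝ H}
    (y : OrthonormalBasis ι ℝ Y) : Submodule.span ℝ (Set.range fun i => (y i : H)) = Y := by
  have := congrArg (Submodule.map Y.subtype) (y.toBasis.span_eq)
  rw [Submodule.map_span, Submodule.map_top, Submodule.range_subtype, ← Set.range_comp] at this
  convert this using 3
  ext x
  simp

variable {J K : Type*} [Fintype J] [Fintype K]

/-- If `T` is diagonal in an orthonormal family `b` whose span is invariant under the isometric
involution `Γ`, and `T + Γ T Γ` is at most `2 δ` on the orthogonal complement of `v`, then the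
truncated trace of `T` is almost nonpositive: `-Γ T Γ` is diagonal in `Γ b` with the negated
diagonal, and by min-max the two counting functions differ by a shift of `2 δ` and by `card K`. -/
theorem sum_clamp_le_of_mirror {ι : Type*} [Fintype ι] {T Γ : H →ₗ[ℝ] H}
    (hΓ : ∀ x y, ⟪Γ x, Γ y⟫ = ⟪x, y⟫) (hΓ2 : ∀ x, Γ (Γ x) = x)
    {b : ι → H} (hb : Orthonormal ℝ b) {a : ι → ℝ} (ha : ∀ i, ⟪T (b i), b i⟫ = a i)
    (hd : ∀ i k, i ≠ k → ⟪T (b i), b k⟫ = 0)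
    (hbΓ : ∀ i, Γ (b i) ∈ Submodule.span ℝ (Set.range b)) (v : K → H) {ε δ : ℝ} (hε : 0 ≤ ε)
    (hδ : 0 ≤ δ)
    (hV : ∀ x, (∀ k, ⟪v k, x⟫ = 0) → ⟪T x, x⟫ + ⟪T (Γ x), Γ x⟫ ≤ 2 * δ * ‖x‖ ^ 2) :
    ∑ i, clamp ε (a i) ≤ δ * Fintype.card ι + ε * Fintype.card K := by
  classical
  have key : ∀ s : ℝ, ∑ i, (if s < a i then (1 : ℝ) else 0) ≤
      ∑ i, (if s < -a i + 2 * δ then (1 : ℝ) else 0) + Fintype.card K := by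
    intro s
    let b1 : {i // s < a i} → H := fun i => b i
    let b2 : {i // ¬ s < -a i + 2 * δ} → H := fun i => Γ (b i)
    let b3 : {i // ¬ s < -a i + 2 * δ} → H := fun i => b i
    have hb1 : Orthonormal ℝ b1 := hb.comp _ Subtype.val_injective
    have hb3 : Orthonormal ℝ b3 := hb.comp _ Subtype.val_injective
    have hb2 : Orthonormal ℝ b2 := by
      rw [orthonormal_iff_ite] at hb3 ⊢
      intro i j
      rw [← hb3 i j]
      exact hΓ _ _
    have h1 : Submodule.span ℝ (Set.range b1) ≤ Submodule.span ℝ (Set.range b) := by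
      rw [Submodule.span_le]
      rintro _ ⟨i, rfl⟩
      exact Submodule.subset_span ⟨i, rfl⟩
    have h2 : Submodule.span ℝ (Set.range b2) ≤ Submodule.span ℝ (Set.range b) := by
      rw [Submodule.span_le]
      rintro _ ⟨i, rfl⟩
      exact hbΓ i
    have : FiniteDimensional ℝ (Submodule.span ℝ (Set.range b)) :=
      FiniteDimensional.span_of_finite ℝ (Set.finite_range b)
    have : FiniteDimensional ℝ (Submodule.span ℝ (Set.range v)) :=
      FiniteDimensional.span_of_finite ℝ (Set.finite_range v)
    have h3 := finrank_add_finrank_le (V := Submodule.span ℝ (Set.range v)) h1 h2 (by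
      intro x hx1 hx2 hx3
      by_contra hx0
      have hlt := lt_inner_of_mem_span hb1 (T := T) (a := fun i => a i) (fun i => ha i)
        (fun i k hik => hd i k fun h => hik (Subtype.ext h)) (s := s) (fun i => i.2) hx1 hx0
      have hx4 : Γ x ∈ Submodule.span ℝ (Set.range b3) := by
        obtain ⟨c, rfl⟩ := (Submodule.mem_span_range_iff_exists_fun ℝ).1 hx2
        rw [map_sum]
        refine Submodule.sum_mem _ fun i _ => ?_
        rw [map_smul, hΓ2]
        exact Submodule.smul_mem _ _ (Submodule.subset_span ⟨i, rfl⟩)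
      have hle := le_inner_of_mem_span hb3 (T := T) (a := fun i => a i) (fun i => ha i)
        (fun i k hik => hd i k fun h => hik (Subtype.ext h)) (s := 2 * δ - s)
        (fun i => by have := i.2; push Not at this; linarith) hx4
      have hn : ‖Γ x‖ ^ 2 = ‖x‖ ^ 2 := by
        rw [← real_inner_self_eq_norm_sq, hΓ, real_inner_self_eq_norm_sq]
      have := hV x fun k => (Submodule.mem_orthogonal _ _).1 hx3 _ (Submodule.subset_span ⟨k, rfl⟩)
      rw [hn] at hle
      nlinarith)
    rw [finrank_span_eq_card_of_orthonormal hb1, finrank_span_eq_card_of_orthonormal hb2,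
      finrank_span_eq_card_of_orthonormal hb] at h3
    have h4 : Module.finrank ℝ (Submodule.span ℝ (Set.range v)) ≤ Fintype.card K :=
      finrank_range_le_card v
    rw [Fintype.card_subtype_compl, Fintype.card_subtype, Fintype.card_subtype] at h3
    rw [Finset.sum_boole, Finset.sum_boole]
    have h5 := Finset.card_le_univ (Finset.univ.filter fun i => s < -a i + 2 * δ)
    norm_cast
    omega
  have := sum_clamp_le (b := fun i => -a i) hε (by linarith : (0 : ℝ) ≤ 2 * δ) key
  simp only [clamp_neg hε, Finset.sum_neg_distrib] at this
  linarith

/-- The sum of the eigenvalues of modulus at least `ε` of a symmetric operator `T` is close to the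
trace of the compression of `T` to a finite-dimensional space `span v`, provided `T` is almost
odd under the mirror symmetry `Γ` on the orthogonal complement of `v`. -/
theorem abs_sum_sub_sum_inner_le {T Γ : H →ₗ[ℝ] H} (hT : T.IsSymmetric)
    (hΓ : ∀ x y, ⟪Γ x, Γ y⟫ = ⟪x, y⟫) (hΓ2 : ∀ x, Γ (Γ x) = x)
    {e : J → H} (he : Orthonormal ℝ e) {τ : J → ℝ} (hτ : ∀ j, T (e j) = τ j • e j) {ε δ : ℝ}
    (hε : 0 < ε) (hδ : 0 ≤ δ) (hτε : ∀ j, ε ≤ |τ j|)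
    (hE : ∀ x, (∀ j, ⟪e j, x⟫ = 0) → |⟪T x, x⟫| ≤ ε * ‖x‖ ^ 2)
    {v : K → H} (hv : Orthonormal ℝ v) (hΓv : ∀ k, Γ (v k) = v k)
    (hV : ∀ x, (∀ k, ⟪v k, x⟫ = 0) → |⟪T x, x⟫ + ⟪T (Γ x), Γ x⟫| ≤ 2 * δ * ‖x‖ ^ 2) :
    |∑ j, τ j - ∑ k, ⟪T (v k), v k⟫| ≤ 2 * δ * (2 * Fintype.card J + Fintype.card K) +
      ε * Fintype.card K +
      ε * |(Fintype.card {j // ε ≤ τ j} : ℝ) - Fintype.card {j // τ j ≤ -ε}| := by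
  classical
  set E := Submodule.span ℝ (Set.range e) with hEdef
  set V := Submodule.span ℝ (Set.range v) with hVdef
  -- Everything happens in a finite-dimensional `Γ`-invariant space `U` containing `E` and `V`.
  set U := E ⊔ E.map Γ ⊔ V with hU
  have hEU : E ≤ U := le_sup_left.trans le_sup_left
  have hVU : V ≤ U := le_sup_right
  have hΓE : E.map Γ ≤ U := le_sup_right.trans le_sup_left
  have : FiniteDimensional ℝ E := FiniteDimensional.span_of_finite ℝ (Set.finite_range e)
  have : FiniteDimensional ℝ V := FiniteDimensional.span_of_finite ℝ (Set.finite_range v)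
  have : FiniteDimensional ℝ (E.map Γ) := by infer_instance
  have : FiniteDimensional ℝ U := by rw [hU]; infer_instance
  have hΓU : ∀ x ∈ U, Γ x ∈ U := by
    have : U ≤ U.comap Γ := by
      refine sup_le (sup_le ?_ ?_) ?_
      · exact fun x hx => hΓE (Submodule.mem_map_of_mem hx)
      · rintro _ ⟨x, hx, rfl⟩
        simpa [hΓ2] using hEU hx
      · rw [hVdef, Submodule.span_le]
        rintro _ ⟨k, rfl⟩
        simpa [hΓv] using hVU (Submodule.subset_span ⟨k, rfl⟩)
    exact this
  have hdim : Module.finrank ℝ U ≤ 2 * Fintype.card J + Fintype.card K := by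
    have h1 := Submodule.finrank_add_le_finrank_add_finrank (E ⊔ E.map Γ) V
    have h2 := Submodule.finrank_add_le_finrank_add_finrank E (E.map Γ)
    have h3 : Module.finrank ℝ (E.map Γ) ≤ Module.finrank ℝ E := Submodule.finrank_map_le Γ E
    have h4 : Module.finrank ℝ E ≤ Fintype.card J := finrank_range_le_card e
    have h5 : Module.finrank ℝ V ≤ Fintype.card K := finrank_range_le_card v
    rw [← hU] at h1
    omega
  -- On `U` the form of `T` is diagonal in `e` together with an eigenbasis of the compression of `T` to
  -- the complement of `E` in `U`. The eigenvalues `l` of the compression are at most `ε`.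
  set Y := Eᗮ ⊓ U with hY
  have : FiniteDimensional ℝ Y := Submodule.finiteDimensional_of_le inf_le_right
  have hEY : E ⊔ Y = U := Submodule.sup_orthogonal_inf_of_hasOrthogonalProjection hEU
  let S : Y →ₗ[ℝ] Y := (Y.orthogonalProjectionOnto : H →ₗ[ℝ] Y) ∘ₗ T ∘ₗ Y.subtype
  have hSi : ∀ y z : Y, ⟪S y, z⟫ = ⟪T (y : H), (z : H)⟫ := fun y z =>
    Submodule.inner_orthogonalProjectionOnto_eq_of_mem_right z (T y)
  have hS : S.IsSymmetric := by
    intro y z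
    rw [hSi, hT, real_inner_comm, ← hSi, real_inner_comm]
  let y := hS.eigenvectorBasis rfl
  let l := hS.eigenvalues rfl
  have hyl : ∀ i, S (y i) = l i • y i := fun i => hS.apply_eigenvectorBasis rfl i
  have hyo : Orthonormal ℝ fun i => (y i : H) := y.orthonormal.comp_linearIsometry Y.subtypeₗᵢ
  have hey : ∀ j i, ⟪e j, (y i : H)⟫ = 0 := fun j i =>
    (Submodule.mem_orthogonal _ _).1 (y i).2.1 _ (Submodule.subset_span ⟨j, rfl⟩)
  have hyspan : Submodule.span ℝ (Set.range fun i => (y i : H)) = Y :=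
    span_range_coe_orthonormalBasis y
  let b : J ⊕ Fin (Module.finrank ℝ Y) → H := Sum.elim e fun i => (y i : H)
  let a : J ⊕ Fin (Module.finrank ℝ Y) → ℝ := Sum.elim τ l
  have hb : Orthonormal ℝ b := by
    rw [orthonormal_iff_ite] at he hyo ⊢
    rintro (j | j) (i | i)
    · simpa [b] using he j i
    · simpa [b] using hey j i
    · simpa [b, real_inner_comm] using hey i j
    · simpa [b] using hyo j i
  have hbspan : Submodule.span ℝ (Set.range b) = U := by
    rw [Set.Sum.elim_range, Submodule.span_union, hyspan, hEY]
  have hTy : ∀ i k, ⟪T (y i : H), (y k : H)⟫ = if i = k then l i else 0 := by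
    intro i k
    rw [← hSi, hyl, real_inner_smul_left, (orthonormal_iff_ite.1 y.orthonormal) i k]
    split_ifs <;> simp
  have ha : ∀ i, ⟪T (b i), b i⟫ = a i := by
    rintro (j | i)
    · simp [b, a, hτ, real_inner_smul_left, he.1]
    · simpa [b, a] using hTy i i
  have hd : ∀ i k, i ≠ k → ⟪T (b i), b k⟫ = 0 := by
    rintro (j | j) (i | i) hij
    · have : j ≠ i := fun h => hij (by rw [h])
      simp [b, hτ, real_inner_smul_left, he.2 this]
    · simp [b, hτ, real_inner_smul_left, hey]
    · have : ⟪T (y j : H), e i⟫ = 0 := by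
        rw [hT, hτ, real_inner_smul_right, real_inner_comm, hey, mul_zero]
      simpa [b] using this
    · have : j ≠ i := fun h => hij (by rw [h])
      simpa [b, this] using hTy j i
  have hbΓ : ∀ i, Γ (b i) ∈ Submodule.span ℝ (Set.range b) := by
    intro i
    rw [hbspan]
    exact hΓU _ (hbspan ▸ Submodule.subset_span ⟨i, rfl⟩)
  have hcard : (Fintype.card (J ⊕ Fin (Module.finrank ℝ Y)) : ℝ) ≤
      2 * Fintype.card J + Fintype.card K := by
    rw [← finrank_span_eq_card_of_orthonormal hb, hbspan]
    exact_mod_cast hdim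
  -- The truncated trace is small, by the mirror symmetry applied to `T` and to `-T`.
  have hc1 := sum_clamp_le_of_mirror hΓ hΓ2 hb ha hd hbΓ v hε.le hδ fun x hx =>
    (le_abs_self _).trans (hV x hx)
  have hc2 := sum_clamp_le_of_mirror (T := -T) (a := fun i => -a i) hΓ hΓ2 hb
    (fun i => by simp [ha]) (fun i k h => by simp [hd i k h]) hbΓ v hε.le hδ fun x hx => by
      have := (neg_le_abs _).trans (hV x hx)
      simp only [LinearMap.neg_apply, inner_neg_left]
      linarith
  simp only [clamp_neg hε.le, Finset.sum_neg_distrib] at hc2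
  -- The trace of `T` over `U` is that over `span v`, up to half of the trace of `T + Γ T Γ`.
  set Z := Vᗮ ⊓ U with hZ
  have : FiniteDimensional ℝ Z := Submodule.finiteDimensional_of_le inf_le_right
  have hVZ : V ⊔ Z = U := Submodule.sup_orthogonal_inf_of_hasOrthogonalProjection hVU
  let w := stdOrthonormalBasis ℝ Z
  have hwo : Orthonormal ℝ fun i => (w i : H) := w.orthonormal.comp_linearIsometry Z.subtypeₗᵢ
  have hvw : ∀ k i, ⟪v k, (w i : H)⟫ = 0 := fun k i =>
    (Submodule.mem_orthogonal _ _).1 (w i).2.1 _ (Submodule.subset_span ⟨k, rfl⟩)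
  have hwspan : Submodule.span ℝ (Set.range fun i => (w i : H)) = Z :=
    span_range_coe_orthonormalBasis w
  let c : K ⊕ Fin (Module.finrank ℝ Z) → H := Sum.elim v fun i => (w i : H)
  have hc : Orthonormal ℝ c := by
    have hv' := hv
    rw [orthonormal_iff_ite] at hv' hwo ⊢
    rintro (j | j) (i | i)
    · simpa [c] using hv' j i
    · simpa [c] using hvw j i
    · simpa [c, real_inner_comm] using hvw i j
    · simpa [c] using hwo j i
  have hcspan : Submodule.span ℝ (Set.range c) = U := by
    rw [Set.Sum.elim_range, Submodule.span_union, hwspan, hVZ]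
  have hbΓo : Orthonormal ℝ fun i => Γ (b i) := by
    rw [orthonormal_iff_ite] at hb ⊢
    intro i j
    rw [← hb i j]
    exact hΓ _ _
  have hbΓspan : Submodule.span ℝ (Set.range fun i => Γ (b i)) = U := by
    refine le_antisymm ?_ fun x hx => ?_
    · rw [Submodule.span_le]
      rintro _ ⟨i, rfl⟩
      exact hbspan ▸ hbΓ i
    · have hx' := hΓU x hx
      rw [← hbspan] at hx'
      obtain ⟨r, hr⟩ := (Submodule.mem_span_range_iff_exists_fun ℝ).1 hx'
      rw [← hΓ2 x, ← hr, map_sum]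
      refine Submodule.sum_mem _ fun i _ => ?_
      rw [map_smul]
      exact Submodule.smul_mem _ _ (Submodule.subset_span ⟨i, rfl⟩)
  have hΓΓ : ∀ x, ⟪(Γ ∘ₗ T ∘ₗ Γ) x, x⟫ = ⟪T (Γ x), Γ x⟫ := by
    intro x
    rw [LinearMap.comp_apply, LinearMap.comp_apply, ← hΓ, hΓ2]
  have ht1 := sum_inner_eq_of_span_le hb hc (hbspan.trans hcspan.symm) T
  have ht2 := sum_inner_eq_of_span_le hbΓo hc (hbΓspan.trans hcspan.symm) (Γ ∘ₗ T ∘ₗ Γ)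
  simp only [hΓΓ, hΓ2] at ht2
  simp only [ha] at ht1 ht2
  have hs : |∑ i, (⟪T (w i : H), (w i : H)⟫ + ⟪T (Γ (w i : H)), Γ (w i : H)⟫)| ≤
      2 * δ * Module.finrank ℝ Z := by
    refine (Finset.abs_sum_le_sum_abs _ _).trans ?_
    refine (Finset.sum_le_sum fun i _ => hV (w i) fun k => hvw k i).trans ?_
    have : ∀ i, ‖(w i : H)‖ = 1 := hwo.1
    simp [this]
    linarith
  rw [Finset.sum_add_distrib] at hs
  have hZle : (Module.finrank ℝ Z : ℝ) ≤ 2 * Fintype.card J + Fintype.card K := by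
    have h1 : Module.finrank ℝ Z ≤ Module.finrank ℝ U := Submodule.finrank_mono inf_le_right
    exact_mod_cast h1.trans hdim
  simp only [Fintype.sum_sum_type, c, a, Sum.elim_inl, Sum.elim_inr, hΓv] at ht1 ht2 hc1 hc2
  have hll : ∀ i, |l i| ≤ ε := by
    intro i
    have h1 := hE (y i) fun j => hey j i
    have h2 := hTy i i
    rw [if_pos rfl] at h2
    rw [h2, hyo.1 i] at h1
    simpa using h1
  -- Truncation at `ε` keeps the `l i` and turns every `τ j` into `ε` or `-ε`, which leaves the
  -- difference of the counts.
  have hcl : ∑ i, clamp ε (l i) = ∑ i, l i :=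
    Finset.sum_congr rfl fun i _ => clamp_of_abs_le (hll i)
  have hcτ : ∑ j, clamp ε (τ j) =
      ε * ((Fintype.card {j // ε ≤ τ j} : ℝ) - Fintype.card {j // τ j ≤ -ε}) := by
    rw [Fintype.card_subtype, Fintype.card_subtype, ← Finset.sum_boole, ← Finset.sum_boole,
      ← Finset.sum_sub_distrib, Finset.mul_sum]
    refine Finset.sum_congr rfl fun j _ => ?_
    rcases le_abs'.1 (hτε j) with h | h
    · rw [clamp_of_le hε.le h, if_neg (by linarith), if_pos h]; ring
    · rw [clamp_of_ge hε.le h, if_pos h, if_neg (by linarith)]; ring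
  rw [hcl, hcτ] at hc1 hc2
  set n := (Fintype.card {j // ε ≤ τ j} : ℝ) - Fintype.card {j // τ j ≤ -ε}
  have hδd := mul_le_mul_of_nonneg_left hcard hδ
  have hδz := mul_le_mul_of_nonneg_left hZle hδ
  obtain ⟨hs1, hs2⟩ := abs_le.1 hs
  have hn1 : ε * n ≤ ε * |n| := mul_le_mul_of_nonneg_left (le_abs_self n) hε.le
  have hn2 : -(ε * |n|) ≤ ε * n := by
    have := mul_le_mul_of_nonneg_left (neg_abs_le n) hε.le
    linarith
  rw [abs_le]
  constructor <;> nlinarith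

end Mirror

/-! ### Hilbert–Schmidt operators and eigenbases -/

section Spectral

local notation "⟪" x ", " y "⟫" => inner ℝ x y

/-- A Hilbert–Schmidt operator is compact: it is the norm limit of its finite-rank truncations. -/
theorem isCompactOperator_of_summable_norm_sq {H H' : Type*} [NormedAddCommGroup H]
    [InnerProductSpace ℝ H] [NormedAddCommGroup H'] [InnerProductSpace ℝ H'] [CompleteSpace H']
    {ι : Type*} (b : HilbertBasis ι ℝ H) (T : H →L[ℝ] H')
    (hs : Summable fun i => ‖T (b i)‖ ^ 2) : IsCompactOperator T := by
  classical
  let A : Finset ι → H →L[ℝ] H' := fun s =>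
    ∑ i ∈ s, (innerSL ℝ (b i)).smulRight (T (b i))
  have hA : ∀ s, IsCompactOperator (A s) := by
    intro s
    induction s using Finset.induction_on with
    | empty => simpa [A] using isCompactOperator_zero
    | insert i s his ih =>
      have h1 : A (insert i s) = (innerSL ℝ (b i)).smulRight (T (b i)) + A s := by
        simp [A, Finset.sum_insert his]
      rw [h1]
      refine IsCompactOperator.add ?_ ih
      have h2 : IsCompactOperator (innerSL ℝ (b i)) :=
        isCompactOperator_of_locallyCompactSpace_dom _
      exact h2.clm_comp (ContinuousLinearMap.toSpanSingleton ℝ (T (b i)))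
  refine isCompactOperator_of_tendsto (F := A) (l := atTop) ?_ (Eventually.of_forall hA)
  rw [Metric.tendsto_atTop]
  intro ε hε
  obtain ⟨s₀, hs₀⟩ := (summable_iff_vanishing_norm.1 hs) ((ε / 2) ^ 2) (by positivity)
  refine ⟨s₀, fun s hs' => ?_⟩
  rw [dist_eq_norm]
  refine lt_of_le_of_lt (ContinuousLinearMap.opNorm_le_bound _ (by positivity : 0 ≤ ε / 2)
    fun x => ?_) (half_lt_self hε)
  have hx : HasSum (fun i => ⟪b i, x⟫ • T (b i)) (T x) := by
    have := (b.hasSum_repr x).mapL T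
    simpa [HilbertBasis.repr_apply_apply] using this
  have hlim : Tendsto (fun t : Finset ι => ‖A s x - ∑ i ∈ t, ⟪b i, x⟫ • T (b i)‖) atTop
      (𝓝 ‖A s x - T x‖) := (tendsto_const_nhds.sub hx).norm
  rw [_root_.sub_apply]
  refine le_of_tendsto hlim ((eventually_ge_atTop s).mono fun t ht => ?_)
  have h1 : A s x - ∑ i ∈ t, ⟪b i, x⟫ • T (b i) = -∑ i ∈ t \ s, ⟪b i, x⟫ • T (b i) := by
    rw [← Finset.sum_sdiff ht]
    simp [A]
  have h2 : ∑ i ∈ t \ s, ‖T (b i)‖ ^ 2 ≤ (ε / 2) ^ 2 := by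
    have h3 := hs₀ (t \ s) (Finset.disjoint_of_subset_right hs' Finset.sdiff_disjoint)
    exact ((le_abs_self _).trans_lt h3).le
  have h4 : ∑ i ∈ t \ s, ⟪b i, x⟫ ^ 2 ≤ ‖x‖ ^ 2 := by
    simpa using b.orthonormal.sum_inner_products_le (x := x) (s := t \ s)
  rw [h1, norm_neg]
  have h5 : ‖∑ i ∈ t \ s, ⟪b i, x⟫ • T (b i)‖ ≤ ∑ i ∈ t \ s, |⟪b i, x⟫| * ‖T (b i)‖ := by
    refine (norm_sum_le _ _).trans_eq ?_
    simp [norm_smul]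
  refine h5.trans ((sq_le_sq₀ (Finset.sum_nonneg fun i _ => by positivity) (by positivity)).1 ?_)
  refine (Finset.sum_mul_sq_le_sq_mul_sq _ _ _).trans ?_
  simp only [sq_abs]
  rw [mul_pow, mul_comm]
  exact mul_le_mul h2 h4 (Finset.sum_nonneg fun i _ => sq_nonneg _) (by positivity)

/-- A compact symmetric operator has a Hilbert basis of eigenvectors. -/
theorem exists_hilbertBasis_eigenvectors.{u} {H : Type u} [NormedAddCommGroup H]
    [InnerProductSpace ℝ H] [CompleteSpace H] (T : H →L[ℝ] H) (hc : IsCompactOperator T)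
    (hT : T.IsSymmetric) : ∃ (ι : Type u) (b : HilbertBasis ι ℝ H) (τ : ι → ℝ),
      ∀ i, T (b i) = τ i • b i := by
  have hcl : ∀ μ : ℝ, IsClosed (Module.End.eigenspace (T : Module.End ℝ H) μ : Set H) := by
    intro μ
    have : (Module.End.eigenspace (T : Module.End ℝ H) μ : Set H) = {x | T x = μ • x} := by
      ext x
      simp
    rw [this]
    exact isClosed_eq T.continuous (continuous_const_smul μ)
  have hcs : ∀ μ : ℝ, CompleteSpace (Module.End.eigenspace (T : Module.End ℝ H) μ) :=
    fun μ => (hcl μ).completeSpace_coe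
  choose w B hB using fun μ : ℝ =>
    exists_hilbertBasis ℝ (Module.End.eigenspace (T : Module.End ℝ H) μ)
  have ho : Orthonormal ℝ fun a : Σ μ : ℝ, w μ => ((B a.1 a.2 : _) : H) :=
    OrthogonalFamily.orthonormal_sigma_orthonormal hT.orthogonalFamily_eigenspaces
      fun μ => (B μ).orthonormal
  have hbot : (Submodule.span ℝ (Set.range fun a : Σ μ : ℝ, w μ => ((B a.1 a.2 : _) : H)))ᗮ = ⊥ := by
    rw [eq_bot_iff, ← ContinuousLinearMap.orthogonalComplement_iSup_eigenspaces_eq_bot hc hT]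
    intro x hx
    rw [← Submodule.iInf_orthogonal]
    rw [Submodule.mem_iInf]
    intro μ
    rw [← Submodule.orthogonalProjectionOnto_eq_zero_iff]
    apply (B μ).repr.injective
    ext i
    simp only [HilbertBasis.repr_apply_apply, map_zero, lp.coeFn_zero, Pi.zero_apply]
    rw [Submodule.inner_orthogonalProjectionOnto_eq_of_mem_left]
    exact (Submodule.mem_orthogonal _ _).1 hx _ (Submodule.subset_span ⟨⟨μ, i⟩, rfl⟩)
  refine ⟨Σ μ : ℝ, w μ, HilbertBasis.mkOfOrthogonalEqBot ho hbot, fun a => a.1, fun a => ?_⟩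
  rw [HilbertBasis.coe_mkOfOrthogonalEqBot]
  exact Module.End.mem_eigenspace_iff.1 (B a.1 a.2).2

/-- On the orthogonal complement of the eigenvectors whose eigenvalue is at least `c`, the
quadratic form of a diagonal operator is at most `c`. -/
theorem inner_map_self_le_of_orthogonal {H : Type*} [NormedAddCommGroup H]
    [InnerProductSpace ℝ H] {ι : Type*} (b : HilbertBasis ι ℝ H) (T : H →L[ℝ] H) {τ : ι → ℝ}
    (hτ : ∀ i, T (b i) = τ i • b i) {c : ℝ} {x : H} (hx : ∀ i, c ≤ τ i → ⟪b i, x⟫ = 0) :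
    ⟪T x, x⟫ ≤ c * ‖x‖ ^ 2 := by
  have h1 : HasSum (fun i => ⟪b i, x⟫ • T (b i)) (T x) := by
    have := (b.hasSum_repr x).mapL T
    simpa [HilbertBasis.repr_apply_apply] using this
  have h2 : HasSum (fun i => τ i * ⟪b i, x⟫ ^ 2) ⟪T x, x⟫ := by
    have := h1.mapL (innerSL ℝ x)
    simp only [innerSL_apply_apply] at this
    rw [real_inner_comm]
    have h3 : (fun i => τ i * ⟪b i, x⟫ ^ 2) = fun i => ⟪x, ⟪b i, x⟫ • T (b i)⟫ := by
      funext i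
      rw [hτ, real_inner_smul_right, real_inner_smul_right, real_inner_comm x]
      ring
    rw [h3]
    exact this
  have h3 : HasSum (fun i => c * ⟪b i, x⟫ ^ 2) (c * ‖x‖ ^ 2) := by
    have := (b.hasSum_inner_mul_inner x x).mul_left c
    rw [real_inner_self_eq_norm_sq] at this
    simpa [real_inner_comm, sq] using this
  refine hasSum_le (fun i => ?_) h2 h3
  by_cases hi : c ≤ τ i
  · simp [hx i hi]
  · exact mul_le_mul_of_nonneg_right (not_le.1 hi).le (sq_nonneg _)

end Spectral

/-! ### Finite partitions of the half-line -/

section Partition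

/-- Downward induction along the consecutive points of a finite set, starting from its largest
point. -/
theorem gap_induction (P : Finset ℝ) (a₀ : ℝ) (Q : ℝ → Prop)
    (hstep : ∀ a b, (a = a₀ ∨ a ∈ P) → b ∈ P → a < b → (∀ p ∈ P, ¬(a < p ∧ p < b)) → Q b → Q a)
    (hlast : ∀ a, (a = a₀ ∨ a ∈ P) → (∀ p ∈ P, p ≤ a) → Q a) : Q a₀ := by
  classical
  suffices h : ∀ n : ℕ, ∀ a, (a = a₀ ∨ a ∈ P) → (P.filter (a < ·)).card = n → Q a from
    h _ a₀ (Or.inl rfl) rfl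
  intro n
  induction n using Nat.strong_induction_on with
  | _ n ih =>
    intro a ha hn
    by_cases hne : (P.filter (a < ·)).Nonempty
    · set b := (P.filter (a < ·)).min' hne
      have hb : b ∈ P ∧ a < b := Finset.mem_filter.1 (Finset.min'_mem _ hne)
      refine hstep a b ha hb.1 hb.2 (fun p hp hpb => ?_) (ih _ ?_ b (Or.inr hb.1) rfl)
      · exact absurd (Finset.min'_le _ p (Finset.mem_filter.2 ⟨hp, hpb.1⟩)) (not_le.2 hpb.2)
      · rw [← hn]
        refine Finset.card_lt_card (Finset.ssubset_iff_of_subset ?_ |>.2 ⟨b, ?_, ?_⟩)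
        · intro p hp
          rw [Finset.mem_filter] at hp ⊢
          exact ⟨hp.1, hb.2.trans hp.2⟩
        · exact Finset.mem_filter.2 hb
        · simp
    · refine hlast a ha fun p hp => ?_
      by_contra h
      exact hne ⟨p, Finset.mem_filter.2 ⟨hp, not_le.1 h⟩⟩

/-- The quantiles of a finite measure `ρ` cut the line into open intervals of measure at most
`c`. -/
theorem exists_finset_measure_gap_le (ρ : Measure ℝ) [IsFiniteMeasure ρ] {c : ℝ} (hc : 0 < c) :
    ∃ P : Finset ℝ, (P.card : ℝ) * c ≤ ρ.real Set.univ ∧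
      ∀ (a : ℝ) (B : Set ℝ), IsLowerSet B → (∀ p ∈ P, ¬(a < p ∧ p ∈ B)) →
        ρ.real (Set.Ioi a ∩ B) ≤ c := by
  classical
  set g : ℝ → ℝ := fun x => ρ.real (Set.Iic x) with hg
  have hgm : Monotone g := fun x y hxy => measureReal_mono (Set.Iic_subset_Iic.2 hxy)
  let q : ℕ → ℝ := fun k => sInf {x | k * c ≤ g x}
  have htot : 0 ≤ ρ.real Set.univ / c := by positivity
  refine ⟨(Finset.Icc 1 ⌊ρ.real Set.univ / c⌋₊).image q, ?_, ?_⟩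
  · rw [← le_div_iff₀ hc]
    have h1 : ((Finset.Icc 1 ⌊ρ.real Set.univ / c⌋₊).image q).card ≤ ⌊ρ.real Set.univ / c⌋₊ := by
      refine Finset.card_image_le.trans ?_
      simp
    exact (Nat.cast_le.2 h1).trans (Nat.floor_le htot)
  intro a B hB hP
  by_contra! hlt
  set k := ⌊g a / c⌋₊ + 1 with hk
  have hga : 0 ≤ g a := measureReal_nonneg
  have hk1 : g a < k * c := by
    rw [← div_lt_iff₀ hc, hk]
    push_cast
    exact Nat.lt_floor_add_one _
  have hk2 : k * c ≤ g a + c := by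
    have := Nat.floor_le (div_nonneg hga hc.le)
    rw [le_div_iff₀ hc] at this
    rw [hk]; push_cast; linarith
  have hdisj : g a + ρ.real (Set.Ioi a ∩ B) = ρ.real (Set.Iic a ∪ (Set.Ioi a ∩ B)) := by
    have hBm : MeasurableSet B := by
      have : B.OrdConnected := hB.ordConnected
      exact this.measurableSet
    rw [measureReal_union _ (measurableSet_Ioi.inter hBm)]
    rw [Set.disjoint_left]
    rintro x hx ⟨hx', -⟩
    exact absurd (show x ≤ a from hx) (not_le.2 hx')
  have hktot : k * c < ρ.real Set.univ := by
    have : ρ.real (Set.Iic a ∪ (Set.Ioi a ∩ B)) ≤ ρ.real Set.univ :=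
      measureReal_mono (Set.subset_univ _)
    linarith
  have hkmem : k ∈ Finset.Icc 1 ⌊ρ.real Set.univ / c⌋₊ := by
    rw [Finset.mem_Icc]
    exact ⟨by omega, Nat.le_floor (by rw [le_div_iff₀ hc]; exact hktot.le)⟩
  have hne : {x | k * c ≤ g x}.Nonempty := by
    have h1 : Tendsto g atTop (𝓝 (ρ.real Set.univ)) :=
      (ENNReal.tendsto_toReal (measure_ne_top ρ _)).comp (tendsto_measure_Iic_atTop ρ)
    obtain ⟨x, hx⟩ := (h1.eventually (lt_mem_nhds hktot)).exists
    exact ⟨x, hx.le⟩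
  have hqa : a < q k := by
    have h1 : Tendsto g (𝓝[>] a) (𝓝 (g a)) := by
      have h2 := tendsto_measure_biInter_gt (μ := ρ) (s := fun r : ℝ => Set.Iic r) (a := a)
        (fun r _ => measurableSet_Iic.nullMeasurableSet)
        (fun i j _ hij => Set.Iic_subset_Iic.2 hij) ⟨a + 1, by simp, measure_ne_top _ _⟩
      have h3 : (⋂ r, ⋂ (_ : r > a), Set.Iic r) = Set.Iic a := by
        ext x
        simp only [Set.mem_iInter, Set.mem_Iic]
        exact ⟨fun h => le_of_forall_gt_imp_ge_of_dense fun r hr => h r hr, fun h r hr => h.trans hr.le⟩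
      rw [h3] at h2
      exact (ENNReal.tendsto_toReal (measure_ne_top ρ _)).comp h2
    obtain ⟨x, hx, hxa⟩ := ((h1.eventually (gt_mem_nhds hk1)).and self_mem_nhdsWithin).exists
    refine lt_of_lt_of_le hxa (le_csInf hne fun y hy => ?_)
    by_contra! hyx
    exact absurd (hgm hyx.le) (not_le.2 (hx.trans_le hy))
  have hbdd : BddBelow {x | k * c ≤ g x} := by
    refine ⟨a, fun y hy => ?_⟩
    by_contra! hya
    exact absurd (hgm hya.le) (not_le.2 (hk1.trans_le hy))
  have hqB : q k ∈ B := by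
    by_contra hqB
    have h1 : Set.Iic a ∪ (Set.Ioi a ∩ B) ⊆ Set.Iio (q k) := by
      rintro x (hx | ⟨-, hx⟩)
      · exact lt_of_le_of_lt hx hqa
      · by_contra hxq
        exact hqB (hB (not_lt.1 hxq) hx)
    have h2 : ρ.real (Set.Iio (q k)) ≤ k * c := by
      have h3 : (⋃ n : ℕ, Set.Iic (q k - 1 / (n + 1))) = Set.Iio (q k) := by
        ext x
        simp only [Set.mem_iUnion, Set.mem_Iic, Set.mem_Iio]
        constructor
        · rintro ⟨n, hn⟩
          have : (0 : ℝ) < 1 / (n + 1) := by positivity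
          linarith
        · intro hx
          obtain ⟨n, hn⟩ := exists_nat_one_div_lt (sub_pos.2 hx)
          exact ⟨n, by linarith⟩
      have h4 := tendsto_measure_iUnion_atTop (μ := ρ)
        (s := fun n : ℕ => Set.Iic (q k - 1 / ((n : ℝ) + 1))) (by
          intro m n hmn
          refine Set.Iic_subset_Iic.2 ?_
          have : (1 : ℝ) / (n + 1) ≤ 1 / (m + 1) := by gcongr
          linarith)
      rw [h3] at h4
      refine le_of_tendsto ((ENNReal.tendsto_toReal (measure_ne_top ρ _)).comp h4)
        (Eventually.of_forall fun n => ?_)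
      by_contra! h5
      have h6 := csInf_le hbdd (show q k - 1 / ((n : ℝ) + 1) ∈ {x | k * c ≤ g x} from h5.le)
      have : (0 : ℝ) < 1 / (n + 1) := by positivity
      have h7 : q k ≤ q k - 1 / ((n : ℝ) + 1) := h6
      linarith
    have := measureReal_mono (μ := ρ) h1
    linarith
  exact hP (q k) (Finset.mem_image_of_mem q hkmem) ⟨hqa, hqB⟩

end Partition

/-! ### Primitives of square integrable functions on the half-line -/

section Primitive

/-- The space `L²(0, ∞)`. -/
abbrev HalfLineL2 : Type := Lp ℝ 2 (volume.restrict (Set.Ioi (0 : ℝ)))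

/-- The primitive `F(y) = ∫₀^y φ` (which vanishes for `y ≤ 0`). -/
noncomputable def prim (φ : HalfLineL2) (y : ℝ) : ℝ := ∫ t in Set.Ioc 0 y, φ t

theorem memLp_two_of_subset (φ : HalfLineL2) {s : Set ℝ} (hs : s ⊆ Set.Ioi 0) :
    MemLp φ 2 (volume.restrict s) :=
  (Lp.memLp φ).mono_measure (Measure.restrict_mono hs le_rfl)

theorem Ioc_subset_Ioi_zero {a b : ℝ} (ha : 0 ≤ a) : Set.Ioc a b ⊆ Set.Ioi 0 :=
  fun _ hx => lt_of_le_of_lt ha hx.1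

theorem integrableOn_Ioc (φ : HalfLineL2) {a : ℝ} (ha : 0 ≤ a) (b : ℝ) :
    IntegrableOn φ (Set.Ioc a b) :=
  (memLp_two_of_subset φ (Ioc_subset_Ioi_zero ha)).integrable (by norm_num)

theorem integrable_sq_of_subset (φ : HalfLineL2) {s : Set ℝ} (hs : s ⊆ Set.Ioi 0) :
    IntegrableOn (fun t => φ t ^ 2) s :=
  (memLp_two_of_subset φ hs).integrable_sq

theorem norm_sq_eq_integral (φ : HalfLineL2) : ‖φ‖ ^ 2 = ∫ t in Set.Ioi 0, φ t ^ 2 := by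
  rw [← real_inner_self_eq_norm_sq, L2.inner_def]
  refine integral_congr_ae (Eventually.of_forall fun t => ?_)
  simp [sq]

theorem inner_eq_integral (φ χ : HalfLineL2) : inner ℝ φ χ = ∫ t in Set.Ioi 0, φ t * χ t := by
  rw [L2.inner_def]
  refine integral_congr_ae (Eventually.of_forall fun t => ?_)
  simp [mul_comm]

theorem ofReal_norm_sq (φ : HalfLineL2) :
    ENNReal.ofReal (‖φ‖ ^ 2) = ∫⁻ t in Set.Ioi 0, ENNReal.ofReal (φ t ^ 2) := by
  rw [norm_sq_eq_integral, ofReal_integral_eq_lintegral_ofReal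
    (integrable_sq_of_subset φ subset_rfl) (Eventually.of_forall fun t => sq_nonneg _)]

theorem prim_of_nonpos (φ : HalfLineL2) {y : ℝ} (hy : y ≤ 0) : prim φ y = 0 := by
  simp [prim, Set.Ioc_eq_empty_of_le hy]

theorem prim_sub_prim (φ : HalfLineL2) {a y : ℝ} (ha : 0 ≤ a) (hay : a ≤ y) :
    prim φ y - prim φ a = ∫ t in Set.Ioc a y, φ t := by
  unfold prim
  rw [← Set.Ioc_union_Ioc_eq_Ioc ha hay, setIntegral_union (Set.Ioc_disjoint_Ioc_of_le le_rfl)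
    measurableSet_Ioc (integrableOn_Ioc φ le_rfl a) (integrableOn_Ioc φ ha y)]
  ring

theorem sq_setIntegral_le {φ : ℝ → ℝ} {a y : ℝ} (hay : a ≤ y)
    (hφ : MemLp φ 2 (volume.restrict (Set.Ioc a y))) :
    (∫ t in Set.Ioc a y, φ t) ^ 2 ≤ (y - a) * ∫ t in Set.Ioc a y, φ t ^ 2 := by
  have h1 := integral_mul_le_Lp_mul_Lq_of_nonneg (μ := volume.restrict (Set.Ioc a y))
    (f := fun t => |φ t|) (g := fun _ => 1) Real.HolderConjugate.two_two
    (Eventually.of_forall fun _ => abs_nonneg _) (Eventually.of_forall fun _ => zero_le_one)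
    (by rw [ENNReal.ofReal_ofNat]; exact hφ.abs) (by simpa using memLp_const _)
  simp only [mul_one, Real.rpow_ofNat, sq_abs, one_pow] at h1
  have h2 : |∫ t in Set.Ioc a y, φ t| ≤ ∫ t in Set.Ioc a y, |φ t| := abs_integral_le_integral_abs
  have h3 : ∫ t in Set.Ioc a y, (1 : ℝ) = y - a := by
    simp [hay]
  rw [h3] at h1
  have h4 : 0 ≤ ∫ t in Set.Ioc a y, φ t ^ 2 := integral_nonneg fun _ => sq_nonneg _
  rw [← sq_abs]
  refine (pow_le_pow_left₀ (abs_nonneg _) (h2.trans h1) 2).trans_eq ?_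
  rw [mul_pow, ← Real.rpow_natCast, ← Real.rpow_natCast, ← Real.rpow_mul h4,
    ← Real.rpow_mul (by linarith)]
  norm_num
  ring

theorem sq_prim_sub_le (φ : HalfLineL2) {a y : ℝ} (ha : 0 ≤ a) (hay : a ≤ y) :
    (prim φ y - prim φ a) ^ 2 ≤ (y - a) * ∫ t in Set.Ioc a y, φ t ^ 2 := by
  rw [prim_sub_prim φ ha hay]
  exact sq_setIntegral_le hay (memLp_two_of_subset φ (Ioc_subset_Ioi_zero ha))

theorem setIntegral_sq_le (φ : HalfLineL2) {s : Set ℝ} (hs : s ⊆ Set.Ioi 0) :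
    ∫ t in s, φ t ^ 2 ≤ ‖φ‖ ^ 2 := by
  rw [norm_sq_eq_integral]
  exact setIntegral_mono_set (integrable_sq_of_subset φ subset_rfl)
    (Eventually.of_forall fun _ => sq_nonneg _) hs.eventuallyLE

theorem sq_prim_sub_le_norm (φ : HalfLineL2) {a y : ℝ} (ha : 0 ≤ a) (hay : a ≤ y) :
    (prim φ y - prim φ a) ^ 2 ≤ (y - a) * ‖φ‖ ^ 2 :=
  (sq_prim_sub_le φ ha hay).trans (mul_le_mul_of_nonneg_left
    (setIntegral_sq_le φ (Ioc_subset_Ioi_zero ha)) (by linarith))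

theorem sq_prim_le (φ : HalfLineL2) {y : ℝ} (hy : 0 ≤ y) : prim φ y ^ 2 ≤ y * ‖φ‖ ^ 2 := by
  simpa [prim_of_nonpos] using sq_prim_sub_le_norm φ le_rfl hy

theorem prim_max_zero (φ : HalfLineL2) (y : ℝ) : prim φ (max y 0) = prim φ y := by
  rcases le_total y 0 with h | h
  · rw [max_eq_right h, prim_of_nonpos φ le_rfl, prim_of_nonpos φ h]
  · rw [max_eq_left h]

theorem abs_prim_sub_le (φ : HalfLineL2) (x y : ℝ) :
    |prim φ y - prim φ x| ≤ √|y - x| * ‖φ‖ := by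
  have key : ∀ a b : ℝ, 0 ≤ a → a ≤ b → |prim φ b - prim φ a| ≤ √|b - a| * ‖φ‖ := by
    intro a b ha hab
    rw [← Real.sqrt_sq_eq_abs, abs_of_nonneg (sub_nonneg.2 hab)]
    refine (Real.sqrt_le_sqrt (sq_prim_sub_le_norm φ ha hab)).trans_eq ?_
    rw [Real.sqrt_mul (sub_nonneg.2 hab), Real.sqrt_sq (norm_nonneg _)]
  have h2 : |max y 0 - max x 0| ≤ |y - x| := abs_max_sub_max_le_abs y x 0
  rw [← prim_max_zero φ y, ← prim_max_zero φ x]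
  refine le_trans ?_ (mul_le_mul_of_nonneg_right (Real.sqrt_le_sqrt h2) (norm_nonneg _))
  rcases le_total (max x 0) (max y 0) with h | h
  · exact key _ _ (le_max_right _ _) h
  · rw [abs_sub_comm, abs_sub_comm (max y 0)]
    exact key _ _ (le_max_right _ _) h

theorem continuous_prim (φ : HalfLineL2) : Continuous (prim φ) := by
  rw [continuous_iff_continuousAt]
  intro x
  rw [ContinuousAt, tendsto_iff_norm_sub_tendsto_zero]
  refine squeeze_zero (fun _ => norm_nonneg _) (fun y => abs_prim_sub_le φ x y) ?_
  have : Tendsto (fun y : ℝ => √|y - x| * ‖φ‖) (𝓝 x) (𝓝 (√|x - x| * ‖φ‖)) :=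
    (by fun_prop : Continuous fun y : ℝ => √|y - x| * ‖φ‖).tendsto x
  simpa using this

theorem prim_add (φ χ : HalfLineL2) (y : ℝ) : prim (φ + χ) y = prim φ y + prim χ y := by
  unfold prim
  rw [← integral_add (integrableOn_Ioc φ le_rfl y) (integrableOn_Ioc χ le_rfl y)]
  refine integral_congr_ae (ae_restrict_of_ae_restrict_of_subset (Ioc_subset_Ioi_zero le_rfl) ?_)
  exact Lp.coeFn_add φ χ

theorem prim_smul (c : ℝ) (φ : HalfLineL2) (y : ℝ) : prim (c • φ) y = c * prim φ y := by
  unfold prim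
  rw [← integral_const_mul]
  refine integral_congr_ae (ae_restrict_of_ae_restrict_of_subset (Ioc_subset_Ioi_zero le_rfl) ?_)
  exact Lp.coeFn_smul c φ

end Primitive

/-! ### Point conditions making a weighted form small -/

section PointConditions

/-- Lengths are controlled by the finite measure `dx / (1 + x²)`, at the cost of a weight `1 + y²`. -/
theorem sub_le_mul_integral_gap {a y : ℝ} (ha : 0 ≤ a) :
    ENNReal.ofReal (y - a) ≤ ENNReal.ofReal (1 + y ^ 2) *
      ∫⁻ x in Set.Ioo a y, ENNReal.ofReal (1 / (1 + x ^ 2)) := by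
  have h1 : ∫⁻ _ in Set.Ioo a y, ENNReal.ofReal (1 / (1 + y ^ 2)) ≤
      ∫⁻ x in Set.Ioo a y, ENNReal.ofReal (1 / (1 + x ^ 2)) := by
    refine setLIntegral_mono' measurableSet_Ioo fun x hx => ENNReal.ofReal_le_ofReal ?_
    have : 0 < x := lt_of_le_of_lt ha hx.1
    have : x ≤ y := hx.2.le
    gcongr
  refine le_trans ?_ (mul_le_mul_right h1 _)
  rw [lintegral_const, Measure.restrict_apply_univ, Real.volume_Ioo, ← mul_assoc,
    ← ENNReal.ofReal_mul (by positivity), mul_one_div_cancel (by positivity)]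
  simp

/-- Estimate on one gap: if `F` vanishes at the left end `a` of the interval `G = (a, ∞) ∩ B`, then
`F(y)² ≤ (y - a) ∫_G φ²`, and `y - a` is controlled by the weight `1 + y²`. -/
theorem lintegral_gap_le (ζ : Measure ℝ) {A : Set ℝ} {a : ℝ} (ha : 0 ≤ a)
    {B : Set ℝ} (hB : IsLowerSet B)
    (hAG : ∀ y ∈ A, a < y → y ∈ B → Set.Ioo a y ⊆ A) (hζA : ζ (Set.Ioi 0 \ A) = 0) {s : ℝ}
    (h : (∫⁻ y in Set.Ioi a ∩ B, ENNReal.ofReal (1 + y ^ 2) ∂ζ) *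
      (∫⁻ y in Set.Ioi a ∩ B, A.indicator (fun x => ENNReal.ofReal (1 / (1 + x ^ 2))) y) ≤
        ENNReal.ofReal (s ^ 2))
    (φ : HalfLineL2) (hφ : prim φ a = 0) :
    ∫⁻ y in Set.Ioi a ∩ B, ENNReal.ofReal (prim φ y ^ 2) ∂ζ ≤
      ENNReal.ofReal (s ^ 2) * ∫⁻ y in Set.Ioi a ∩ B, ENNReal.ofReal (φ y ^ 2) := by
  have hBm : MeasurableSet B := by
    have : B.OrdConnected := hB.ordConnected
    exact this.measurableSet
  have hGm : MeasurableSet (Set.Ioi a ∩ B) := measurableSet_Ioi.inter hBm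
  set θ := ∫⁻ y in Set.Ioi a ∩ B, A.indicator (fun x => ENNReal.ofReal (1 / (1 + x ^ 2))) y
  set m := ∫⁻ y in Set.Ioi a ∩ B, ENNReal.ofReal (φ y ^ 2)
  have hpt : ∀ y ∈ A, y ∈ Set.Ioi a ∩ B →
      ENNReal.ofReal (prim φ y ^ 2) ≤ ENNReal.ofReal (1 + y ^ 2) * (θ * m) := by
    rintro y hyA ⟨hya, hyB⟩
    have h1 := sq_prim_sub_le φ ha (le_of_lt hya)
    rw [hφ, sub_zero] at h1
    refine (ENNReal.ofReal_le_ofReal h1).trans ?_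
    rw [ENNReal.ofReal_mul (by simpa using (le_of_lt hya)), ← mul_assoc]
    refine mul_le_mul' ((sub_le_mul_integral_gap ha).trans ?_) ?_
    · refine mul_le_mul_right ?_ _
      have hsub : Set.Ioo a y ⊆ Set.Ioi a ∩ B := fun x hx => ⟨hx.1, hB hx.2.le hyB⟩
      refine le_trans ?_ (lintegral_mono_set hsub)
      refine setLIntegral_mono' measurableSet_Ioo fun x hx => ?_
      rw [Set.indicator_of_mem (hAG y hyA hya hyB hx)]
    · rw [ofReal_integral_eq_lintegral_ofReal
        (integrable_sq_of_subset φ (Ioc_subset_Ioi_zero ha))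
        (Eventually.of_forall fun t => sq_nonneg _)]
      exact lintegral_mono_set fun x hx => ⟨hx.1, hB hx.2 hyB⟩
  have hae : ∀ᵐ y ∂ζ.restrict (Set.Ioi a ∩ B),
      ENNReal.ofReal (prim φ y ^ 2) ≤ ENNReal.ofReal (1 + y ^ 2) * (θ * m) := by
    rw [ae_restrict_iff' hGm]
    have : ∀ᵐ y ∂ζ, y ∉ Set.Ioi 0 \ A := measure_eq_zero_iff_ae_notMem.1 hζA
    filter_upwards [this] with y hy hyG
    refine hpt y ?_ hyG
    by_contra hyA
    exact hy ⟨lt_of_le_of_lt ha hyG.1, hyA⟩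
  refine (lintegral_mono_ae hae).trans ?_
  rw [lintegral_mul_const _ (by fun_prop), ← mul_assoc]
  exact mul_le_mul_left h _

/-- For a measure `ζ` on the half-line with `∫ (1 + y²) dζ ≤ Z`, concentrated on a union `A` of
gaps of `P₀` with `∫_A dx / (1 + x²) ≤ t`, about `√(Z t) / s` point conditions on `F` suffice to
get `∫ F² dζ ≤ s² ‖φ‖²`. The points are quantiles of a suitable combination of the measures
`(1 + y²) ζ` and `dx / (1 + x²)` on `A`. -/
theorem exists_finset_lintegral_sq_prim_le (ζ : Measure ℝ) {A : Set ℝ} (P₀ : Finset ℝ)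
    (hA0 : ∀ x y, 0 ≤ x → x < y → y ∈ A → (∀ p ∈ P₀, ¬(x < p ∧ p ≤ y)) → Set.Ioo x y ⊆ A)
    (hζA : ζ (Set.Ioi 0 \ A) = 0) {Z t s : ℝ} (hZ : 0 < Z) (ht : 0 < t) (hs : 0 < s)
    (hζ : ∫⁻ y in Set.Ioi 0, ENNReal.ofReal (1 + y ^ 2) ∂ζ ≤ ENNReal.ofReal Z)
    (hθ : ∫⁻ y in Set.Ioi 0, A.indicator (fun x => ENNReal.ofReal (1 / (1 + x ^ 2))) y ≤
      ENNReal.ofReal t) :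
    ∃ P : Finset ℝ, P₀ ⊆ P ∧ (P.card : ℝ) ≤ P₀.card + √(Z * t) / s ∧
      ∀ φ : HalfLineL2, (∀ p ∈ P, prim φ p = 0) →
        ∫⁻ y in Set.Ioi 0, ENNReal.ofReal (prim φ y ^ 2) ∂ζ ≤ ENNReal.ofReal (s ^ 2 * ‖φ‖ ^ 2) := by
  classical
  -- `α` balances the masses of the two measures: `α Z = α⁻¹ t = √(Z t)`.
  set α := √(t / Z) with hα
  have hα0 : 0 < α := Real.sqrt_pos.2 (by positivity)
  have hα2 : α ^ 2 = t / Z := Real.sq_sqrt (by positivity)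
  let ρ₁ : Measure ℝ := (ζ.restrict (Set.Ioi 0)).withDensity fun y => ENNReal.ofReal (1 + y ^ 2)
  let ρ₂ : Measure ℝ := (volume.restrict (Set.Ioi 0)).withDensity
    (A.indicator fun x => ENNReal.ofReal (1 / (1 + x ^ 2)))
  have hρ₁ : ρ₁ Set.univ ≤ ENNReal.ofReal Z := by
    simpa [ρ₁, withDensity_apply] using hζ
  have hρ₂ : ρ₂ Set.univ ≤ ENNReal.ofReal t := by
    simpa [ρ₂, withDensity_apply] using hθ
  have hf₁ : IsFiniteMeasure ρ₁ := ⟨hρ₁.trans_lt ENNReal.ofReal_lt_top⟩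
  have hf₂ : IsFiniteMeasure ρ₂ := ⟨hρ₂.trans_lt ENNReal.ofReal_lt_top⟩
  let ρ : Measure ℝ := (α.toNNReal) • ρ₁ + (α⁻¹.toNNReal) • ρ₂
  have hρr : ∀ G : Set ℝ, ρ.real G = α * ρ₁.real G + α⁻¹ * ρ₂.real G := by
    intro G
    simp only [ρ]
    rw [measureReal_add_apply, measureReal_nnreal_smul_apply, measureReal_nnreal_smul_apply]
    simp [hα0.le]
  obtain ⟨P₁, hP₁, hgap⟩ := exists_finset_measure_gap_le ρ (c := 2 * s) (by positivity)
  have hcard : (P₁.card : ℝ) ≤ √(Z * t) / s := by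
    have h1 : ρ.real Set.univ ≤ α * Z + α⁻¹ * t := by
      rw [hρr]
      have h2 : ρ₁.real Set.univ ≤ Z := ENNReal.toReal_le_of_le_ofReal hZ.le hρ₁
      have h3 : ρ₂.real Set.univ ≤ t := ENNReal.toReal_le_of_le_ofReal ht.le hρ₂
      gcongr
    have h4 : α * Z = √(Z * t) := by
      rw [eq_comm, Real.sqrt_eq_iff_mul_self_eq (by positivity) (by positivity)]
      have : α * Z * (α * Z) = α ^ 2 * Z ^ 2 := by ring
      rw [this, hα2]; field_simp
    have h5 : α⁻¹ * t = √(Z * t) := by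
      rw [← h4]
      have : t = α ^ 2 * Z := by rw [hα2]; field_simp
      rw [this]; field_simp
    rw [le_div_iff₀ hs]
    linarith
  refine ⟨P₀ ∪ P₁, Finset.subset_union_left, ?_, fun φ hφ => ?_⟩
  · have := Finset.card_union_le P₀ P₁
    have : ((P₀ ∪ P₁).card : ℝ) ≤ P₀.card + P₁.card := by exact_mod_cast this
    linarith
  have hlocal : ∀ a, 0 ≤ a → prim φ a = 0 → ∀ B, IsLowerSet B →
      (∀ p ∈ P₀ ∪ P₁, ¬(a < p ∧ p ∈ B)) →
      ∫⁻ y in Set.Ioi a ∩ B, ENNReal.ofReal (prim φ y ^ 2) ∂ζ ≤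
      ENNReal.ofReal (s ^ 2) * ∫⁻ y in Set.Ioi a ∩ B, ENNReal.ofReal (φ y ^ 2) := by
    intro a ha hφa B hB hPB
    have hBm : MeasurableSet B := by
      have : B.OrdConnected := hB.ordConnected
      exact this.measurableSet
    have hGm : MeasurableSet (Set.Ioi a ∩ B) := measurableSet_Ioi.inter hBm
    have hGs : (Set.Ioi a ∩ B) ∩ Set.Ioi 0 = Set.Ioi a ∩ B :=
      Set.inter_eq_left.2 fun x hx => lt_of_le_of_lt ha hx.1
    refine lintegral_gap_le ζ ha hB (fun y hyA hay hyB => hA0 a y ha hay hyA fun p hp hpy =>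
      hPB p (Finset.mem_union_left _ hp) ⟨hpy.1, hB hpy.2 hyB⟩) hζA ?_ φ hφa
    have h1 : ∫⁻ y in Set.Ioi a ∩ B, ENNReal.ofReal (1 + y ^ 2) ∂ζ = ρ₁ (Set.Ioi a ∩ B) := by
      rw [withDensity_apply _ hGm, Measure.restrict_restrict hGm, hGs]
    have h2 : ∫⁻ y in Set.Ioi a ∩ B, A.indicator (fun x => ENNReal.ofReal (1 / (1 + x ^ 2))) y =
        ρ₂ (Set.Ioi a ∩ B) := by
      rw [withDensity_apply _ hGm, Measure.restrict_restrict hGm, hGs]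
    rw [h1, h2, ← ofReal_measureReal, ← ofReal_measureReal, ← ENNReal.ofReal_mul measureReal_nonneg]
    refine ENNReal.ofReal_le_ofReal ?_
    have h3 := hgap a B hB fun p hp => hPB p (Finset.mem_union_right _ hp)
    rw [hρr] at h3
    -- the arithmetic-geometric mean inequality for `α x + α⁻¹ y ≤ 2 s`
    set x := ρ₁.real (Set.Ioi a ∩ B)
    set y := ρ₂.real (Set.Ioi a ∩ B)
    have hx : 0 ≤ α * x := mul_nonneg hα0.le measureReal_nonneg
    have hy : 0 ≤ α⁻¹ * y := mul_nonneg (inv_nonneg.2 hα0.le) measureReal_nonneg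
    have hxy : x * y = (α * x) * (α⁻¹ * y) := by field_simp
    rw [hxy]
    nlinarith [sq_nonneg (α * x - α⁻¹ * y)]
  rw [ENNReal.ofReal_mul (by positivity), ofReal_norm_sq]
  suffices h : (0 : ℝ) ≤ 0 ∧ (prim φ 0 = 0 → ∫⁻ y in Set.Ioi 0, ENNReal.ofReal (prim φ y ^ 2) ∂ζ ≤
      ENNReal.ofReal (s ^ 2) * ∫⁻ y in Set.Ioi 0, ENNReal.ofReal (φ y ^ 2)) from
    h.2 (prim_of_nonpos φ le_rfl)
  have hz : ∀ a, (a = 0 ∨ a ∈ (P₀ ∪ P₁).filter (0 < ·)) → 0 ≤ a ∧ prim φ a = 0 := by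
    rintro a (rfl | ha)
    · exact ⟨le_rfl, prim_of_nonpos φ le_rfl⟩
    · rw [Finset.mem_filter] at ha
      exact ⟨ha.2.le, hφ a ha.1⟩
  refine gap_induction ((P₀ ∪ P₁).filter (0 < ·)) 0 (fun a => 0 ≤ a ∧ (prim φ a = 0 →
    ∫⁻ y in Set.Ioi a, ENNReal.ofReal (prim φ y ^ 2) ∂ζ ≤
      ENNReal.ofReal (s ^ 2) * ∫⁻ y in Set.Ioi a, ENNReal.ofReal (φ y ^ 2))) ?_ ?_
  · intro a b ha hb hab hno ih
    refine ⟨(hz a ha).1, fun hφa => ?_⟩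
    have hd : Disjoint (Set.Ioo a b) (Set.Ici b) := by
      rw [Set.disjoint_left]
      exact fun x hx hx' => absurd hx.2 (not_lt.2 hx')
    have hu : Set.Ioi a = Set.Ioo a b ∪ Set.Ici b := (Set.Ioo_union_Ici_eq_Ioi hab).symm
    have hsing : ∀ (m : Measure ℝ) (f : ℝ → ENNReal), f b = 0 →
        ∫⁻ y in Set.Ici b, f y ∂m = ∫⁻ y in Set.Ioi b, f y ∂m := by
      intro m f hf
      rw [← Set.Ioi_insert, Set.insert_eq, lintegral_union measurableSet_Ioi (by simp)]
      simp [hf]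
    have hvol : ∫⁻ y in Set.Ici b, ENNReal.ofReal (φ y ^ 2) =
        ∫⁻ y in Set.Ioi b, ENNReal.ofReal (φ y ^ 2) :=
      setLIntegral_congr Ioi_ae_eq_Ici.symm
    have hb0 : prim φ b = 0 := (hz b (Or.inr hb)).2
    rw [hu, lintegral_union measurableSet_Ici hd, lintegral_union measurableSet_Ici hd, mul_add,
      hvol, hsing ζ _ (by simp [hb0])]
    refine add_le_add ?_ (ih.2 hb0)
    have := hlocal a (hz a ha).1 hφa (Set.Iio b) (isLowerSet_Iio b) (fun p hp hpb =>
      hno p (Finset.mem_filter.2 ⟨hp, lt_of_le_of_lt (hz a ha).1 hpb.1⟩) hpb)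
    rwa [Set.Ioi_inter_Iio] at this
  · intro a ha hlast
    refine ⟨(hz a ha).1, fun hφa => ?_⟩
    have := hlocal a (hz a ha).1 hφa Set.univ isLowerSet_univ (fun p hp hpb =>
      absurd (hlast p (Finset.mem_filter.2 ⟨hp, lt_of_le_of_lt (hz a ha).1 hpb.1⟩))
        (not_le.2 hpb.1))
    rwa [Set.inter_univ] at this

end PointConditions

/-! ### Volterra operators and their adjoints -/

section Volterra

theorem lintegral_volterra_le (m : Measure ℝ) (w : ℝ → ℝ) (φ : HalfLineL2) :
    ∫⁻ y, ENNReal.ofReal ((w y * prim φ y) ^ 2) ∂m ≤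
      (∫⁻ y, ENNReal.ofReal (w y ^ 2 * y) ∂m) * ENNReal.ofReal (‖φ‖ ^ 2) := by
  rw [← lintegral_mul_const' _ _ ENNReal.ofReal_ne_top]
  refine lintegral_mono fun y => ?_
  rcases le_total y 0 with hy | hy
  · simp [prim_of_nonpos φ hy]
  · rw [← ENNReal.ofReal_mul (by positivity), mul_pow, mul_assoc]
    exact ENNReal.ofReal_le_ofReal (mul_le_mul_of_nonneg_left (sq_prim_le φ hy) (sq_nonneg _))

theorem memLp_two_of_lintegral_sq {α : Type*} {_ : MeasurableSpace α} {m : Measure α} {f : α → ℝ}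
    (hf : AEStronglyMeasurable f m) (h : ∫⁻ y, ENNReal.ofReal (f y ^ 2) ∂m ≠ ⊤) : MemLp f 2 m := by
  rw [memLp_two_iff_integrable_sq hf]
  refine ⟨hf.pow 2, ?_⟩
  rw [hasFiniteIntegral_iff_ofReal (Eventually.of_forall fun _ => sq_nonneg _)]
  exact h.lt_top

theorem ofReal_norm_sq_Lp {α : Type*} {_ : MeasurableSpace α} {m : Measure α} (f : Lp ℝ 2 m) :
    ENNReal.ofReal (‖f‖ ^ 2) = ∫⁻ y, ENNReal.ofReal (f y ^ 2) ∂m := by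
  rw [← ofReal_integral_eq_lintegral_ofReal (Lp.memLp f).integrable_sq
    (Eventually.of_forall fun t => sq_nonneg _), ← real_inner_self_eq_norm_sq, L2.inner_def]
  congr 1
  refine integral_congr_ae (Eventually.of_forall fun t => ?_)
  simp [sq]

theorem inner_Lp_eq_integral {α : Type*} {_ : MeasurableSpace α} {m : Measure α} (f g : Lp ℝ 2 m) :
    inner ℝ f g = ∫ t, f t * g t ∂m := by
  rw [L2.inner_def]
  refine integral_congr_ae (Eventually.of_forall fun t => ?_)
  simp [mul_comm]

theorem memLp_volterra {m : Measure ℝ} {w : ℝ → ℝ} (hw : Measurable w)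
    (h : ∫⁻ y, ENNReal.ofReal (w y ^ 2 * y) ∂m ≠ ⊤) (φ : HalfLineL2) :
    MemLp (fun y => w y * prim φ y) 2 m :=
  memLp_two_of_lintegral_sq (hw.mul (continuous_prim φ).measurable).aestronglyMeasurable
    (ne_top_of_le_ne_top (ENNReal.mul_ne_top h ENNReal.ofReal_ne_top) (lintegral_volterra_le m w φ))

/-- The operator `φ ↦ w · ∫₀^y φ` from `L²(0, ∞)` to `L²(m)`, for a weight with `∫ w² y dm < ∞`. -/
noncomputable def volterra (m : Measure ℝ) (w : ℝ → ℝ) (hw : Measurable w)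
    (h : ∫⁻ y, ENNReal.ofReal (w y ^ 2 * y) ∂m ≠ ⊤) : HalfLineL2 →L[ℝ] Lp ℝ 2 m :=
  LinearMap.mkContinuous
    { toFun := fun φ => (memLp_volterra hw h φ).toLp _
      map_add' := fun φ χ => by
        rw [← MemLp.toLp_add]
        congr 1
        funext y
        simp [prim_add, mul_add]
      map_smul' := fun c φ => by
        rw [RingHom.id_apply, ← MemLp.toLp_const_smul]
        congr 1
        funext y
        simp only [prim_smul, Pi.smul_apply, smul_eq_mul]
        ring }
    (√(∫⁻ y, ENNReal.ofReal (w y ^ 2 * y) ∂m).toReal) (fun φ => by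
      refine abs_le_of_sq_le_sq' ?_ (by positivity) |>.2
      rw [mul_pow, Real.sq_sqrt ENNReal.toReal_nonneg,
        ← ENNReal.ofReal_le_ofReal_iff (by positivity), ofReal_norm_sq_Lp,
        ENNReal.ofReal_mul ENNReal.toReal_nonneg, ENNReal.ofReal_toReal h]
      refine le_trans (le_of_eq (lintegral_congr_ae ?_)) (lintegral_volterra_le m w φ)
      filter_upwards [MemLp.coeFn_toLp (memLp_volterra hw h φ)] with y hy
      change ENNReal.ofReal (((memLp_volterra hw h φ).toLp _ y) ^ 2) = _
      rw [hy])

variable {m : Measure ℝ} {w : ℝ → ℝ} (hw : Measurable w)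
  (h : ∫⁻ y, ENNReal.ofReal (w y ^ 2 * y) ∂m ≠ ⊤)

theorem coeFn_volterra (φ : HalfLineL2) : volterra m w hw h φ =ᵐ[m] fun y => w y * prim φ y :=
  MemLp.coeFn_toLp (memLp_volterra hw h φ)

theorem inner_volterra_left (φ : HalfLineL2) (ψ : Lp ℝ 2 m) :
    inner ℝ (volterra m w hw h φ) ψ = ∫ y, w y * prim φ y * ψ y ∂m := by
  rw [inner_Lp_eq_integral]
  refine integral_congr_ae ?_
  filter_upwards [coeFn_volterra hw h φ] with y hy
  rw [hy]

include hw h in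
theorem memLp_weight_Ici {a : ℝ} (ha : 0 < a) : MemLp w 2 (m.restrict (Set.Ici a)) := by
  refine memLp_two_of_lintegral_sq hw.aestronglyMeasurable ?_
  have h1 : ∫⁻ y in Set.Ici a, ENNReal.ofReal (w y ^ 2) ∂m ≤
      ENNReal.ofReal a⁻¹ * ∫⁻ y, ENNReal.ofReal (w y ^ 2 * y) ∂m := by
    rw [← lintegral_const_mul' _ _ ENNReal.ofReal_ne_top]
    refine le_trans (setLIntegral_mono' measurableSet_Ici fun y hy => ?_) (setLIntegral_le_lintegral _ _)
    have hy' : a ≤ y := hy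
    rw [← ENNReal.ofReal_mul (by positivity)]
    refine ENNReal.ofReal_le_ofReal ?_
    rw [inv_mul_eq_div, le_div_iff₀ ha]
    gcongr
  exact ne_top_of_le_ne_top (ENNReal.mul_ne_top ENNReal.ofReal_ne_top h) h1

include hw h in
theorem integrableOn_weight_mul_Ici {a : ℝ} (ha : 0 < a) (ψ : Lp ℝ 2 m) :
    IntegrableOn (fun y => w y * ψ y) (Set.Ici a) m :=
  (memLp_weight_Ici hw h ha).integrable_mul ((Lp.memLp ψ).mono_measure Measure.restrict_le_self)

/-- The adjoint of `φ ↦ w ∫₀^y φ` is `ψ ↦ ∫_{[y, ∞)} w ψ dm`. -/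
theorem coeFn_adjoint_volterra [SFinite m] (ψ : Lp ℝ 2 m) :
    (volterra m w hw h).adjoint ψ =ᵐ[volume.restrict (Set.Ioi 0)]
      fun y => ∫ t in Set.Ici y, w t * ψ t ∂m := by
  set g : HalfLineL2 := (volterra m w hw h).adjoint ψ with hg
  -- the two functions agree almost everywhere on each `(a, b]` with `0 < a`
  have key : ∀ a b : ℝ, 0 < a → ∀ᵐ y ∂(volume.restrict (Set.Ioc a b)),
      g y = ∫ t in Set.Ici y, w t * ψ t ∂m := by
    intro a b ha
    have hsub : Set.Ioc a b ⊆ Set.Ioi 0 := Ioc_subset_Ioi_zero ha.le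
    have hI := integrableOn_weight_mul_Ici hw h ha ψ
    have hprod : Integrable (fun p : ℝ × ℝ =>
        Set.indicator {p : ℝ × ℝ | p.1 ≤ p.2} (fun p => w p.2 * ψ p.2) p)
        ((volume.restrict (Set.Ioc a b)).prod (m.restrict (Set.Ici a))) := by
      refine Integrable.indicator ?_ (measurableSet_le measurable_fst measurable_snd)
      exact hI.comp_snd (volume.restrict (Set.Ioc a b))
    have hEq : ∀ y ∈ Set.Ioc a b, ∫ t in Set.Ici y, w t * ψ t ∂m =
        ∫ t in Set.Ici a, Set.indicator {p : ℝ × ℝ | p.1 ≤ p.2} (fun p => w p.2 * ψ p.2) (y, t) ∂m := by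
      intro y hy
      have : (fun t => Set.indicator {p : ℝ × ℝ | p.1 ≤ p.2} (fun p => w p.2 * ψ p.2) (y, t)) =
          Set.indicator (Set.Ici y) (fun t => w t * ψ t) := by
        funext t
        simp [Set.indicator_apply]
      rw [this, setIntegral_indicator measurableSet_Ici, Set.inter_eq_self_of_subset_right]
      exact Set.Ici_subset_Ici.2 hy.1.le
    have hint2 : Integrable (fun y => ∫ t in Set.Ici y, w t * ψ t ∂m)
        (volume.restrict (Set.Ioc a b)) := by
      refine (hprod.integral_prod_left).congr ?_
      filter_upwards [ae_restrict_mem measurableSet_Ioc] with y hy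
      exact (hEq y hy).symm
    refine Integrable.ae_eq_of_forall_setIntegral_eq _ _ (integrableOn_Ioc g ha.le b) hint2 ?_
    intro s hs _
    rw [Measure.restrict_restrict hs]
    set s' := s ∩ Set.Ioc a b with hs'
    have hs'm : MeasurableSet s' := hs.inter measurableSet_Ioc
    have hs's : s' ⊆ Set.Ioc a b := Set.inter_subset_right
    have hfin : (volume.restrict (Set.Ioi (0:ℝ))) s' ≠ ⊤ := by
      refine ne_top_of_le_ne_top ?_ (Measure.restrict_apply_le _ _)
      exact ne_top_of_le_ne_top (by simp) (measure_mono hs's)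
    set φ : HalfLineL2 := indicatorConstLp 2 hs'm hfin (1 : ℝ) with hφ
    have h1 : ∫ t in s', g t = inner ℝ φ g := by
      rw [hφ, L2.inner_indicatorConstLp_one, Measure.restrict_restrict hs'm,
        Set.inter_eq_self_of_subset_left (hs's.trans hsub)]
    have hprim : ∀ y, prim φ y = ∫ t in s', Set.indicator (Set.Iic y) (fun _ => (1:ℝ)) t := by
      intro y
      have h2 : prim φ y = ∫ t in Set.Ioc 0 y, Set.indicator s' (fun _ => (1:ℝ)) t := by
        unfold prim
        refine integral_congr_ae (ae_restrict_of_ae_restrict_of_subset (Ioc_subset_Ioi_zero le_rfl) ?_)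
        exact indicatorConstLp_coeFn
      rw [h2, setIntegral_indicator hs'm, setIntegral_indicator measurableSet_Iic]
      congr 2
      ext t
      simp only [Set.mem_inter_iff, Set.mem_Ioc, Set.mem_Iic]
      constructor
      · rintro ⟨⟨_, h3⟩, h4⟩; exact ⟨h4, h3⟩
      · rintro ⟨h4, h3⟩; exact ⟨⟨hsub (hs's h4), h3⟩, h4⟩
    rw [h1, hg, ContinuousLinearMap.adjoint_inner_right, inner_volterra_left]
    have hzero : ∀ y, y ∉ Set.Ici a → w y * prim φ y * ψ y = 0 := by
      intro y hy
      rw [hprim, ← integral_indicator hs'm, integral_eq_zero_of_ae, mul_zero, zero_mul]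
      refine Eventually.of_forall fun t => ?_
      change s'.indicator ((Set.Iic y).indicator fun _ => (1 : ℝ)) t = 0
      rw [Set.indicator_indicator, Set.indicator_of_notMem]
      exact fun h3 => hy ((hs's h3.1).1.le.trans h3.2)
    rw [← setIntegral_eq_integral_of_forall_compl_eq_zero (s := Set.Ici a) hzero]
    have hR : ∫ y in s', (∫ t in Set.Ici y, w t * ψ t ∂m) =
        ∫ y in s', ∫ t in Set.Ici a,
          Set.indicator {p : ℝ × ℝ | p.1 ≤ p.2} (fun p => w p.2 * ψ p.2) (y, t) ∂m :=
      setIntegral_congr_fun hs'm fun y hy => hEq y (hs's hy)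
    rw [hR, integral_integral_swap]
    · refine integral_congr_ae (Eventually.of_forall fun y => ?_)
      simp only
      rw [hprim]
      have : ∀ t, Set.indicator {p : ℝ × ℝ | p.1 ≤ p.2} (fun p => w p.2 * ψ p.2) (t, y) =
          Set.indicator (Set.Iic y) (fun _ => (1:ℝ)) t * (w y * ψ y) := by
        intro t
        simp [Set.indicator_apply]
      simp_rw [this]
      rw [integral_mul_const]
      ring
    · refine hprod.mono_measure (Measure.prod_mono (Measure.restrict_mono hs's le_rfl) le_rfl)
  have hall : ∀ᵐ y ∂volume, ∀ n : ℕ, y ∈ Set.Ioc (1 / ((n:ℝ) + 1)) (n + 1) →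
      g y = ∫ t in Set.Ici y, w t * ψ t ∂m := by
    rw [ae_all_iff]
    intro n
    exact (ae_restrict_iff' measurableSet_Ioc).1 (key _ _ (by positivity))
  rw [EventuallyEq, ae_restrict_iff' measurableSet_Ioi]
  filter_upwards [hall] with y hy hy0
  obtain ⟨n1, h1⟩ := exists_nat_one_div_lt (show (0:ℝ) < y from hy0)
  obtain ⟨n2, h2⟩ := exists_nat_gt y
  refine hy (max n1 n2) ⟨lt_of_le_of_lt ?_ h1, ?_⟩
  · have : (n1 : ℝ) ≤ (max n1 n2 : ℕ) := by exact_mod_cast le_max_left _ _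
    gcongr
  · have : (n2 : ℝ) ≤ (max n1 n2 : ℕ) := by exact_mod_cast le_max_right _ _
    linarith

end Volterra

/-! ### Hilbert–Schmidt norms of integral operators -/

/-- The Hilbert–Schmidt norm of an operator with values in `L²(m)` that is given by a kernel `k`:
Parseval's identity for `k s`, integrated over `s`. -/
theorem tsum_ofReal_norm_sq_of_kernel {E : Type*} [NormedAddCommGroup E] [InnerProductSpace ℝ E]
    [CompleteSpace E] {ι : Type*} [Countable ι] (b : HilbertBasis ι ℝ E) {α : Type*}
    {_ : MeasurableSpace α} {m : Measure α} (A : E →L[ℝ] Lp ℝ 2 m) (k : α → E)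
    (hk : ∀ x, ∀ᵐ s ∂m, A x s = inner ℝ (k s) x) :
    ∑' i, ENNReal.ofReal (‖A (b i)‖ ^ 2) = ∫⁻ s, ENNReal.ofReal (‖k s‖ ^ 2) ∂m := by
  simp_rw [ofReal_norm_sq_Lp]
  rw [← lintegral_tsum fun i => ((Lp.aestronglyMeasurable _).aemeasurable.pow_const 2).ennreal_ofReal]
  refine lintegral_congr_ae ?_
  filter_upwards [ae_all_iff.2 fun i => hk (b i)] with s hs
  simp_rw [hs]
  have h1 := b.hasSum_inner_mul_inner (k s) (k s)
  rw [real_inner_self_eq_norm_sq] at h1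
  have h2 : HasSum (fun i => inner ℝ (k s) (b i) ^ 2) (‖k s‖ ^ 2) := by
    refine h1.congr_fun fun i => ?_
    rw [sq, real_inner_comm (b i) (k s)]
  rw [← h2.tsum_eq, ENNReal.ofReal_tsum_of_nonneg (fun _ => sq_nonneg _) h2.summable]

theorem norm_sq_indicatorConstLp_one {α : Type*} {_ : MeasurableSpace α} {m : Measure α} {s : Set α}
    (hs : MeasurableSet s) (h : m s ≠ ⊤) : ‖indicatorConstLp 2 hs h (1 : ℝ)‖ ^ 2 = m.real s := by
  rw [norm_indicatorConstLp (by norm_num) (by norm_num), norm_one, one_mul, ENNReal.toReal_ofNat,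
    ← Real.sqrt_eq_rpow, Real.sq_sqrt measureReal_nonneg]

/-! ### The generalized string on the half-line and its block operator -/

/-- The coefficients of a generalized string on `(0, ∞)`: a density `κ` and a measure `ν`, both
with finite moments up to order two (in the sense required below). -/
structure HalfLineString where
  /-- The coefficient multiplying the spectral parameter. -/
  κ : ℝ → ℝ
  /-- The coefficient multiplying the square of the spectral parameter. -/
  ν : Measure ℝ
  measurable_κ : Measurable κ
  lintegral_κ : ∫⁻ y in Set.Ioi 0, ENNReal.ofReal ((1 + y ^ 2) * κ y ^ 2) ≠ ⊤
  ν_Iic : ν (Set.Iic 0) = 0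
  lintegral_ν : ∫⁻ y, ENNReal.ofReal (1 + y ^ 2) ∂ν ≠ ⊤

namespace HalfLineString

variable (S : HalfLineString)

instance : IsFiniteMeasure S.ν := by
  refine ⟨lt_of_le_of_lt ?_ S.lintegral_ν.lt_top⟩
  rw [← lintegral_one]
  refine lintegral_mono fun y => ?_
  rw [← ENNReal.ofReal_one]
  exact ENNReal.ofReal_le_ofReal (by nlinarith [sq_nonneg y])

theorem ae_pos_ν : ∀ᵐ y ∂S.ν, 0 < y := by
  rw [ae_iff]
  convert S.ν_Iic using 2
  ext y; simp

theorem lintegral_κ_sq_mul_ne_top :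
    ∫⁻ y in Set.Ioi 0, ENNReal.ofReal (S.κ y ^ 2 * y) ≠ ⊤ := by
  refine ne_top_of_le_ne_top S.lintegral_κ (lintegral_mono fun y => ENNReal.ofReal_le_ofReal ?_)
  rw [mul_comm]
  exact mul_le_mul_of_nonneg_right (by nlinarith [sq_nonneg (y - 1)]) (sq_nonneg _)

theorem lintegral_one_sq_mul_ne_top :
    ∫⁻ y, ENNReal.ofReal ((1 : ℝ) ^ 2 * y) ∂S.ν ≠ ⊤ := by
  refine ne_top_of_le_ne_top S.lintegral_ν (lintegral_mono fun y => ENNReal.ofReal_le_ofReal ?_)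
  nlinarith [sq_nonneg (y - 1)]

/-- The operator `φ ↦ κ ∫₀^y φ` on `L²(0, ∞)`. -/
noncomputable def opL : HalfLineL2 →L[ℝ] HalfLineL2 :=
  volterra (volume.restrict (Set.Ioi 0)) S.κ S.measurable_κ S.lintegral_κ_sq_mul_ne_top

/-- The operator `φ ↦ ∫₀^y φ` from `L²(0, ∞)` to `L²(ν)`. -/
noncomputable def opJ : HalfLineL2 →L[ℝ] Lp ℝ 2 S.ν :=
  volterra S.ν (fun _ => 1) measurable_const S.lintegral_one_sq_mul_ne_top

/-- The Hilbert space `L²(0, ∞) ⊕ L²(ν)`. -/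
abbrev Space : Type := WithLp 2 (HalfLineL2 × Lp ℝ 2 S.ν)

/-- The block operator `(φ, ψ) ↦ (L φ + L* φ + J* ψ, J φ)`. -/
noncomputable def op : S.Space →L[ℝ] S.Space :=
  ((WithLp.prodContinuousLinearEquiv 2 ℝ HalfLineL2 (Lp ℝ 2 S.ν)).symm : _ →L[ℝ] _) ∘L
    (((S.opL + S.opL.adjoint) ∘L ContinuousLinearMap.fst ℝ _ _ +
        S.opJ.adjoint ∘L ContinuousLinearMap.snd ℝ _ _).prod
      (S.opJ ∘L ContinuousLinearMap.fst ℝ _ _)) ∘L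
    ((WithLp.prodContinuousLinearEquiv 2 ℝ HalfLineL2 (Lp ℝ 2 S.ν)) : _ →L[ℝ] _)

/-- The reflection `(φ, ψ) ↦ (φ, -ψ)`. -/
noncomputable def refl : S.Space →L[ℝ] S.Space :=
  ((WithLp.prodContinuousLinearEquiv 2 ℝ HalfLineL2 (Lp ℝ 2 S.ν)).symm : _ →L[ℝ] _) ∘L
    ((ContinuousLinearMap.fst ℝ HalfLineL2 (Lp ℝ 2 S.ν)).prod
      (-ContinuousLinearMap.snd ℝ HalfLineL2 (Lp ℝ 2 S.ν))) ∘L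
    ((WithLp.prodContinuousLinearEquiv 2 ℝ HalfLineL2 (Lp ℝ 2 S.ν)) : _ →L[ℝ] _)

@[simp] theorem op_fst (x : S.Space) :
    (S.op x).fst = S.opL x.fst + S.opL.adjoint x.fst + S.opJ.adjoint x.snd := rfl

@[simp] theorem op_snd (x : S.Space) : (S.op x).snd = S.opJ x.fst := rfl

@[simp] theorem refl_fst (x : S.Space) : (S.refl x).fst = x.fst := rfl

@[simp] theorem refl_snd (x : S.Space) : (S.refl x).snd = -x.snd := rfl

theorem inner_op (x y : S.Space) : inner ℝ (S.op x) y =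
    inner ℝ (S.opL x.fst) y.fst + inner ℝ x.fst (S.opL y.fst) + inner ℝ x.snd (S.opJ y.fst) +
      inner ℝ (S.opJ x.fst) y.snd := by
  rw [WithLp.prod_inner_apply]
  change inner ℝ (S.op x).fst y.fst + inner ℝ (S.op x).snd y.snd = _
  rw [op_fst, op_snd, inner_add_left, inner_add_left, ContinuousLinearMap.adjoint_inner_left,
    ContinuousLinearMap.adjoint_inner_left]

theorem isSymmetric_op : (S.op : S.Space →ₗ[ℝ] S.Space).IsSymmetric := by
  intro x y
  change inner ℝ (S.op x) y = inner ℝ x (S.op y)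
  rw [inner_op, real_inner_comm (S.op y) x, inner_op, real_inner_comm x.fst (S.opL y.fst),
    real_inner_comm (S.opL x.fst) y.fst, real_inner_comm (S.opJ x.fst) y.snd,
    real_inner_comm x.snd (S.opJ y.fst)]
  ring

theorem opL_coeFn (φ : HalfLineL2) :
    S.opL φ =ᵐ[volume.restrict (Set.Ioi 0)] fun y => S.κ y * prim φ y :=
  coeFn_volterra _ _ φ

theorem opJ_coeFn (φ : HalfLineL2) : S.opJ φ =ᵐ[S.ν] fun y => prim φ y := by
  refine (coeFn_volterra _ _ φ).trans (Eventually.of_forall fun y => ?_)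
  simp

theorem op_fst_coeFn (x : S.Space) : (S.op x).fst =ᵐ[volume.restrict (Set.Ioi 0)] fun y =>
    S.κ y * prim x.fst y + (∫ t in Set.Ici y, S.κ t * x.fst t ∂(volume.restrict (Set.Ioi 0))) +
      ∫ t in Set.Ici y, x.snd t ∂S.ν := by
  rw [op_fst]
  filter_upwards [Lp.coeFn_add (S.opL x.fst + S.opL.adjoint x.fst) (S.opJ.adjoint x.snd),
    Lp.coeFn_add (S.opL x.fst) (S.opL.adjoint x.fst), S.opL_coeFn x.fst,
    coeFn_adjoint_volterra S.measurable_κ S.lintegral_κ_sq_mul_ne_top x.fst,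
    coeFn_adjoint_volterra measurable_const S.lintegral_one_sq_mul_ne_top x.snd]
    with y h1 h2 h3 h4 h5
  simp only [one_mul] at h5
  rw [h1, Pi.add_apply, h2, Pi.add_apply, h3, opL, h4, opJ, h5]

/-- The kernel of the first component of `S.op`. -/
theorem exists_kernel_fst {y : ℝ} (hy : 0 < y) : ∃ k : S.Space,
    (∀ x : S.Space, inner ℝ k x = S.κ y * prim x.fst y +
      (∫ t in Set.Ici y, S.κ t * x.fst t ∂(volume.restrict (Set.Ioi 0))) +
      ∫ t in Set.Ici y, x.snd t ∂S.ν) ∧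
    ENNReal.ofReal (‖k‖ ^ 2) = ENNReal.ofReal (S.κ y ^ 2 * y) +
      (∫⁻ t in Set.Ici y, ENNReal.ofReal (S.κ t ^ 2) ∂(volume.restrict (Set.Ioi 0))) +
      S.ν (Set.Ici y) := by
  set g : ℝ → ℝ := fun t => Set.indicator (Set.Ioc 0 y) (fun _ => S.κ y) t +
    Set.indicator (Set.Ici y) S.κ t with hg
  have hm1 : MemLp (Set.indicator (Set.Ioc 0 y) (fun _ => S.κ y)) 2
      (volume.restrict (Set.Ioi (0:ℝ))) :=
    memLp_indicator_const 2 measurableSet_Ioc _ (Or.inr (by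
      refine ne_top_of_le_ne_top ?_ (Measure.restrict_apply_le _ _)
      simp))
  have hm2 : MemLp (Set.indicator (Set.Ici y) S.κ) 2 (volume.restrict (Set.Ioi (0:ℝ))) :=
    (memLp_indicator_iff_restrict measurableSet_Ici).2
      (memLp_weight_Ici S.measurable_κ S.lintegral_κ_sq_mul_ne_top hy)
  have hg2 : MemLp g 2 (volume.restrict (Set.Ioi (0:ℝ))) := hm1.add hm2
  have hν : S.ν (Set.Ici y) ≠ ⊤ := measure_ne_top _ _
  refine ⟨WithLp.toLp 2 (hg2.toLp g, indicatorConstLp 2 measurableSet_Ici hν 1), fun x => ?_, ?_⟩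
  · rw [WithLp.prod_inner_apply]
    change inner ℝ (hg2.toLp g) x.fst + inner ℝ (indicatorConstLp 2 measurableSet_Ici hν (1:ℝ)) x.snd = _
    rw [L2.inner_indicatorConstLp_one]
    congr 1
    rw [inner_eq_integral]
    have h1 : ∀ᵐ t ∂(volume.restrict (Set.Ioi (0:ℝ))), hg2.toLp g t * x.fst t =
        S.κ y * Set.indicator (Set.Ioc 0 y) x.fst t +
          Set.indicator (Set.Ici y) (fun t => S.κ t * x.fst t) t := by
      filter_upwards [hg2.coeFn_toLp] with t ht
      rw [ht, hg]
      simp only [Set.indicator_apply, add_mul, ite_mul, mul_ite, zero_mul, mul_zero]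
    rw [integral_congr_ae h1, integral_add, integral_const_mul, integral_indicator measurableSet_Ioc,
      integral_indicator measurableSet_Ici, Measure.restrict_restrict measurableSet_Ioc,
      Set.inter_eq_self_of_subset_left (Ioc_subset_Ioi_zero le_rfl)]
    · rfl
    · refine Integrable.const_mul ?_ _
      rw [integrable_indicator_iff measurableSet_Ioc, IntegrableOn,
        Measure.restrict_restrict measurableSet_Ioc,
        Set.inter_eq_self_of_subset_left (Ioc_subset_Ioi_zero le_rfl)]
      exact integrableOn_Ioc x.fst le_rfl y
    · rw [integrable_indicator_iff measurableSet_Ici]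
      exact integrableOn_weight_mul_Ici S.measurable_κ S.lintegral_κ_sq_mul_ne_top hy x.fst
  · rw [WithLp.prod_norm_sq_eq_of_L2]
    change ENNReal.ofReal (‖hg2.toLp g‖ ^ 2 +
      ‖indicatorConstLp 2 measurableSet_Ici hν (1:ℝ)‖ ^ 2) = _
    rw [ENNReal.ofReal_add (by positivity) (by positivity)]
    congr 1
    · rw [ofReal_norm_sq_Lp]
      have h1 : ∀ᵐ t ∂(volume.restrict (Set.Ioi (0:ℝ))), ENNReal.ofReal (hg2.toLp g t ^ 2) =
        Set.indicator (Set.Ioc 0 y) (fun _ => ENNReal.ofReal (S.κ y ^ 2)) t +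
          Set.indicator (Set.Ici y) (fun t => ENNReal.ofReal (S.κ t ^ 2)) t := by
        have hne : ∀ᵐ t ∂(volume.restrict (Set.Ioi (0:ℝ))), t ≠ y :=
          ae_restrict_of_ae (Measure.ae_ne volume y)
        filter_upwards [hg2.coeFn_toLp, hne] with t ht hty
        rw [ht, hg]
        simp only [Set.indicator_apply, Set.mem_Ioc, Set.mem_Ici]
        rcases lt_or_gt_of_ne hty with h | h
        · rw [if_neg (not_le.2 h), if_neg (not_le.2 h)]
          split_ifs <;> simp
        · simp [h.le, not_le.2 h]
      rw [lintegral_congr_ae h1, lintegral_add_left (measurable_const.indicator measurableSet_Ioc),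
        lintegral_indicator measurableSet_Ioc, lintegral_indicator measurableSet_Ici,
        setLIntegral_const, Measure.restrict_apply measurableSet_Ioc,
        Set.inter_eq_self_of_subset_left (Ioc_subset_Ioi_zero le_rfl), Real.volume_Ioc, sub_zero,
        ENNReal.ofReal_mul (sq_nonneg _)]
    · rw [norm_sq_indicatorConstLp_one, ofReal_measureReal]

/-- The kernel of the second component of `S.op`. -/
theorem exists_kernel_snd {y : ℝ} (hy : 0 < y) : ∃ k : S.Space,
    (∀ x : S.Space, inner ℝ k x = prim x.fst y) ∧
    ENNReal.ofReal (‖k‖ ^ 2) = ENNReal.ofReal y := by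
  have hfin : (volume.restrict (Set.Ioi (0:ℝ))) (Set.Ioc 0 y) ≠ ⊤ := by
    refine ne_top_of_le_ne_top ?_ (Measure.restrict_apply_le _ _)
    simp
  refine ⟨WithLp.toLp 2 (indicatorConstLp 2 measurableSet_Ioc hfin 1, 0), fun x => ?_, ?_⟩
  · rw [WithLp.prod_inner_apply]
    change inner ℝ (indicatorConstLp 2 measurableSet_Ioc hfin (1:ℝ)) x.fst +
      inner ℝ (0 : Lp ℝ 2 S.ν) x.snd = _
    rw [L2.inner_indicatorConstLp_one, inner_zero_left, add_zero,
      Measure.restrict_restrict measurableSet_Ioc,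
      Set.inter_eq_self_of_subset_left (Ioc_subset_Ioi_zero le_rfl)]
    rfl
  · rw [WithLp.prod_norm_sq_eq_of_L2]
    change ENNReal.ofReal (‖indicatorConstLp 2 measurableSet_Ioc hfin (1:ℝ)‖ ^ 2 +
      ‖(0 : Lp ℝ 2 S.ν)‖ ^ 2) = _
    have : (volume.restrict (Set.Ioi (0:ℝ))).real (Set.Ioc 0 y) = y := by
      rw [measureReal_def, Measure.restrict_apply measurableSet_Ioc,
        Set.inter_eq_self_of_subset_left (Ioc_subset_Ioi_zero le_rfl)]
      simp [hy.le]
    rw [norm_sq_indicatorConstLp_one, this]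
    simp

/-- The Hilbert–Schmidt norm of the block operator. -/
theorem tsum_ofReal_norm_sq_op {ι : Type*} [Countable ι] (b : HilbertBasis ι ℝ S.Space) :
    ∑' i, ENNReal.ofReal (‖S.op (b i)‖ ^ 2) =
      2 * ((∫⁻ y in Set.Ioi 0, ENNReal.ofReal (S.κ y ^ 2 * y)) + ∫⁻ y, ENNReal.ofReal y ∂S.ν) := by
  classical
  choose! k1 hk1 hk1n using fun (y : ℝ) (hy : 0 < y) => S.exists_kernel_fst hy
  choose! k2 hk2 hk2n using fun (y : ℝ) (hy : 0 < y) => S.exists_kernel_snd hy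
  have hsplit : ∀ i, ENNReal.ofReal (‖S.op (b i)‖ ^ 2) =
      ENNReal.ofReal (‖(WithLp.fstL 2 ℝ _ _ ∘L S.op) (b i)‖ ^ 2) +
        ENNReal.ofReal (‖(WithLp.sndL 2 ℝ _ _ ∘L S.op) (b i)‖ ^ 2) := by
    intro i
    rw [WithLp.prod_norm_sq_eq_of_L2, ENNReal.ofReal_add (by positivity) (by positivity)]
    rfl
  simp_rw [hsplit]
  rw [ENNReal.tsum_add, tsum_ofReal_norm_sq_of_kernel b _ k1, tsum_ofReal_norm_sq_of_kernel b _ k2]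
  · have e1 : ∫⁻ y in Set.Ioi 0, ENNReal.ofReal (‖k1 y‖ ^ 2) =
        ∫⁻ y in Set.Ioi 0, (ENNReal.ofReal (S.κ y ^ 2 * y) +
          (∫⁻ t in Set.Ici y, ENNReal.ofReal (S.κ t ^ 2) ∂(volume.restrict (Set.Ioi 0))) +
          S.ν (Set.Ici y)) :=
      setLIntegral_congr_fun measurableSet_Ioi fun y hy => hk1n y hy
    have e2 : ∫⁻ y, ENNReal.ofReal (‖k2 y‖ ^ 2) ∂S.ν = ∫⁻ y, ENNReal.ofReal y ∂S.ν :=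
      lintegral_congr_ae (S.ae_pos_ν.mono fun y hy => hk2n y hy)
    -- the layer cake formula evaluates the tails
    have e3 : ∫⁻ y in Set.Ioi 0, S.ν (Set.Ici y) = ∫⁻ y, ENNReal.ofReal y ∂S.ν :=
      (lintegral_eq_lintegral_meas_le S.ν (S.ae_pos_ν.mono fun y hy => hy.le) aemeasurable_id).symm
    set ρ := (volume.restrict (Set.Ioi (0:ℝ))).withDensity fun t => ENNReal.ofReal (S.κ t ^ 2) with hρ
    have hmκ : Measurable fun t => ENNReal.ofReal (S.κ t ^ 2) :=
      (S.measurable_κ.pow_const 2).ennreal_ofReal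
    have e4 : ∫⁻ y in Set.Ioi 0,
        (∫⁻ t in Set.Ici y, ENNReal.ofReal (S.κ t ^ 2) ∂(volume.restrict (Set.Ioi 0))) =
        ∫⁻ y in Set.Ioi 0, ENNReal.ofReal (S.κ y ^ 2 * y) := by
      have h1 := lintegral_eq_lintegral_meas_le (f := id) ρ
        ((withDensity_absolutelyContinuous _ _).ae_le
          ((ae_restrict_mem measurableSet_Ioi).mono fun y (hy : (0:ℝ) < y) => hy.le))
        aemeasurable_id
      have h2 : ∫⁻ y, ENNReal.ofReal (id y) ∂ρ =
          ∫⁻ y in Set.Ioi 0, ENNReal.ofReal (S.κ y ^ 2 * y) := by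
        rw [hρ, lintegral_withDensity_eq_lintegral_mul _ hmκ (by fun_prop)]
        refine lintegral_congr fun y => ?_
        simp [ENNReal.ofReal_mul (sq_nonneg _)]
      rw [← h2, h1]
      refine lintegral_congr fun y => ?_
      change _ = ρ (Set.Ici y)
      rw [hρ, withDensity_apply _ measurableSet_Ici]
    have hmν : Measurable fun y => S.ν (Set.Ici y) :=
      (antitone_iff_forall_lt.2 fun a b hab => measure_mono (Set.Ici_subset_Ici.2 hab.le)).measurable
    have hm1 : Measurable fun y => ENNReal.ofReal (S.κ y ^ 2 * y) :=
      ((S.measurable_κ.pow_const 2).mul measurable_id).ennreal_ofReal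
    rw [e1, e2, lintegral_add_right _ hmν, lintegral_add_left hm1, e3, e4]
    ring
  · intro x
    filter_upwards [S.opJ_coeFn x.fst, S.ae_pos_ν] with y hy h0
    rw [hk2 y h0]
    exact hy
  · intro x
    filter_upwards [S.op_fst_coeFn x, ae_restrict_mem measurableSet_Ioi] with y hy h0
    rw [hk1 y h0]
    exact hy

end HalfLineString

theorem countable_of_hilbertBasis {E : Type*} [NormedAddCommGroup E] [InnerProductSpace ℝ E]
    [SecondCountableTopology E] {ι : Type*} (b : HilbertBasis ι ℝ E) : Countable ι := by
  have hdist : ∀ i j, i ≠ j → 1 ≤ dist (b i) (b j) := by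
    intro i j hij
    rw [dist_eq_norm, ← abs_of_nonneg (norm_nonneg (b i - b j)), ← Real.sqrt_sq_eq_abs]
    refine Real.le_sqrt_of_sq_le ?_
    rw [norm_sub_sq_real, b.orthonormal.2 hij, b.orthonormal.1, b.orthonormal.1]
    norm_num
  have : DiscreteTopology (Set.range b) := by
    refine DiscreteTopology.of_forall_le_dist (r := 1) one_pos ?_
    rintro ⟨_, i, rfl⟩ ⟨_, j, rfl⟩ hij
    exact hdist i j fun h => hij (by rw [h])
  have h2 : Countable (Set.range b) := TopologicalSpace.separableSpace_iff_countable.1 inferInstance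
  exact (Set.rangeFactorization_injective.2 b.orthonormal.linearIndependent.injective).countable

namespace HalfLineString

variable (S : HalfLineString)

/-- The quantity `∫₀^∞ y κ² dy + ∫ y dν`. -/
noncomputable def moment : ℝ :=
  ((∫⁻ y in Set.Ioi 0, ENNReal.ofReal (S.κ y ^ 2 * y)) + ∫⁻ y, ENNReal.ofReal y ∂S.ν).toReal

instance : SecondCountableTopology S.Space :=
  have : Fact ((2 : ENNReal) ≠ ⊤) := ⟨by norm_num⟩
  have : SecondCountableTopology HalfLineL2 := inferInstance
  have : SecondCountableTopology (Lp ℝ 2 S.ν) := inferInstance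
  (WithLp.prodContinuousLinearEquiv 2 ℝ HalfLineL2 (Lp ℝ 2 S.ν)).toHomeomorph.secondCountableTopology

theorem tsum_ofReal_norm_sq_op_eq {ι : Type*} (b : HilbertBasis ι ℝ S.Space) :
    ∑' i, ENNReal.ofReal (‖S.op (b i)‖ ^ 2) = ENNReal.ofReal (2 * S.moment) := by
  have := countable_of_hilbertBasis b
  have h2 : ∫⁻ y, ENNReal.ofReal y ∂S.ν ≠ ⊤ := by simpa using S.lintegral_one_sq_mul_ne_top
  rw [S.tsum_ofReal_norm_sq_op b, ENNReal.ofReal_mul zero_le_two, moment, ENNReal.ofReal_toReal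
    (ENNReal.add_ne_top.2 ⟨S.lintegral_κ_sq_mul_ne_top, h2⟩)]
  norm_num

theorem moment_nonneg : 0 ≤ S.moment := ENNReal.toReal_nonneg

theorem hasSum_norm_sq_op {ι : Type*} (b : HilbertBasis ι ℝ S.Space) :
    HasSum (fun i => ‖S.op (b i)‖ ^ 2) (2 * S.moment) := by
  have h := S.tsum_ofReal_norm_sq_op_eq b
  have h1 : Summable fun i => ‖S.op (b i)‖ ^ 2 := by
    have := ENNReal.summable_toReal (h.trans_ne ENNReal.ofReal_ne_top)
    simpa using this
  rw [← ENNReal.ofReal_tsum_of_nonneg (fun _ => sq_nonneg _) h1,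
    ENNReal.ofReal_eq_ofReal_iff (tsum_nonneg fun _ => sq_nonneg _)
      (mul_nonneg zero_le_two S.moment_nonneg)] at h
  exact h ▸ h1.hasSum

/-- The block operator is diagonalizable, and its squared eigenvalues sum to twice the moment. -/
theorem exists_eigenbasis : ∃ (ι : Type) (b : HilbertBasis ι ℝ S.Space) (τ : ι → ℝ),
    (∀ i, S.op (b i) = τ i • b i) ∧ HasSum (fun i => τ i ^ 2) (2 * S.moment) := by
  obtain ⟨w, b₀, -⟩ := exists_hilbertBasis ℝ S.Space
  obtain ⟨ι, b, τ, h⟩ := exists_hilbertBasis_eigenvectors S.op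
    (isCompactOperator_of_summable_norm_sq b₀ S.op (S.hasSum_norm_sq_op b₀).summable)
    S.isSymmetric_op
  refine ⟨ι, b, τ, h, (S.hasSum_norm_sq_op b).congr_fun fun i => ?_⟩
  rw [h, norm_smul, b.orthonormal.1, mul_one, Real.norm_eq_abs, sq_abs]

/-! ### Simplicity of the eigenvalues -/

theorem memLp_κ : MemLp S.κ 2 (volume.restrict (Set.Ioi 0)) := by
  refine memLp_two_of_lintegral_sq S.measurable_κ.aestronglyMeasurable ?_
  refine ne_top_of_le_ne_top S.lintegral_κ (lintegral_mono fun y => ENNReal.ofReal_le_ofReal ?_)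
  nlinarith [sq_nonneg (S.κ y), sq_nonneg (y * S.κ y)]

/-- If the integral equation satisfied by an eigenvector has no constant term, it is a homogeneous
Volterra equation, so the eigenvector is zero. -/
theorem eq_zero_of_eigenvector {x : S.Space} {t : ℝ} (ht : t ≠ 0) (hx : S.op x = t • x)
    (h0 : (∫ y in Set.Ioi 0, S.κ y * x.fst y) + ∫ y, x.snd y ∂S.ν = 0) : x = 0 := by
  set φ := x.fst with hφ
  set ψ := x.snd with hψ
  have hfst : (S.op x).fst = t • φ := by rw [hx]; rfl
  have hsnd : S.opJ φ = t • ψ := by rw [← op_snd, hx]; rfl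
  have hψae : ∀ᵐ y ∂S.ν, ψ y = t⁻¹ * prim φ y := by
    filter_upwards [S.opJ_coeFn φ, Lp.coeFn_smul t ψ] with y h1 h2
    rw [hsnd, h2] at h1
    simp only [Pi.smul_apply, smul_eq_mul] at h1
    rw [← h1, inv_mul_cancel_left₀ ht]
  have hψi : Integrable ψ S.ν := (Lp.memLp ψ).integrable (by norm_num)
  have hκφ : IntegrableOn (fun y => S.κ y * φ y) (Set.Ioi 0) := S.memLp_κ.integrable_mul (Lp.memLp φ)
  have heq : ∀ᵐ y ∂(volume.restrict (Set.Ioi (0:ℝ))), t * φ y = S.κ y * prim φ y -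
      (∫ s in Set.Ioo 0 y, S.κ s * φ s) - ∫ s in Set.Iio y, ψ s ∂S.ν := by
    filter_upwards [S.op_fst_coeFn x, ae_restrict_mem measurableSet_Ioi, hfst ▸ Lp.coeFn_smul t φ]
      with y h1 (h2 : 0 < y) h3
    rw [h1] at h3
    simp only [Pi.smul_apply, smul_eq_mul] at h3
    have e1 : (∫ s in Set.Iio y, ψ s ∂S.ν) + ∫ s in Set.Ici y, ψ s ∂S.ν = ∫ s, ψ s ∂S.ν := by
      rw [← integral_add_compl (measurableSet_Iio (a := y)) hψi, Set.compl_Iio]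
    have e2 : (∫ s in Set.Ioo 0 y, S.κ s * φ s) +
        (∫ s in Set.Ici y, S.κ s * φ s ∂(volume.restrict (Set.Ioi 0))) =
        ∫ s in Set.Ioi 0, S.κ s * φ s := by
      rw [← integral_add_compl (measurableSet_Iio (a := y)) hκφ, Set.compl_Iio,
        Measure.restrict_restrict measurableSet_Iio, Set.Iio_inter_Ioi]
    rw [← h3]
    linarith
  set k := ∫ y in Set.Ioi 0, S.κ y ^ 2 with hk
  have hk0 : 0 ≤ k := integral_nonneg fun _ => sq_nonneg _
  set n := S.ν.real Set.univ with hn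
  have hn0 : 0 ≤ n := measureReal_nonneg
  set C := 3 * (2 * k + n ^ 2 / t ^ 2) with hC
  have hC0 : 0 ≤ C := by positivity
  have ht2 : 0 < t ^ 2 := by positivity
  -- a step length for which the Volterra operator is a strict contraction
  obtain ⟨d, hd0, hd1, hdC⟩ : ∃ d : ℝ, 0 < d ∧ d ≤ 1 ∧ d * C < t ^ 2 := by
    refine ⟨min 1 (t ^ 2 / (C + 1)), by positivity, min_le_left _ _, ?_⟩
    have h1 : min 1 (t ^ 2 / (C + 1)) * (C + 1) ≤ t ^ 2 := by
      rw [← le_div_iff₀ (by positivity)]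
      exact min_le_right _ _
    have h2 : 0 < min 1 (t ^ 2 / (C + 1)) := by positivity
    nlinarith
  -- If `φ` vanishes on `(0, a]`, it vanishes on `(a, a + d]`.
  have hstep : ∀ a : ℝ, 0 ≤ a → (∀ y ≤ a, prim φ y = 0) → ∫ s in Set.Ioc 0 a, φ s ^ 2 = 0 →
      ∫ s in Set.Ioc a (a + d), φ s ^ 2 = 0 := by
    intro a ha hFa hφa
    have hsub : Set.Ioc a (a + d) ⊆ Set.Ioi 0 := Ioc_subset_Ioi_zero ha
    set M := ∫ s in Set.Ioc a (a + d), φ s ^ 2 with hM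
    have hM0 : 0 ≤ M := integral_nonneg fun _ => sq_nonneg _
    have hFle : ∀ y ≤ a + d, prim φ y ^ 2 ≤ d * M := by
      intro y hy
      rcases le_total y a with hya | hya
      · rw [hFa y hya]; simpa using mul_nonneg hd0.le hM0
      · have h1 := sq_prim_sub_le φ ha hya
        rw [hFa a le_rfl, sub_zero] at h1
        refine h1.trans (mul_le_mul (by linarith) ?_ (integral_nonneg fun _ => sq_nonneg _) hd0.le)
        exact setIntegral_mono_set (integrable_sq_of_subset φ hsub)
          (Eventually.of_forall fun _ => sq_nonneg _)
          (Set.Ioc_subset_Ioc_right hy).eventuallyLE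
    have hφ0 : ∀ᵐ s ∂(volume.restrict (Set.Ioc 0 a)), φ s = 0 := by
      have := (integral_eq_zero_iff_of_nonneg (fun _ => sq_nonneg _)
        (integrable_sq_of_subset φ (Ioc_subset_Ioi_zero le_rfl))).1 hφa
      filter_upwards [this] with s hs
      simpa using hs
    have hB : ∀ y ∈ Set.Ioc a (a + d), (∫ s in Set.Ioo 0 y, S.κ s * φ s) ^ 2 ≤ k * M := by
      intro y hy
      have e1 : ∫ s in Set.Ioo 0 y, S.κ s * φ s = ∫ s in Set.Ioo a y, S.κ s * φ s := by
        rw [← Set.Ioc_union_Ioo_eq_Ioo ha hy.1, setIntegral_union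
          (Set.disjoint_left.2 fun s hs hs' => absurd hs.2 (not_le.2 hs'.1)) measurableSet_Ioo
          (hκφ.mono_set (Ioc_subset_Ioi_zero le_rfl))
          (hκφ.mono_set (Set.Ioo_subset_Ioc_self.trans (Ioc_subset_Ioi_zero ha)))]
        rw [integral_eq_zero_of_ae, zero_add]
        filter_upwards [hφ0] with s hs
        simp [hs]
      have hsub2 : Set.Ioo a y ⊆ Set.Ioi 0 := Set.Ioo_subset_Ioc_self.trans (Ioc_subset_Ioi_zero ha)
      have m1 : MemLp S.κ 2 (volume.restrict (Set.Ioo a y)) :=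
        S.memLp_κ.mono_measure (Measure.restrict_mono hsub2 le_rfl)
      have m2 := memLp_two_of_subset φ hsub2
      have h1 := integral_mul_le_Lp_mul_Lq_of_nonneg (μ := volume.restrict (Set.Ioo a y))
        (f := fun s => |S.κ s|) (g := fun s => |φ s|) Real.HolderConjugate.two_two
        (Eventually.of_forall fun _ => abs_nonneg _) (Eventually.of_forall fun _ => abs_nonneg _)
        (by rw [ENNReal.ofReal_ofNat]; exact m1.abs) (by rw [ENNReal.ofReal_ofNat]; exact m2.abs)
      simp only [Real.rpow_ofNat, sq_abs, ← Real.sqrt_eq_rpow] at h1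
      have h2 : |∫ s in Set.Ioo a y, S.κ s * φ s| ≤ ∫ s in Set.Ioo a y, |S.κ s| * |φ s| := by
        simp_rw [← abs_mul]
        exact abs_integral_le_integral_abs
      rw [e1, ← sq_abs]
      refine (pow_le_pow_left₀ (abs_nonneg _) (h2.trans h1) 2).trans ?_
      rw [mul_pow, Real.sq_sqrt (integral_nonneg fun _ => sq_nonneg _),
        Real.sq_sqrt (integral_nonneg fun _ => sq_nonneg _)]
      refine mul_le_mul ?_ ?_ (integral_nonneg fun _ => sq_nonneg _) hk0
      · exact setIntegral_mono_set S.memLp_κ.integrable_sq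
          (Eventually.of_forall fun _ => sq_nonneg _) hsub2.eventuallyLE
      · exact setIntegral_mono_set (integrable_sq_of_subset φ hsub)
          (Eventually.of_forall fun _ => sq_nonneg _)
          (Set.Ioo_subset_Ioc_self.trans (Set.Ioc_subset_Ioc_right hy.2)).eventuallyLE
    have hCC : ∀ y ∈ Set.Ioc a (a + d), (∫ s in Set.Iio y, ψ s ∂S.ν) ^ 2 ≤ n ^ 2 / t ^ 2 * M := by
      intro y hy
      have h1 : ‖∫ s in Set.Iio y, ψ s ∂S.ν‖ ≤ |t⁻¹| * √(d * M) * S.ν.real (Set.Iio y) := by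
        refine norm_setIntegral_le_of_norm_le_const_ae (measure_lt_top _ _) ?_
        rw [ae_restrict_iff' measurableSet_Iio] at *
        filter_upwards [hψae] with s hs hsy
        rw [hs, norm_mul, Real.norm_eq_abs, Real.norm_eq_abs]
        refine mul_le_mul_of_nonneg_left ?_ (abs_nonneg _)
        exact Real.abs_le_sqrt (hFle s ((le_of_lt hsy).trans hy.2))
      have h2 : S.ν.real (Set.Iio y) ≤ n := measureReal_mono (Set.subset_univ _)
      rw [← sq_abs, ← Real.norm_eq_abs]
      refine (pow_le_pow_left₀ (norm_nonneg _) (h1.trans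
        (mul_le_mul_of_nonneg_left h2 (by positivity))) 2).trans ?_
      rw [mul_pow, mul_pow, sq_abs, Real.sq_sqrt (by positivity), inv_pow, div_eq_mul_inv]
      have : d * M ≤ M := by nlinarith
      calc (t ^ 2)⁻¹ * (d * M) * n ^ 2 ≤ (t ^ 2)⁻¹ * M * n ^ 2 := by gcongr
        _ = _ := by ring
    have hsq : ∀ᵐ y ∂(volume.restrict (Set.Ioc a (a + d))), t ^ 2 * φ y ^ 2 ≤
        3 * d * M * S.κ y ^ 2 + 3 * (k * M + n ^ 2 / t ^ 2 * M) := by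
      filter_upwards [ae_restrict_of_ae_restrict_of_subset hsub heq,
        ae_restrict_mem measurableSet_Ioc] with y h1 h2
      rw [← mul_pow, h1]
      have h3 := hB y h2
      have h4 := hCC y h2
      have h5 := mul_le_mul_of_nonneg_left (hFle y h2.2) (sq_nonneg (S.κ y))
      set A := S.κ y * prim φ y
      set B := ∫ s in Set.Ioo 0 y, S.κ s * φ s
      set D := ∫ s in Set.Iio y, ψ s ∂S.ν
      have h6 : A ^ 2 ≤ S.κ y ^ 2 * (d * M) := by rw [mul_pow]; exact h5
      nlinarith [sq_nonneg (A + B), sq_nonneg (A + D), sq_nonneg (B - D)]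
    have hκi : IntegrableOn (fun y => S.κ y ^ 2) (Set.Ioc a (a + d)) :=
      S.memLp_κ.integrable_sq.mono_measure (Measure.restrict_mono hsub le_rfl)
    have hint := integral_mono_ae ((integrable_sq_of_subset φ hsub).const_mul (t ^ 2))
      ((hκi.const_mul (3 * d * M)).add (integrable_const _)) hsq
    rw [integral_const_mul, integral_add' (hκi.const_mul _) (integrable_const _),
      integral_const_mul, integral_const] at hint
    have hvol : (volume.restrict (Set.Ioc a (a + d))).real Set.univ = d := by
      simp [measureReal_def, hd0.le]
    have hκle : ∫ s in Set.Ioc a (a + d), S.κ s ^ 2 ≤ k :=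
      setIntegral_mono_set S.memLp_κ.integrable_sq
          (Eventually.of_forall fun _ => sq_nonneg _) hsub.eventuallyLE
    rw [hvol, smul_eq_mul] at hint
    have h7 : t ^ 2 * M ≤ d * C * M := by
      refine hint.trans ?_
      have := mul_le_mul_of_nonneg_left hκle (show 0 ≤ 3 * d * M by positivity)
      rw [hC]
      linarith
    by_contra hne
    have hMpos : 0 < M := lt_of_le_of_ne hM0 (Ne.symm hne)
    nlinarith
  have hall : ∀ j : ℕ, ∫ s in Set.Ioc 0 (j * d), φ s ^ 2 = 0 := by
    intro j
    induction j with
    | zero => simp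
    | succ j ih =>
      have hj : (0:ℝ) ≤ j * d := by positivity
      have hF : ∀ y ≤ j * d, prim φ y = 0 := by
        intro y hy
        rcases le_total y 0 with h | h
        · exact prim_of_nonpos φ h
        have h1 := sq_prim_sub_le φ le_rfl h
        rw [prim_of_nonpos φ le_rfl, sub_zero, sub_zero] at h1
        have h2 : ∫ s in Set.Ioc 0 y, φ s ^ 2 ≤ ∫ s in Set.Ioc 0 (j * d), φ s ^ 2 :=
          setIntegral_mono_set (integrable_sq_of_subset φ (Ioc_subset_Ioi_zero le_rfl))
            (Eventually.of_forall fun _ => sq_nonneg _) (Set.Ioc_subset_Ioc_right hy).eventuallyLE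
        have h3 : prim φ y ^ 2 ≤ 0 := h1.trans (mul_nonpos_of_nonneg_of_nonpos h (h2.trans ih.le))
        exact pow_eq_zero_iff two_ne_zero |>.1 (le_antisymm h3 (sq_nonneg _))
      have h1 := hstep _ hj hF ih
      have e : ((j + 1 : ℕ) : ℝ) * d = j * d + d := by push_cast; ring
      rw [e, ← Set.Ioc_union_Ioc_eq_Ioc hj (by linarith : (j:ℝ) * d ≤ j * d + d),
        setIntegral_union (Set.Ioc_disjoint_Ioc_of_le le_rfl) measurableSet_Ioc
          (integrable_sq_of_subset φ (Ioc_subset_Ioi_zero le_rfl))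
          (integrable_sq_of_subset φ (Ioc_subset_Ioi_zero hj)), ih, h1, add_zero]
  have hφz : φ = 0 := by
    rw [Lp.eq_zero_iff_ae_eq_zero, EventuallyEq, ae_restrict_iff' measurableSet_Ioi]
    have : ∀ᵐ y : ℝ, ∀ j : ℕ, y ∈ Set.Ioc 0 (j * d) → φ y = 0 := by
      rw [ae_all_iff]
      intro j
      rw [← ae_restrict_iff' measurableSet_Ioc]
      have := (integral_eq_zero_iff_of_nonneg (fun _ => sq_nonneg _)
        (integrable_sq_of_subset φ (Ioc_subset_Ioi_zero le_rfl))).1 (hall j)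
      filter_upwards [this] with s hs
      simpa using hs
    filter_upwards [this] with y hy (hy0 : 0 < y)
    obtain ⟨j, hj⟩ := exists_nat_ge (y / d)
    exact hy j ⟨hy0, (div_le_iff₀ hd0).1 hj⟩
  have hψz : ψ = 0 := by
    rw [hφz, map_zero, eq_comm, smul_eq_zero] at hsnd
    exact hsnd.resolve_left ht
  exact WithLp.ofLp_injective 2 (Prod.ext hφz hψz)

/-- Nonzero eigenvalues are simple: some nontrivial combination of two eigenvectors has no constant
term, so that `eq_zero_of_eigenvector` applies to it. -/
theorem eigenvector_unique {x x' : S.Space} {t : ℝ} (ht : t ≠ 0) (hx : S.op x = t • x)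
    (hx' : S.op x' = t • x') (hne : x ≠ 0) : ∃ c : ℝ, x' = c • x := by
  set p : S.Space → ℝ := fun x => (∫ y in Set.Ioi 0, S.κ y * x.fst y) + ∫ y, x.snd y ∂S.ν with hp
  have hlin : ∀ a b : ℝ, p (a • x - b • x') = a * p x - b * p x' := by
    intro a b
    have hκφ : ∀ φ : HalfLineL2, IntegrableOn (fun y => S.κ y * φ y) (Set.Ioi 0) :=
      fun φ => S.memLp_κ.integrable_mul (Lp.memLp φ)
    have hψi : ∀ ψ : Lp ℝ 2 S.ν, Integrable ψ S.ν := fun ψ => (Lp.memLp ψ).integrable (by norm_num)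
    have e1 : (a • x - b • x').fst = a • x.fst - b • x'.fst := rfl
    have e2 : (a • x - b • x').snd = a • x.snd - b • x'.snd := rfl
    have e3 : ∫ y in Set.Ioi 0, S.κ y * (a • x.fst - b • x'.fst) y =
        a * (∫ y in Set.Ioi 0, S.κ y * x.fst y) - b * ∫ y in Set.Ioi 0, S.κ y * x'.fst y := by
      rw [← integral_const_mul, ← integral_const_mul,
        ← integral_sub ((hκφ _).const_mul _) ((hκφ _).const_mul _)]
      refine integral_congr_ae ?_
      filter_upwards [Lp.coeFn_sub (a • x.fst) (b • x'.fst), Lp.coeFn_smul a x.fst,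
        Lp.coeFn_smul b x'.fst] with y h1 h2 h3
      rw [h1, Pi.sub_apply, h2, h3]
      simp only [Pi.smul_apply, smul_eq_mul]
      ring
    have e4 : ∫ y, (a • x.snd - b • x'.snd) y ∂S.ν =
        a * (∫ y, x.snd y ∂S.ν) - b * ∫ y, x'.snd y ∂S.ν := by
      rw [← integral_const_mul, ← integral_const_mul,
        ← integral_sub ((hψi _).const_mul _) ((hψi _).const_mul _)]
      refine integral_congr_ae ?_
      filter_upwards [Lp.coeFn_sub (a • x.snd) (b • x'.snd), Lp.coeFn_smul a x.snd,
        Lp.coeFn_smul b x'.snd] with y h1 h2 h3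
      rw [h1, Pi.sub_apply, h2, h3]
      simp only [Pi.smul_apply, smul_eq_mul]
    simp only [hp, e1, e2, e3, e4]
    ring
  have hpx : p x ≠ 0 := fun h => hne (S.eq_zero_of_eigenvector ht hx h)
  have h1 := S.eq_zero_of_eigenvector (x := p x' • x - p x • x') ht (by
    rw [map_sub, map_smul, map_smul, hx, hx', smul_sub, smul_comm t, smul_comm t]) (by
    change p _ = 0
    rw [hlin]; ring)
  refine ⟨(p x)⁻¹ * p x', ?_⟩
  rw [mul_smul, sub_eq_zero.1 h1, inv_smul_smul₀ hpx]

end HalfLineString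

/-! ### Step functions on the half-line -/

section Step

/-- The left end of the cell `(cellLeft P p, p]` which ends at `p` in the partition of `(0, ∞)` by
the points of `P`. -/
noncomputable def cellLeft (P : Finset ℝ) (p : ℝ) : ℝ :=
  (insert 0 (P.filter fun q => 0 < q ∧ q < p)).max' (Finset.insert_nonempty _ _)

variable {P : Finset ℝ} {p q : ℝ}

theorem cellLeft_eq_or (P : Finset ℝ) (p : ℝ) :
    cellLeft P p = 0 ∨ (cellLeft P p ∈ P ∧ 0 < cellLeft P p ∧ cellLeft P p < p) := by
  have := Finset.max'_mem _ (Finset.insert_nonempty 0 (P.filter fun q => 0 < q ∧ q < p))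
  rw [Finset.mem_insert, Finset.mem_filter] at this
  exact this

theorem cellLeft_nonneg (P : Finset ℝ) (p : ℝ) : 0 ≤ cellLeft P p :=
  Finset.le_max' _ _ (Finset.mem_insert_self _ _)

theorem cellLeft_lt (hp : 0 < p) : cellLeft P p < p := by
  rcases cellLeft_eq_or P p with h | h
  · rwa [h]
  · exact h.2.2

theorem le_cellLeft (hq : q ∈ P) (h0 : 0 < q) (hqp : q < p) : q ≤ cellLeft P p :=
  Finset.le_max' _ _ (Finset.mem_insert_of_mem (Finset.mem_filter.2 ⟨hq, h0, hqp⟩))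

theorem Ioc_cellLeft_subset (P : Finset ℝ) (p : ℝ) : Set.Ioc (cellLeft P p) p ⊆ Set.Ioi 0 :=
  Ioc_subset_Ioi_zero (cellLeft_nonneg P p)

theorem pairwise_disjoint_cells (hP : ∀ p ∈ P, 0 < p) :
    (P : Set ℝ).Pairwise fun p q =>
      Disjoint (Set.Ioc (cellLeft P p) p) (Set.Ioc (cellLeft P q) q) := by
  have key : ∀ p ∈ P, ∀ q ∈ P, p < q →
      Disjoint (Set.Ioc (cellLeft P p) p) (Set.Ioc (cellLeft P q) q) := fun p hp q _ hpq =>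
    Set.Ioc_disjoint_Ioc_of_le (le_cellLeft hp (hP p hp) hpq)
  intro p hp q hq hpq
  rcases lt_or_gt_of_ne hpq with h | h
  · exact key p hp q hq h
  · exact (key q hq p hp h).symm

theorem exists_mem_cell {y : ℝ} (hy : 0 < y) (h : ∃ p ∈ P, y ≤ p) :
    ∃ p ∈ P, y ∈ Set.Ioc (cellLeft P p) p := by
  have hne : (P.filter (y ≤ ·)).Nonempty := by
    obtain ⟨p, hp, hyp⟩ := h
    exact ⟨p, Finset.mem_filter.2 ⟨hp, hyp⟩⟩
  set p := (P.filter (y ≤ ·)).min' hne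
  have hp : p ∈ P ∧ y ≤ p := Finset.mem_filter.1 (Finset.min'_mem _ hne)
  refine ⟨p, hp.1, ?_, hp.2⟩
  rcases cellLeft_eq_or P p with h | h
  · rwa [h]
  · by_contra! hy'
    exact absurd (Finset.min'_le _ _ (Finset.mem_filter.2 ⟨h.1, hy'⟩)) (not_le.2 h.2.2)

theorem setIntegral_eq_sum_cells (hP : ∀ p ∈ P, 0 < p) {g : ℝ → ℝ}
    (hg : IntegrableOn g (Set.Ioi 0)) (h0 : ∀ y, (∀ p ∈ P, p < y) → g y = 0) :
    ∫ y in Set.Ioi 0, g y = ∑ p ∈ P, ∫ y in Set.Ioc (cellLeft P p) p, g y := by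
  rw [← integral_biUnion_finset P (fun _ _ => measurableSet_Ioc) (pairwise_disjoint_cells hP)
    (fun p _ => hg.mono_set (Ioc_cellLeft_subset P p))]
  refine setIntegral_eq_of_subset_of_forall_sdiff_eq_zero measurableSet_Ioi
    (Set.iUnion₂_subset fun p _ => Ioc_cellLeft_subset P p) ?_
  rintro y ⟨hy, hyn⟩
  refine h0 y fun p hp => ?_
  by_contra! hyp
  obtain ⟨q, hq, hyq⟩ := exists_mem_cell hy ⟨p, hp, hyp⟩
  exact hyn (Set.mem_biUnion hq hyq)

/-- `g` is constant on the cells of the partition of `(0, ∞)` by `P`, and zero to the right of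
all points of `P`. -/
structure IsStepOn (P : Finset ℝ) (g : ℝ → ℝ) : Prop where
  pos : ∀ p ∈ P, 0 < p
  const : ∀ p ∈ P, ∀ y ∈ Set.Ioc (cellLeft P p) p, g y = g p
  zero : ∀ y, 0 < y → (∀ p ∈ P, p < y) → g y = 0

theorem IsStepOn.mono {P P' : Finset ℝ} {g : ℝ → ℝ} (h : IsStepOn P g) (hPP' : P ⊆ P')
    (hP' : ∀ p ∈ P', 0 < p) : IsStepOn P' g := by
  refine ⟨hP', fun p hp y hy => ?_, fun y hy0 hy => h.zero y hy0 fun p hp => hy p (hPP' hp)⟩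
  have hp0 := hP' p hp
  have hy0 : 0 < y := Ioc_cellLeft_subset _ _ hy
  by_cases hq : ∃ q ∈ P, p ≤ q
  · obtain ⟨q, hqP, hpq⟩ := exists_mem_cell hp0 hq
    rw [h.const q hqP p hpq, h.const q hqP y ⟨?_, hy.2.trans hpq.2⟩]
    refine lt_of_le_of_lt ?_ hy.1
    rcases cellLeft_eq_or P q with h1 | h1
    · rw [h1]; exact cellLeft_nonneg _ _
    · exact le_cellLeft (hPP' h1.1) h1.2.1 hpq.1
  · push Not at hq
    rw [h.zero p hp0 hq, h.zero y hy0 fun q hqP => ?_]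
    exact lt_of_le_of_lt (le_cellLeft (hPP' hqP) (h.pos q hqP) (hq q hqP)) hy.1

theorem IsStepOn.sq {P : Finset ℝ} {g : ℝ → ℝ} (h : IsStepOn P g) : IsStepOn P fun y => g y ^ 2 :=
  ⟨h.pos, fun p hp y hy => by simp only [h.const p hp y hy], fun y h0 hy => by
    simp [h.zero y h0 hy]⟩

/-- A continuous function of compact support is uniformly approximated by step functions, all of which
vanish to the right of the same point `R`. -/
theorem exists_isStepOn_dist_le {g : ℝ → ℝ} (hg : Continuous g) (hgc : HasCompactSupport g) :
    ∃ R > 0, (∀ y, R < y → g y = 0) ∧ ∀ δ > 0, ∃ (P : Finset ℝ) (st : ℝ → ℝ), Measurable st ∧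
      IsStepOn P st ∧ (∀ y, R < y → st y = 0) ∧ ∀ y ∈ Set.Ioc 0 R, |g y - st y| ≤ δ := by
  classical
  obtain ⟨R, hR, hR0⟩ : ∃ R > 0, ∀ y, R < y → g y = 0 := by
    obtain ⟨R, hR⟩ := hgc.isCompact.isBounded.subset_closedBall 0
    refine ⟨max R 1, by positivity, fun y hy => ?_⟩
    by_contra hne
    have := hR (subset_tsupport _ hne)
    rw [mem_closedBall_zero_iff, Real.norm_eq_abs] at this
    have h1 := le_max_left R 1
    have h2 := le_abs_self y
    linarith
  refine ⟨R, hR, hR0, fun δ hδ => ?_⟩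
  obtain ⟨d, hd, hgd⟩ := Metric.uniformContinuous_iff.1 (hgc.uniformContinuous_of_continuous hg) δ hδ
  obtain ⟨N, hN⟩ := exists_nat_gt (R / d)
  have hN0 : (0:ℝ) < N := lt_of_le_of_lt (by positivity) hN
  set h := R / N with hh
  have hh0 : 0 < h := by positivity
  have hhd : h < d := by
    rw [hh, div_lt_iff₀ hN0]
    rw [div_lt_iff₀ hd] at hN
    linarith
  have hhN : h * N = R := by rw [hh]; field_simp
  refine ⟨(Finset.range N).image fun k : ℕ => h * (k + 1),
    fun y => if y ∈ Set.Ioc 0 R then g (h * ⌈y / h⌉) else 0, ?_, ⟨?_, ?_, ?_⟩, ?_, ?_⟩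
  · refine Measurable.ite measurableSet_Ioc (hg.measurable.comp ?_) measurable_const
    have : Measurable fun y : ℝ => ((⌈y / h⌉ : ℤ) : ℝ) :=
      (measurable_from_top (f := fun z : ℤ => (z : ℝ))).comp (Int.measurable_ceil.comp (by fun_prop))
    exact this.const_mul h
  · intro p hp
    obtain ⟨k, -, rfl⟩ := Finset.mem_image.1 hp
    positivity
  · intro p hp y hy
    obtain ⟨k, hk, rfl⟩ := Finset.mem_image.1 hp
    rw [Finset.mem_range] at hk
    have hy0 : 0 < y := Ioc_cellLeft_subset _ _ hy
    have hkN : ((k:ℝ) + 1) ≤ N := by exact_mod_cast hk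
    have hpR : h * ((k:ℝ) + 1) ≤ R := by rw [← hhN]; gcongr
    have hlow : h * k < y := by
      rcases Nat.eq_zero_or_pos k with h0 | h0
      · simpa [h0] using hy0
      · refine lt_of_le_of_lt (le_cellLeft ?_ (by positivity) (by gcongr; linarith)) hy.1
        refine Finset.mem_image.2 ⟨k - 1, Finset.mem_range.2 (by omega), ?_⟩
        rw [Nat.cast_sub h0]
        simp
    have hp' : h * ((k:ℝ) + 1) ∈ Set.Ioc 0 R := ⟨by positivity, hpR⟩
    have hy' : y ∈ Set.Ioc 0 R := ⟨hy0, hy.2.trans hpR⟩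
    have c1 : ⌈y / h⌉ = (k:ℤ) + 1 := by
      rw [Int.ceil_eq_iff]
      push_cast
      constructor
      · rw [lt_div_iff₀ hh0]; linarith
      · rw [div_le_iff₀ hh0]; linarith [hy.2]
    have c2 : ⌈h * ((k:ℝ) + 1) / h⌉ = (k:ℤ) + 1 := by
      rw [mul_div_cancel_left₀ _ hh0.ne']
      exact_mod_cast Int.ceil_intCast ((k:ℤ) + 1)
    simp only [if_pos hp', if_pos hy', c1, c2]
  · intro y hy0 hy
    refine if_neg fun hyR => ?_
    have hN1 : 0 < N := by exact_mod_cast hN0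
    have := hy (h * (((N - 1 : ℕ) : ℝ) + 1)) (Finset.mem_image.2 ⟨N - 1, Finset.mem_range.2 (by omega), rfl⟩)
    rw [Nat.cast_sub hN1, Nat.cast_one, sub_add_cancel, hhN] at this
    exact absurd hyR.2 (not_le.2 this)
  · intro y hy
    exact if_neg fun hyR => absurd hyR.2 (not_le.2 hy)
  · intro y hy
    simp only [if_pos hy]
    rw [← Real.dist_eq]
    refine (hgd ?_).le
    rw [Real.dist_eq]
    have h1 := Int.le_ceil (y / h)
    have h2 := Int.ceil_lt_add_one (y / h)
    rw [div_le_iff₀ hh0] at h1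
    have h3 : (⌈y / h⌉ : ℝ) * h < y + h := by
      calc (⌈y / h⌉ : ℝ) * h < (y / h + 1) * h := by gcongr
        _ = y + h := by field_simp
    rw [abs_lt]
    constructor <;> nlinarith

/-- Step functions are dense in `L²((1 + y²) dy)` on the half-line. -/
theorem exists_isStepOn_lintegral_le {f : ℝ → ℝ} (hf : Measurable f)
    (h : ∫⁻ y in Set.Ioi 0, ENNReal.ofReal ((1 + y ^ 2) * f y ^ 2) ≠ ⊤) {η : ℝ} (hη : 0 < η) :
    ∃ (P : Finset ℝ) (st : ℝ → ℝ), Measurable st ∧ IsStepOn P st ∧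
      ∫⁻ y in Set.Ioi 0, ENNReal.ofReal ((1 + y ^ 2) * (f y - st y) ^ 2) ≤ ENNReal.ofReal η := by
  have hsq : ∀ y : ℝ, √(1 + y ^ 2) ^ 2 = 1 + y ^ 2 := fun y => Real.sq_sqrt (by positivity)
  have hfm : MemLp (fun y => √(1 + y ^ 2) * f y) 2 (volume.restrict (Set.Ioi (0:ℝ))) := by
    refine memLp_two_of_lintegral_sq (by fun_prop) ?_
    simpa only [mul_pow, hsq] using h
  have hmem : MemLp (fun y => √(1 + y ^ 2) * f y) (ENNReal.ofReal 2) (volume.restrict (Set.Ioi (0:ℝ))) := by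
    rwa [ENNReal.ofReal_ofNat]
  obtain ⟨g, hgc, hgi, hg, hgm⟩ := hmem.exists_hasCompactSupport_integral_rpow_sub_le
    (by norm_num) (show 0 < η / 4 by positivity)
  rw [ENNReal.ofReal_ofNat] at hgm
  set g' : ℝ → ℝ := fun y => (√(1 + y ^ 2))⁻¹ * g y with hg'
  have hpos : ∀ y : ℝ, 0 < √(1 + y ^ 2) := fun y => Real.sqrt_pos.2 (by positivity)
  have hg'c : Continuous g' := by
    refine Continuous.mul (Continuous.inv₀ (by fun_prop) fun y => (hpos y).ne') hg
  obtain ⟨R, hR, hR0, hst⟩ := exists_isStepOn_dist_le hg'c (hgc.mul_left)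
  obtain ⟨P, st, hstm, hstP, hst0, hstd⟩ := hst (√(η / (4 * ((1 + R ^ 2) * R)))) (by positivity)
  refine ⟨P, st, hstm, hstP, ?_⟩
  have h1 : ∫⁻ y in Set.Ioi 0, ENNReal.ofReal ((1 + y ^ 2) * (f y - g' y) ^ 2) ≤ ENNReal.ofReal (η / 4) := by
    have e : ∀ y, (1 + y ^ 2) * (f y - g' y) ^ 2 = (√(1 + y ^ 2) * f y - g y) ^ 2 := by
      intro y
      have : g y = √(1 + y ^ 2) * g' y := by
        rw [hg']; simp only; rw [mul_inv_cancel_left₀ (hpos y).ne']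
      rw [this, ← mul_sub, mul_pow, hsq]
    simp_rw [e]
    have hi : Integrable (fun y => (√(1 + y ^ 2) * f y - g y) ^ 2)
        (volume.restrict (Set.Ioi (0:ℝ))) := (hfm.sub hgm).integrable_sq
    rw [← ofReal_integral_eq_lintegral_ofReal hi
      (Eventually.of_forall fun _ => sq_nonneg _)]
    refine ENNReal.ofReal_le_ofReal ((le_of_eq ?_).trans hgi)
    refine integral_congr_ae (Eventually.of_forall fun y => ?_)
    simp
  have h2 : ∫⁻ y in Set.Ioi 0, ENNReal.ofReal ((1 + y ^ 2) * (g' y - st y) ^ 2) ≤ ENNReal.ofReal (η / 4) := by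
    calc ∫⁻ y in Set.Ioi 0, ENNReal.ofReal ((1 + y ^ 2) * (g' y - st y) ^ 2)
        ≤ ∫⁻ y in Set.Ioi 0, Set.indicator (Set.Ioc 0 R)
            (fun _ => ENNReal.ofReal ((1 + R ^ 2) * (η / (4 * ((1 + R ^ 2) * R))))) y := by
          refine setLIntegral_mono' measurableSet_Ioi fun y hy => ?_
          by_cases hyR : y ≤ R
          · have hy' : y ∈ Set.Ioc 0 R := ⟨hy, hyR⟩
            have hy0 : (0:ℝ) < y := hy
            rw [Set.indicator_of_mem hy']
            refine ENNReal.ofReal_le_ofReal ?_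
            have h3 := hstd y hy'
            have h4 : (g' y - st y) ^ 2 ≤ η / (4 * ((1 + R ^ 2) * R)) := by
              rw [← sq_abs]
              refine (pow_le_pow_left₀ (abs_nonneg _) h3 2).trans_eq (Real.sq_sqrt (by positivity))
            gcongr
          · rw [hR0 y (not_le.1 hyR), hst0 y (not_le.1 hyR)]
            simp
      _ = ENNReal.ofReal (η / 4) := by
          rw [lintegral_indicator measurableSet_Ioc, setLIntegral_const,
            Measure.restrict_apply measurableSet_Ioc,
            Set.inter_eq_self_of_subset_left (Ioc_subset_Ioi_zero le_rfl), Real.volume_Ioc, sub_zero,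
            ← ENNReal.ofReal_mul (by positivity)]
          congr 1
          field_simp
  have hm : Measurable fun y => ENNReal.ofReal ((1 + y ^ 2) * (f y - g' y) ^ 2) :=
    (by fun_prop : Measurable fun y => (1 + y ^ 2) * (f y - g' y) ^ 2).ennreal_ofReal
  calc ∫⁻ y in Set.Ioi 0, ENNReal.ofReal ((1 + y ^ 2) * (f y - st y) ^ 2)
      ≤ ∫⁻ y in Set.Ioi 0, (2 * ENNReal.ofReal ((1 + y ^ 2) * (f y - g' y) ^ 2) +
          2 * ENNReal.ofReal ((1 + y ^ 2) * (g' y - st y) ^ 2)) := by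
        refine lintegral_mono fun y => ?_
        simp only
        rw [← mul_add, ← ENNReal.ofReal_add (by positivity) (by positivity),
          ← ENNReal.ofReal_ofNat 2, ← ENNReal.ofReal_mul zero_le_two]
        refine ENNReal.ofReal_le_ofReal ?_
        have h5 : (f y - st y) ^ 2 ≤ 2 * ((f y - g' y) ^ 2 + (g' y - st y) ^ 2) := by
          nlinarith [sq_nonneg ((f y - g' y) - (g' y - st y))]
        calc (1 + y ^ 2) * (f y - st y) ^ 2
            ≤ (1 + y ^ 2) * (2 * ((f y - g' y) ^ 2 + (g' y - st y) ^ 2)) := by gcongr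
          _ = _ := by ring
    _ ≤ ENNReal.ofReal η := by
        rw [lintegral_add_left (hm.const_mul 2), lintegral_const_mul' _ _ (by norm_num),
          lintegral_const_mul' _ _ (by norm_num)]
        calc _ ≤ 2 * ENNReal.ofReal (η / 4) + 2 * ENNReal.ofReal (η / 4) := by gcongr
          _ = ENNReal.ofReal η := by
            rw [← ENNReal.ofReal_ofNat 2, ← ENNReal.ofReal_mul zero_le_two,
              ← ENNReal.ofReal_add (by positivity) (by positivity)]
            congr 1
            ring

end Step

/-! ### Primitives as absolutely continuous functions -/

theorem intervalIntegrable_indicator (φ : HalfLineL2) (a b : ℝ) :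
    IntervalIntegrable ((Set.Ioi 0).indicator φ) volume a b := by
  have : MemLp ((Set.Ioi 0).indicator φ) 2 volume :=
    (memLp_indicator_iff_restrict measurableSet_Ioi).2 (Lp.memLp φ)
  have hfin : IsFiniteMeasure (volume.restrict (Set.uIoc a b)) :=
    ⟨by rw [Measure.restrict_apply_univ]; simp [Set.uIoc]⟩
  rw [intervalIntegrable_iff]
  exact (this.mono_measure Measure.restrict_le_self).integrable (by norm_num)

theorem prim_eq_intervalIntegral (φ : HalfLineL2) :
    prim φ = fun y => ∫ t in (0:ℝ)..y, (Set.Ioi 0).indicator φ t := by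
  funext y
  rcases le_total 0 y with hy | hy
  · rw [intervalIntegral.integral_of_le hy, prim]
    refine setIntegral_congr_fun measurableSet_Ioc fun t ht => ?_
    rw [Set.indicator_of_mem (show t ∈ Set.Ioi 0 from ht.1)]
  · rw [intervalIntegral.integral_of_ge hy, prim_of_nonpos φ hy, integral_eq_zero_of_ae, neg_zero]
    filter_upwards [ae_restrict_mem measurableSet_Ioc] with t ht
    exact Set.indicator_of_notMem (not_lt.2 ht.2) _

theorem absolutelyContinuousOnInterval_prim (φ : HalfLineL2) (a b : ℝ) :
    AbsolutelyContinuousOnInterval (prim φ) a b := by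
  rw [prim_eq_intervalIntegral]
  have h : ∀ c : ℝ, |c| ≤ |a| + |b| → c ∈ Set.uIcc (-(|a| + |b|)) (|a| + |b|) := by
    intro c hc
    rw [Set.uIcc_of_le (by linarith [abs_nonneg a, abs_nonneg b])]
    exact abs_le.1 hc
  refine ((intervalIntegrable_indicator φ (-(|a| + |b|)) (|a| + |b|)).absolutelyContinuousOnInterval_intervalIntegral
    (h 0 (by rw [abs_zero]; positivity))).mono ?_
  exact Set.uIcc_subset_uIcc (h a (by linarith [abs_nonneg b])) (h b (by linarith [abs_nonneg a]))

theorem ae_hasDerivAt_prim (φ : HalfLineL2) :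
    ∀ᵐ y, 0 < y → HasDerivAt (prim φ) (φ y) y := by
  have : ∀ᵐ y, ∀ n : ℕ, y ∈ Set.uIcc 0 (n:ℝ) → ∀ c ∈ Set.uIcc 0 (n:ℝ),
      HasDerivAt (fun x => ∫ t in c..x, (Set.Ioi 0).indicator φ t) ((Set.Ioi 0).indicator φ y) y := by
    rw [ae_all_iff]
    intro n
    exact (intervalIntegrable_indicator φ 0 n).ae_hasDerivAt_integral
  filter_upwards [this] with y hy hy0
  obtain ⟨n, hn⟩ := exists_nat_ge y
  have h1 := hy n (by rw [Set.uIcc_of_le n.cast_nonneg]; exact ⟨hy0.le, hn⟩) 0 Set.left_mem_uIcc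
  rw [prim_eq_intervalIntegral]
  rwa [Set.indicator_of_mem (show y ∈ Set.Ioi 0 from hy0)] at h1

/-- The fundamental theorem of calculus for `g · F²`. -/
theorem integral_deriv_mul_sq_prim (φ : HalfLineL2) {a b : ℝ} (ha : 0 ≤ a) (hab : a ≤ b)
    {g g' : ℝ → ℝ} (hg : ∀ y ∈ Set.Icc a b, HasDerivAt g (g' y) y)
    (hg' : ContinuousOn g' (Set.Icc a b)) :
    ∫ y in Set.Ioc a b, (g' y * prim φ y ^ 2 + g y * (2 * prim φ y * φ y)) =
      g b * prim φ b ^ 2 - g a * prim φ a ^ 2 := by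
  rcases hab.eq_or_lt with rfl | hab'
  · simp
  have hF := absolutelyContinuousOnInterval_prim φ a b
  have hgc : ContDiffOn ℝ 1 g (Set.uIcc a b) := by
    have hu := uniqueDiffOn_Icc hab'
    rw [Set.uIcc_of_le hab, contDiffOn_one_iff_derivWithin hu]
    refine ⟨fun y hy => (hg y hy).differentiableAt.differentiableWithinAt, hg'.congr fun y hy => ?_⟩
    exact (hg y hy).hasDerivWithinAt.derivWithin (hu y hy)
  have hgac := hgc.absolutelyContinuousOnInterval
  have h := (hgac.mul (hF.mul hF)).integral_deriv_eq_sub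
  simp only [Pi.mul_apply] at h
  rw [sq, sq, ← h, intervalIntegral.integral_of_le hab]
  refine integral_congr_ae ?_
  filter_upwards [ae_restrict_of_ae (ae_hasDerivAt_prim φ), ae_restrict_mem measurableSet_Ioc] with y h1 h2
  have h3 := h1 (lt_of_le_of_lt ha h2.1)
  have h4 := (hg y (Set.Ioc_subset_Icc_self h2)).mul (h3.mul h3)
  rw [h4.deriv, Pi.mul_apply]
  ring

theorem two_mul_integral_prim_mul (φ : HalfLineL2) {a b : ℝ} (ha : 0 ≤ a) (hab : a ≤ b) :
    2 * ∫ y in Set.Ioc a b, prim φ y * φ y = prim φ b ^ 2 - prim φ a ^ 2 := by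
  have := integral_deriv_mul_sq_prim φ ha hab (g := fun _ => 1) (g' := fun _ => 0)
    (fun y _ => hasDerivAt_const y 1) continuousOn_const
  simp only [zero_mul, zero_add, one_mul] at this
  rw [← this, ← integral_const_mul]
  simp only [mul_assoc]

/-- The Poincaré inequality with the sharp constant: `c² ∫ F² ≤ ∫ φ²` on an interval of length less
than `π / c` at whose ends `F` vanishes. Expand `0 ≤ (φ + c tan θ F)²` with `θ = c (y - m)`, `m` the
midpoint. -/
theorem sq_mul_integral_sq_prim_le (φ : HalfLineL2) {a b c : ℝ} (ha : 0 ≤ a) (hab : a ≤ b)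
    (hc : 0 ≤ c) (hcab : c * (b - a) < Real.pi) (hFa : prim φ a = 0) (hFb : prim φ b = 0) :
    c ^ 2 * ∫ y in Set.Ioc a b, prim φ y ^ 2 ≤ ∫ y in Set.Ioc a b, φ y ^ 2 := by
  set θ : ℝ → ℝ := fun y => c * (y - (a + b) / 2) with hθ
  have hcos : ∀ y ∈ Set.Icc a b, 0 < Real.cos (θ y) := by
    intro y hy
    refine Real.cos_pos_of_mem_Ioo ⟨?_, ?_⟩
    · have : c * ((a + b) / 2 - y) ≤ c * ((b - a) / 2) :=
        mul_le_mul_of_nonneg_left (by linarith [hy.1]) hc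
      simp only [hθ]; linarith
    · have : c * (y - (a + b) / 2) ≤ c * ((b - a) / 2) :=
        mul_le_mul_of_nonneg_left (by linarith [hy.2]) hc
      simp only [hθ]; linarith
  have hder : ∀ y ∈ Set.Icc a b, HasDerivAt (fun y => c * Real.tan (θ y))
      (c * (1 / Real.cos (θ y) ^ 2 * c)) y := by
    intro y hy
    have h1 : HasDerivAt θ c y := by
      simpa [hθ] using ((hasDerivAt_id y).sub_const ((a + b) / 2)).const_mul c
    exact ((Real.hasDerivAt_tan (hcos y hy).ne').comp y h1).const_mul c
  have hcont : ContinuousOn (fun y => c * (1 / Real.cos (θ y) ^ 2 * c)) (Set.Icc a b) := by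
    refine ContinuousOn.mul continuousOn_const (ContinuousOn.mul (ContinuousOn.div continuousOn_const
      (by fun_prop) fun y hy => by have := hcos y hy; positivity) continuousOn_const)
  have hid := integral_deriv_mul_sq_prim φ ha hab hder hcont
  rw [hFa, hFb] at hid
  simp only [ne_eq, OfNat.ofNat_ne_zero, not_false_eq_true, zero_pow, mul_zero, sub_zero] at hid
  have hFi : IntegrableOn (fun y => prim φ y ^ 2) (Set.Ioc a b) :=
    (((continuous_prim φ).pow 2).integrableOn_Icc).mono_set Set.Ioc_subset_Icc_self
  have hφi := integrable_sq_of_subset φ (Ioc_subset_Ioi_zero ha (b := b))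
  have htan : ContinuousOn (fun y => c * Real.tan (θ y)) (Set.Icc a b) :=
    fun y hy => (hder y hy).continuousAt.continuousWithinAt
  have hint : IntegrableOn (fun y => c * (1 / Real.cos (θ y) ^ 2 * c) * prim φ y ^ 2 +
      c * Real.tan (θ y) * (2 * prim φ y * φ y)) (Set.Ioc a b) := by
    refine Integrable.add ?_ ?_
    · exact ((hcont.mul ((continuous_prim φ).pow 2).continuousOn).integrableOn_Icc).mono_set
        Set.Ioc_subset_Icc_self
    · have hφ1 : IntegrableOn φ (Set.Icc a b) :=
        (integrableOn_Icc_iff_integrableOn_Ioc).2 (integrableOn_Ioc φ ha b)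
      have h2 := hφ1.continuousOn_mul (htan.mul
        ((continuous_prim φ).const_mul 2).continuousOn) isCompact_Icc
      refine (h2.mono_set Set.Ioc_subset_Icc_self).congr (Eventually.of_forall fun y => ?_)
      simp only [Pi.mul_apply]
      ring
  have hmono : ∫ y in Set.Ioc a b, c ^ 2 * prim φ y ^ 2 ≤
      ∫ y in Set.Ioc a b, (φ y ^ 2 + (c * (1 / Real.cos (θ y) ^ 2 * c) * prim φ y ^ 2 +
      c * Real.tan (θ y) * (2 * prim φ y * φ y))) := by
    refine setIntegral_mono_on (hFi.const_mul _) (hφi.add hint) measurableSet_Ioc fun y hy => ?_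
    have h1 := (hcos y (Set.Ioc_subset_Icc_self hy)).ne'
    have h2 : 1 / Real.cos (θ y) ^ 2 = 1 + Real.tan (θ y) ^ 2 := by
      rw [Real.tan_eq_sin_div_cos]
      field_simp
      linarith [Real.sin_sq_add_cos_sq (θ y)]
    rw [h2]
    nlinarith [sq_nonneg (φ y + c * Real.tan (θ y) * prim φ y)]
  rw [integral_add hφi hint, hid, integral_const_mul, add_zero] at hmono
  exact hmono

/-! ### Normalized indicators of cells -/

section CellVec

/-- The indicator function of `(a, b]` as an element of `L²(0, ∞)`. -/
noncomputable def indIoc (a b : ℝ) : HalfLineL2 :=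
  indicatorConstLp 2 (measurableSet_Ioc (a := a) (b := b))
    (ne_top_of_le_ne_top measure_Ioc_lt_top.ne (Measure.restrict_apply_le _ _)) 1

theorem inner_indIoc {a : ℝ} (ha : 0 ≤ a) (b : ℝ) (φ : HalfLineL2) :
    inner ℝ (indIoc a b) φ = ∫ t in Set.Ioc a b, φ t := by
  rw [indIoc, L2.inner_indicatorConstLp_one, Measure.restrict_restrict measurableSet_Ioc,
    Set.inter_eq_self_of_subset_left (Ioc_subset_Ioi_zero ha)]

theorem indIoc_coeFn (a b : ℝ) : indIoc a b =ᵐ[volume.restrict (Set.Ioi 0)]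
    (Set.Ioc a b).indicator fun _ => 1 := indicatorConstLp_coeFn

theorem prim_indIoc {a b : ℝ} (ha : 0 ≤ a) (y : ℝ) :
    prim (indIoc a b) y = max (min y b - a) 0 := by
  unfold prim
  have h1 : ∫ t in Set.Ioc 0 y, indIoc a b t = ∫ t in Set.Ioc 0 y, (Set.Ioc a b).indicator (fun _ => (1:ℝ)) t :=
    integral_congr_ae (ae_restrict_of_ae_restrict_of_subset (Ioc_subset_Ioi_zero le_rfl)
      (indIoc_coeFn a b))
  rw [h1, setIntegral_indicator measurableSet_Ioc, Set.Ioc_inter_Ioc, setIntegral_const,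
    max_eq_right ha, smul_eq_mul, mul_one, measureReal_def, Real.volume_Ioc,
    ENNReal.toReal_ofReal']

theorem inner_indIoc_self {a b : ℝ} (ha : 0 ≤ a) (hab : a ≤ b) :
    inner ℝ (indIoc a b) (indIoc a b) = b - a := by
  rw [inner_indIoc ha, ← prim_sub_prim _ ha hab, prim_indIoc ha, prim_indIoc ha]
  simp [hab]

theorem inner_indIoc_of_le {a b c d : ℝ} (ha : 0 ≤ a) (hab : a ≤ b) (hbc : b ≤ c) :
    inner ℝ (indIoc a b) (indIoc c d) = 0 := by
  rw [inner_indIoc ha, ← prim_sub_prim _ ha hab, prim_indIoc (ha.trans (hab.trans hbc)),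
    prim_indIoc (ha.trans (hab.trans hbc))]
  have h1 : min b d - c ≤ 0 := by linarith [min_le_left b d]
  have h2 : min a d - c ≤ 0 := by linarith [min_le_left a d]
  rw [max_eq_right h1, max_eq_right h2, sub_zero]

/-- The normalized indicator function of the cell `(cellLeft P p, p]`. -/
noncomputable def cellVec (P : Finset ℝ) (p : ℝ) : HalfLineL2 :=
  (√(p - cellLeft P p))⁻¹ • indIoc (cellLeft P p) p

theorem orthonormal_cellVec {P : Finset ℝ} (hP : ∀ p ∈ P, 0 < p) :
    Orthonormal ℝ fun p : P => cellVec P p := by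
  have hlt : ∀ p q : P, (p : ℝ) < q → inner ℝ (cellVec P p) (cellVec P q) = 0 := by
    intro p q hpq
    rw [cellVec, cellVec, inner_smul_left, inner_smul_right, inner_indIoc_of_le
      (cellLeft_nonneg _ _) (cellLeft_lt (hP p p.2)).le (le_cellLeft p.2 (hP p p.2) hpq)]
    simp
  refine ⟨fun p => ?_, fun p q hpq => ?_⟩
  · have h1 := cellLeft_lt (P := P) (hP p p.2)
    have h2 : ‖cellVec P p‖ ^ 2 = 1 := by
      rw [← real_inner_self_eq_norm_sq, cellVec, inner_smul_left, inner_smul_right,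
        inner_indIoc_self (cellLeft_nonneg _ _) h1.le]
      have h3 := Real.sq_sqrt (sub_nonneg.2 h1.le)
      have h4 : √((p:ℝ) - cellLeft P p) ≠ 0 := (Real.sqrt_pos.2 (sub_pos.2 h1)).ne'
      simp only [map_inv₀, conj_trivial]
      field_simp
      linarith
    exact (pow_eq_one_iff_of_nonneg (norm_nonneg _) two_ne_zero).1 h2
  · rcases lt_or_gt_of_ne (fun h => hpq (Subtype.ext h) : (p : ℝ) ≠ q) with h | h
    · exact hlt p q h
    · rw [real_inner_comm]; exact hlt q p h

/-- Orthogonality to all cell vectors means that the primitive vanishes on the partition. -/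
theorem prim_eq_zero_of_inner_cellVec {P : Finset ℝ} (hP : ∀ p ∈ P, 0 < p) {φ : HalfLineL2}
    (h : ∀ p ∈ P, inner ℝ (cellVec P p) φ = 0) : ∀ p ∈ P, prim φ p = 0 := by
  have hstep : ∀ p ∈ P, prim φ p = prim φ (cellLeft P p) := by
    intro p hp
    have h1 := cellLeft_lt (P := P) (hP p hp)
    have h2 := h p hp
    rw [cellVec, inner_smul_left, inner_indIoc (cellLeft_nonneg _ _),
      ← prim_sub_prim _ (cellLeft_nonneg _ _) h1.le, mul_eq_zero] at h2
    rcases h2 with h2 | h2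
    · simp only [map_inv₀, conj_trivial, inv_eq_zero] at h2
      exact absurd h2 (Real.sqrt_pos.2 (sub_pos.2 h1)).ne'
    · linarith
  by_contra! hne
  obtain ⟨p, hp, hpne⟩ := hne
  have hF : (P.filter fun p => prim φ p ≠ 0).Nonempty := ⟨p, Finset.mem_filter.2 ⟨hp, hpne⟩⟩
  set q := (P.filter fun p => prim φ p ≠ 0).min' hF with hq
  have hqm : q ∈ P ∧ prim φ q ≠ 0 := Finset.mem_filter.1 (Finset.min'_mem _ hF)
  refine hqm.2 ((hstep q hqm.1).trans ?_)
  rcases cellLeft_eq_or P q with h1 | h1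
  · rw [h1, prim_of_nonpos φ le_rfl]
  · by_contra h2
    have hm : cellLeft P q ∈ P.filter fun p => prim φ p ≠ 0 := Finset.mem_filter.2 ⟨h1.1, h2⟩
    have := Finset.min'_le _ _ hm
    linarith [h1.2.2]

end CellVec

namespace HalfLineString

variable (S : HalfLineString)

theorem inner_opL (φ χ : HalfLineL2) :
    inner ℝ (S.opL φ) χ = ∫ y in Set.Ioi 0, S.κ y * prim φ y * χ y :=
  inner_volterra_left _ _ φ χ

theorem integrableOn_κ_mul_prim_mul (φ χ : HalfLineL2) :
    IntegrableOn (fun y => S.κ y * prim φ y * χ y) (Set.Ioi 0) :=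
  (memLp_volterra S.measurable_κ S.lintegral_κ_sq_mul_ne_top φ).integrable_mul (Lp.memLp χ)

/-- The primitive of the normalized indicator of a cell is linear on that cell, so the form of `κ`
averages `κ` there with a linear weight. -/
theorem two_mul_inner_opL_cellVec {P : Finset ℝ} {p : ℝ} (hp : 0 < p) :
    2 * inner ℝ (S.opL (cellVec P p)) (cellVec P p) = ∫ y in Set.Ioc (cellLeft P p) p,
      S.κ y * (2 * (y - cellLeft P p) / (p - cellLeft P p)) := by
  set a := cellLeft P p
  have ha : 0 ≤ a := cellLeft_nonneg _ _
  have hap : a < p := cellLeft_lt hp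
  have hs : (√(p - a))⁻¹ * (√(p - a))⁻¹ = (p - a)⁻¹ := by
    rw [← mul_inv, Real.mul_self_sqrt (sub_nonneg.2 hap.le)]
  rw [cellVec, map_smul, inner_smul_left, inner_smul_right, inner_opL]
  have h1 : ∀ᵐ y ∂(volume.restrict (Set.Ioi (0:ℝ))), S.κ y * prim (indIoc a p) y * indIoc a p y =
      Set.indicator (Set.Ioc a p) (fun y => S.κ y * (y - a)) y := by
    filter_upwards [indIoc_coeFn a p] with y hy
    rw [hy, prim_indIoc ha]
    by_cases h : y ∈ Set.Ioc a p
    · rw [Set.indicator_of_mem h, Set.indicator_of_mem h, min_eq_left h.2,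
        max_eq_left (by linarith [h.1]), mul_one]
    · rw [Set.indicator_of_notMem h, Set.indicator_of_notMem h, mul_zero]
  rw [integral_congr_ae h1, setIntegral_indicator measurableSet_Ioc,
    Set.inter_eq_self_of_subset_right (Ioc_subset_Ioi_zero ha)]
  simp only [map_inv₀, conj_trivial]
  rw [← mul_assoc (√(p - a))⁻¹, hs, ← mul_assoc, ← integral_const_mul]
  refine integral_congr_ae (Eventually.of_forall fun y => ?_)
  simp only
  field_simp

end HalfLineString

/-! ### Smallness of the form of `κ` on functions vanishing on a finite set -/

theorem lintegral_one_div_one_add_sq_le (s : Set ℝ) :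
    ∫⁻ y in s, ENNReal.ofReal (1 / (1 + y ^ 2)) ≤ ENNReal.ofReal 4 := by
  refine (setLIntegral_le_lintegral _ _).trans ?_
  simp_rw [one_div]
  rw [← ofReal_integral_eq_lintegral_ofReal integrable_inv_one_add_sq
    (Eventually.of_forall fun y => by positivity), integral_univ_inv_one_add_sq]
  exact ENNReal.ofReal_le_ofReal Real.pi_le_four

/-- The Cauchy–Schwarz inequality against the integrable weight `1 / (1 + y²)`. -/
theorem integrableOn_and_integral_abs_le {f : ℝ → ℝ} (hf : Measurable f) {η : ℝ} (hη : 0 < η)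
    (h : ∫⁻ y in Set.Ioi 0, ENNReal.ofReal ((1 + y ^ 2) * f y ^ 2) ≤ ENNReal.ofReal (η ^ 2 / 4)) :
    IntegrableOn f (Set.Ioi 0) ∧ ∫ y in Set.Ioi 0, |f y| ≤ η := by
  have h1 : ∫⁻ y in Set.Ioi 0, ENNReal.ofReal |f y| ≤ ENNReal.ofReal η := by
    calc ∫⁻ y in Set.Ioi 0, ENNReal.ofReal |f y|
        ≤ ∫⁻ y in Set.Ioi 0, (ENNReal.ofReal (2 / η) * ENNReal.ofReal ((1 + y ^ 2) * f y ^ 2) +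
            ENNReal.ofReal (η / 8) * ENNReal.ofReal (1 / (1 + y ^ 2))) := by
          refine lintegral_mono fun y => ?_
          simp only
          rw [← ENNReal.ofReal_mul (by positivity), ← ENNReal.ofReal_mul (by positivity),
            ← ENNReal.ofReal_add (by positivity) (by positivity)]
          refine ENNReal.ofReal_le_ofReal ?_
          have hy : (0:ℝ) < 1 + y ^ 2 := by positivity
          rw [← sq_abs (f y)]
          set A := |f y|
          have h2 : 2 / η * ((1 + y ^ 2) * A ^ 2) + η / 8 * (1 / (1 + y ^ 2)) - A =
              (4 * (1 + y ^ 2) * A - η) ^ 2 / (8 * η * (1 + y ^ 2)) := by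
            field_simp
            ring
          have h3 : 0 ≤ (4 * (1 + y ^ 2) * A - η) ^ 2 / (8 * η * (1 + y ^ 2)) := by positivity
          linarith
      _ ≤ ENNReal.ofReal (2 / η) * ENNReal.ofReal (η ^ 2 / 4) +
            ENNReal.ofReal (η / 8) * ENNReal.ofReal 4 := by
          rw [lintegral_add_right _ (by fun_prop), lintegral_const_mul' _ _ ENNReal.ofReal_ne_top,
            lintegral_const_mul' _ _ ENNReal.ofReal_ne_top]
          gcongr
          exact lintegral_one_div_one_add_sq_le _
      _ = ENNReal.ofReal η := by
          rw [← ENNReal.ofReal_mul (by positivity), ← ENNReal.ofReal_mul (by positivity),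
            ← ENNReal.ofReal_add (by positivity) (by positivity)]
          congr 1
          field_simp
          ring
  have h2 : IntegrableOn f (Set.Ioi 0) := by
    refine ⟨hf.aestronglyMeasurable, ?_⟩
    rw [← hasFiniteIntegral_norm_iff, hasFiniteIntegral_iff_ofReal
      (Eventually.of_forall fun _ => norm_nonneg _)]
    exact lt_of_le_of_lt h1 ENNReal.ofReal_lt_top
  refine ⟨h2, ?_⟩
  rw [← ENNReal.ofReal_le_ofReal_iff hη.le, ofReal_integral_eq_lintegral_ofReal h2.abs
    (Eventually.of_forall fun _ => abs_nonneg _)]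
  exact h1

theorem setLIntegral_withDensity_Ioi {w g : ℝ → ENNReal} (hw : Measurable w) (hg : Measurable g) :
    ∫⁻ y in Set.Ioi (0:ℝ), g y ∂((volume.restrict (Set.Ioi (0:ℝ))).withDensity w) =
      ∫⁻ y in Set.Ioi (0:ℝ), w y * g y := by
  rw [restrict_withDensity measurableSet_Ioi, Measure.restrict_restrict measurableSet_Ioi,
    Set.inter_self, lintegral_withDensity_eq_lintegral_mul _ hw hg]
  rfl

theorem measurable_ofReal_sq_prim (φ : HalfLineL2) :
    Measurable fun y => ENNReal.ofReal (prim φ y ^ 2) :=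
  ((continuous_prim φ).measurable.pow_const 2).ennreal_ofReal

/-- The zeros needed to make a measure of small weighted mass negligible. -/
theorem exists_finset_of_small (ζ : Measure ℝ) (P₀ : Finset ℝ) {Z s : ℝ} (hZ : 0 < Z) (hs : 0 < s)
    (hζ : ∫⁻ y in Set.Ioi 0, ENNReal.ofReal (1 + y ^ 2) ∂ζ ≤ ENNReal.ofReal Z) :
    ∃ P : Finset ℝ, P₀ ⊆ P ∧ (P.card : ℝ) ≤ P₀.card + √(4 * Z) / s ∧
      ∀ φ : HalfLineL2, (∀ p ∈ P, prim φ p = 0) →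
        ∫⁻ y in Set.Ioi 0, ENNReal.ofReal (prim φ y ^ 2) ∂ζ ≤ ENNReal.ofReal (s ^ 2 * ‖φ‖ ^ 2) := by
  have := exists_finset_lintegral_sq_prim_le ζ (A := Set.univ) P₀ (fun _ _ _ _ _ _ =>
    Set.subset_univ _) (by simp) hZ (by norm_num : (0:ℝ) < 4) hs hζ (by
      simpa using lintegral_one_div_one_add_sq_le (Set.Ioi 0))
  rwa [mul_comm Z 4] at this

/-- Primitives vanish on `(-∞, 0]`, so nonpositive points can be dropped from a set of point
conditions. -/
theorem exists_pos_subset {P₀ : Finset ℝ} (hP₀ : ∀ p ∈ P₀, 0 < p) {C : ℝ} {Q : HalfLineL2 → Prop}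
    (h : ∃ P : Finset ℝ, P₀ ⊆ P ∧ (P.card : ℝ) ≤ C ∧ ∀ φ, (∀ p ∈ P, prim φ p = 0) → Q φ) :
    ∃ P : Finset ℝ, P₀ ⊆ P ∧ (∀ p ∈ P, 0 < p) ∧ (P.card : ℝ) ≤ C ∧
      ∀ φ, (∀ p ∈ P, prim φ p = 0) → Q φ := by
  classical
  obtain ⟨P, h0, hC, hQ⟩ := h
  refine ⟨P.filter (0 < ·), fun p hp => Finset.mem_filter.2 ⟨h0 hp, hP₀ p hp⟩,
    fun p hp => (Finset.mem_filter.1 hp).2, le_trans ?_ hC, fun φ hφ => hQ φ fun p hp => ?_⟩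
  · exact_mod_cast Finset.card_filter_le _ _
  · rcases le_or_gt p 0 with h | h
    · exact prim_of_nonpos φ h
    · exact hφ p (Finset.mem_filter.2 ⟨hp, h⟩)

namespace HalfLineString

variable (S : HalfLineString)

theorem integrableOn_κ : IntegrableOn S.κ (Set.Ioi 0) := by
  set M := (∫⁻ y in Set.Ioi 0, ENNReal.ofReal ((1 + y ^ 2) * S.κ y ^ 2)).toReal
  have hM : 0 ≤ M := ENNReal.toReal_nonneg
  refine (integrableOn_and_integral_abs_le S.measurable_κ (η := 2 * √(M + 1)) (by positivity) ?_).1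
  rw [mul_pow, Real.sq_sqrt (by positivity), ← ENNReal.ofReal_toReal S.lintegral_κ]
  exact ENNReal.ofReal_le_ofReal (by change M ≤ _; linarith)

/-- On the space of functions whose primitive vanishes on a finite set of `O(1) + η / ε` points, the
form of `κ` is at most `η ε`; and the trace of that form on the complementary space of step
functions is close to `∫ κ`. A step part of `κ` contributes `F(b)² - F(a)² = 0` on each of its
cells, so only the `L²`-small remainder matters. -/
theorem exists_finset_abs_inner_opL_le {η : ℝ} (hη : 0 < η) : ∃ N₀ : ℝ, ∀ ε > 0, ∃ P : Finset ℝ,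
    (∀ p ∈ P, 0 < p) ∧ (P.card : ℝ) ≤ N₀ + η / ε ∧
    (∀ φ, (∀ p ∈ P, prim φ p = 0) → |2 * inner ℝ (S.opL φ) φ| ≤ η * ε * ‖φ‖ ^ 2) ∧
    |∑ p ∈ P, 2 * inner ℝ (S.opL (cellVec P p)) (cellVec P p) - ∫ y in Set.Ioi 0, S.κ y| ≤ η := by
  -- The first bound gives `∫ |r| ≤ η` for the remainder `r` of `κ`, the second bounds the number of
  -- points which make the form of `r` small by `η / ε`.
  set η₁ := min (η ^ 2 / 4) (η ^ 4 / 16) with hη₁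
  have hη₁0 : 0 < η₁ := by positivity
  obtain ⟨P₀, st, hstm, hst, hr⟩ := exists_isStepOn_lintegral_le S.measurable_κ S.lintegral_κ hη₁0
  set r : ℝ → ℝ := fun y => S.κ y - st y with hrdef
  have hrm : Measurable r := S.measurable_κ.sub hstm
  obtain ⟨hri, hrabs⟩ := integrableOn_and_integral_abs_le hrm hη
    (hr.trans (ENNReal.ofReal_le_ofReal (min_le_left _ _)))
  refine ⟨P₀.card, fun ε hε => ?_⟩
  have hw : Measurable fun y => ENNReal.ofReal (r y ^ 2) := (hrm.pow_const 2).ennreal_ofReal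
  have hζ : ∫⁻ y in Set.Ioi (0:ℝ), ENNReal.ofReal (1 + y ^ 2)
      ∂((volume.restrict (Set.Ioi (0:ℝ))).withDensity fun y => ENNReal.ofReal (r y ^ 2)) ≤
      ENNReal.ofReal η₁ := by
    rw [setLIntegral_withDensity_Ioi hw (by fun_prop)]
    refine le_trans (le_of_eq (lintegral_congr fun y => ?_)) hr
    rw [← ENNReal.ofReal_mul (sq_nonneg _), mul_comm]
  obtain ⟨P, hP₀P, hPpos, hPcard, hP⟩ := exists_pos_subset hst.pos
    (exists_finset_of_small _ P₀ hη₁0 (show 0 < η * ε / 2 by positivity) hζ)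
  have hstP := hst.mono hP₀P hPpos
  refine ⟨P, hPpos, hPcard.trans ?_, fun φ hφ => ?_, ?_⟩
  · refine add_le_add le_rfl ?_
    rw [div_le_div_iff₀ (by positivity) hε]
    have : √(4 * η₁) ≤ η ^ 2 / 2 := by
      rw [Real.sqrt_le_left (by positivity)]
      have := min_le_right (η ^ 2 / 4) (η ^ 4 / 16)
      nlinarith
    nlinarith
  · have h1 := hP φ hφ
    rw [setLIntegral_withDensity_Ioi hw (measurable_ofReal_sq_prim φ)] at h1
    have h2 : ∫⁻ y in Set.Ioi 0, ENNReal.ofReal ((r y * prim φ y) ^ 2) ≤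
        ENNReal.ofReal ((η * ε / 2) ^ 2 * ‖φ‖ ^ 2) := by
      refine le_trans (le_of_eq (lintegral_congr fun y => ?_)) h1
      rw [← ENNReal.ofReal_mul (sq_nonneg _), mul_pow]
    have hmem : MemLp (fun y => r y * prim φ y) 2 (volume.restrict (Set.Ioi 0)) :=
      memLp_two_of_lintegral_sq (hrm.mul (continuous_prim φ).measurable).aestronglyMeasurable
        (ne_top_of_le_ne_top ENNReal.ofReal_ne_top h2)
    have hrFi : IntegrableOn (fun y => r y * prim φ y * φ y) (Set.Ioi 0) :=
      hmem.integrable_mul (Lp.memLp φ)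
    have hsFi : IntegrableOn (fun y => st y * prim φ y * φ y) (Set.Ioi 0) := by
      refine ((S.integrableOn_κ_mul_prim_mul φ φ).sub hrFi).congr (Eventually.of_forall fun y => ?_)
      simp only [hrdef, Pi.sub_apply]
      ring
    have hst0 : ∫ y in Set.Ioi 0, st y * prim φ y * φ y = 0 := by
      have hg : IntegrableOn (fun y => Set.indicator (Set.Ioi 0)
          (fun y => st y * prim φ y * φ y) y) (Set.Ioi 0) := hsFi.indicator measurableSet_Ioi
      have e : ∫ y in Set.Ioi 0, st y * prim φ y * φ y =
          ∫ y in Set.Ioi 0, Set.indicator (Set.Ioi 0) (fun y => st y * prim φ y * φ y) y := by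
        rw [setIntegral_indicator measurableSet_Ioi, Set.inter_self]
      rw [e, setIntegral_eq_sum_cells hPpos hg]
      · refine Finset.sum_eq_zero fun p hp => ?_
        rw [setIntegral_indicator measurableSet_Ioi,
          Set.inter_eq_self_of_subset_left (Ioc_cellLeft_subset P p)]
        have h3 : ∫ y in Set.Ioc (cellLeft P p) p, st y * prim φ y * φ y =
            st p * ∫ y in Set.Ioc (cellLeft P p) p, prim φ y * φ y := by
          rw [← integral_const_mul]
          refine setIntegral_congr_fun measurableSet_Ioc fun y hy => ?_
          rw [hstP.const p hp y hy, mul_assoc]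
        have h4 := two_mul_integral_prim_mul φ (cellLeft_nonneg P p) (cellLeft_lt (hPpos p hp)).le
        have h5 : prim φ (cellLeft P p) = 0 := by
          rcases cellLeft_eq_or P p with h | h
          · rw [h, prim_of_nonpos φ le_rfl]
          · exact hφ _ h.1
        rw [hφ p hp, h5] at h4
        rw [h3, show ∫ y in Set.Ioc (cellLeft P p) p, prim φ y * φ y = 0 by linarith, mul_zero]
      · intro y hy
        by_cases hy0 : 0 < y
        · rw [Set.indicator_of_mem (show y ∈ Set.Ioi 0 from hy0), hstP.zero y hy0 hy]
          simp
        · exact Set.indicator_of_notMem hy0 _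
    have h6 : inner ℝ (S.opL φ) φ = inner ℝ (hmem.toLp _) φ := by
      rw [inner_opL, inner_eq_integral]
      have e : ∫ y in Set.Ioi 0, S.κ y * prim φ y * φ y =
          (∫ y in Set.Ioi 0, r y * prim φ y * φ y) + ∫ y in Set.Ioi 0, st y * prim φ y * φ y := by
        rw [← integral_add hrFi hsFi]
        refine integral_congr_ae (Eventually.of_forall fun y => ?_)
        simp only [hrdef]; ring
      rw [e, hst0, add_zero]
      refine integral_congr_ae ?_
      filter_upwards [hmem.coeFn_toLp] with y hy
      rw [hy]
    have h7 : ‖hmem.toLp _‖ ≤ η * ε / 2 * ‖φ‖ := by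
      refine abs_le_of_sq_le_sq' ?_ (by positivity) |>.2
      rw [← ENNReal.ofReal_le_ofReal_iff (by positivity), ofReal_norm_sq_Lp, mul_pow]
      refine le_trans (le_of_eq (lintegral_congr_ae ?_)) h2
      filter_upwards [hmem.coeFn_toLp] with y hy
      rw [hy]
    have h8 := abs_real_inner_le_norm (hmem.toLp _) φ
    rw [abs_mul, abs_two, h6]
    nlinarith [norm_nonneg φ]
  · -- on each cell the weight `2 (y - a) / (b - a)` has mean one
    set wt : ℝ → ℝ → ℝ := fun p y => 2 * (y - cellLeft P p) / (p - cellLeft P p) with hwt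
    have hwt1 : ∀ p ∈ P, ∀ y ∈ Set.Ioc (cellLeft P p) p, |wt p y - 1| ≤ 1 := by
      intro p hp y hy
      have h0 : 0 < p - cellLeft P p := sub_pos.2 (cellLeft_lt (hPpos p hp))
      rw [abs_le, hwt]
      simp only
      constructor
      · have : 0 ≤ 2 * (y - cellLeft P p) / (p - cellLeft P p) :=
          div_nonneg (by linarith [hy.1]) h0.le
        linarith
      · have : 2 * (y - cellLeft P p) / (p - cellLeft P p) ≤ 2 := by
          rw [div_le_iff₀ h0]; linarith [hy.2]
        linarith
    have hwti : ∀ p ∈ P, ∫ y in Set.Ioc (cellLeft P p) p, (wt p y - 1) = 0 := by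
      intro p hp
      have h0 := cellLeft_lt (P := P) (hPpos p hp)
      rw [← intervalIntegral.integral_of_le h0.le]
      have h1 : ∀ y ∈ Set.uIcc (cellLeft P p) p, HasDerivAt
          (fun y => (y - cellLeft P p) ^ 2 / (p - cellLeft P p) - y) (wt p y - 1) y := by
        intro y _
        have := ((((hasDerivAt_id y).sub_const (cellLeft P p)).pow 2).div_const
          (p - cellLeft P p)).sub (hasDerivAt_id y)
        convert! this using 1
        simp [hwt]
      rw [intervalIntegral.integral_eq_sub_of_hasDerivAt h1 (by
        apply Continuous.intervalIntegrable
        simp only [hwt]; fun_prop)]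
      have : p - cellLeft P p ≠ 0 := (sub_pos.2 h0).ne'
      field_simp
      ring
    have hcell : ∀ p ∈ P, 2 * inner ℝ (S.opL (cellVec P p)) (cellVec P p) -
        ∫ y in Set.Ioc (cellLeft P p) p, S.κ y =
        ∫ y in Set.Ioc (cellLeft P p) p, r y * (wt p y - 1) := by
      intro p hp
      rw [S.two_mul_inner_opL_cellVec (hPpos p hp)]
      have hκi : IntegrableOn S.κ (Set.Ioc (cellLeft P p) p) :=
        S.integrableOn_κ.mono_set (Ioc_cellLeft_subset P p)
      have hwc : Continuous fun y => wt p y := by simp only [hwt]; fun_prop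
      have hκw : IntegrableOn (fun y => S.κ y * wt p y) (Set.Ioc (cellLeft P p) p) := by
        have := (((integrableOn_Icc_iff_integrableOn_Ioc).2 hκi).mul_continuousOn
          hwc.continuousOn isCompact_Icc).mono_set Set.Ioc_subset_Icc_self
        exact this
      have hsw : IntegrableOn (fun y => st p * (wt p y - 1)) (Set.Ioc (cellLeft P p) p) :=
        ((by fun_prop : Continuous fun y => st p * (wt p y - 1)).integrableOn_Icc).mono_set
          Set.Ioc_subset_Icc_self
      have hzero : ∫ y in Set.Ioc (cellLeft P p) p, st p * (wt p y - 1) = 0 := by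
        rw [integral_const_mul, hwti p hp, mul_zero]
      have hd : IntegrableOn (fun y => S.κ y * wt p y - S.κ y) (Set.Ioc (cellLeft P p) p) :=
        hκw.sub hκi
      rw [← integral_sub hκw hκi, ← sub_zero (∫ y in Set.Ioc (cellLeft P p) p, _), ← hzero,
        ← integral_sub hd hsw]
      refine setIntegral_congr_fun measurableSet_Ioc fun y hy => ?_
      simp only [hrdef]
      rw [hstP.const p hp y hy]
      ring
    -- the part of `κ` to the right of all cells is a part of the remainder
    set U : Set ℝ := ⋃ p ∈ P, Set.Ioc (cellLeft P p) p with hU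
    have hUm : MeasurableSet U := Finset.measurableSet_biUnion P fun _ _ => measurableSet_Ioc
    have hUs : U ⊆ Set.Ioi 0 := Set.iUnion₂_subset fun p _ => Ioc_cellLeft_subset P p
    have hUsum : ∀ g : ℝ → ℝ, IntegrableOn g (Set.Ioi 0) →
        ∫ y in U, g y = ∑ p ∈ P, ∫ y in Set.Ioc (cellLeft P p) p, g y := fun g hg =>
      integral_biUnion_finset P (fun _ _ => measurableSet_Ioc) (pairwise_disjoint_cells hPpos)
        (fun p _ => hg.mono_set (Ioc_cellLeft_subset P p))
    have hsplit : ∀ g : ℝ → ℝ, IntegrableOn g (Set.Ioi 0) →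
        ∫ y in Set.Ioi 0, g y = (∫ y in U, g y) + ∫ y in Set.Ioi 0 \ U, g y := by
      intro g hg
      conv_lhs => rw [← Set.union_sdiff_cancel hUs]
      exact setIntegral_union Set.disjoint_sdiff_right (measurableSet_Ioi.diff hUm)
        (hg.mono_set hUs) (hg.mono_set Set.sdiff_subset)
    have htail : ∫ y in Set.Ioi 0 \ U, S.κ y = ∫ y in Set.Ioi 0 \ U, r y := by
      refine setIntegral_congr_fun (measurableSet_Ioi.diff hUm) fun y hy => ?_
      simp only [hrdef]
      rw [hstP.zero y hy.1, sub_zero]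
      intro p hp
      by_contra! hyp
      obtain ⟨q, hq, hyq⟩ := exists_mem_cell hy.1 ⟨p, hp, hyp⟩
      exact hy.2 (Set.mem_biUnion hq hyq)
    have e1 : ∑ p ∈ P, 2 * inner ℝ (S.opL (cellVec P p)) (cellVec P p) - ∫ y in Set.Ioi 0, S.κ y =
        (∑ p ∈ P, ∫ y in Set.Ioc (cellLeft P p) p, r y * (wt p y - 1)) -
          ∫ y in Set.Ioi 0 \ U, r y := by
      rw [← Finset.sum_congr rfl hcell, Finset.sum_sub_distrib, hsplit _ S.integrableOn_κ,
        hUsum _ S.integrableOn_κ, htail]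
      ring
    rw [e1]
    refine le_trans ?_ hrabs
    rw [hsplit _ hri.abs, hUsum _ hri.abs]
    refine (abs_sub _ _).trans (add_le_add ((Finset.abs_sum_le_sum_abs _ _).trans
      (Finset.sum_le_sum fun p hp => ?_)) abs_integral_le_integral_abs)
    have hrip : IntegrableOn r (Set.Ioc (cellLeft P p) p) :=
      hri.mono_set (Ioc_cellLeft_subset P p)
    have hrw : IntegrableOn (fun y => r y * (wt p y - 1)) (Set.Ioc (cellLeft P p) p) :=
      (((integrableOn_Icc_iff_integrableOn_Ioc).2 hrip).mul_continuousOn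
        (by simp only [hwt]; fun_prop : Continuous fun y => wt p y - 1).continuousOn
        isCompact_Icc).mono_set Set.Ioc_subset_Icc_self
    refine abs_integral_le_integral_abs.trans
      (setIntegral_mono_on hrw.abs hrip.abs measurableSet_Ioc fun y hy => ?_)
    rw [abs_mul]
    exact mul_le_of_le_one_right (abs_nonneg _) (hwt1 p hp y hy)

end HalfLineString

/-! ### Measures which are negligible for the counting of eigenvalues -/

/-- The form `φ ↦ ∫ F² dζ` is at most `η ε² ‖φ‖²` as soon as `F` vanishes on a suitable set of
`O(1) + η / ε` points. -/
def IsNegligible (ζ : Measure ℝ) (η : ℝ) : Prop :=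
  ∃ N : ℝ, ∀ ε > 0, ∃ P : Finset ℝ, (P.card : ℝ) ≤ N + η / ε ∧
    ∀ φ : HalfLineL2, (∀ p ∈ P, prim φ p = 0) →
      ∫⁻ y in Set.Ioi 0, ENNReal.ofReal (prim φ y ^ 2) ∂ζ ≤ ENNReal.ofReal (η * ε ^ 2 * ‖φ‖ ^ 2)

theorem IsNegligible.add {ζ₁ ζ₂ : Measure ℝ} {η₁ η₂ : ℝ} (hη₁ : 0 ≤ η₁) (hη₂ : 0 ≤ η₂)
    (h₁ : IsNegligible ζ₁ η₁) (h₂ : IsNegligible ζ₂ η₂) :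
    IsNegligible (ζ₁ + ζ₂) (η₁ + η₂) := by
  classical
  obtain ⟨N₁, h₁⟩ := h₁
  obtain ⟨N₂, h₂⟩ := h₂
  refine ⟨N₁ + N₂, fun ε hε => ?_⟩
  obtain ⟨P₁, hP₁, hF₁⟩ := h₁ ε hε
  obtain ⟨P₂, hP₂, hF₂⟩ := h₂ ε hε
  refine ⟨P₁ ∪ P₂, ?_, fun φ hφ => ?_⟩
  · have : ((P₁ ∪ P₂).card : ℝ) ≤ P₁.card + P₂.card := by exact_mod_cast Finset.card_union_le _ _
    rw [add_div]
    linarith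
  · rw [Measure.restrict_add, lintegral_add_measure, add_mul, add_mul,
      ENNReal.ofReal_add (by positivity) (by positivity)]
    exact add_le_add (hF₁ φ fun p hp => hφ p (Finset.mem_union_left _ hp))
      (hF₂ φ fun p hp => hφ p (Finset.mem_union_right _ hp))

/-- A measure of small weighted mass `Z` is negligible: about `√Z / ε` zeros suffice. -/
theorem isNegligible_of_small {ζ : Measure ℝ} {η Z : ℝ} (hη : 0 < η) (hZ : 0 < Z)
    (hZη : 4 * Z ≤ η ^ 3)
    (hζ : ∫⁻ y in Set.Ioi 0, ENNReal.ofReal (1 + y ^ 2) ∂ζ ≤ ENNReal.ofReal Z) :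
    IsNegligible ζ η := by
  refine ⟨0, fun ε hε => ?_⟩
  obtain ⟨P, -, hP, hF⟩ := exists_finset_of_small ζ ∅ hZ (show 0 < √η * ε by positivity) hζ
  refine ⟨P, hP.trans ?_, fun φ hφ => (hF φ hφ).trans (le_of_eq ?_)⟩
  · rw [Finset.card_empty, Nat.cast_zero]
    refine add_le_add le_rfl ?_
    rw [div_le_div_iff₀ (by positivity) hε, ← mul_assoc]
    refine mul_le_mul_of_nonneg_right ?_ hε.le
    rw [Real.sqrt_le_left (by positivity), mul_pow, Real.sq_sqrt hη.le]
    linarith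
  · rw [mul_pow, Real.sq_sqrt hη.le]

/-- A measure carried by a compact Lebesgue null set is negligible: the null set is covered by
finitely many intervals of small total length. -/
theorem isNegligible_of_compact_null {ζ : Measure ℝ} {K : Set ℝ} (hK : IsCompact K)
    (hK0 : volume K = 0) (hζK : ζ Kᶜ = 0)
    (hζ : ∫⁻ y in Set.Ioi 0, ENNReal.ofReal (1 + y ^ 2) ∂ζ ≠ ⊤) {η : ℝ} (hη : 0 < η) :
    IsNegligible ζ η := by
  classical
  set Z := (∫⁻ y in Set.Ioi 0, ENNReal.ofReal (1 + y ^ 2) ∂ζ).toReal + 1 with hZdef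
  have hZ : 0 < Z := by have := ENNReal.toReal_nonneg (a := ∫⁻ y in Set.Ioi 0, ENNReal.ofReal (1 + y ^ 2) ∂ζ); linarith
  have hζZ : ∫⁻ y in Set.Ioi 0, ENNReal.ofReal (1 + y ^ 2) ∂ζ ≤ ENNReal.ofReal Z := by
    rw [← ENNReal.ofReal_toReal hζ]
    exact ENNReal.ofReal_le_ofReal (by linarith)
  set t := η ^ 3 / Z with ht
  have ht0 : 0 < t := by positivity
  obtain ⟨U, hKU, hUo, hU⟩ := K.exists_isOpen_lt_of_lt (μ := volume) (ENNReal.ofReal t)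
    (by rw [hK0]; simpa using ht0)
  have hball : ∀ x : K, ∃ r > 0, Metric.ball (x : ℝ) r ⊆ U := fun x =>
    Metric.isOpen_iff.1 hUo x (hKU x.2)
  choose r hr0 hrU using hball
  obtain ⟨T, hT⟩ := hK.elim_finite_subcover (fun x : K => Metric.ball (x : ℝ) (r x))
    (fun _ => Metric.isOpen_ball)
    (fun x hx => Set.mem_iUnion.2 ⟨⟨x, hx⟩, Metric.mem_ball_self (hr0 _)⟩)
  set A : Set ℝ := ⋃ x ∈ T, Metric.ball (x : ℝ) (r x) with hA
  have hAU : A ⊆ U := Set.iUnion₂_subset fun x _ => hrU x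
  set P₀ : Finset ℝ := T.image fun x : K => (x : ℝ) - r x with hP₀
  refine ⟨P₀.card, fun ε hε => ?_⟩
  have hA0 : ∀ x y, 0 ≤ x → x < y → y ∈ A → (∀ p ∈ P₀, ¬(x < p ∧ p ≤ y)) → Set.Ioo x y ⊆ A := by
    -- a gap of `P₀` whose right part meets one of the intervals lies in it
    intro x y _ hxy hyA hp
    obtain ⟨c, hcT, hyc⟩ := Set.mem_iUnion₂.1 hyA
    rw [Real.ball_eq_Ioo] at hyc
    have h1 : (c : ℝ) - r c ≤ x := by
      by_contra! h
      exact hp _ (Finset.mem_image_of_mem _ hcT) ⟨h, hyc.1.le⟩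
    intro z hz
    refine Set.mem_iUnion₂.2 ⟨c, hcT, ?_⟩
    rw [Real.ball_eq_Ioo]
    exact ⟨lt_of_le_of_lt h1 hz.1, hz.2.trans hyc.2⟩
  have hζA : ζ (Set.Ioi 0 \ A) = 0 := by
    refine measure_mono_null ?_ hζK
    rintro y ⟨-, hyA⟩ hyK
    exact hyA (hT hyK)
  have hθ : ∫⁻ y in Set.Ioi 0, A.indicator (fun x => ENNReal.ofReal (1 / (1 + x ^ 2))) y ≤
      ENNReal.ofReal t := by
    have hAm : MeasurableSet A := (isOpen_biUnion fun _ _ => Metric.isOpen_ball).measurableSet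
    calc ∫⁻ y in Set.Ioi 0, A.indicator (fun x => ENNReal.ofReal (1 / (1 + x ^ 2))) y
        ≤ ∫⁻ y, A.indicator (fun _ => 1) y := by
          refine (setLIntegral_le_lintegral _ _).trans (lintegral_mono fun y => ?_)
          refine Set.indicator_le_indicator ?_
          rw [← ENNReal.ofReal_one]
          refine ENNReal.ofReal_le_ofReal ?_
          rw [div_le_one (by positivity)]
          linarith [sq_nonneg y]
      _ = volume A := by rw [lintegral_indicator_const hAm, one_mul]
      _ ≤ ENNReal.ofReal t := (measure_mono hAU).trans hU.le
  obtain ⟨P, -, hP, hF⟩ := exists_finset_lintegral_sq_prim_le ζ (A := A) P₀ hA0 hζA hZ ht0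
    (show 0 < √η * ε by positivity) hζZ hθ
  refine ⟨P, hP.trans ?_, fun φ hφ => (hF φ hφ).trans (le_of_eq ?_)⟩
  · refine add_le_add le_rfl ?_
    rw [div_le_div_iff₀ (by positivity) hε, ← mul_assoc]
    refine mul_le_mul_of_nonneg_right ?_ hε.le
    rw [Real.sqrt_le_left (by positivity), mul_pow, Real.sq_sqrt hη.le, ht, mul_div_cancel₀ _ hZ.ne']
    linarith
  · rw [mul_pow, Real.sq_sqrt hη.le]

/-- A singular measure is negligible: up to a small remainder it is carried by a compact null set. -/
theorem isNegligible_of_mutuallySingular {ζ : Measure ℝ} (hs : ζ ⟂ₘ volume)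
    (hζ : ∫⁻ y, ENNReal.ofReal (1 + y ^ 2) ∂ζ ≠ ⊤) {η : ℝ} (hη : 0 < η) : IsNegligible ζ η := by
  obtain ⟨N, hN, hN1, hN2⟩ := hs
  have hw : Measurable fun y : ℝ => ENNReal.ofReal (1 + y ^ 2) := by fun_prop
  set ρ := ζ.withDensity fun y => ENNReal.ofReal (1 + y ^ 2) with hρ
  have hfin : IsFiniteMeasure ρ := isFiniteMeasure_withDensity hζ
  set Z := (η / 2) ^ 3 / 4 with hZ
  have hZ0 : 0 < Z := by positivity
  obtain ⟨K, hKN, hK, hKρ⟩ := hN.compl.exists_isCompact_sdiff_lt (μ := ρ) (measure_ne_top _ _)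
    (show ENNReal.ofReal Z ≠ 0 by simpa using hZ0)
  have hKm := hK.measurableSet
  have hsplit : ζ = ζ.restrict Kᶜ + ζ.restrict K := (Measure.restrict_compl_add_restrict hKm).symm
  rw [hsplit, ← add_halves η]
  refine IsNegligible.add (by positivity) (by positivity)
    (isNegligible_of_small (by positivity) hZ0 (by rw [hZ]; linarith) ?_)
    (isNegligible_of_compact_null hK (measure_mono_null hKN hN2) ?_ ?_ (by positivity))
  · refine (setLIntegral_le_lintegral _ _).trans ?_
    rw [← withDensity_apply _ hKm.compl]
    have : ρ Kᶜ ≤ ρ N + ρ (Nᶜ \ K) := by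
      refine (measure_mono ?_).trans (measure_union_le _ _)
      intro y hy
      by_cases h : y ∈ N
      · exact Or.inl h
      · exact Or.inr ⟨h, hy⟩
    have h0 : ρ N = 0 := withDensity_absolutelyContinuous _ _ hN1
    rw [h0, zero_add] at this
    exact this.trans hKρ.le
  · rw [Measure.restrict_apply hKm.compl]
    simp
  · refine ne_top_of_le_ne_top hζ ((setLIntegral_le_lintegral _ _).trans ?_)
    exact setLIntegral_le_lintegral _ _

namespace HalfLineString

variable (S : HalfLineString)

/-- Up to negligible measures, `ν` has a density which is the square of a step function. -/
theorem exists_step_approx : ∃ Λ : ℝ, 0 ≤ Λ ∧ ∀ η > 0, ∃ (P₀ : Finset ℝ) (st : ℝ → ℝ) (ζ : Measure ℝ),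
    Measurable st ∧ IsStepOn P₀ st ∧ ∑ p ∈ P₀, (p - cellLeft P₀ p) * |st p| ≤ Λ ∧
    IsNegligible ζ η ∧
    S.ν ≤ (volume.restrict (Set.Ioi 0)).withDensity (fun y => ENNReal.ofReal (st y ^ 2)) + ζ ∧
    (volume.restrict (Set.Ioi 0)).withDensity (fun y => ENNReal.ofReal (st y ^ 2)) ≤ S.ν + ζ := by
  set f := S.ν.rnDeriv volume with hf
  have hfm : Measurable f := Measure.measurable_rnDeriv _ _
  -- The square root `b` of the density is approximated by a step function in a weighted `L²` norm. The
  -- measure `ζ` collects the error `|b² - st²|` and the singular part of `ν`.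
  set b : ℝ → ℝ := fun y => √(f y).toReal with hb
  have hbm : Measurable b := hfm.ennreal_toReal.sqrt
  have hbf : ∀ᵐ y, ENNReal.ofReal (b y ^ 2) = f y := by
    filter_upwards [Measure.rnDeriv_lt_top S.ν volume] with y hy
    rw [hb]
    simp only
    rw [Real.sq_sqrt ENNReal.toReal_nonneg, ENNReal.ofReal_toReal hy.ne]
  have hbint : ∫⁻ y in Set.Ioi 0, ENNReal.ofReal ((1 + y ^ 2) * b y ^ 2) ≠ ⊤ := by
    refine ne_top_of_le_ne_top S.lintegral_ν ?_
    calc ∫⁻ y in Set.Ioi 0, ENNReal.ofReal ((1 + y ^ 2) * b y ^ 2)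
        ≤ ∫⁻ y, ENNReal.ofReal ((1 + y ^ 2) * b y ^ 2) := setLIntegral_le_lintegral _ _
      _ = ∫⁻ y, f y * ENNReal.ofReal (1 + y ^ 2) := by
          refine lintegral_congr_ae ?_
          filter_upwards [hbf] with y hy
          rw [ENNReal.ofReal_mul (by positivity), hy, mul_comm]
      _ = ∫⁻ y, ENNReal.ofReal (1 + y ^ 2) ∂(volume.withDensity f) := by
          rw [lintegral_withDensity_eq_lintegral_mul _ hfm (by fun_prop)]
          rfl
      _ ≤ _ := lintegral_mono' (Measure.withDensity_rnDeriv_le _ _) le_rfl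
  set M := (∫⁻ y in Set.Ioi 0, ENNReal.ofReal ((1 + y ^ 2) * b y ^ 2)).toReal with hM
  have hM0 : 0 ≤ M := ENNReal.toReal_nonneg
  have hMeq : ∫⁻ y in Set.Ioi 0, ENNReal.ofReal ((1 + y ^ 2) * b y ^ 2) = ENNReal.ofReal M :=
    (ENNReal.ofReal_toReal hbint).symm
  refine ⟨2 * √(2 * M + 2), by positivity, fun η hη => ?_⟩
  set Z := (η / 2) ^ 3 / 4 with hZ
  have hZ0 : 0 < Z := by positivity
  -- `l` is the parameter in `|b² - st²| ≤ l b² + (1 + 1 / l) (b - st)²`.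
  set l := Z / (2 * (M + 1)) with hl
  have hl0 : 0 < l := by positivity
  set η₁ := min 1 (Z / (2 * (1 + 1 / l))) with hη₁
  have hη₁0 : 0 < η₁ := by positivity
  obtain ⟨P₀, st, hstm, hst, hr⟩ := exists_isStepOn_lintegral_le hbm hbint hη₁0
  set r : ℝ → ℝ := fun y => |b y ^ 2 - st y ^ 2| with hrdef
  have hrm : Measurable r := ((hbm.pow_const 2).sub (hstm.pow_const 2)).abs
  set V := volume.restrict (Set.Ioi (0:ℝ)) with hV
  set νs := S.ν.singularPart volume with hνs
  have hm1 : Measurable fun y => ENNReal.ofReal ((1 + y ^ 2) * b y ^ 2) :=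
    (by fun_prop : Measurable fun y => (1 + y ^ 2) * b y ^ 2).ennreal_ofReal
  have hm2 : Measurable fun y => ENNReal.ofReal ((1 + y ^ 2) * (b y - st y) ^ 2) :=
    (by fun_prop : Measurable fun y => (1 + y ^ 2) * (b y - st y) ^ 2).ennreal_ofReal
  refine ⟨P₀, st, V.withDensity (fun y => ENNReal.ofReal (r y)) + νs.restrict (Set.Ioi 0),
    hstm, hst, ?_, ?_, ?_, ?_⟩
  · -- the integral of `|st|` is bounded by its weighted `L²` norm
    have h2 : ∫⁻ y in Set.Ioi 0, ENNReal.ofReal ((1 + y ^ 2) * st y ^ 2) ≤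
        ENNReal.ofReal ((2 * √(2 * M + 2)) ^ 2 / 4) := by
      calc ∫⁻ y in Set.Ioi 0, ENNReal.ofReal ((1 + y ^ 2) * st y ^ 2)
          ≤ ∫⁻ y in Set.Ioi 0, (2 * ENNReal.ofReal ((1 + y ^ 2) * b y ^ 2) +
              2 * ENNReal.ofReal ((1 + y ^ 2) * (b y - st y) ^ 2)) := by
            refine lintegral_mono fun y => ?_
            simp only
            rw [← mul_add, ← ENNReal.ofReal_add (by positivity) (by positivity),
              ← ENNReal.ofReal_ofNat 2, ← ENNReal.ofReal_mul zero_le_two]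
            refine ENNReal.ofReal_le_ofReal ?_
            have : st y ^ 2 ≤ 2 * (b y ^ 2 + (b y - st y) ^ 2) := by
              nlinarith [sq_nonneg (2 * b y - st y)]
            calc (1 + y ^ 2) * st y ^ 2 ≤ (1 + y ^ 2) * (2 * (b y ^ 2 + (b y - st y) ^ 2)) := by gcongr
              _ = _ := by ring
        _ ≤ 2 * ENNReal.ofReal M + 2 * ENNReal.ofReal 1 := by
            rw [lintegral_add_left (hm1.const_mul 2), lintegral_const_mul' _ _ (by norm_num),
              lintegral_const_mul' _ _ (by norm_num), hMeq]
            gcongr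
            exact hr.trans (ENNReal.ofReal_le_ofReal (min_le_left _ _))
        _ = _ := by
            rw [← ENNReal.ofReal_ofNat 2, ← ENNReal.ofReal_mul zero_le_two,
              ← ENNReal.ofReal_mul zero_le_two, ← ENNReal.ofReal_add (by positivity) (by positivity),
              mul_pow, Real.sq_sqrt (by positivity)]
            congr 1
            ring
    obtain ⟨hi, hle⟩ := integrableOn_and_integral_abs_le hstm (by positivity) h2
    have hia : IntegrableOn (fun y => |st y|) (Set.Ioi 0) := hi.abs
    refine le_trans (le_of_eq ?_) hle
    have hU : ∫ y in ⋃ p ∈ P₀, Set.Ioc (cellLeft P₀ p) p, |st y| = ∫ y in Set.Ioi 0, |st y| := by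
      refine (setIntegral_eq_of_subset_of_forall_sdiff_eq_zero measurableSet_Ioi
        (Set.iUnion₂_subset fun p _ => Ioc_cellLeft_subset P₀ p) ?_).symm
      rintro y ⟨hy, hyn⟩
      rw [hst.zero y hy, abs_zero]
      intro p hp
      by_contra! hyp
      obtain ⟨q, hq, hyq⟩ := exists_mem_cell hy ⟨p, hp, hyp⟩
      exact hyn (Set.mem_biUnion hq hyq)
    rw [← hU, integral_biUnion_finset P₀ (fun _ _ => measurableSet_Ioc)
      (pairwise_disjoint_cells hst.pos) (fun p _ => hia.mono_set (Ioc_cellLeft_subset P₀ p))]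
    refine Finset.sum_congr rfl fun p hp => ?_
    have h3 : ∫ y in Set.Ioc (cellLeft P₀ p) p, |st y| =
        ∫ y in Set.Ioc (cellLeft P₀ p) p, |st p| :=
      setIntegral_congr_fun measurableSet_Ioc fun y hy => by simp only [hst.const p hp y hy]
    rw [h3, setIntegral_const, smul_eq_mul, measureReal_def, Real.volume_Ioc,
      ENNReal.toReal_ofReal (sub_nonneg.2 (cellLeft_lt (hst.pos p hp)).le)]
  · rw [← add_halves η]
    refine IsNegligible.add (by positivity) (by positivity)
      (isNegligible_of_small (by positivity) hZ0 (by rw [hZ]; linarith) ?_)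
      (isNegligible_of_mutuallySingular ?_ ?_ (by positivity))
    · rw [hV, setLIntegral_withDensity_Ioi hrm.ennreal_ofReal (by fun_prop)]
      calc ∫⁻ y in Set.Ioi 0, ENNReal.ofReal (r y) * ENNReal.ofReal (1 + y ^ 2)
          ≤ ∫⁻ y in Set.Ioi 0, (ENNReal.ofReal l * ENNReal.ofReal ((1 + y ^ 2) * b y ^ 2) +
              ENNReal.ofReal (1 + 1 / l) * ENNReal.ofReal ((1 + y ^ 2) * (b y - st y) ^ 2)) := by
            refine lintegral_mono fun y => ?_
            simp only
            rw [← ENNReal.ofReal_mul (abs_nonneg _), ← ENNReal.ofReal_mul (by positivity),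
              ← ENNReal.ofReal_mul (by positivity),
              ← ENNReal.ofReal_add (by positivity) (by positivity)]
            refine ENNReal.ofReal_le_ofReal ?_
            have h1 : r y ≤ l * b y ^ 2 + (1 + 1 / l) * (b y - st y) ^ 2 := by
              rw [hrdef, abs_le]
              set c := b y - st y with hc
              have e1 : st y = b y - c := by rw [hc]; ring
              have e2 : 0 ≤ (l * b y - c) ^ 2 / l := by positivity
              have e3 : 0 ≤ (l * b y + c) ^ 2 / l := by positivity
              have e4 : (l * b y - c) ^ 2 / l = l * b y ^ 2 - 2 * b y * c + 1 / l * c ^ 2 := by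
                field_simp
                ring
              have e5 : (l * b y + c) ^ 2 / l = l * b y ^ 2 + 2 * b y * c + 1 / l * c ^ 2 := by
                field_simp
                ring
              rw [e1]
              constructor <;> nlinarith [sq_nonneg c]
            calc r y * (1 + y ^ 2) ≤
                (l * b y ^ 2 + (1 + 1 / l) * (b y - st y) ^ 2) * (1 + y ^ 2) := by gcongr
              _ = _ := by ring
        _ ≤ ENNReal.ofReal l * ENNReal.ofReal M + ENNReal.ofReal (1 + 1 / l) * ENNReal.ofReal η₁ := by
            rw [lintegral_add_left (hm1.const_mul _), lintegral_const_mul' _ _ ENNReal.ofReal_ne_top,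
              lintegral_const_mul' _ _ ENNReal.ofReal_ne_top, hMeq]
            gcongr
        _ ≤ ENNReal.ofReal Z := by
            rw [← ENNReal.ofReal_mul hl0.le, ← ENNReal.ofReal_mul (by positivity),
              ← ENNReal.ofReal_add (by positivity) (by positivity)]
            refine ENNReal.ofReal_le_ofReal ?_
            have h1 : l * M ≤ Z / 2 := by
              rw [hl, div_mul_eq_mul_div, div_le_div_iff₀ (by positivity) (by positivity)]
              nlinarith
            have h2 : (1 + 1 / l) * η₁ ≤ Z / 2 := by
              have : η₁ ≤ Z / (2 * (1 + 1 / l)) := min_le_right _ _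
              rw [le_div_iff₀ (by positivity)] at this
              linarith
            linarith
    · exact (Measure.mutuallySingular_singularPart _ _).mono_ac
        Measure.restrict_le_self.absolutelyContinuous Measure.AbsolutelyContinuous.rfl
    · refine ne_top_of_le_ne_top S.lintegral_ν (lintegral_mono' ?_ le_rfl)
      exact Measure.restrict_le_self.trans (Measure.singularPart_le _ _)
  all_goals
    have hν : S.ν = V.withDensity f + νs.restrict (Set.Ioi 0) := by
      rw [hV, ← restrict_withDensity measurableSet_Ioi, ← Measure.restrict_add, add_comm,
        ← Measure.haveLebesgueDecomposition_add]
      exact (Measure.restrict_eq_self_of_ae_mem S.ae_pos_ν).symm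
    have hbfV : ∀ᵐ y ∂V, ENNReal.ofReal (b y ^ 2) = f y := ae_restrict_of_ae hbf
  · conv_lhs => rw [hν]
    rw [← add_assoc]
    refine add_le_add ?_ le_rfl
    rw [← withDensity_add_left ((hstm.pow_const 2).ennreal_ofReal)]
    refine withDensity_mono ?_
    filter_upwards [hbfV] with y hy
    rw [← hy, Pi.add_apply, ← ENNReal.ofReal_add (sq_nonneg _) (abs_nonneg _)]
    refine ENNReal.ofReal_le_ofReal ?_
    have := le_abs_self (b y ^ 2 - st y ^ 2)
    linarith
  · have h1 : V.withDensity (fun y => ENNReal.ofReal (st y ^ 2)) ≤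
        V.withDensity f + V.withDensity fun y => ENNReal.ofReal (r y) := by
      rw [← withDensity_add_left hfm]
      refine withDensity_mono ?_
      filter_upwards [hbfV] with y hy
      rw [Pi.add_apply, ← hy, ← ENNReal.ofReal_add (sq_nonneg _) (abs_nonneg _)]
      refine ENNReal.ofReal_le_ofReal ?_
      have := neg_abs_le (b y ^ 2 - st y ^ 2)
      linarith
    refine h1.trans (add_le_add ?_ ?_)
    · conv_rhs => rw [hν]
      exact Measure.le_add_right le_rfl
    · exact Measure.le_add_right le_rfl

end HalfLineString

/-! ### Variational bounds for the number of eigenvalues -/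

/-- The linear functional `φ ↦ ∫₀^y φ`. -/
noncomputable def primL (y : ℝ) : HalfLineL2 →ₗ[ℝ] ℝ where
  toFun φ := prim φ y
  map_add' φ χ := prim_add φ χ y
  map_smul' c φ := prim_smul c φ y

namespace HalfLineString

variable (S : HalfLineString)

theorem norm_sq_space (x : S.Space) : ‖x‖ ^ 2 = ‖x.fst‖ ^ 2 + ‖x.snd‖ ^ 2 :=
  WithLp.prod_norm_sq_eq_of_L2 x

theorem inner_op_self (x : S.Space) : inner ℝ (S.op x) x =
    2 * inner ℝ (S.opL x.fst) x.fst + 2 * inner ℝ (S.opJ x.fst) x.snd := by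
  rw [inner_op, real_inner_comm (S.opL x.fst) x.fst, real_inner_comm (S.opJ x.fst) x.snd]
  ring

theorem finite_le_eigenvalue {ι : Type*} {τ : ι → ℝ} (hs : Summable fun i => τ i ^ 2) {ε : ℝ}
    (hε : 0 < ε) : {i | ε ≤ |τ i|}.Finite := by
  have h := hs.tendsto_cofinite_zero.eventually (gt_mem_nhds (show 0 < ε ^ 2 by positivity))
  refine Set.Finite.subset (eventually_cofinite.1 h) fun i (hi : ε ≤ |τ i|) => ?_
  simp only [not_lt]
  change ε ^ 2 ≤ τ i ^ 2
  rw [← sq_abs (τ i)]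
  gcongr

variable {ι : Type*} (b : HilbertBasis ι ℝ S.Space) {τ : ι → ℝ}
  (hb : ∀ i, S.op (b i) = τ i • b i) (hs : Summable fun i => τ i ^ 2)

include hs in
theorem finite_le_mul {σ : ℝ} (hσ : σ = 1 ∨ σ = -1) {ε : ℝ} (hε : 0 < ε) :
    {i | ε ≤ σ * τ i}.Finite := by
  refine (finite_le_eigenvalue hs hε).subset fun i (hi : ε ≤ σ * τ i) => hi.trans ?_
  have : |σ * τ i| = |τ i| := by rcases hσ with rfl | rfl <;> simp
  exact this ▸ le_abs_self _

include b hb hs in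
/-- If the quadratic form is below `ε²` on the functions vanishing at the points of `P`, there are
at most `|P|` eigenvalues beyond `ε`. -/
theorem ncard_le_of_form_lt {σ : ℝ} (hσ : σ = 1 ∨ σ = -1) {ε : ℝ} (hε : 0 < ε) (P : Finset ℝ)
    (hP : ∀ φ : HalfLineL2, φ ≠ 0 → (∀ p ∈ P, prim φ p = 0) →
      σ * ε * (2 * inner ℝ (S.opL φ) φ) + ‖S.opJ φ‖ ^ 2 < ε ^ 2 * ‖φ‖ ^ 2) :
    {i | ε ≤ σ * τ i}.ncard ≤ P.card := by
  classical
  have hfin := finite_le_mul hs hσ hε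
  by_contra! hlt
  have : Fintype {i | ε ≤ σ * τ i} := hfin.fintype
  let e : {i | ε ≤ σ * τ i} → S.Space := fun i => b i
  have he : Orthonormal ℝ e := b.orthonormal.comp _ Subtype.val_injective
  have hfd : FiniteDimensional ℝ (Submodule.span ℝ (Set.range e)) :=
    FiniteDimensional.span_of_finite ℝ (Set.finite_range e)
  obtain ⟨x, hx, hx0, hxP⟩ := exists_ne_zero_forall_eq_zero (Submodule.span ℝ (Set.range e))
    (fun p : P => (primL p).comp (WithLp.fstL 2 ℝ HalfLineL2 (Lp ℝ 2 S.ν) : S.Space →ₗ[ℝ] HalfLineL2))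
    (by rw [finrank_span_eq_card he.linearIndependent, Fintype.card_coe, ← Set.toFinset_card,
      ← Set.ncard_eq_toFinset_card']; exact hlt)
  have hFP : ∀ p ∈ P, prim x.fst p = 0 := fun p hp => hxP ⟨p, hp⟩
  have h1 := le_inner_of_mem_span he (T := σ • (S.op : S.Space →ₗ[ℝ] S.Space)) (a := fun i => σ * τ i)
    (fun i => by
      change inner ℝ (σ • S.op (b i)) (b i) = _
      rw [hb, smul_smul, inner_smul_left, real_inner_self_eq_norm_sq, b.orthonormal.1]
      simp)
    (fun i j hij => by
      change inner ℝ (σ • S.op (b i)) (b j) = _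
      rw [hb, smul_smul, inner_smul_left, b.orthonormal.2 (fun h => hij (Subtype.ext h)), mul_zero])
    (fun i => i.2) hx
  change ε * ‖x‖ ^ 2 ≤ inner ℝ (σ • S.op x) x at h1
  rw [inner_smul_left, inner_op_self, norm_sq_space] at h1
  simp only [conj_trivial] at h1
  have hσ2 : σ ^ 2 = 1 := by rcases hσ with rfl | rfl <;> norm_num
  -- Completing the square eliminates the second component.
  have h2 : 2 * (σ * inner ℝ (S.opJ x.fst) x.snd) * ε ≤ ‖S.opJ x.fst‖ ^ 2 + ε ^ 2 * ‖x.snd‖ ^ 2 := by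
    have := norm_sub_sq_real (S.opJ x.fst) ((σ * ε) • x.snd)
    rw [inner_smul_right, norm_smul, mul_pow, Real.norm_eq_abs, sq_abs, mul_pow, hσ2] at this
    nlinarith [sq_nonneg ‖S.opJ x.fst - (σ * ε) • x.snd‖]
  by_cases hφ : x.fst = 0
  · rw [hφ] at h1
    simp only [map_zero, inner_zero_left, mul_zero, add_zero, norm_zero] at h1
    have h3 : ‖x.snd‖ ^ 2 ≤ 0 := by
      by_contra! h
      nlinarith
    have h4 : x.snd = 0 := by
      rw [← norm_eq_zero]
      exact pow_eq_zero_iff two_ne_zero |>.1 (le_antisymm h3 (sq_nonneg _))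
    exact hx0 (WithLp.ofLp_injective 2 (Prod.ext hφ h4))
  · have h3 := hP x.fst hφ hFP
    nlinarith

include b hb hs in
/-- If the quadratic form exceeds `ε²` on the members of `W` vanishing at the points of `P`, there
are at least `dim W - |P|` eigenvalues beyond `ε`. -/
theorem finrank_le_of_lt_form {σ : ℝ} (hσ : σ = 1 ∨ σ = -1) {ε : ℝ} (hε : 0 < ε) (P : Finset ℝ)
    (W : Submodule ℝ HalfLineL2) [FiniteDimensional ℝ W]
    (hP : ∀ φ ∈ W, φ ≠ 0 → (∀ p ∈ P, prim φ p = 0) →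
      ε ^ 2 * ‖φ‖ ^ 2 < σ * ε * (2 * inner ℝ (S.opL φ) φ) + ‖S.opJ φ‖ ^ 2) :
    Module.finrank ℝ W ≤ {i | ε ≤ σ * τ i}.ncard + P.card := by
  classical
  have hfin := finite_le_mul hs hσ hε
  by_contra! hlt
  have : Fintype {i | ε ≤ σ * τ i} := hfin.fintype
  -- The second component `σ ε⁻¹ J φ` is the one for which completing the square loses nothing.
  let lift : HalfLineL2 →ₗ[ℝ] S.Space :=
    ((WithLp.prodContinuousLinearEquiv 2 ℝ HalfLineL2 (Lp ℝ 2 S.ν)).symm : _ →ₗ[ℝ] S.Space).comp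
      (LinearMap.id.prod ((σ / ε) • (S.opJ : HalfLineL2 →ₗ[ℝ] Lp ℝ 2 S.ν)))
  have hl1 : ∀ φ, (lift φ).fst = φ := fun _ => rfl
  have hl2 : ∀ φ, (lift φ).snd = (σ / ε) • S.opJ φ := fun _ => rfl
  obtain ⟨φ, hφ, hφ0, hφP⟩ := exists_ne_zero_forall_eq_zero W
    (Sum.elim (fun i : {i | ε ≤ σ * τ i} => (innerₗ S.Space (b i)).comp lift) (fun p : P => primL p))
    (by rw [Fintype.card_sum, Fintype.card_coe, ← Set.toFinset_card,
      ← Set.ncard_eq_toFinset_card']; exact hlt)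
  have h1 := inner_map_self_le_of_orthogonal b (σ • S.op) (τ := fun i => σ * τ i) (c := ε)
    (x := lift φ) (fun i => by
      change σ • S.op (b i) = _
      rw [hb, smul_smul])
    (fun i hi => hφP (Sum.inl ⟨i, hi⟩))
  change inner ℝ (σ • S.op (lift φ)) (lift φ) ≤ _ at h1
  rw [inner_smul_left, inner_op_self, norm_sq_space, hl1, hl2, inner_smul_right,
    real_inner_self_eq_norm_sq, norm_smul, mul_pow, Real.norm_eq_abs, sq_abs] at h1
  have h2 := hP φ hφ hφ0 (fun p hp => hφP (Sum.inr ⟨p, hp⟩))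
  have hσ2 : σ ^ 2 = 1 := by rcases hσ with rfl | rfl <;> norm_num
  simp only [conj_trivial] at h1
  rw [div_pow, hσ2] at h1
  set q := inner ℝ (S.opL φ) φ
  set j := ‖S.opJ φ‖ ^ 2
  have h3 : σ * (2 * q + 2 * (σ / ε * j)) = 2 * σ * q + 2 * (σ ^ 2) * j / ε := by
    field_simp
  rw [h3, hσ2] at h1
  have h4 : (2 * σ * q + 2 * 1 * j / ε) * ε ≤ (ε * (‖φ‖ ^ 2 + 1 / ε ^ 2 * j)) * ε :=
    mul_le_mul_of_nonneg_right h1 hε.le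
  have h5 : (2 * σ * q + 2 * 1 * j / ε) * ε = 2 * σ * q * ε + 2 * j := by field_simp
  have h6 : (ε * (‖φ‖ ^ 2 + 1 / ε ^ 2 * j)) * ε = ε ^ 2 * ‖φ‖ ^ 2 + j := by field_simp
  rw [h5, h6] at h4
  linarith

end HalfLineString

/-! ### Counting for step densities: upper bound -/

theorem setLIntegral_eq_sum_cells {P : Finset ℝ} (hP : ∀ p ∈ P, 0 < p) {g : ℝ → ENNReal}
    (h0 : ∀ y, 0 < y → (∀ p ∈ P, p < y) → g y = 0) :
    ∫⁻ y in Set.Ioi 0, g y = ∑ p ∈ P, ∫⁻ y in Set.Ioc (cellLeft P p) p, g y := by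
  rw [← lintegral_biUnion_finset (pairwise_disjoint_cells hP) (fun _ _ => measurableSet_Ioc)]
  have hU : MeasurableSet (⋃ p ∈ P, Set.Ioc (cellLeft P p) p) :=
    Finset.measurableSet_biUnion P fun _ _ => measurableSet_Ioc
  have hsub : (⋃ p ∈ P, Set.Ioc (cellLeft P p) p) ⊆ Set.Ioi 0 :=
    Set.iUnion₂_subset fun p _ => Ioc_cellLeft_subset P p
  rw [← lintegral_inter_add_sdiff _ (Set.Ioi 0) hU, Set.inter_eq_self_of_subset_right hsub]
  conv_rhs => rw [← add_zero (∫⁻ y in _, g y)]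
  congr 1
  rw [setLIntegral_congr_fun (g := fun _ => 0) (measurableSet_Ioi.diff hU), lintegral_zero]
  rintro y ⟨hy, hyn⟩
  refine h0 y hy fun p hp => ?_
  by_contra! hyp
  obtain ⟨q, hq, hyq⟩ := exists_mem_cell hy ⟨p, hp, hyp⟩
  exact hyn (Set.mem_biUnion hq hyq)

theorem sq_mul_integral_sq_prim_le_of_subdivision (φ : HalfLineL2) {a b c : ℝ} (ha : 0 ≤ a)
    (hab : a ≤ b) (hc : 0 ≤ c) {n : ℕ} (hn : 0 < n) (hcab : c * (b - a) < Real.pi * n)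
    (hF : ∀ j : ℕ, j ≤ n → prim φ (a + j * ((b - a) / n)) = 0) :
    c ^ 2 * ∫ y in Set.Ioc a b, prim φ y ^ 2 ≤ ∫ y in Set.Ioc a b, φ y ^ 2 := by
  have hn' : (0:ℝ) < n := by exact_mod_cast hn
  set d := (b - a) / n with hd
  have hd0 : 0 ≤ d := div_nonneg (by linarith) hn'.le
  set x : ℕ → ℝ := fun j => a + j * d with hx
  have hx0 : x 0 = a := by simp [hx]
  have hxn : x n = b := by simp only [hx, hd]; field_simp; ring
  have hxs : ∀ j, x (j + 1) = x j + d := fun j => by simp only [hx]; push_cast; ring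
  have hxa : ∀ j, 0 ≤ x j := fun j => by simp only [hx]; positivity
  have hFi : ∀ j < n, IntervalIntegrable (fun y => prim φ y ^ 2) volume (x j) (x (j + 1)) :=
    fun j _ => ((continuous_prim φ).pow 2).intervalIntegrable _ _
  have hφi : ∀ j < n, IntervalIntegrable (fun y => φ y ^ 2) volume (x j) (x (j + 1)) := by
    intro j _
    rw [intervalIntegrable_iff_integrableOn_Ioc_of_le (by rw [hxs]; linarith)]
    exact integrable_sq_of_subset φ (Ioc_subset_Ioi_zero (hxa j))
  rw [← intervalIntegral.integral_of_le hab, ← intervalIntegral.integral_of_le hab, ← hx0, ← hxn,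
    ← intervalIntegral.sum_integral_adjacent_intervals hFi,
    ← intervalIntegral.sum_integral_adjacent_intervals hφi, Finset.mul_sum]
  refine Finset.sum_le_sum fun j hj => ?_
  have hjn := Finset.mem_range.1 hj
  have hle : x j ≤ x (j + 1) := by rw [hxs]; linarith
  rw [intervalIntegral.integral_of_le hle, intervalIntegral.integral_of_le hle]
  refine sq_mul_integral_sq_prim_le φ (hxa j) hle hc ?_ (hF j hjn.le) (hF (j + 1) hjn)
  rw [hxs, add_sub_cancel_left, hd, ← mul_div_assoc, div_lt_iff₀ hn']
  exact hcab

/-- The sharp Poincaré inequality on a subdivision of the cells of a step function `st` shows that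
`∫ st² F² ≤ θ ‖φ‖²` if `F` vanishes on about `∫ |st| / (π √θ)` points. -/
theorem exists_finset_lintegral_step_le {P₀ : Finset ℝ} {st : ℝ → ℝ} (hst : IsStepOn P₀ st) {θ : ℝ}
    (hθ : 0 < θ) : ∃ G : Finset ℝ,
      (G.card : ℝ) ≤ (∑ p ∈ P₀, (p - cellLeft P₀ p) * |st p|) / (Real.pi * √θ) + P₀.card ∧
      ∀ φ : HalfLineL2, (∀ p ∈ G, prim φ p = 0) →
        ∫⁻ y in Set.Ioi 0, ENNReal.ofReal (st y ^ 2) * ENNReal.ofReal (prim φ y ^ 2) ≤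
          ENNReal.ofReal (θ * ‖φ‖ ^ 2) := by
  classical
  have hsθ : 0 < √θ := Real.sqrt_pos.2 hθ
  set k : ℝ → ℕ := fun p => ⌊(p - cellLeft P₀ p) * |st p| / (Real.pi * √θ)⌋₊ + 1 with hk
  set G : Finset ℝ := P₀.biUnion fun p => (Finset.range (k p)).image fun j : ℕ =>
    cellLeft P₀ p + (j + 1 : ℕ) * ((p - cellLeft P₀ p) / k p) with hG
  have hkpos : ∀ p, (0:ℝ) < k p := fun p => by simp only [hk]; positivity
  refine ⟨G, ?_, fun φ hφ => ?_⟩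
  · have h1 : G.card ≤ ∑ p ∈ P₀, k p := by
      refine Finset.card_biUnion_le.trans (Finset.sum_le_sum fun p _ => ?_)
      exact Finset.card_image_le.trans (by simp)
    have h2 : (G.card : ℝ) ≤ ∑ p ∈ P₀, (k p : ℝ) := by exact_mod_cast h1
    refine h2.trans ?_
    rw [Finset.sum_div, Finset.card_eq_sum_ones, Nat.cast_sum, ← Finset.sum_add_distrib]
    refine Finset.sum_le_sum fun p hp => ?_
    have h3 : 0 ≤ (p - cellLeft P₀ p) * |st p| / (Real.pi * √θ) := by
      have := (cellLeft_lt (P := P₀) (hst.pos p hp)).le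
      exact div_nonneg (mul_nonneg (by linarith) (abs_nonneg _)) (by positivity)
    have := Nat.floor_le h3
    simp only [hk]
    push_cast
    linarith
  · have hend : ∀ p ∈ P₀, prim φ p = 0 := by
      intro p hp
      refine hφ p (Finset.mem_biUnion.2 ⟨p, hp, Finset.mem_image.2 ⟨k p - 1, ?_, ?_⟩⟩)
      · simp [hk]
      · have h1 : k p - 1 + 1 = k p := by simp [hk]
        rw [h1]
        have := (hkpos p).ne'
        field_simp
        ring
    rw [setLIntegral_eq_sum_cells hst.pos (fun y h0 hy => by simp [hst.zero y h0 hy]),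
      ENNReal.ofReal_mul hθ.le, ofReal_norm_sq]
    have hle : ∑ p ∈ P₀, ∫⁻ y in Set.Ioc (cellLeft P₀ p) p, ENNReal.ofReal (φ y ^ 2) ≤
        ∫⁻ y in Set.Ioi 0, ENNReal.ofReal (φ y ^ 2) := by
      rw [← lintegral_biUnion_finset (pairwise_disjoint_cells hst.pos) (fun _ _ => measurableSet_Ioc)]
      exact lintegral_mono_set (Set.iUnion₂_subset fun p _ => Ioc_cellLeft_subset P₀ p)
    refine le_trans ?_ (mul_le_mul_right hle _)
    rw [Finset.mul_sum]
    refine Finset.sum_le_sum fun p hp => ?_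
    have hcl := cellLeft_lt (P := P₀) (hst.pos p hp)
    have hFi : IntegrableOn (fun y => prim φ y ^ 2) (Set.Ioc (cellLeft P₀ p) p) :=
      (((continuous_prim φ).pow 2).integrableOn_Icc).mono_set Set.Ioc_subset_Icc_self
    have hφi := integrable_sq_of_subset φ (Ioc_cellLeft_subset P₀ p)
    have e1 : ∫⁻ y in Set.Ioc (cellLeft P₀ p) p,
        ENNReal.ofReal (st y ^ 2) * ENNReal.ofReal (prim φ y ^ 2) =
        ENNReal.ofReal (st p ^ 2 * ∫ y in Set.Ioc (cellLeft P₀ p) p, prim φ y ^ 2) := by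
      rw [ENNReal.ofReal_mul (sq_nonneg _), ofReal_integral_eq_lintegral_ofReal hFi
        (Eventually.of_forall fun _ => sq_nonneg _), ← lintegral_const_mul' _ _ ENNReal.ofReal_ne_top]
      exact setLIntegral_congr_fun measurableSet_Ioc fun y hy => by simp only [hst.const p hp y hy]
    rw [e1, ← ofReal_integral_eq_lintegral_ofReal hφi (Eventually.of_forall fun _ => sq_nonneg _),
      ← ENNReal.ofReal_mul hθ.le]
    refine ENNReal.ofReal_le_ofReal ?_
    have h1 := sq_mul_integral_sq_prim_le_of_subdivision φ (cellLeft_nonneg P₀ p) hcl.le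
      (c := |st p| / √θ) (by positivity) (n := k p) (by simp [hk]) (by
        have h2 := Nat.lt_floor_add_one ((p - cellLeft P₀ p) * |st p| / (Real.pi * √θ))
        rw [div_lt_iff₀ (by positivity)] at h2
        rw [div_mul_eq_mul_div, div_lt_iff₀ hsθ]
        simp only [hk]
        push_cast
        linarith) (by
        intro j hj
        rcases Nat.eq_zero_or_pos j with h0 | h0
        · rw [h0, Nat.cast_zero, zero_mul, add_zero]
          rcases cellLeft_eq_or P₀ p with h | h
          · rw [h, prim_of_nonpos φ le_rfl]
          · exact hend _ h.1
        · refine hφ _ (Finset.mem_biUnion.2 ⟨p, hp, Finset.mem_image.2 ⟨j - 1, ?_, ?_⟩⟩)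
          · rw [Finset.mem_range]; omega
          · rw [Nat.sub_add_cancel h0])
    rw [div_pow, Real.sq_sqrt hθ.le, sq_abs, div_mul_eq_mul_div, div_le_iff₀ hθ] at h1
    linarith

/-! ### Counting for step densities: lower bound -/

section TestFunctions

/-- The first nontrivial Neumann eigenfunction of `(a, b]`, normalized in `L²`; its primitive
vanishes outside of `(a, b]`. -/
noncomputable def testFun (a b y : ℝ) : ℝ :=
  (Set.Ioc a b).indicator (fun y => √(2 / (b - a)) * Real.cos (Real.pi * (y - a) / (b - a))) y

theorem memLp_testFun (a b : ℝ) : MemLp (testFun a b) 2 (volume.restrict (Set.Ioi 0)) := by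
  refine (memLp_indicator_iff_restrict measurableSet_Ioc).2 ?_
  have : IsFiniteMeasure ((volume.restrict (Set.Ioi (0:ℝ))).restrict (Set.Ioc a b)) := by
    refine ⟨?_⟩
    rw [Measure.restrict_apply_univ]
    exact lt_of_le_of_lt (Measure.restrict_apply_le _ _) measure_Ioc_lt_top
  refine MemLp.of_bound (by fun_prop) (√(2 / (b - a))) (Eventually.of_forall fun y => ?_)
  rw [norm_mul, Real.norm_eq_abs, Real.norm_eq_abs, abs_of_nonneg (Real.sqrt_nonneg _)]
  exact mul_le_of_le_one_right (Real.sqrt_nonneg _) (Real.abs_cos_le_one _)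

/-- `testFun` as an element of `L²(0, ∞)`. -/
noncomputable def testVec (a b : ℝ) : HalfLineL2 := (memLp_testFun a b).toLp _

variable {a b : ℝ}

theorem integral_cos_sq_cell (hab : a < b) :
    ∫ y in Set.Ioc a b, Real.cos (Real.pi * (y - a) / (b - a)) ^ 2 = (b - a) / 2 := by
  have hL : b - a ≠ 0 := (sub_pos.2 hab).ne'
  have hpi := Real.pi_ne_zero
  rw [← intervalIntegral.integral_of_le hab.le]
  have hd : ∀ y ∈ Set.uIcc a b, HasDerivAt (fun y => y / 2 + (b - a) / (4 * Real.pi) *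
      Real.sin (2 * (Real.pi * (y - a) / (b - a)))) (Real.cos (Real.pi * (y - a) / (b - a)) ^ 2) y := by
    intro y _
    have h1 : HasDerivAt (fun y => 2 * (Real.pi * (y - a) / (b - a))) (2 * (Real.pi / (b - a))) y := by
      have := ((((hasDerivAt_id y).sub_const a).const_mul Real.pi).div_const (b - a)).const_mul 2
      simpa using this
    have h2 := ((hasDerivAt_id y).div_const 2).add (h1.sin.const_mul ((b - a) / (4 * Real.pi)))
    convert! h2 using 1
    rw [Real.cos_two_mul]
    field_simp
    ring
  rw [intervalIntegral.integral_eq_sub_of_hasDerivAt hd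
    (by apply Continuous.intervalIntegrable; fun_prop)]
  have e1 : 2 * (Real.pi * (b - a) / (b - a)) = 2 * Real.pi := by field_simp
  rw [e1, Real.sin_two_pi, sub_self, mul_zero, mul_zero, zero_div, mul_zero, Real.sin_zero]
  ring

theorem integral_sin_sq_cell (hab : a < b) :
    ∫ y in Set.Ioc a b, Real.sin (Real.pi * (y - a) / (b - a)) ^ 2 = (b - a) / 2 := by
  have hi : IntegrableOn (fun y => Real.cos (Real.pi * (y - a) / (b - a)) ^ 2) (Set.Ioc a b) :=
    ((by fun_prop : Continuous fun y => Real.cos (Real.pi * (y - a) / (b - a)) ^ 2).integrableOn_Icc).mono_set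
      Set.Ioc_subset_Icc_self
  simp_rw [Real.sin_sq]
  rw [integral_sub (integrable_const _) hi, integral_cos_sq_cell hab, integral_const, smul_eq_mul,
    mul_one, measureReal_restrict_apply_univ, measureReal_def, Real.volume_Ioc,
    ENNReal.toReal_ofReal (by linarith)]
  ring

theorem prim_testVec (ha : 0 ≤ a) (y : ℝ) :
    prim (testVec a b) y = ∫ t in Set.Ioc a (min y b), √(2 / (b - a)) * Real.cos (Real.pi * (t - a) / (b - a)) := by
  have h1 : prim (testVec a b) y = ∫ t in Set.Ioc 0 y, testFun a b t :=
    integral_congr_ae (ae_restrict_of_ae_restrict_of_subset (Ioc_subset_Ioi_zero le_rfl)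
      (memLp_testFun a b).coeFn_toLp)
  rw [h1]
  unfold testFun
  rw [setIntegral_indicator measurableSet_Ioc, Set.Ioc_inter_Ioc, max_eq_right ha]

theorem prim_testVec_of_mem (ha : 0 ≤ a) (hab : a < b) {y : ℝ} (hy : y ∈ Set.Icc a b) :
    prim (testVec a b) y = √(2 / (b - a)) * ((b - a) / Real.pi) * Real.sin (Real.pi * (y - a) / (b - a)) := by
  have hL : b - a ≠ 0 := (sub_pos.2 hab).ne'
  have hpi := Real.pi_ne_zero
  rw [prim_testVec ha, min_eq_left hy.2, ← intervalIntegral.integral_of_le hy.1,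
    intervalIntegral.integral_const_mul, mul_assoc]
  congr 1
  have hd : ∀ t ∈ Set.uIcc a y, HasDerivAt (fun t => (b - a) / Real.pi *
      Real.sin (Real.pi * (t - a) / (b - a))) (Real.cos (Real.pi * (t - a) / (b - a))) t := by
    intro t _
    have h1 : HasDerivAt (fun y => Real.pi * (y - a) / (b - a)) (Real.pi / (b - a)) t := by
      simpa using (((hasDerivAt_id t).sub_const a).const_mul Real.pi).div_const (b - a)
    convert! h1.sin.const_mul ((b - a) / Real.pi) using 1
    field_simp
  rw [intervalIntegral.integral_eq_sub_of_hasDerivAt hd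
    (by apply Continuous.intervalIntegrable; fun_prop)]
  simp

theorem prim_testVec_of_notMem (ha : 0 ≤ a) (hab : a < b) {y : ℝ} (hy : y ∉ Set.Ioc a b) :
    prim (testVec a b) y = 0 := by
  rcases le_or_gt y a with h | h
  · rw [prim_testVec ha, min_eq_left (h.trans hab.le), Set.Ioc_eq_empty_of_le h]
    simp
  · have hyb : b ≤ y := by
      by_contra! h'
      exact hy ⟨h, h'.le⟩
    have h1 : prim (testVec a b) y = prim (testVec a b) b := by
      rw [prim_testVec ha, prim_testVec ha, min_eq_right hyb, min_self]
    rw [h1, prim_testVec_of_mem ha hab ⟨hab.le, le_rfl⟩, mul_div_assoc, div_self (sub_pos.2 hab).ne',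
      mul_one, Real.sin_pi, mul_zero]

theorem integral_sq_prim_testVec (ha : 0 ≤ a) (hab : a < b) :
    ∫ y in Set.Ioc a b, prim (testVec a b) y ^ 2 = ((b - a) / Real.pi) ^ 2 := by
  have h1 : ∫ y in Set.Ioc a b, prim (testVec a b) y ^ 2 = ∫ y in Set.Ioc a b,
      (√(2 / (b - a)) * ((b - a) / Real.pi)) ^ 2 * Real.sin (Real.pi * (y - a) / (b - a)) ^ 2 :=
    setIntegral_congr_fun measurableSet_Ioc fun y hy => by
      simp only [prim_testVec_of_mem ha hab (Set.Ioc_subset_Icc_self hy), mul_pow]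
  have hL : 0 < b - a := sub_pos.2 hab
  rw [h1, integral_const_mul, integral_sin_sq_cell hab, mul_pow, Real.sq_sqrt (by positivity)]
  field_simp

theorem norm_testVec (ha : 0 ≤ a) (hab : a < b) : ‖testVec a b‖ = 1 := by
  have hL : 0 < b - a := sub_pos.2 hab
  have h2 : ‖testVec a b‖ ^ 2 = 1 := by
    rw [norm_sq_eq_integral]
    have h1 : ∀ᵐ y ∂(volume.restrict (Set.Ioi (0:ℝ))), testVec a b y ^ 2 =
        (Set.Ioc a b).indicator (fun y => 2 / (b - a) * Real.cos (Real.pi * (y - a) / (b - a)) ^ 2) y := by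
      filter_upwards [(memLp_testFun a b).coeFn_toLp] with y hy
      rw [testVec, hy, testFun]
      by_cases h : y ∈ Set.Ioc a b
      · rw [Set.indicator_of_mem h, Set.indicator_of_mem h, mul_pow, Real.sq_sqrt (by positivity)]
      · rw [Set.indicator_of_notMem h, Set.indicator_of_notMem h]
        norm_num
    rw [integral_congr_ae h1, setIntegral_indicator measurableSet_Ioc,
      Set.inter_eq_self_of_subset_right (Ioc_subset_Ioi_zero ha), integral_const_mul,
      integral_cos_sq_cell hab]
    field_simp
  exact (pow_eq_one_iff_of_nonneg (norm_nonneg _) two_ne_zero).1 h2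

theorem inner_testVec_of_disjoint {a b c d : ℝ} (h : Disjoint (Set.Ioc a b) (Set.Ioc c d)) :
    inner ℝ (testVec a b) (testVec c d) = 0 := by
  rw [inner_eq_integral, integral_eq_zero_of_ae]
  filter_upwards [(memLp_testFun a b).coeFn_toLp, (memLp_testFun c d).coeFn_toLp] with y h1 h2
  rw [testVec, testVec, h1, h2, testFun, testFun]
  by_cases hy : y ∈ Set.Ioc a b
  · rw [Set.indicator_of_notMem (Set.disjoint_left.1 h hy), mul_zero]; rfl
  · rw [Set.indicator_of_notMem hy, zero_mul]; rfl

/-- On the span of test functions of disjoint intervals on which a density is large enough, the form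
`∫ w F²` is at least `θ ‖φ‖²`. -/
theorem le_lintegral_of_mem_span_testVec {K : Type*} [Fintype K] {a b : K → ℝ} (ha : ∀ k, 0 ≤ a k)
    (hab : ∀ k, a k < b k) (hd : Pairwise fun j k => Disjoint (Set.Ioc (a j) (b j)) (Set.Ioc (a k) (b k)))
    {w : ℝ → ℝ} {θ : ℝ} (hθ : 0 ≤ θ) {W : K → ℝ} (hW : ∀ k, ∀ y ∈ Set.Ioc (a k) (b k), w y = W k)
    (hWθ : ∀ k, θ ≤ W k * ((b k - a k) / Real.pi) ^ 2) :
    Orthonormal ℝ (fun k => testVec (a k) (b k)) ∧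
    ∀ φ ∈ Submodule.span ℝ (Set.range fun k => testVec (a k) (b k)),
      ENNReal.ofReal (θ * ‖φ‖ ^ 2) ≤
        ∫⁻ y in Set.Ioi 0, ENNReal.ofReal (w y) * ENNReal.ofReal (prim φ y ^ 2) := by
  classical
  have hon : Orthonormal ℝ (fun k => testVec (a k) (b k)) :=
    ⟨fun k => norm_testVec (ha k) (hab k), fun j k hjk => inner_testVec_of_disjoint (hd hjk)⟩
  refine ⟨hon, fun φ hφ => ?_⟩
  obtain ⟨c, rfl⟩ := (Submodule.mem_span_range_iff_exists_fun ℝ).1 hφ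
  rw [norm_sq_sum_smul hon]
  set φ := ∑ k, c k • testVec (a k) (b k) with hφdef
  have hprim : ∀ k, ∀ y ∈ Set.Ioc (a k) (b k), prim φ y = c k * prim (testVec (a k) (b k)) y := by
    intro k y hy
    change primL y φ = _
    rw [hφdef, map_sum, Finset.sum_eq_single k]
    · rw [map_smul]; rfl
    · intro j _ hjk
      rw [map_smul]
      change c j • prim _ _ = 0
      rw [prim_testVec_of_notMem (ha j) (hab j) (Set.disjoint_right.1 (hd hjk) hy), smul_zero]
    · simp
  have hcell : ∀ k, ENNReal.ofReal (θ * c k ^ 2) ≤ ∫⁻ y in Set.Ioc (a k) (b k),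
      ENNReal.ofReal (w y) * ENNReal.ofReal (prim φ y ^ 2) := by
    intro k
    have hW0 : 0 ≤ W k := by
      have h1 : 0 < ((b k - a k) / Real.pi) ^ 2 := by
        have := sub_pos.2 (hab k)
        positivity
      by_contra! h
      nlinarith [hWθ k]
    have hFi : IntegrableOn (fun y => prim (testVec (a k) (b k)) y ^ 2) (Set.Ioc (a k) (b k)) :=
      (((continuous_prim _).pow 2).integrableOn_Icc).mono_set Set.Ioc_subset_Icc_self
    have e1 : ∫⁻ y in Set.Ioc (a k) (b k), ENNReal.ofReal (w y) * ENNReal.ofReal (prim φ y ^ 2) =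
        ENNReal.ofReal (W k * c k ^ 2 * ((b k - a k) / Real.pi) ^ 2) := by
      rw [ENNReal.ofReal_mul (mul_nonneg hW0 (sq_nonneg _)), ← integral_sq_prim_testVec (ha k) (hab k),
        ofReal_integral_eq_lintegral_ofReal hFi (Eventually.of_forall fun _ => sq_nonneg _),
        ← lintegral_const_mul' _ _ ENNReal.ofReal_ne_top]
      refine setLIntegral_congr_fun measurableSet_Ioc fun y hy => ?_
      rw [hW k y hy, hprim k y hy, mul_pow, ENNReal.ofReal_mul (sq_nonneg _),
        ENNReal.ofReal_mul hW0, mul_assoc]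
    rw [e1]
    refine ENNReal.ofReal_le_ofReal ?_
    have := mul_le_mul_of_nonneg_right (hWθ k) (sq_nonneg (c k))
    linarith
  have hdisj : ((Finset.univ : Finset K) : Set K).Pairwise fun j k =>
      Disjoint (Set.Ioc (a j) (b j)) (Set.Ioc (a k) (b k)) := fun j _ k _ hjk => hd hjk
  rw [Finset.mul_sum, ENNReal.ofReal_sum_of_nonneg fun k _ => mul_nonneg hθ (sq_nonneg _)]
  calc ∑ k, ENNReal.ofReal (θ * c k ^ 2)
      ≤ ∑ k, ∫⁻ y in Set.Ioc (a k) (b k), ENNReal.ofReal (w y) * ENNReal.ofReal (prim φ y ^ 2) :=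
        Finset.sum_le_sum fun k _ => hcell k
    _ = ∫⁻ y in ⋃ k ∈ (Finset.univ : Finset K), Set.Ioc (a k) (b k),
          ENNReal.ofReal (w y) * ENNReal.ofReal (prim φ y ^ 2) :=
        (lintegral_biUnion_finset hdisj (fun _ _ => measurableSet_Ioc) _).symm
    _ ≤ _ := lintegral_mono_set (Set.iUnion₂_subset fun k _ => Ioc_subset_Ioi_zero (ha k))

end TestFunctions

/-- The test functions of a subdivision of every cell, into as many pieces as the threshold `θ` allows,
span a space on which the form of a step function is at least `θ`. -/
theorem exists_submodule_le_lintegral_step {P₀ : Finset ℝ} {st : ℝ → ℝ} (hst : IsStepOn P₀ st)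
    {θ : ℝ} (hθ : 0 < θ) : ∃ W : Submodule ℝ HalfLineL2, FiniteDimensional ℝ W ∧
      (∑ p ∈ P₀, (p - cellLeft P₀ p) * |st p|) / (Real.pi * √θ) - P₀.card ≤ Module.finrank ℝ W ∧
      ∀ φ ∈ W, ENNReal.ofReal (θ * ‖φ‖ ^ 2) ≤
        ∫⁻ y in Set.Ioi 0, ENNReal.ofReal (st y ^ 2) * ENNReal.ofReal (prim φ y ^ 2) := by
  classical
  have hsθ : 0 < √θ := Real.sqrt_pos.2 hθ
  set k : ℝ → ℕ := fun p => ⌊(p - cellLeft P₀ p) * |st p| / (Real.pi * √θ)⌋₊ with hk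
  have hlen : ∀ p ∈ P₀, 0 < p - cellLeft P₀ p := fun p hp => sub_pos.2 (cellLeft_lt (hst.pos p hp))
  have hx0 : ∀ p ∈ P₀, 0 ≤ (p - cellLeft P₀ p) * |st p| / (Real.pi * √θ) := fun p hp =>
    div_nonneg (mul_nonneg (hlen p hp).le (abs_nonneg _)) (by positivity)
  let K := Σ p : P₀, Fin (k p)
  let d : K → ℝ := fun x => (x.1 - cellLeft P₀ x.1) / k x.1
  let a : K → ℝ := fun x => cellLeft P₀ x.1 + (x.2 : ℕ) * d x
  let b : K → ℝ := fun x => cellLeft P₀ x.1 + ((x.2 : ℕ) + 1) * d x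
  have hkpos : ∀ x : K, (0:ℝ) < k x.1 := fun x => by
    have := x.2.pos
    exact_mod_cast this
  have hd0 : ∀ x : K, 0 < d x := fun x => div_pos (hlen x.1 x.1.2) (hkpos x)
  have hba : ∀ x : K, b x - a x = d x := fun x => by simp only [a, b]; ring
  have hab : ∀ x : K, a x < b x := fun x => by have := hba x; have := hd0 x; linarith
  have hca : ∀ x : K, cellLeft P₀ x.1 ≤ a x := fun x => by
    have := hd0 x
    simp only [a]
    have : (0:ℝ) ≤ (x.2 : ℕ) * d x := by positivity
    linarith
  have hbp : ∀ x : K, b x ≤ x.1 := fun x => by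
    have h1 : (((x.2 : ℕ) : ℝ) + 1) ≤ k x.1 := by exact_mod_cast x.2.2
    have h2 : (((x.2 : ℕ) : ℝ) + 1) * d x ≤ k x.1 * d x := by
      have := (hd0 x).le
      gcongr
    have h3 : k x.1 * d x = x.1 - cellLeft P₀ x.1 := by
      simp only [d]
      rw [mul_div_cancel₀ _ (hkpos x).ne']
    simp only [b]
    linarith
  have hsub : ∀ x : K, Set.Ioc (a x) (b x) ⊆ Set.Ioc (cellLeft P₀ x.1) x.1 := fun x =>
    Set.Ioc_subset_Ioc (hca x) (hbp x)
  have hdisj : Pairwise fun x y : K => Disjoint (Set.Ioc (a x) (b x)) (Set.Ioc (a y) (b y)) := by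
    have key : ∀ (p : P₀) (i j : Fin (k p)), (i : ℕ) < j →
        Disjoint (Set.Ioc (a ⟨p, i⟩) (b ⟨p, i⟩)) (Set.Ioc (a ⟨p, j⟩) (b ⟨p, j⟩)) := by
      intro p i j hij
      refine Set.Ioc_disjoint_Ioc_of_le ?_
      have h1 : (((i : ℕ) : ℝ) + 1) ≤ (j : ℕ) := by exact_mod_cast hij
      have h2 := (hd0 ⟨p, i⟩).le
      have h3 : d ⟨p, i⟩ = d ⟨p, j⟩ := rfl
      simp only [a, b]
      rw [← h3]
      gcongr
    rintro ⟨p, i⟩ ⟨q, j⟩ hne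
    by_cases hpq : p = q
    · subst hpq
      have hij : (i : ℕ) ≠ j := fun h => hne (by rw [Fin.ext h])
      rcases lt_or_gt_of_ne hij with h | h
      · exact key p i j h
      · exact (key p j i h).symm
    · exact (pairwise_disjoint_cells hst.pos p.2 q.2 fun h => hpq (Subtype.ext h)).mono
        (hsub ⟨p, i⟩) (hsub ⟨q, j⟩)
  obtain ⟨hon, hform⟩ := le_lintegral_of_mem_span_testVec (w := fun y => st y ^ 2) (θ := θ)
    (W := fun x : K => st x.1 ^ 2) (fun x => (cellLeft_nonneg _ _).trans (hca x)) hab hdisj hθ.le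
    (fun x y hy => by simp only [hst.const x.1 x.1.2 y (hsub x hy)]) (fun x => by
      rw [hba]
      have h1 : (k x.1 : ℝ) ≤ (x.1 - cellLeft P₀ x.1) * |st x.1| / (Real.pi * √θ) :=
        Nat.floor_le (hx0 x.1 x.1.2)
      rw [le_div_iff₀ (by positivity)] at h1
      have h2 : √θ ≤ |st x.1| * (d x / Real.pi) := by
        simp only [d]
        rw [div_div, mul_div_assoc', le_div_iff₀ (mul_pos (hkpos x) Real.pi_pos)]
        linarith
      have h3 := pow_le_pow_left₀ hsθ.le h2 2
      rwa [Real.sq_sqrt hθ.le, mul_pow, sq_abs] at h3)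
  refine ⟨Submodule.span ℝ (Set.range fun x : K => testVec (a x) (b x)),
    FiniteDimensional.span_of_finite ℝ (Set.finite_range _), ?_, hform⟩
  rw [finrank_span_eq_card hon.linearIndependent, Fintype.card_sigma]
  simp only [Fintype.card_fin]
  rw [Finset.sum_coe_sort P₀ k, Finset.sum_div, Finset.card_eq_sum_ones, Nat.cast_sum, Nat.cast_sum,
    ← Finset.sum_sub_distrib]
  refine Finset.sum_le_sum fun p _ => ?_
  have := Nat.lt_floor_add_one ((p - cellLeft P₀ p) * |st p| / (Real.pi * √θ))
  simp only [hk, Nat.cast_one]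
  linarith

/-! ### Asymptotics of the number of eigenvalues -/

namespace HalfLineString

variable (S : HalfLineString)

theorem ofReal_norm_sq_opJ (φ : HalfLineL2) : ENNReal.ofReal (‖S.opJ φ‖ ^ 2) =
    ∫⁻ y in Set.Ioi 0, ENNReal.ofReal (prim φ y ^ 2) ∂S.ν := by
  have h : S.ν.restrict (Set.Ioi 0) = S.ν := Measure.restrict_eq_self_of_ae_mem S.ae_pos_ν
  rw [h, ofReal_norm_sq_Lp]
  refine lintegral_congr_ae ?_
  filter_upwards [S.opJ_coeFn φ] with y hy
  rw [hy]

variable {ι : Type*} (b : HilbertBasis ι ℝ S.Space) {τ : ι → ℝ}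
  (hb : ∀ i, S.op (b i) = τ i • b i) (hs : Summable fun i => τ i ^ 2)

include b hb hs in
/-- Two-sided bounds for the number of positive and of negative eigenvalues of modulus at least `ε`.
The main term does not depend on the sign. -/
theorem exists_ncard_bounds : ∃ Λ : ℝ, 0 ≤ Λ ∧ ∀ η : ℝ, 0 < η → η ≤ 1 / 10 →
    ∃ L N : ℝ, 0 ≤ L ∧ L ≤ Λ ∧ ∀ ε > 0, ∀ σ : ℝ, σ = 1 ∨ σ = -1 →
      ({i | ε ≤ σ * τ i}.ncard : ℝ) ≤ L / (Real.pi * (ε * √(1 - 3 * η))) + N + 2 * η / ε ∧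
      L / (Real.pi * (ε * √(1 + 3 * η))) - N - 2 * η / ε ≤ {i | ε ≤ σ * τ i}.ncard := by
  classical
  obtain ⟨Λ, hΛ, happ⟩ := S.exists_step_approx
  refine ⟨Λ, hΛ, fun η hη hη1 => ?_⟩
  obtain ⟨P₀, st, ζ, hstm, hst, hL, ⟨Nζ, hζ⟩, hν1, hν2⟩ := happ η hη
  obtain ⟨Nκ, hκ⟩ := S.exists_finset_abs_inner_opL_le hη
  set L := ∑ p ∈ P₀, (p - cellLeft P₀ p) * |st p| with hLdef
  have hL0 : 0 ≤ L := Finset.sum_nonneg fun p hp =>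
    mul_nonneg (sub_nonneg.2 (cellLeft_lt (hst.pos p hp)).le) (abs_nonneg _)
  refine ⟨L, Nκ + Nζ + P₀.card, hL0, hL, fun ε hε σ hσ => ?_⟩
  obtain ⟨Pκ, -, hPκ, hFκ, -⟩ := hκ ε hε
  obtain ⟨Pζ, hPζ, hFζ⟩ := hζ ε hε
  have hsq : ∀ c : ℝ, √(ε ^ 2 * c) = ε * √c := fun c => by
    rw [Real.sqrt_mul (sq_nonneg _), Real.sqrt_sq hε.le]
  have hstm2 : Measurable fun y => ENNReal.ofReal (st y ^ 2) := (hstm.pow_const 2).ennreal_ofReal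
  have hσq : ∀ q c : ℝ, |q| ≤ c → |σ * ε * q| ≤ ε * c := by
    intro q c hq
    have h1 : |σ| = 1 := by rcases hσ with rfl | rfl <;> simp
    rw [abs_mul, abs_mul, h1, one_mul, abs_of_pos hε]
    gcongr
  have hadd : 2 * η / ε = η / ε + η / ε := by ring
  constructor
  -- The step density takes `(1 - 3 η) ε²` and the terms of `κ` and `ζ` take `η ε²` each, which leaves
  -- a margin of `η ε²` for a strict inequality.
  · have hθ : 0 < ε ^ 2 * (1 - 3 * η) := mul_pos (by positivity) (by linarith)
    obtain ⟨G, hGcard, hG⟩ := exists_finset_lintegral_step_le hst hθ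
    have h1 := S.ncard_le_of_form_lt b hb hs hσ hε (Pκ ∪ Pζ ∪ G) (by
      intro φ hφ0 hφ
      have hφκ : ∀ p ∈ Pκ, prim φ p = 0 := fun p hp =>
        hφ p (Finset.mem_union_left _ (Finset.mem_union_left _ hp))
      have hφζ : ∀ p ∈ Pζ, prim φ p = 0 := fun p hp =>
        hφ p (Finset.mem_union_left _ (Finset.mem_union_right _ hp))
      have hφG : ∀ p ∈ G, prim φ p = 0 := fun p hp => hφ p (Finset.mem_union_right _ hp)
      have h2 : ‖S.opJ φ‖ ^ 2 ≤ ε ^ 2 * (1 - 3 * η) * ‖φ‖ ^ 2 + η * ε ^ 2 * ‖φ‖ ^ 2 := by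
        rw [← ENNReal.ofReal_le_ofReal_iff (by positivity), S.ofReal_norm_sq_opJ,
          ENNReal.ofReal_add (by positivity) (by positivity)]
        refine (lintegral_mono' (Measure.restrict_mono le_rfl hν1) le_rfl).trans ?_
        rw [Measure.restrict_add, lintegral_add_measure,
          setLIntegral_withDensity_Ioi hstm2 (measurable_ofReal_sq_prim φ)]
        exact add_le_add (hG φ hφG) (hFζ φ hφζ)
      have h3 := (abs_le.1 (hσq _ _ (hFκ φ hφκ))).2
      have h4 : 0 < ‖φ‖ ^ 2 := by have := norm_pos_iff.2 hφ0; positivity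
      have h5 : 0 < η * (ε ^ 2 * ‖φ‖ ^ 2) := by positivity
      nlinarith)
    have h2 : (((Pκ ∪ Pζ ∪ G).card : ℕ) : ℝ) ≤ Pκ.card + Pζ.card + G.card := by
      exact_mod_cast (Finset.card_union_le _ _).trans
        (Nat.add_le_add_right (Finset.card_union_le _ _) _)
    have h3 : ({i | ε ≤ σ * τ i}.ncard : ℝ) ≤ ((Pκ ∪ Pζ ∪ G).card : ℕ) := by exact_mod_cast h1
    rw [hsq] at hGcard
    rw [hadd]
    linarith
  · have hθ : 0 < ε ^ 2 * (1 + 3 * η) := by positivity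
    obtain ⟨W, hWfd, hWdim, hW⟩ := exists_submodule_le_lintegral_step hst hθ
    have h1 := S.finrank_le_of_lt_form b hb hs hσ hε (Pκ ∪ Pζ) W (by
      intro φ hφW hφ0 hφ
      have hφκ : ∀ p ∈ Pκ, prim φ p = 0 := fun p hp => hφ p (Finset.mem_union_left _ hp)
      have hφζ : ∀ p ∈ Pζ, prim φ p = 0 := fun p hp => hφ p (Finset.mem_union_right _ hp)
      have h2 : ε ^ 2 * (1 + 3 * η) * ‖φ‖ ^ 2 ≤ ‖S.opJ φ‖ ^ 2 + η * ε ^ 2 * ‖φ‖ ^ 2 := by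
        rw [← ENNReal.ofReal_le_ofReal_iff (by positivity),
          ENNReal.ofReal_add (by positivity) (by positivity), S.ofReal_norm_sq_opJ]
        refine (hW φ hφW).trans ?_
        rw [← setLIntegral_withDensity_Ioi hstm2 (measurable_ofReal_sq_prim φ)]
        refine (lintegral_mono' (Measure.restrict_mono le_rfl hν2) le_rfl).trans ?_
        rw [Measure.restrict_add, lintegral_add_measure]
        exact add_le_add le_rfl (hFζ φ hφζ)
      have h3 := (abs_le.1 (hσq _ _ (hFκ φ hφκ))).1
      have h4 : 0 < ‖φ‖ ^ 2 := by have := norm_pos_iff.2 hφ0; positivity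
      have h5 : 0 < η * (ε ^ 2 * ‖φ‖ ^ 2) := by positivity
      nlinarith)
    have h2 : (((Pκ ∪ Pζ).card : ℕ) : ℝ) ≤ Pκ.card + Pζ.card := by
      exact_mod_cast Finset.card_union_le _ _
    have h3 : (Module.finrank ℝ W : ℝ) ≤ {i | ε ≤ σ * τ i}.ncard + ((Pκ ∪ Pζ).card : ℕ) := by
      exact_mod_cast h1
    rw [hsq] at hWdim
    rw [hadd]
    linarith

include b hb hs in
/-- The number of eigenvalues of modulus at least `ε` is `O(1 / ε)`. -/
theorem exists_ncard_le : ∃ C : ℝ, 0 ≤ C ∧ ∀ ε : ℝ, 0 < ε → ε ≤ 1 → ∀ σ : ℝ, σ = 1 ∨ σ = -1 →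
    ({i | ε ≤ σ * τ i}.ncard : ℝ) ≤ C / ε := by
  obtain ⟨Λ, hΛ, h⟩ := S.exists_ncard_bounds b hb hs
  obtain ⟨L, N, hL0, hL, h⟩ := h (1 / 10) (by norm_num) le_rfl
  set s := √(1 - 3 * (1 / 10 : ℝ)) with hs'
  have hs0 : 0 < s := Real.sqrt_pos.2 (by norm_num)
  refine ⟨L / (Real.pi * s) + |N| + 2 * (1 / 10), by positivity, fun ε hε hε1 σ hσ => ?_⟩
  refine ((h ε hε σ hσ).1).trans ?_
  have h1 : N ≤ |N| / ε := by
    rw [le_div_iff₀ hε]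
    nlinarith [le_abs_self N, abs_nonneg N]
  have h2 : L / (Real.pi * (ε * s)) = L / (Real.pi * s) / ε := by
    field_simp
  rw [add_div, add_div, h2]
  linarith

/-- The gap between the main terms of the upper and the lower bound for the number of eigenvalues. -/
theorem inv_sqrt_sub_inv_sqrt_le {x : ℝ} (hx : 0 < x) (hx1 : x ≤ 3 / 10) :
    1 / √(1 - x) - 1 / √(1 + x) ≤ 2 * x := by
  have h1 : 0 < √(1 - x) := Real.sqrt_pos.2 (by linarith)
  have h2 : 0 < √(1 + x) := Real.sqrt_pos.2 (by linarith)
  have h3 : 1 / √(1 - x) ≤ 1 + x := by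
    rw [div_le_iff₀ h1]
    refine abs_le_of_sq_le_sq' ?_ (by positivity) |>.2
    rw [mul_pow, Real.sq_sqrt (by linarith)]
    nlinarith [mul_nonneg hx.le (by nlinarith : (0:ℝ) ≤ 1 - x - x ^ 2)]
  have h4 : 1 - x ≤ 1 / √(1 + x) := by
    rw [le_div_iff₀ h2]
    refine abs_le_of_sq_le_sq' ?_ zero_le_one |>.2
    rw [mul_pow, Real.sq_sqrt (by linarith)]
    nlinarith [sq_nonneg x]
  linarith

include b hb hs in
/-- The numbers of positive and of negative eigenvalues of modulus at least `ε` differ by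
`o(1 / ε)`. -/
theorem exists_abs_ncard_sub_le {ρ : ℝ} (hρ : 0 < ρ) : ∃ ε₀ > 0, ∀ ε : ℝ, 0 < ε → ε ≤ ε₀ →
    |({i | ε ≤ 1 * τ i}.ncard : ℝ) - {i | ε ≤ -1 * τ i}.ncard| ≤ ρ / ε := by
  obtain ⟨Λ, hΛ, h⟩ := S.exists_ncard_bounds b hb hs
  set η := min (1 / 10) (ρ / (2 * (2 * Λ + 4))) with hη
  have hη0 : 0 < η := by positivity
  have hη1 : η ≤ 1 / 10 := min_le_left _ _
  have hη2 : (2 * Λ + 4) * η ≤ ρ / 2 := by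
    have : η ≤ ρ / (2 * (2 * Λ + 4)) := min_le_right _ _
    rw [le_div_iff₀ (by positivity)] at this
    linarith
  obtain ⟨L, N, hL0, hL, h⟩ := h η hη0 hη1
  refine ⟨ρ / (4 * (|N| + 1)), by positivity, fun ε hε hε1 => ?_⟩
  have hd := inv_sqrt_sub_inv_sqrt_le (x := 3 * η) (by positivity) (by linarith)
  have key : L / (Real.pi * (ε * √(1 - 3 * η))) - L / (Real.pi * (ε * √(1 + 3 * η))) +
      2 * N + 4 * η / ε ≤ ρ / ε := by
    have e1 : L / (Real.pi * (ε * √(1 - 3 * η))) - L / (Real.pi * (ε * √(1 + 3 * η))) =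
        L / (Real.pi * ε) * (1 / √(1 - 3 * η) - 1 / √(1 + 3 * η)) := by
      rw [mul_sub, div_mul_div_comm, div_mul_div_comm, mul_one, mul_assoc, mul_assoc]
    have e2 : L / (Real.pi * ε) * (1 / √(1 - 3 * η) - 1 / √(1 + 3 * η)) ≤
        Λ / (3 * ε) * (2 * (3 * η)) := by
      refine mul_le_mul ?_ hd ?_ (by positivity)
      · have := Real.pi_gt_three.le
        gcongr
      · rw [sub_nonneg]
        have : 0 < √(1 - 3 * η) := Real.sqrt_pos.2 (by linarith)
        gcongr
        linarith
    have e3 : Λ / (3 * ε) * (2 * (3 * η)) = 2 * Λ * η / ε := by field_simp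
    have e4 : 2 * N ≤ ρ / 2 / ε := by
      rw [le_div_iff₀ hε]
      rw [le_div_iff₀ (by positivity)] at hε1
      nlinarith [le_abs_self N, abs_nonneg N]
    have e5 : 2 * Λ * η / ε + 4 * η / ε ≤ ρ / 2 / ε := by
      rw [← add_div]
      gcongr
      linarith
    have e6 : ρ / 2 / ε + ρ / 2 / ε = ρ / ε := by rw [← add_div, add_halves]
    linarith
  have hp := h ε hε 1 (Or.inl rfl)
  have hm := h ε hε (-1) (Or.inr rfl)
  have e7 : 4 * η / ε = 2 * η / ε + 2 * η / ε := by ring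
  rw [abs_le]
  constructor <;> linarith [hp.1, hp.2, hm.1, hm.2]

/-! ### The trace formula for the string -/

include b hb in
/-- The principal value of the sum of all eigenvalues is the integral of `κ`. -/
theorem exists_abs_sum_eigenvalues_sub_le {ρ : ℝ} (hρ : 0 < ρ) : ∃ ε₀ > 0, ∀ ε : ℝ, (hε : 0 < ε) →
    ε ≤ ε₀ → |∑ i ∈ (finite_le_eigenvalue hs hε).toFinset, τ i - ∫ y in Set.Ioi 0, S.κ y| ≤ ρ := by
  classical
  obtain ⟨C, hC0, hC⟩ := S.exists_ncard_le b hb hs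
  set η := min 1 (ρ / (4 * (8 * C + 4))) with hη
  have hη0 : 0 < η := by positivity
  have hη1 : η ≤ 1 := min_le_left _ _
  have hη2 : (8 * C + 4) * η ≤ ρ / 4 := by
    have : η ≤ ρ / (4 * (8 * C + 4)) := min_le_right _ _
    rw [le_div_iff₀ (by positivity)] at this
    linarith
  obtain ⟨ε₁, hε₁, hdiff⟩ := S.exists_abs_ncard_sub_le b hb hs (show 0 < ρ / 4 by positivity)
  obtain ⟨N, hN⟩ := S.exists_finset_abs_inner_opL_le hη0
  refine ⟨min (min 1 ε₁) (ρ / (4 * (3 * (|N| + 1)))), by positivity, fun ε hε hεle => ?_⟩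
  have hεa : ε ≤ 1 := hεle.trans ((min_le_left _ _).trans (min_le_left _ _))
  have hεb : ε ≤ ε₁ := hεle.trans ((min_le_left _ _).trans (min_le_right _ _))
  have hεc : 3 * (|N| + 1) * ε ≤ ρ / 4 := by
    have : ε ≤ ρ / (4 * (3 * (|N| + 1))) := hεle.trans (min_le_right _ _)
    rw [le_div_iff₀ (by positivity)] at this
    linarith
  obtain ⟨P, hPpos, hPcard, hPform, hPtr⟩ := hN ε hε
  set hfin := finite_le_eigenvalue hs hε
  have : Fintype {i // ε ≤ |τ i|} := hfin.fintype
  -- The normalized indicators of the cells, as vectors fixed by the reflection.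
  let v : P → S.Space := fun p => WithLp.toLp 2 (cellVec P p, 0)
  have hv : Orthonormal ℝ v := by
    have h0 := orthonormal_cellVec hPpos
    refine ⟨fun p => ?_, fun p q hpq => ?_⟩
    · have h1 : ‖v p‖ ^ 2 = 1 := by
        rw [S.norm_sq_space]
        change ‖cellVec P p‖ ^ 2 + ‖(0 : Lp ℝ 2 S.ν)‖ ^ 2 = 1
        rw [h0.1 p]; simp
      exact (pow_eq_one_iff_of_nonneg (norm_nonneg _) two_ne_zero).1 h1
    · change inner ℝ (v p) (v q) = 0
      rw [WithLp.prod_inner_apply]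
      change inner ℝ (cellVec P p) (cellVec P q) + inner ℝ (0 : Lp ℝ 2 S.ν) 0 = 0
      rw [h0.2 hpq]; simp
  have hmain := abs_sum_sub_sum_inner_le (T := (S.op : S.Space →ₗ[ℝ] S.Space))
    (Γ := (S.refl : S.Space →ₗ[ℝ] S.Space)) S.isSymmetric_op
    (fun x y => by
      change inner ℝ (S.refl x) (S.refl y) = _
      rw [WithLp.prod_inner_apply, WithLp.prod_inner_apply]
      change inner ℝ (S.refl x).fst (S.refl y).fst + inner ℝ (S.refl x).snd (S.refl y).snd = _
      rw [refl_fst, refl_fst, refl_snd, refl_snd, inner_neg_neg]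
      rfl)
    (fun x => by
      change S.refl (S.refl x) = x
      refine WithLp.ofLp_injective 2 (Prod.ext ?_ ?_)
      · rfl
      · exact neg_neg x.snd)
    (e := fun j : {i // ε ≤ |τ i|} => b j) (τ := fun j => τ j) (b.orthonormal.comp _ Subtype.val_injective)
    (fun j => hb j) hε (δ := η * ε) (by positivity) (fun j => j.2)
    (fun x hx => by
      change |inner ℝ (S.op x) x| ≤ _
      rw [abs_le]
      constructor
      · have := inner_map_self_le_of_orthogonal b (-S.op) (τ := fun i => -τ i) (c := ε) (x := x)
          (fun i => by
            change -S.op (b i) = _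
            rw [hb, neg_smul])
          (fun i hi => hx ⟨i, hi.trans (neg_le_abs _)⟩)
        change inner ℝ (-S.op x) x ≤ _ at this
        rw [inner_neg_left] at this
        linarith
      · exact inner_map_self_le_of_orthogonal b S.op hb (fun i hi => hx ⟨i, hi.trans (le_abs_self _)⟩))
    hv (fun p => by
      refine WithLp.ofLp_injective 2 (Prod.ext rfl ?_)
      exact neg_zero)
    (fun x hx => by
      change |inner ℝ (S.op x) x + inner ℝ (S.op (S.refl x)) (S.refl x)| ≤ _
      have h1 : ∀ p ∈ P, inner ℝ (cellVec P p) x.fst = 0 := by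
        intro p hp
        have := hx ⟨p, hp⟩
        rw [WithLp.prod_inner_apply] at this
        change inner ℝ (cellVec P p) x.fst + inner ℝ (0 : Lp ℝ 2 S.ν) x.snd = 0 at this
        rwa [inner_zero_left, add_zero] at this
      have h2 := hPform x.fst (prim_eq_zero_of_inner_cellVec hPpos h1)
      have h3 : ‖x.fst‖ ^ 2 ≤ ‖x‖ ^ 2 := by
        rw [S.norm_sq_space]
        linarith [sq_nonneg ‖x.snd‖]
      rw [S.inner_op_self, S.inner_op_self, refl_fst, refl_snd, inner_neg_right]
      have e1 : 2 * inner ℝ (S.opL x.fst) x.fst + 2 * inner ℝ (S.opJ x.fst) x.snd +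
          (2 * inner ℝ (S.opL x.fst) x.fst + 2 * -inner ℝ (S.opJ x.fst) x.snd) =
          2 * (2 * inner ℝ (S.opL x.fst) x.fst) := by ring
      rw [e1, abs_mul, abs_two]
      have : η * ε * ‖x.fst‖ ^ 2 ≤ η * ε * ‖x‖ ^ 2 := by gcongr
      linarith)
  have hsum : ∑ i ∈ hfin.toFinset, τ i = ∑ j : {i // ε ≤ |τ i|}, τ j := by
    rw [← Finset.sum_coe_sort]
    refine Fintype.sum_equiv (Equiv.subtypeEquivRight fun i => by simp) _ _ fun _ => rfl
  have htr : ∑ p : P, inner ℝ ((S.op : S.Space →ₗ[ℝ] S.Space) (v p)) (v p) =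
      ∑ p ∈ P, 2 * inner ℝ (S.opL (cellVec P p)) (cellVec P p) := by
    rw [← Finset.sum_coe_sort P]
    refine Finset.sum_congr rfl fun p _ => ?_
    change inner ℝ (S.op (v p)) (v p) = _
    rw [S.inner_op_self]
    change 2 * inner ℝ (S.opL (cellVec P p)) (cellVec P p) +
      2 * inner ℝ (S.opJ (cellVec P p)) (0 : Lp ℝ 2 S.ν) = _
    rw [inner_zero_right, mul_zero, add_zero]
  have hn1 : (Fintype.card {j : {i // ε ≤ |τ i|} // ε ≤ τ j}) = {i | ε ≤ 1 * τ i}.ncard := by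
    rw [← Nat.card_eq_fintype_card, ← Nat.card_coe_set_eq]
    refine Nat.card_congr ((Equiv.subtypeSubtypeEquivSubtype
      (q := fun i => ε ≤ τ i) fun h => h.trans (le_abs_self _)).trans
      (Equiv.subtypeEquivRight fun i => by simp))
  have hn2 : (Fintype.card {j : {i // ε ≤ |τ i|} // τ j ≤ -ε}) = {i | ε ≤ -1 * τ i}.ncard := by
    rw [← Nat.card_eq_fintype_card, ← Nat.card_coe_set_eq]
    refine Nat.card_congr ((Equiv.subtypeSubtypeEquivSubtype
      (q := fun i => τ i ≤ -ε) fun h => (le_neg_of_le_neg h).trans (neg_le_abs _)).trans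
      (Equiv.subtypeEquivRight fun i => by simp [le_neg]))
  have hJ : (Fintype.card {i // ε ≤ |τ i|} : ℝ) ≤ 2 * (C / ε) := by
    have h1 : Fintype.card {i // ε ≤ |τ i|} ≤ {i | ε ≤ 1 * τ i}.ncard + {i | ε ≤ -1 * τ i}.ncard := by
      rw [← Nat.card_eq_fintype_card]
      have h2 : {i | ε ≤ |τ i|} = {i | ε ≤ 1 * τ i} ∪ {i | ε ≤ -1 * τ i} := by
        ext i
        simp [le_abs]
      change Nat.card {i | ε ≤ |τ i|} ≤ _
      rw [Nat.card_coe_set_eq, h2]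
      exact Set.ncard_union_le _ _
    have h3 : (Fintype.card {i // ε ≤ |τ i|} : ℝ) ≤
      ({i | ε ≤ 1 * τ i}.ncard : ℝ) + {i | ε ≤ -1 * τ i}.ncard := by exact_mod_cast h1
    linarith [hC ε hε hεa 1 (Or.inl rfl), hC ε hε hεa (-1) (Or.inr rfl)]
  have hd := hdiff ε hε hεb
  rw [hn1, hn2, htr, Fintype.card_coe] at hmain
  rw [hsum]
  have t1 : 2 * (η * ε) * (2 * (Fintype.card {i // ε ≤ |τ i|} : ℝ) + P.card) ≤
      8 * C * η + 2 * η * ε * |N| + 2 * η ^ 2 := by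
    calc 2 * (η * ε) * (2 * (Fintype.card {i // ε ≤ |τ i|} : ℝ) + P.card)
        ≤ 2 * (η * ε) * (2 * (2 * (C / ε)) + (|N| + η / ε)) := by
          have := le_abs_self N
          gcongr
          linarith
      _ = _ := by field_simp; ring
  have t2 : ε * (P.card : ℝ) ≤ ε * |N| + η := by
    calc ε * (P.card : ℝ) ≤ ε * (|N| + η / ε) := by
          have := le_abs_self N
          gcongr
          linarith
      _ = _ := by field_simp
  have t3 : ε * |({i | ε ≤ 1 * τ i}.ncard : ℝ) - {i | ε ≤ -1 * τ i}.ncard| ≤ ρ / 4 := by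
    calc _ ≤ ε * (ρ / 4 / ε) := by gcongr
      _ = _ := by field_simp
  have t4 : 2 * η * ε * |N| ≤ 2 * ε * |N| := by
    have : 0 ≤ 2 * ε * |N| := by positivity
    nlinarith
  have t5 : 2 * η ^ 2 ≤ 2 * η := by nlinarith
  have tri := abs_sub_le (∑ j : {i // ε ≤ |τ i|}, τ j)
    (∑ p ∈ P, 2 * inner ℝ (S.opL (cellVec P p)) (cellVec P p)) (∫ y in Set.Ioi 0, S.κ y)
  linarith

end HalfLineString

/-! ### The characteristic values of the block operator -/

namespace HalfLineString

variable (S : HalfLineString)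

/-- The characteristic values of the block operator, the reciprocals of its nonzero eigenvalues. -/
def charValues : Set ℝ := {z | z ≠ 0 ∧ ∃ x : S.Space, x ≠ 0 ∧ z • S.op x = x}

/-- The characteristic values are simple and are listed by any eigenbasis. -/
theorem bijOn_charValues {ι : Type} (b : HilbertBasis ι ℝ S.Space) {τ : ι → ℝ}
    (hb : ∀ i, S.op (b i) = τ i • b i) :
    Set.BijOn (fun i => (τ i)⁻¹) {i | τ i ≠ 0} S.charValues := by
  have hb0 : ∀ i, b i ≠ 0 := fun i => b.orthonormal.ne_zero i
  refine ⟨fun i (hi : τ i ≠ 0) => ⟨inv_ne_zero hi, b i, hb0 i, ?_⟩, ?_, ?_⟩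
  · rw [hb, inv_smul_smul₀ hi]
  · intro i (hi : τ i ≠ 0) j _ hij
    have hij' : τ i = τ j := inv_injective hij
    by_contra hne
    obtain ⟨c, hc⟩ := S.eigenvector_unique hi (hb i) (by rw [hij']; exact hb j) (hb0 i)
    have h1 : inner ℝ (b i) (b j) = 0 := b.orthonormal.2 hne
    have h2 : inner ℝ (b j) (b j) = 0 := by
      nth_rw 1 [hc]
      rw [inner_smul_left, h1, mul_zero]
    exact hb0 j (inner_self_eq_zero.1 h2)
  · rintro z ⟨hz, x, hx, hzx⟩
    by_contra hno
    have hno' : ∀ i, τ i ≠ z⁻¹ := by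
      intro i hi
      exact hno ⟨i, by rw [Set.mem_ofPred_eq, hi]; exact inv_ne_zero hz, by simp [hi]⟩
    have hx' : S.op x = z⁻¹ • x := by rw [← hzx, inv_smul_smul₀ hz, hzx]
    refine hx ?_
    rw [← b.repr.map_eq_zero_iff]
    ext i
    rw [b.repr_apply_apply]
    have h := S.isSymmetric_op (b i) x
    change inner ℝ (S.op (b i)) x = inner ℝ (b i) (S.op x) at h
    rw [hb, hx', inner_smul_left, inner_smul_right] at h
    have h3 : (τ i - z⁻¹) * inner ℝ (b i) x = 0 := by
      rw [sub_mul, sub_eq_zero]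
      exact h
    exact (mul_eq_zero.1 h3).resolve_left (sub_ne_zero.2 (hno' i))

theorem hasSum_charValues : HasSum (fun z : S.charValues => 1 / (z : ℝ) ^ 2) (2 * S.moment) := by
  obtain ⟨ι, b, τ, hb, hs⟩ := S.exists_eigenbasis
  have hbij := S.bijOn_charValues b hb
  rw [← hbij.equiv.hasSum_iff]
  have h1 : HasSum (fun i : {i | τ i ≠ 0} => τ i ^ 2) (2 * S.moment) := by
    refine (hasSum_subtype_iff_of_support_subset (f := fun i => τ i ^ 2) ?_).2 hs
    intro i hi h0
    exact hi (by simp [h0])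
  refine h1.congr_fun fun i => ?_
  change 1 / ((τ i)⁻¹) ^ 2 = τ i ^ 2
  rw [inv_pow, one_div, inv_inv]

/-- The characteristic values in `[-r, r]` are the reciprocals of the eigenvalues of modulus at least
`1 / r`. -/
theorem image_le_eigenvalue {ι : Type} (b : HilbertBasis ι ℝ S.Space) {τ : ι → ℝ}
    (hb : ∀ i, S.op (b i) = τ i • b i) {r : ℝ} (hr : 0 < r) :
    {z ∈ S.charValues | |z| ≤ r} = (fun i => (τ i)⁻¹) '' {i | r⁻¹ ≤ |τ i|} := by
  have hbij := S.bijOn_charValues b hb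
  rw [← hbij.image_eq]
  ext z
  constructor
  · rintro ⟨⟨i, hi, rfl⟩, h⟩
    refine ⟨i, ?_, rfl⟩
    simp only [abs_inv] at h
    exact inv_le_of_inv_le₀ (abs_pos.2 hi) h
  · rintro ⟨i, hi, rfl⟩
    have h0 : 0 < |τ i| := (inv_pos.2 hr).trans_le hi
    refine ⟨⟨i, abs_pos.1 h0, rfl⟩, ?_⟩
    simp only [abs_inv]
    exact inv_le_of_inv_le₀ hr hi

theorem finite_charValues (r : ℝ) : {z ∈ S.charValues | |z| ≤ r}.Finite := by
  obtain ⟨ι, b, τ, hb, hs⟩ := S.exists_eigenbasis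
  have hr : 0 < max r 1 := lt_max_of_lt_right one_pos
  refine Set.Finite.subset (?_ : {z ∈ S.charValues | |z| ≤ max r 1}.Finite)
    fun z hz => ⟨hz.1, hz.2.trans (le_max_left _ _)⟩
  rw [S.image_le_eigenvalue b hb hr]
  exact (finite_le_eigenvalue hs.summable (inv_pos.2 hr)).image _

/-- The trace of the block operator, summed in the principal value sense. -/
theorem tendsto_finsum_charValues :
    Tendsto (fun r : ℝ => ∑ᶠ z ∈ {z ∈ S.charValues | |z| ≤ r}, 1 / z) atTop
      (𝓝 (∫ y in Set.Ioi 0, S.κ y)) := by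
  obtain ⟨ι, b, τ, hb, hs⟩ := S.exists_eigenbasis
  have hbij := S.bijOn_charValues b hb
  rw [Metric.tendsto_atTop]
  intro ρ hρ
  obtain ⟨ε₀, hε₀, h⟩ := S.exists_abs_sum_eigenvalues_sub_le b hb hs.summable (half_pos hρ)
  refine ⟨ε₀⁻¹, fun r hr => ?_⟩
  have hr0 : 0 < r := (inv_pos.2 hε₀).trans_le hr
  have h1 := h r⁻¹ (inv_pos.2 hr0) (inv_le_of_inv_le₀ hε₀ hr)
  rw [Real.dist_eq]
  refine lt_of_le_of_lt ?_ (half_lt_self hρ)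
  rw [S.image_le_eigenvalue b hb hr0, finsum_mem_image,
    finsum_mem_eq_finite_toFinset_sum _ (finite_le_eigenvalue hs.summable (inv_pos.2 hr0))]
  · simpa using h1
  · refine hbij.injOn.mono fun i hi => ?_
    exact abs_pos.1 ((inv_pos.2 hr0).trans_le hi)

end HalfLineString

/-! ### Absolutely continuous functions on the line -/

theorem continuous_of_absCont {F : Type*} [NormedAddCommGroup F] {f : ℝ → F}
    (hf : ∀ a b, AbsolutelyContinuousOnInterval f a b) : Continuous f := by
  rw [continuous_iff_continuousAt]
  intro x
  have h := (hf (x - 1) (x + 1)).continuousOn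
  rw [Set.uIcc_of_le (by linarith)] at h
  exact h.continuousAt (Icc_mem_nhds (by linarith) (by linarith))

theorem ae_differentiableAt_of_absCont {f : ℝ → ℝ}
    (hf : ∀ a b, AbsolutelyContinuousOnInterval f a b) : ∀ᵐ x, DifferentiableAt ℝ f x := by
  have : ∀ᵐ x : ℝ, ∀ n : ℕ, x ∈ Set.uIcc (-n : ℝ) n → DifferentiableAt ℝ f x :=
    ae_all_iff.2 fun n => (hf (-n) n).ae_differentiableAt
  filter_upwards [this] with x hx
  obtain ⟨n, hn⟩ := exists_nat_ge |x|
  refine hx n ?_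
  rw [Set.uIcc_of_le (by linarith [abs_nonneg x])]
  exact abs_le.1 hn

theorem ae_deriv_mul {f q : ℝ → ℝ} (hf : ∀ a b, AbsolutelyContinuousOnInterval f a b)
    (hq : ∀ a b, AbsolutelyContinuousOnInterval q a b) :
    ∀ᵐ x, deriv (fun x => f x * q x) x = deriv f x * q x + f x * deriv q x := by
  filter_upwards [ae_differentiableAt_of_absCont hf, ae_differentiableAt_of_absCont hq] with x h1 h2
  exact deriv_fun_mul h1 h2

/-- An integrable function with integrable derivative tends to `0` at `-∞`. -/
theorem setIntegral_Iic_deriv {q : ℝ → ℝ} (hq : ∀ a b, AbsolutelyContinuousOnInterval q a b) {c : ℝ}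
    (hi : IntegrableOn q (Set.Iic c)) (hi' : IntegrableOn (deriv q) (Set.Iic c)) :
    ∫ x in Set.Iic c, deriv q x = q c := by
  have hbot : Tendsto q atBot (𝓝 (q c - ∫ t in Set.Iic c, deriv q t)) := by
    refine (tendsto_const_nhds.sub (intervalIntegral_tendsto_integral_Iic c hi'
      tendsto_id)).congr fun x => ?_
    rw [id, (hq x c).integral_deriv_eq_sub]
    ring
  have h2 : q c - ∫ t in Set.Iic c, deriv q t = 0 := by
    refine IntegrableAtFilter.eq_zero_of_tendsto ⟨Set.Iic c, Iic_mem_atBot c, hi⟩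
      (fun s hs => ?_) hbot
    rcases mem_atBot_sets.1 hs with ⟨b, hb⟩
    rw [← top_le_iff, ← Real.volume_Iic (a := b)]
    exact measure_mono hb
  linarith

theorem setIntegral_Ioi_deriv {q : ℝ → ℝ} (hq : ∀ a b, AbsolutelyContinuousOnInterval q a b) {c : ℝ}
    (hi : IntegrableOn q (Set.Ioi c)) (hi' : IntegrableOn (deriv q) (Set.Ioi c)) :
    ∫ x in Set.Ioi c, deriv q x = -q c := by
  have htop : Tendsto q atTop (𝓝 (q c + ∫ t in Set.Ioi c, deriv q t)) := by
    refine (tendsto_const_nhds.add (intervalIntegral_tendsto_integral_Ioi c hi'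
      tendsto_id)).congr fun x => ?_
    rw [id, (hq c x).integral_deriv_eq_sub]
    ring
  have h1 : q c + ∫ t in Set.Ioi c, deriv q t = 0 := by
    refine IntegrableAtFilter.eq_zero_of_tendsto ⟨Set.Ioi c, Ioi_mem_atTop c, hi⟩
      (fun s hs => ?_) htop
    rcases mem_atTop_sets.1 hs with ⟨b, hb⟩
    rw [← top_le_iff, ← Real.volume_Ici (a := b)]
    exact measure_mono hb
  linarith

theorem integral_deriv_eq_zero {q : ℝ → ℝ} (hq : ∀ a b, AbsolutelyContinuousOnInterval q a b)
    (hi : Integrable q) (hi' : Integrable (deriv q)) : ∫ x, deriv q x = 0 := by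
  rw [← intervalIntegral.integral_Iic_add_Ioi hi'.integrableOn hi'.integrableOn (b := 0),
    setIntegral_Iic_deriv hq hi.integrableOn hi'.integrableOn,
    setIntegral_Ioi_deriv hq hi.integrableOn hi'.integrableOn, add_neg_cancel]

/-- Monotone absolutely continuous substitutions preserve absolute continuity. -/
theorem absCont_comp_monotone {F : Type*} [NormedAddCommGroup F] {f : ℝ → F} {g : ℝ → ℝ} {a b : ℝ}
    (hf : AbsolutelyContinuousOnInterval f (g a) (g b)) (hg : AbsolutelyContinuousOnInterval g a b)
    (hm : Monotone g) : AbsolutelyContinuousOnInterval (f ∘ g) a b := by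
  have h : Tendsto (fun E : ℕ × (ℕ → ℝ × ℝ) => (E.1, fun i => (g (E.2 i).1, g (E.2 i).2)))
      (AbsolutelyContinuousOnInterval.totalLengthFilter ⊓
        𝓟 (AbsolutelyContinuousOnInterval.disjWithin a b))
      (AbsolutelyContinuousOnInterval.totalLengthFilter ⊓
        𝓟 (AbsolutelyContinuousOnInterval.disjWithin (g a) (g b))) := by
    refine tendsto_inf.2 ⟨tendsto_comap_iff.2 hg, tendsto_principal.2 ?_⟩
    refine (eventually_principal.2 fun E hE => ?_).filter_mono inf_le_right
    obtain ⟨h1, h2⟩ := hE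
    refine ⟨fun i hi => ?_, fun i hi j hj hij => ?_⟩
    · have := h1 i hi
      simp only [Set.uIcc, Set.mem_Icc, ← hm.map_min, ← hm.map_max] at this ⊢
      exact ⟨⟨hm this.1.1, hm this.1.2⟩, hm this.2.1, hm this.2.2⟩
    · have := h2 hi hj hij
      simp only [Function.onFun, Set.uIoc, Set.Ioc_disjoint_Ioc] at this ⊢
      simp only [← hm.map_min, ← hm.map_max]
      exact hm this
  refine (Tendsto.comp (f := fun E : ℕ × (ℕ → ℝ × ℝ) => (E.1, fun i => (g (E.2 i).1, g (E.2 i).2)))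
    (g := fun E : ℕ × (ℕ → ℝ × ℝ) => ∑ i ∈ Finset.range E.1, dist (f (E.2 i).1) (f (E.2 i).2))
    hf h :)

namespace MemH1

variable {f q : ℝ → ℝ}

theorem integrable_mul (hf : MemH1 f) (hq : MemH1 q) : Integrable fun x => f x * q x :=
  hf.memLp.integrable_mul hq.memLp

theorem integrable_deriv_mul (hf : MemH1 f) (hq : MemH1 q) :
    Integrable fun x => deriv f x * q x :=
  hf.memLp_deriv.integrable_mul hq.memLp

theorem integrable_deriv_mul_deriv (hf : MemH1 f) (hq : MemH1 q) :
    Integrable fun x => deriv f x * deriv q x :=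
  hf.memLp_deriv.integrable_mul hq.memLp_deriv

theorem integrable_mul_deriv (hf : MemH1 f) (hq : MemH1 q) :
    Integrable fun x => f x * deriv q x :=
  hf.memLp.integrable_mul hq.memLp_deriv

theorem integrable_deriv_mul_fun (hf : MemH1 f) (hq : MemH1 q) :
    Integrable (deriv fun x => f x * q x) :=
  ((hf.integrable_deriv_mul hq).add (hf.integrable_mul_deriv hq)).congr
    ((ae_deriv_mul hf.absCont hq.absCont).mono fun _ h => h.symm)

theorem integral_deriv_mul_fun (hf : MemH1 f) (hq : MemH1 q) :
    ∫ x, deriv (fun x => f x * q x) x = 0 :=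
  integral_deriv_eq_zero (fun a b => (hf.absCont a b).mul (hq.absCont a b)) (hf.integrable_mul hq)
    (hf.integrable_deriv_mul_fun hq)

theorem integral_deriv_mul_add (hf : MemH1 f) (hq : MemH1 q) :
    ∫ x, (deriv f x * q x + f x * deriv q x) = 0 := by
  rw [← hf.integral_deriv_mul_fun hq]
  exact integral_congr_ae ((ae_deriv_mul hf.absCont hq.absCont).mono fun _ h => h.symm)

end MemH1

/-! ### Exponential decay -/

theorem hasDerivAt_expTrunc {s δ : ℝ} (hδ : 0 ≤ δ) (x : ℝ) :
    HasDerivAt (fun x => Real.exp (s * x) / (1 + δ * Real.exp (s * x)))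
      (s * Real.exp (s * x) / (1 + δ * Real.exp (s * x)) ^ 2) x := by
  have h1 : HasDerivAt (fun x => Real.exp (s * x)) (Real.exp (s * x) * s) x := by
    simpa using ((hasDerivAt_id x).const_mul s).exp
  have h2 : 1 + δ * Real.exp (s * x) ≠ 0 := by positivity
  refine (h1.fun_div ((h1.const_mul δ).const_add 1) h2).congr_deriv ?_
  congr 1
  ring

/-- The energy estimate behind the decay of `u`: integrate the derivative of `s g u²` for the bounded
weight `g = e^{sx} / (1 + δ e^{sx})`. -/
theorem lintegral_expTrunc_le {u : ℝ → ℝ} (hu : MemH1 u) {s δ : ℝ} (hs : s ^ 2 = 1) (hδ : 0 < δ) :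
    ∫⁻ x, ENNReal.ofReal (Real.exp (s * x) / (1 + δ * Real.exp (s * x)) * u x ^ 2) ≤
      ∫⁻ x, ENNReal.ofReal (Real.exp (s * x) * (deriv u x - s * u x) ^ 2) := by
  set g : ℝ → ℝ := fun x => Real.exp (s * x) / (1 + δ * Real.exp (s * x)) with hg
  have hg0 : ∀ x, 0 ≤ g x := fun x => by positivity
  have hg1 : ∀ x, g x ≤ Real.exp (s * x) := fun x =>
    div_le_self (Real.exp_pos _).le (by nlinarith [Real.exp_pos (s * x)])
  have hgb : ∀ x, ‖g x‖ ≤ δ⁻¹ := fun x => by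
    rw [Real.norm_of_nonneg (hg0 x), hg, ← one_div]
    beta_reduce
    rw [div_le_div_iff₀ (by positivity) hδ]
    nlinarith [Real.exp_pos (s * x)]
  have hgd := fun x => hasDerivAt_expTrunc (s := s) hδ.le x
  have hgc : ContDiff ℝ 1 g := by
    refine ContDiff.div (by fun_prop) (by fun_prop) fun x => by positivity
  set g' : ℝ → ℝ := fun x => s * Real.exp (s * x) / (1 + δ * Real.exp (s * x)) ^ 2 with hg'
  have hsg' : ∀ x, 0 ≤ s * g' x := fun x => by
    have : s * g' x = s ^ 2 * Real.exp (s * x) / (1 + δ * Real.exp (s * x)) ^ 2 := by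
      rw [hg']; ring
    rw [this, hs]; positivity
  have hg'b : ∀ x, ‖g' x‖ ≤ |s| * δ⁻¹ := fun x => by
    have : g' x = s * (g x * (1 + δ * Real.exp (s * x))⁻¹) := by
      rw [hg', hg]; field_simp
    rw [this, norm_mul, norm_mul, Real.norm_eq_abs]
    have h2 : ‖(1 + δ * Real.exp (s * x))⁻¹‖ ≤ 1 := by
      rw [norm_inv, Real.norm_of_nonneg (by positivity)]
      exact inv_le_one_of_one_le₀ (by nlinarith [Real.exp_pos (s * x)])
    calc |s| * (‖g x‖ * ‖(1 + δ * Real.exp (s * x))⁻¹‖) ≤ |s| * (δ⁻¹ * 1) := by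
          gcongr
          exact hgb x
      _ = _ := by ring
  have hgcont : Continuous g := hgc.continuous
  have hg'cont : Continuous g' := by
    refine Continuous.div (by fun_prop) (by fun_prop) fun x => by positivity
  have hac : ∀ a b, AbsolutelyContinuousOnInterval (g * (u * u)) a b := fun a b =>
    (hgc.contDiffOn.absolutelyContinuousOnInterval).mul ((hu.absCont a b).mul (hu.absCont a b))
  have hdq : ∀ᵐ x, deriv (g * (u * u)) x = g' x * (u x * u x) + g x * (2 * (u x * deriv u x)) := by
    filter_upwards [ae_differentiableAt_of_absCont hu.absCont] with x hx
    have := ((hgd x).mul (hx.hasDerivAt.mul hx.hasDerivAt)).deriv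
    rw [this, Pi.mul_apply]
    ring
  have hi1 : Integrable fun x => g' x * (u x * u x) :=
    (hu.integrable_mul hu).bdd_mul hg'cont.aestronglyMeasurable (Eventually.of_forall hg'b)
  have hi2 : Integrable fun x => g x * (2 * (u x * deriv u x)) :=
    ((hu.integrable_mul_deriv hu).const_mul 2).bdd_mul hgcont.aestronglyMeasurable
      (Eventually.of_forall hgb)
  have hz := integral_deriv_eq_zero hac
    ((hu.integrable_mul hu).bdd_mul hgcont.aestronglyMeasurable (Eventually.of_forall hgb))
    ((hi1.add hi2).congr (hdq.mono fun _ h => h.symm))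
  rw [integral_congr_ae hdq] at hz
  have hw : MemLp (fun x => deriv u x - s * u x) 2 volume :=
    hu.memLp_deriv.sub (hu.memLp.const_mul s)
  have hi3 : Integrable fun x => g x * (deriv u x - s * u x) ^ 2 :=
    hw.integrable_sq.bdd_mul hgcont.aestronglyMeasurable (Eventually.of_forall hgb)
  have hi4 : Integrable fun x => g x * u x ^ 2 :=
    hu.memLp.integrable_sq.bdd_mul hgcont.aestronglyMeasurable (Eventually.of_forall hgb)
  have hmain : ∫ x, g x * u x ^ 2 ≤ ∫ x, g x * (deriv u x - s * u x) ^ 2 := by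
    -- Since `s g' ≥ 0`, pointwise `s (g u²)' ≥ 2 s g u u' ≥ g (u² - (u' - s u)²)`.
    have h1 : ∫ x, (g x * u x ^ 2 - g x * (deriv u x - s * u x) ^ 2) ≤
        ∫ x, s * (g' x * (u x * u x) + g x * (2 * (u x * deriv u x))) := by
      refine integral_mono (hi4.sub hi3) ((hi1.add hi2).const_mul s) fun x => ?_
      have e1 := mul_nonneg (hsg' x) (mul_self_nonneg (u x))
      have e2 : s * (g x * (2 * (u x * deriv u x))) = g x * (2 * u x ^ 2) +
          g x * (2 * (s * u x) * (deriv u x - s * u x)) := by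
        linear_combination (2 * g x * u x ^ 2) * hs
      have e3 : 0 ≤ g x * (s * u x + (deriv u x - s * u x)) ^ 2 := mul_nonneg (hg0 x) (sq_nonneg _)
      have e4 : g x * (s * u x) ^ 2 = g x * u x ^ 2 := by rw [mul_pow, hs, one_mul]
      beta_reduce
      nlinarith
    rw [integral_const_mul, hz, mul_zero, integral_sub hi4 hi3] at h1
    linarith
  have hnn : 0 ≤ᵐ[volume] fun x => g x * u x ^ 2 :=
    Eventually.of_forall fun x => mul_nonneg (hg0 x) (sq_nonneg _)
  rw [← ofReal_integral_eq_lintegral_ofReal hi4 hnn]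
  refine (ENNReal.ofReal_le_ofReal hmain).trans ?_
  rw [ofReal_integral_eq_lintegral_ofReal hi3
    (Eventually.of_forall fun x => mul_nonneg (hg0 x) (sq_nonneg _))]
  exact lintegral_mono fun x => ENNReal.ofReal_le_ofReal
    (mul_le_mul_of_nonneg_right (hg1 x) (sq_nonneg _))

/-- The decay of `u`: Fatou's lemma removes the truncation of the weight from `lintegral_expTrunc_le`. -/
theorem lintegral_exp_mul_sq_le {u : ℝ → ℝ} (hu : MemH1 u) {s : ℝ} (hs : s ^ 2 = 1) :
    ∫⁻ x, ENNReal.ofReal (Real.exp (s * x) * u x ^ 2) ≤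
      ∫⁻ x, ENNReal.ofReal (Real.exp (s * x) * (deriv u x - s * u x) ^ 2) := by
  have hc := continuous_of_absCont hu.absCont
  have hlim : ∀ x, Tendsto (fun n : ℕ => ENNReal.ofReal
      (Real.exp (s * x) / (1 + 1 / ((n:ℝ) + 1) * Real.exp (s * x)) * u x ^ 2)) atTop
      (𝓝 (ENNReal.ofReal (Real.exp (s * x) * u x ^ 2))) := by
    intro x
    refine (ENNReal.continuous_ofReal.tendsto _).comp ?_
    refine Tendsto.mul_const _ ?_
    have h1 : Tendsto (fun n : ℕ => 1 + 1 / ((n:ℝ) + 1) * Real.exp (s * x)) atTop (𝓝 1) := by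
      simpa using (tendsto_one_div_add_atTop_nhds_zero_nat (𝕜 := ℝ)).mul_const (Real.exp (s * x))
        |>.const_add 1
    have h2 := Tendsto.div (tendsto_const_nhds (x := Real.exp (s * x))) h1 one_ne_zero
    rw [div_one] at h2
    exact h2
  calc ∫⁻ x, ENNReal.ofReal (Real.exp (s * x) * u x ^ 2)
      = ∫⁻ x, liminf (fun n : ℕ => ENNReal.ofReal
          (Real.exp (s * x) / (1 + 1 / ((n:ℝ) + 1) * Real.exp (s * x)) * u x ^ 2)) atTop :=
        lintegral_congr fun x => (hlim x).liminf_eq.symm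
    _ ≤ liminf (fun n : ℕ => ∫⁻ x, ENNReal.ofReal
          (Real.exp (s * x) / (1 + 1 / ((n:ℝ) + 1) * Real.exp (s * x)) * u x ^ 2)) atTop :=
        lintegral_liminf_le fun n => by
          have := hc.measurable
          fun_prop
    _ ≤ _ := by
        refine liminf_le_of_frequently_le' (Frequently.of_forall fun n => ?_)
        exact lintegral_expTrunc_le hu hs (by positivity)

/-! ### The change of variables `y = eˣ` -/

theorem exp_image_univ : Real.exp '' Set.univ = Set.Ioi 0 := by
  rw [Set.image_univ, Real.range_exp]

theorem lintegral_Ioi_eq_exp (f : ℝ → ENNReal) :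
    ∫⁻ y in Set.Ioi 0, f y = ∫⁻ x, ENNReal.ofReal (Real.exp x) * f (Real.exp x) := by
  have := lintegral_image_eq_lintegral_abs_deriv_mul MeasurableSet.univ
    (fun x _ => (Real.hasDerivAt_exp x).hasDerivWithinAt) Real.exp_injective.injOn f
  rw [exp_image_univ] at this
  simpa using this

theorem integral_Ioi_eq_exp (f : ℝ → ℝ) :
    ∫ y in Set.Ioi 0, f y = ∫ x, Real.exp x * f (Real.exp x) := by
  have := integral_image_eq_integral_abs_deriv_smul MeasurableSet.univ
    (fun x _ => (Real.hasDerivAt_exp x).hasDerivWithinAt) Real.exp_injective.injOn f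
  rw [exp_image_univ] at this
  simpa using this

theorem integrableOn_Ioi_iff_exp (f : ℝ → ℝ) :
    IntegrableOn f (Set.Ioi 0) ↔ Integrable fun x => Real.exp x * f (Real.exp x) := by
  have := integrableOn_image_iff_integrableOn_abs_deriv_smul MeasurableSet.univ
    (fun x _ => (Real.hasDerivAt_exp x).hasDerivWithinAt) Real.exp_injective.injOn f
  rw [exp_image_univ] at this
  simpa using this

theorem ae_exp_of_ae {p : ℝ → Prop} (h : ∀ᵐ y ∂(volume.restrict (Set.Ioi (0:ℝ))), p y) :
    ∀ᵐ x : ℝ, p (Real.exp x) := by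
  obtain ⟨N, hN, hNm, hN0⟩ := exists_measurable_superset_of_null (ae_iff.1 h)
  have h1 : ∫⁻ y in Set.Ioi 0, N.indicator 1 y = 0 := by
    rw [lintegral_indicator_one hNm, hN0]
  rw [lintegral_Ioi_eq_exp, lintegral_eq_zero_iff (by
    refine Measurable.mul (by fun_prop) ?_
    exact (measurable_one.indicator hNm).comp Real.measurable_exp)] at h1
  filter_upwards [h1] with x hx
  by_contra hp
  have hm : Real.exp x ∈ N := hN hp
  simp [hm, (Real.exp_pos x).not_ge] at hx

theorem ae_prim_exp (φ : HalfLineL2) :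
    ∀ᵐ x, HasDerivAt (prim φ) (φ (Real.exp x)) (Real.exp x) := by
  have h : ∀ᵐ y ∂(volume.restrict (Set.Ioi (0:ℝ))), HasDerivAt (prim φ) (φ y) y := by
    filter_upwards [ae_restrict_of_ae (ae_hasDerivAt_prim φ), ae_restrict_mem measurableSet_Ioi]
      with y h1 h2
    exact h1 h2
  exact ae_exp_of_ae h

/-- The function `x ↦ e^{-x/2} F(eˣ)` on the line, where `F` is the primitive of `φ`. -/
noncomputable def toLine (φ : HalfLineL2) (x : ℝ) : ℝ := Real.exp (-x / 2) * prim φ (Real.exp x)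

theorem prim_exp (φ : HalfLineL2) (x : ℝ) : prim φ (Real.exp x) = Real.exp (x / 2) * toLine φ x := by
  rw [toLine, ← mul_assoc, ← Real.exp_add]
  simp [neg_div]

theorem ae_hasDerivAt_toLine (φ : HalfLineL2) : ∀ᵐ x,
    HasDerivAt (toLine φ) (Real.exp (x / 2) * φ (Real.exp x) - toLine φ x / 2) x := by
  filter_upwards [ae_prim_exp φ] with x hx
  have h1 : HasDerivAt (fun x : ℝ => Real.exp (-x / 2)) (Real.exp (-x / 2) * (-1 / 2)) x := by
    simpa using ((hasDerivAt_id x).neg.div_const 2).exp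
  have h2 := h1.mul (hx.comp x (Real.hasDerivAt_exp x))
  refine h2.congr_deriv ?_
  have h3 : Real.exp x = Real.exp (x / 2) * Real.exp (x / 2) := by
    rw [← Real.exp_add]; congr 1; ring
  have h4 : Real.exp (-x / 2) * Real.exp (x / 2) = 1 := by
    rw [← Real.exp_add]; simp [neg_div]
  rw [toLine, Function.comp]
  linear_combination (φ (Real.exp x) * Real.exp (-x / 2)) * h3 +
    (φ (Real.exp x) * Real.exp (x / 2)) * h4

theorem absCont_toLine (φ : HalfLineL2) (a b : ℝ) : AbsolutelyContinuousOnInterval (toLine φ) a b := by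
  have h1 : AbsolutelyContinuousOnInterval (fun x : ℝ => Real.exp (-x / 2)) a b :=
    ContDiffOn.absolutelyContinuousOnInterval (by fun_prop)
  have h2 : AbsolutelyContinuousOnInterval Real.exp a b :=
    ContDiffOn.absolutelyContinuousOnInterval (by fun_prop)
  have h3 : AbsolutelyContinuousOnInterval (prim φ ∘ Real.exp) a b :=
    absCont_comp_monotone (absolutelyContinuousOnInterval_prim φ (Real.exp a) (Real.exp b)) h2
      Real.exp_monotone
  exact h1.mul h3

theorem continuous_toLine (φ : HalfLineL2) : Continuous (toLine φ) :=
  continuous_of_absCont (absCont_toLine φ)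

theorem inner_eq_integral_exp (φ χ : HalfLineL2) : inner ℝ φ χ =
    ∫ x, (Real.exp (x / 2) * φ (Real.exp x)) * (Real.exp (x / 2) * χ (Real.exp x)) := by
  rw [inner_eq_integral, integral_Ioi_eq_exp]
  refine integral_congr_ae (Eventually.of_forall fun x => ?_)
  have h3 : Real.exp x = Real.exp (x / 2) * Real.exp (x / 2) := by
    rw [← Real.exp_add]; congr 1; ring
  beta_reduce
  generalize φ (Real.exp x) = A
  generalize χ (Real.exp x) = B
  rw [h3]
  ring

theorem memLp_exp_mul (φ : HalfLineL2) :
    MemLp (fun x => Real.exp (x / 2) * φ (Real.exp x)) 2 volume := by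
  have hm : AEStronglyMeasurable (fun x => Real.exp (x / 2) * φ (Real.exp x)) volume := by
    obtain ⟨g, hg, hφg⟩ := (Lp.memLp φ).1
    refine ⟨fun x => Real.exp (x / 2) * g (Real.exp x), ?_, ?_⟩
    · have := hg.measurable
      exact Measurable.stronglyMeasurable (by fun_prop)
    · filter_upwards [ae_exp_of_ae hφg] with x hx
      rw [hx]
  rw [memLp_two_iff_integrable_sq hm]
  have h := (integrableOn_Ioi_iff_exp _).1 (Lp.memLp φ).integrable_sq
  refine h.congr (Eventually.of_forall fun x => ?_)
  have h3 : Real.exp x = Real.exp (x / 2) * Real.exp (x / 2) := by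
    rw [← Real.exp_add]; congr 1; ring
  beta_reduce
  generalize φ (Real.exp x) = A
  rw [h3]
  ring

/-- The bound `F(y)² ≤ y ‖φ‖²` on the line. -/
theorem sq_toLine_le (φ : HalfLineL2) (x : ℝ) : toLine φ x ^ 2 ≤ ‖φ‖ ^ 2 := by
  have h1 := sq_prim_sub_le φ le_rfl (Real.exp_pos x).le
  rw [prim_of_nonpos φ le_rfl, sub_zero, sub_zero, prim_exp, mul_pow] at h1
  have h3 : Real.exp x = Real.exp (x / 2) ^ 2 := by
    rw [← Real.exp_nat_mul]; congr 1; push_cast; ring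
  have h2 : ∫ t in Set.Ioc 0 (Real.exp x), φ t ^ 2 ≤ ‖φ‖ ^ 2 := by
    rw [← real_inner_self_eq_norm_sq, inner_eq_integral]
    simp only [← sq]
    exact setIntegral_mono_set (Lp.memLp φ).integrable_sq (Eventually.of_forall fun _ => sq_nonneg _)
      (Ioc_subset_Ioi_zero le_rfl).eventuallyLE
  have h4 := h1.trans (mul_le_mul_of_nonneg_left h2 (Real.exp_pos x).le)
  rw [h3] at h4
  exact le_of_mul_le_mul_left h4 (by positivity)

/-- Functions of the form `toLine φ` belong to `H¹(ℝ)`: with `g = f' + f / 2`, the integral of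
`g² = f'² + f² / 4 + (f²)' / 2` controls both terms because `f` is bounded. -/
theorem memH1_toLine (φ : HalfLineL2) : MemH1 (toLine φ) := by
  set f := toLine φ with hf
  set g : ℝ → ℝ := fun x => Real.exp (x / 2) * φ (Real.exp x) with hg
  have hgL := memLp_exp_mul φ
  have hder : ∀ᵐ x, deriv f x = g x - f x / 2 := (ae_hasDerivAt_toLine φ).mono fun x h => h.deriv
  have hfc : Continuous f := continuous_toLine φ
  have hg2 : ∫ x, g x ^ 2 = ‖φ‖ ^ 2 := by
    rw [← real_inner_self_eq_norm_sq, inner_eq_integral_exp]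
    simp only [sq, hg]
  have hfI : Integrable fun x => f x ^ 2 := by
    have hcov : AECover volume atTop fun n : ℕ => Set.Ioc (-(n:ℝ)) n :=
      aecover_Ioc (tendsto_neg_atTop_atBot.comp tendsto_natCast_atTop_atTop)
        tendsto_natCast_atTop_atTop
    refine hcov.integrable_of_integral_bounded_of_nonneg_ae (8 * ‖φ‖ ^ 2)
      (fun n => ((hfc.pow 2).integrableOn_Icc).mono_set Set.Ioc_subset_Icc_self)
      (Eventually.of_forall fun x => sq_nonneg _) (Eventually.of_forall fun n => ?_)
    have hn : -(n:ℝ) ≤ n := by linarith [n.cast_nonneg (α := ℝ)]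
    have hac := ((absCont_toLine φ (-n) n).mul (absCont_toLine φ (-n) n)).integral_deriv_eq_sub
    rw [intervalIntegral.integral_of_le hn] at hac
    have hfi : IntegrableOn (fun x => f x ^ 2) (Set.Ioc (-(n:ℝ)) n) :=
      ((hfc.pow 2).integrableOn_Icc).mono_set Set.Ioc_subset_Icc_self
    have hff : MemLp f 2 (volume.restrict (Set.Ioc (-(n:ℝ)) n)) :=
      (memLp_two_iff_integrable_sq hfc.aestronglyMeasurable).2 hfi
    have hgf : IntegrableOn (fun x => g x * f x) (Set.Ioc (-(n:ℝ)) n) :=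
      (hgL.mono_measure Measure.restrict_le_self).integrable_mul hff
    have hgI : IntegrableOn (fun x => g x ^ 2) (Set.Ioc (-(n:ℝ)) n) := hgL.integrable_sq.integrableOn
    have h1 : ∫ x in Set.Ioc (-(n:ℝ)) n, deriv (f * f) x =
        2 * (∫ x in Set.Ioc (-(n:ℝ)) n, g x * f x) - ∫ x in Set.Ioc (-(n:ℝ)) n, f x ^ 2 := by
      rw [← integral_const_mul, ← integral_sub (hgf.const_mul 2) hfi]
      refine integral_congr_ae (ae_restrict_of_ae ?_)
      filter_upwards [ae_hasDerivAt_toLine φ] with x hx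
      rw [(hx.mul hx).deriv]
      ring
    have h2 : 2 * (∫ x in Set.Ioc (-(n:ℝ)) n, g x * f x) ≤
        2 * (∫ x in Set.Ioc (-(n:ℝ)) n, g x ^ 2) + 1 / 2 * ∫ x in Set.Ioc (-(n:ℝ)) n, f x ^ 2 := by
      rw [← integral_const_mul, ← integral_const_mul, ← integral_const_mul,
        ← integral_add (hgI.const_mul 2) (hfi.const_mul _)]
      refine integral_mono (hgf.const_mul 2) ((hgI.const_mul 2).add (hfi.const_mul _)) fun x => ?_
      beta_reduce
      nlinarith [sq_nonneg (2 * g x - f x)]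
    have h3 : ∫ x in Set.Ioc (-(n:ℝ)) n, g x ^ 2 ≤ ‖φ‖ ^ 2 := by
      rw [← hg2]
      exact setIntegral_le_integral hgL.integrable_sq (Eventually.of_forall fun x => sq_nonneg _)
    have h4 := sq_toLine_le φ (-n)
    have h5 : 0 ≤ f n * f n := mul_self_nonneg _
    rw [Pi.mul_apply, Pi.mul_apply] at hac
    have h6 : f (-n) * f (-n) ≤ ‖φ‖ ^ 2 := by rw [← sq]; exact h4
    change ∫ x in Set.Ioc (-(n:ℝ)) n, deriv (f * f) x = f n * f n - f (-n) * f (-n) at hac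
    have h7 : 0 ≤ ‖φ‖ ^ 2 := sq_nonneg _
    linarith
  have hfL : MemLp f 2 volume := (memLp_two_iff_integrable_sq hfc.aestronglyMeasurable).2 hfI
  refine ⟨absCont_toLine φ, hfL, (memLp_congr_ae hder).2 (hgL.sub ?_)⟩
  simpa [div_eq_inv_mul] using hfL.const_mul (2:ℝ)⁻¹

/-- Every member of `H¹(ℝ)` is of the form `toLine φ`. -/
theorem exists_toLine_eq {f : ℝ → ℝ} (hf : MemH1 f) : ∃ φ : HalfLineL2, toLine φ = f := by
  set g : ℝ → ℝ := fun x => deriv f x + f x / 2 with hg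
  have hgL : MemLp g 2 volume := by
    refine hf.memLp_deriv.add ?_
    simpa [div_eq_inv_mul] using hf.memLp.const_mul (2:ℝ)⁻¹
  have hgm : Measurable g := by
    have := (continuous_of_absCont hf.absCont).measurable
    have := measurable_deriv f
    fun_prop
  set φ₀ : ℝ → ℝ := fun y => g (Real.log y) * Real.exp (-Real.log y / 2) with hφ₀
  have hφm : Measurable φ₀ := by
    have := Real.measurable_log
    fun_prop
  have hexp : ∀ x : ℝ, Real.exp x * Real.exp (-x / 2) = Real.exp (x / 2) := fun x => by
    rw [← Real.exp_add]; congr 1; ring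
  have hφL : MemLp φ₀ 2 (volume.restrict (Set.Ioi (0:ℝ))) := by
    rw [memLp_two_iff_integrable_sq hφm.aestronglyMeasurable]
    refine (integrableOn_Ioi_iff_exp _).2 (hgL.integrable_sq.congr (Eventually.of_forall fun x => ?_))
    simp only [hφ₀, Real.log_exp]
    have : Real.exp x * Real.exp (-x / 2) ^ 2 = 1 := by
      rw [sq, ← mul_assoc, hexp, ← Real.exp_add]; simp [neg_div]
    linear_combination (-g x ^ 2) * this
  refine ⟨hφL.toLp φ₀, ?_⟩
  funext x
  have hexpL : MemLp (fun t : ℝ => Real.exp (t / 2)) 2 (volume.restrict (Set.Iic x)) := by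
    rw [memLp_two_iff_integrable_sq (by fun_prop)]
    refine (integrableOn_exp_Iic x).congr (Eventually.of_forall fun t => ?_)
    beta_reduce
    rw [← Real.exp_nat_mul]; congr 1; push_cast; ring
  set q : ℝ → ℝ := fun t => Real.exp (t / 2) * f t with hq
  have hqac : ∀ a b, AbsolutelyContinuousOnInterval q a b := fun a b => by
    have h1 : AbsolutelyContinuousOnInterval (fun x : ℝ => Real.exp (x / 2)) a b :=
      ContDiffOn.absolutelyContinuousOnInterval (by fun_prop)
    exact h1.mul (hf.absCont a b)
  have hqd : ∀ᵐ t, deriv q t = Real.exp (t / 2) * g t := by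
    filter_upwards [ae_differentiableAt_of_absCont hf.absCont] with t ht
    have h1 : HasDerivAt (fun x : ℝ => Real.exp (x / 2)) (Real.exp (t / 2) * (1 / 2)) t := by
      simpa using ((hasDerivAt_id t).div_const 2).exp
    rw [(h1.fun_mul ht.hasDerivAt).deriv]
    ring
  have hlim := setIntegral_Iic_deriv hqac (c := x)
    (hexpL.integrable_mul (hf.memLp.mono_measure Measure.restrict_le_self))
    ((hexpL.integrable_mul (hgL.mono_measure Measure.restrict_le_self)).congr
      (ae_restrict_of_ae (hqd.mono fun _ h => h.symm)))
  have hprim : prim (hφL.toLp φ₀) (Real.exp x) = Real.exp (x / 2) * f x := by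
    change _ = q x
    rw [← hlim, prim]
    have h1 : ∫ t in Set.Ioc 0 (Real.exp x), hφL.toLp φ₀ t = ∫ t in Set.Ioc 0 (Real.exp x), φ₀ t :=
      integral_congr_ae (ae_restrict_of_ae_restrict_of_subset (Ioc_subset_Ioi_zero le_rfl)
        hφL.coeFn_toLp)
    have h2 : ∫ t in Set.Ioc 0 (Real.exp x), φ₀ t =
        ∫ t in Set.Ioi 0, (Set.Iic (Real.exp x)).indicator φ₀ t := by
      rw [setIntegral_indicator measurableSet_Iic, Set.Ioi_inter_Iic]
    rw [h1, h2, integral_Ioi_eq_exp, ← integral_indicator measurableSet_Iic]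
    refine integral_congr_ae ?_
    filter_upwards [hqd] with t ht
    simp only [Set.indicator_apply, Set.mem_Iic, Real.exp_le_exp]
    split_ifs
    · rw [ht, hφ₀]
      simp only [Real.log_exp]
      rw [mul_left_comm, hexp, mul_comm]
    · simp
  rw [toLine, hprim, ← mul_assoc, ← Real.exp_add]
  simp [neg_div]

theorem eq_zero_of_prim_eq_zero {φ : HalfLineL2} (h : ∀ y, prim φ y = 0) : φ = 0 := by
  rw [Lp.eq_zero_iff_ae_eq_zero]
  filter_upwards [ae_restrict_of_ae (ae_hasDerivAt_prim φ), ae_restrict_mem measurableSet_Ioi]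
    with y h1 h2
  have h3 : prim φ = fun _ => 0 := funext h
  have h4 := h1 h2
  rw [h3] at h4
  exact h4.unique (hasDerivAt_const y 0)

theorem toLine_eq_zero_iff {φ : HalfLineL2} : toLine φ = 0 ↔ φ = 0 := by
  constructor
  · intro h
    refine eq_zero_of_prim_eq_zero fun y => ?_
    rcases le_or_gt y 0 with hy | hy
    · exact prim_of_nonpos φ hy
    · rw [← Real.exp_log hy, prim_exp, h]
      simp
  · rintro rfl
    funext x
    have : prim 0 (Real.exp x) = 0 := by
      rw [prim]
      exact integral_eq_zero_of_ae (ae_restrict_of_ae_restrict_of_subset (Ioc_subset_Ioi_zero le_rfl)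
        (Lp.coeFn_zero _ _ _))
    rw [toLine, this, mul_zero, Pi.zero_apply]

/-! ### The half-line string of a pair `(u, μ)` -/

theorem MemH1.exists_abs_le {f : ℝ → ℝ} (hf : MemH1 f) : ∃ C, ∀ x, |f x| ≤ C := by
  obtain ⟨φ, rfl⟩ := exists_toLine_eq hf
  exact ⟨‖φ‖, fun x => abs_le_of_sq_le_sq (sq_toLine_le φ x) (norm_nonneg φ)⟩

theorem memLp_mul_of_abs_le {f g : ℝ → ℝ} {C : ℝ} (hf : Continuous f) (hC : ∀ x, |f x| ≤ C)
    (hg : MemLp g 2 volume) : MemLp (fun x => f x * g x) 2 volume := by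
  refine (hg.const_mul C).mono (hf.aestronglyMeasurable.mul hg.1) (Eventually.of_forall fun x => ?_)
  rw [norm_mul, norm_mul]
  gcongr
  exact (hC x).trans (le_abs_self C)

theorem MemH1.mul {f q : ℝ → ℝ} (hf : MemH1 f) (hq : MemH1 q) : MemH1 fun x => f x * q x := by
  obtain ⟨C, hC⟩ := hf.exists_abs_le
  obtain ⟨D, hD⟩ := hq.exists_abs_le
  have hfc := continuous_of_absCont hf.absCont
  have hqc := continuous_of_absCont hq.absCont
  refine ⟨fun a b => (hf.absCont a b).mul (hq.absCont a b), memLp_mul_of_abs_le hfc hC hq.memLp,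
    (memLp_congr_ae (ae_deriv_mul hf.absCont hq.absCont)).2
      (MemLp.add ?_ (memLp_mul_of_abs_le hfc hC hq.memLp_deriv))⟩
  simpa only [mul_comm] using memLp_mul_of_abs_le hqc hD hf.memLp_deriv

section String

variable {u : ℝ → ℝ} {μ : Measure ℝ}

theorem isFiniteMeasure_upsilon (h : (u, μ) ∈ classE) : IsFiniteMeasure (upsilon u μ) :=
  have : IsFiniteMeasure μ := h.1.1.2.1
  isFiniteMeasure_of_le μ Measure.sub_le

theorem memH1_of_mem (h : (u, μ) ∈ classE) : MemH1 u := h.1.1.1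

theorem measurable_of_mem (h : (u, μ) ∈ classE) : Measurable u :=
  (continuous_of_absCont (memH1_of_mem h).absCont).measurable

/-- Each growth condition bounds `e^{±x} (u + u')²` for one of the two signs; for the sign for which it
involves `u' - u` instead, the difference `2 u` is controlled by the decay of `u`. -/
theorem lintegral_growth_ne_top (h : (u, μ) ∈ classE) :
    ∫⁻ x, ENNReal.ofReal ((Real.exp (-x) + Real.exp x) * (u x + deriv u x) ^ 2) ≠ ⊤ := by
  have hp : ∫⁻ x, ENNReal.ofReal (Real.exp x * (deriv u x - u x) ^ 2) ≠ ⊤ := by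
    have := (le_self_add.trans_lt h.1.2).ne
    simpa using this
  have hm : ∫⁻ x, ENNReal.ofReal (Real.exp (-x) * (u x + deriv u x) ^ 2) ≠ ⊤ := by
    have := (le_self_add.trans_lt h.2.2).ne
    simpa [add_comm] using this
  have hu : ∫⁻ x, ENNReal.ofReal (Real.exp x * u x ^ 2) ≠ ⊤ := by
    have := lintegral_exp_mul_sq_le (memH1_of_mem h) (s := 1) (by norm_num)
    simp only [one_mul] at this
    exact ne_top_of_le_ne_top hp this
  have hum := measurable_of_mem h
  have hum' := measurable_deriv u
  refine ne_top_of_le_ne_top (ENNReal.add_ne_top.2 ⟨hm, ENNReal.add_ne_top.2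
    ⟨ENNReal.mul_ne_top (ENNReal.ofNat_ne_top (n := 2)) hp,
      ENNReal.mul_ne_top (ENNReal.ofNat_ne_top (n := 8)) hu⟩⟩) ?_
  rw [← lintegral_const_mul _ (by fun_prop), ← lintegral_const_mul _ (by fun_prop),
    ← lintegral_add_left (by fun_prop), ← lintegral_add_left (by fun_prop)]
  refine lintegral_mono fun x => ?_
  have e2 : (2 : ENNReal) = ENNReal.ofReal 2 := by simp
  have e8 : (8 : ENNReal) = ENNReal.ofReal 8 := by simp
  rw [e2, e8, ← ENNReal.ofReal_mul (by norm_num), ← ENNReal.ofReal_mul (by norm_num),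
    ← ENNReal.ofReal_add (by positivity) (by positivity),
    ← ENNReal.ofReal_add (by positivity) (by positivity)]
  refine ENNReal.ofReal_le_ofReal ?_
  have h1 : Real.exp x * (u x + deriv u x) ^ 2 ≤
      Real.exp x * (2 * (deriv u x - u x) ^ 2 + 8 * u x ^ 2) :=
    mul_le_mul_of_nonneg_left (by nlinarith [sq_nonneg (deriv u x - u x - 2 * u x)])
      (Real.exp_pos x).le
  nlinarith

theorem lintegral_growth_upsilon_ne_top (h : (u, μ) ∈ classE) :
    ∫⁻ x, ENNReal.ofReal (Real.exp (-x) + Real.exp x) ∂(upsilon u μ) ≠ ⊤ := by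
  have hp : ∫⁻ x, ENNReal.ofReal (Real.exp x) ∂(upsilon u μ) ≠ ⊤ := by
    have := (le_add_self.trans_lt h.1.2).ne
    simpa using this
  have hm : ∫⁻ x, ENNReal.ofReal (Real.exp (-x)) ∂(upsilon u μ) ≠ ⊤ := by
    have := (le_add_self.trans_lt h.2.2).ne
    simpa using this
  refine ne_top_of_le_ne_top (ENNReal.add_ne_top.2 ⟨hm, hp⟩) ?_
  rw [← lintegral_add_left (by fun_prop)]
  exact lintegral_mono fun x => ENNReal.ofReal_add_le

/-- The Cauchy–Schwarz inequality: the weight dominates `1 + x²`, whose reciprocal is integrable. -/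
theorem integrable_of_lintegral_growth {g : ℝ → ℝ} (hg : Measurable g)
    (h : ∫⁻ x, ENNReal.ofReal ((Real.exp (-x) + Real.exp x) * g x ^ 2) ≠ ⊤) : Integrable g := by
  have h1 : Integrable fun x => (Real.exp (-x) + Real.exp x) * g x ^ 2 := by
    refine ⟨by fun_prop, ?_⟩
    rw [hasFiniteIntegral_iff_ofReal (Eventually.of_forall fun x => by positivity)]
    exact h.lt_top
  refine ((h1.const_mul 2).add integrable_inv_one_add_sq).mono' hg.aestronglyMeasurable
    (Eventually.of_forall fun x => ?_)
  have h2 : 1 + x ^ 2 ≤ 2 * (Real.exp (-x) + Real.exp x) := by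
    have e1 := Real.add_one_le_exp x
    have e2 := Real.add_one_le_exp (-x)
    rcases le_total 0 x with hx | hx
    · linarith [Real.quadratic_le_exp_of_nonneg hx]
    · linarith [Real.quadratic_le_exp_of_nonneg (neg_nonneg.2 hx), neg_sq x]
  have h3 : (1 + x ^ 2) * g x ^ 2 ≤ 2 * (Real.exp (-x) + Real.exp x) * g x ^ 2 := by gcongr
  have h4 : 0 < 1 + x ^ 2 := by positivity
  have h5 : (1 + x ^ 2) * (1 + x ^ 2)⁻¹ = 1 := mul_inv_cancel₀ h4.ne'
  have h6 : 0 < (1 + x ^ 2)⁻¹ := by positivity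
  have h7 : 0 ≤ (1 + x ^ 2) * (|g x| - (1 + x ^ 2)⁻¹) ^ 2 := by positivity
  have h8 : (1 + x ^ 2) * (|g x| - (1 + x ^ 2)⁻¹) ^ 2 =
      (1 + x ^ 2) * g x ^ 2 - 2 * |g x| + (1 + x ^ 2)⁻¹ := by
    rw [← sq_abs (g x)]
    linear_combination (-2 * |g x| + (1 + x ^ 2)⁻¹) * h5
  rw [Real.norm_eq_abs]
  rw [Pi.add_apply]
  linarith [abs_nonneg (g x)]

theorem integrable_add_deriv (h : (u, μ) ∈ classE) : Integrable fun x => u x + deriv u x := by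
  have := measurable_of_mem h
  have := measurable_deriv u
  exact integrable_of_lintegral_growth (by fun_prop) (lintegral_growth_ne_top h)

theorem integrable_of_mem (h : (u, μ) ∈ classE) : Integrable u := by
  refine integrable_of_lintegral_growth (measurable_of_mem h) ?_
  have hum := measurable_of_mem h
  have h1 : ∫⁻ x, ENNReal.ofReal (Real.exp x * u x ^ 2) ≠ ⊤ := by
    have := lintegral_exp_mul_sq_le (memH1_of_mem h) (s := 1) (by norm_num)
    simp only [one_mul] at this
    refine ne_top_of_le_ne_top ?_ this
    simpa using (le_self_add.trans_lt h.1.2).ne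
  have h2 : ∫⁻ x, ENNReal.ofReal (Real.exp (-x) * u x ^ 2) ≠ ⊤ := by
    have := lintegral_exp_mul_sq_le (memH1_of_mem h) (s := -1) (by norm_num)
    refine ne_top_of_le_ne_top (le_self_add.trans_lt h.2.2).ne ?_
    simpa only [neg_one_mul] using this
  refine ne_top_of_le_ne_top (ENNReal.add_ne_top.2 ⟨h2, h1⟩) ?_
  rw [← lintegral_add_left (by fun_prop)]
  refine lintegral_mono fun x => ?_
  rw [add_mul]
  exact ENNReal.ofReal_add_le

theorem exp_mul_sq_div (x v : ℝ) :
    Real.exp x * ((1 + Real.exp x ^ 2) * (v / Real.exp x) ^ 2) = (Real.exp (-x) + Real.exp x) * v ^ 2 := by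
  rw [Real.exp_neg]
  field_simp

/-- The string on the half-line `y = eˣ > 0` with density `κ(y) = (u + u')(log y) / y` and dipole
measure `ν`, the image of `e^{-x} υ`. -/
noncomputable def stringOf (h : (u, μ) ∈ classE) : HalfLineString where
  κ := (Set.Ioi 0).indicator fun y => (u (Real.log y) + deriv u (Real.log y)) / y
  ν := ((upsilon u μ).withDensity fun x => ENNReal.ofReal (Real.exp (-x))).map Real.exp
  measurable_κ := by
    have := measurable_of_mem h
    have := measurable_deriv u
    have := Real.measurable_log
    exact Measurable.indicator (by fun_prop) measurableSet_Ioi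
  lintegral_κ := by
    rw [lintegral_Ioi_eq_exp]
    convert lintegral_growth_ne_top h using 3 with x
    rw [Set.indicator_of_mem (Set.mem_Ioi.2 (Real.exp_pos x)), Real.log_exp,
      ← ENNReal.ofReal_mul (Real.exp_pos x).le, exp_mul_sq_div]
  ν_Iic := by
    rw [Measure.map_apply Real.measurable_exp measurableSet_Iic]
    have : Real.exp ⁻¹' Set.Iic 0 = ∅ := by
      ext x
      simp [Real.exp_pos x]
    rw [this, measure_empty]
  lintegral_ν := by
    rw [lintegral_map (by fun_prop) Real.measurable_exp,
      lintegral_withDensity_eq_lintegral_mul _ (by fun_prop) (by fun_prop)]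
    convert lintegral_growth_upsilon_ne_top h using 3 with x
    rw [Pi.mul_apply, ← ENNReal.ofReal_mul (Real.exp_pos _).le, Real.exp_neg]
    congr 1
    field_simp

theorem stringOf_κ_exp (h : (u, μ) ∈ classE) (x : ℝ) :
    (stringOf h).κ (Real.exp x) = (u x + deriv u x) / Real.exp x := by
  change (Set.Ioi 0).indicator _ _ = _
  rw [Set.indicator_of_mem (Set.mem_Ioi.2 (Real.exp_pos x)), Real.log_exp]

theorem integral_κ_stringOf (h : (u, μ) ∈ classE) :
    ∫ y in Set.Ioi 0, (stringOf h).κ y = ∫ x, u x := by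
  rw [integral_Ioi_eq_exp]
  have h1 : ∀ x, Real.exp x * (stringOf h).κ (Real.exp x) = u x + deriv u x := fun x => by
    rw [stringOf_κ_exp]; field_simp
  simp only [h1]
  have hu := integrable_of_mem h
  have hu' : Integrable (deriv u) := by
    refine ((integrable_add_deriv h).sub hu).congr (Eventually.of_forall fun x => ?_)
    simp
  rw [integral_add hu hu', integral_deriv_eq_zero (memH1_of_mem h).absCont hu hu', add_zero]

/-- The cross term `2 u u'` of `(u + u')²` integrates to zero, so the moment is the total mass of `μ`. -/
theorem moment_stringOf (h : (u, μ) ∈ classE) : (stringOf h).moment = (μ Set.univ).toReal := by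
  rw [HalfLineString.moment]
  congr 1
  have hu := memH1_of_mem h
  rw [measure_eq_lintegral_add_upsilon h.1.1 MeasurableSet.univ, Measure.restrict_univ,
    lintegral_Ioi_eq_exp]
  congr 1
  · have h1 : ∀ x, ENNReal.ofReal (Real.exp x) *
        ENNReal.ofReal ((stringOf h).κ (Real.exp x) ^ 2 * Real.exp x) =
        ENNReal.ofReal ((u x + deriv u x) ^ 2) := fun x => by
      rw [stringOf_κ_exp, ← ENNReal.ofReal_mul (Real.exp_pos x).le]
      congr 1
      field_simp
    simp only [h1]
    have hi1 : Integrable fun x => (u x + deriv u x) ^ 2 :=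
      (hu.memLp.add hu.memLp_deriv).integrable_sq
    have hi2 : Integrable fun x => u x ^ 2 + deriv u x ^ 2 :=
      hu.memLp.integrable_sq.add hu.memLp_deriv.integrable_sq
    rw [← ofReal_integral_eq_lintegral_ofReal hi1 (Eventually.of_forall fun x => sq_nonneg _),
      ← ofReal_integral_eq_lintegral_ofReal hi2 (Eventually.of_forall fun x => add_nonneg (sq_nonneg _) (sq_nonneg _))]
    congr 1
    have h2 : ∀ x, (u x + deriv u x) ^ 2 =
        (u x ^ 2 + deriv u x ^ 2) + (deriv u x * u x + u x * deriv u x) := fun x => by ring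
    have hi3 : Integrable fun x => deriv u x * u x + u x * deriv u x :=
      (hu.integrable_deriv_mul hu).add (hu.integrable_mul_deriv hu)
    simp only [h2]
    rw [integral_add hi2 hi3, hu.integral_deriv_mul_add hu,
      add_zero]
  · change ∫⁻ y, ENNReal.ofReal y ∂(Measure.map Real.exp _) = _
    rw [lintegral_map (by fun_prop) Real.measurable_exp,
      lintegral_withDensity_eq_lintegral_mul _ (by fun_prop) (by fun_prop), ← lintegral_one]
    refine lintegral_congr fun x => ?_
    rw [Pi.mul_apply, ← ENNReal.ofReal_mul (Real.exp_pos _).le, ← Real.exp_add]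
    simp

/-! ### The quadratic forms of the equation -/

/-- The inner product of `L²(0, ∞)` is the energy form of the equation: the cross terms
`(f' g + f g') / 2` integrate to zero. -/
theorem inner_eq_integral_toLine (φ χ : HalfLineL2) : inner ℝ φ χ =
    (∫ x, deriv (toLine φ) x * deriv (toLine χ) x) + 1 / 4 * ∫ x, toLine φ x * toLine χ x := by
  have hf := memH1_toLine φ
  have hq := memH1_toLine χ
  have h0 := hf.integral_deriv_mul_add hq
  have hi1 : Integrable fun x =>
      Real.exp (x / 2) * φ (Real.exp x) * (Real.exp (x / 2) * χ (Real.exp x)) :=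
    (memLp_exp_mul φ).integrable_mul (memLp_exp_mul χ)
  have hi2 : Integrable fun x => deriv (toLine φ) x * deriv (toLine χ) x +
      1 / 4 * (toLine φ x * toLine χ x) :=
    (hf.integrable_deriv_mul_deriv hq).add ((hf.integrable_mul hq).const_mul _)
  rw [inner_eq_integral_exp, ← integral_const_mul,
    ← integral_add (hf.integrable_deriv_mul_deriv hq) ((hf.integrable_mul hq).const_mul _),
    ← sub_eq_zero, ← integral_sub hi1 hi2]
  refine Eq.trans ?_ ((integral_const_mul (1 / 2 : ℝ) _).trans ((congrArg _ h0).trans (mul_zero _)))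
  refine integral_congr_ae ?_
  filter_upwards [ae_hasDerivAt_toLine φ, ae_hasDerivAt_toLine χ] with x h1 h2
  rw [h1.deriv, h2.deriv]
  ring

theorem integrable_mul_toLine_mul (h : (u, μ) ∈ classE) (φ χ : HalfLineL2) :
    Integrable fun x => (u x + deriv u x) * (toLine φ x * (Real.exp (x / 2) * χ (Real.exp x))) := by
  have hu := memH1_of_mem h
  exact (hu.memLp.add hu.memLp_deriv).integrable_mul (memLp_mul_of_abs_le (continuous_toLine φ)
    (fun x => abs_le_of_sq_le_sq (sq_toLine_le φ x) (norm_nonneg φ)) (memLp_exp_mul χ))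

theorem inner_opL_stringOf (h : (u, μ) ∈ classE) (φ χ : HalfLineL2) :
    inner ℝ ((stringOf h).opL φ) χ =
      ∫ x, (u x + deriv u x) * (toLine φ x * (Real.exp (x / 2) * χ (Real.exp x))) := by
  have h1 : inner ℝ ((stringOf h).opL φ) χ =
      ∫ y in Set.Ioi 0, (stringOf h).κ y * prim φ y * χ y := by
    rw [inner_eq_integral]
    refine integral_congr_ae ?_
    filter_upwards [(stringOf h).opL_coeFn φ] with y hy
    rw [hy]
  rw [h1, integral_Ioi_eq_exp]
  refine integral_congr_ae (Eventually.of_forall fun x => ?_)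
  beta_reduce
  rw [stringOf_κ_exp, prim_exp]
  generalize χ (Real.exp x) = B
  have := (Real.exp_pos x).ne'
  field_simp

/-- The form of `L + L*` is that of the distribution `ω`: `F' G + F G'` gives `(f g)' + f g`, and the
terms `u (f g)' + u' f g = (u f g)'` integrate to zero. -/
theorem inner_opL_add_stringOf (h : (u, μ) ∈ classE) (φ χ : HalfLineL2) :
    inner ℝ ((stringOf h).opL φ) χ + inner ℝ φ ((stringOf h).opL χ) =
      (∫ x, u x * (toLine φ x * toLine χ x)) +
        ∫ x, deriv u x * deriv (fun x => toLine φ x * toLine χ x) x := by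
  have hu := memH1_of_mem h
  have hf := memH1_toLine φ
  have hq := memH1_toLine χ
  have hfq := hf.mul hq
  have h0 := hu.integral_deriv_mul_add hfq
  have hi1 : Integrable fun x =>
      (u x + deriv u x) * (toLine φ x * (Real.exp (x / 2) * χ (Real.exp x))) +
      (u x + deriv u x) * (toLine χ x * (Real.exp (x / 2) * φ (Real.exp x))) :=
    (integrable_mul_toLine_mul h φ χ).add (integrable_mul_toLine_mul h χ φ)
  have hi2 : Integrable fun x => u x * (toLine φ x * toLine χ x) +
      deriv u x * deriv (fun x => toLine φ x * toLine χ x) x :=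
    (hu.integrable_mul hfq).add (hu.integrable_deriv_mul_deriv hfq)
  rw [real_inner_comm ((stringOf h).opL χ) φ, inner_opL_stringOf, inner_opL_stringOf,
    ← integral_add (integrable_mul_toLine_mul h φ χ) (integrable_mul_toLine_mul h χ φ),
    ← integral_add (hu.integrable_mul hfq) (hu.integrable_deriv_mul_deriv hfq),
    ← sub_eq_zero, ← integral_sub hi1 hi2]
  refine Eq.trans (integral_congr_ae ?_) h0
  filter_upwards [ae_hasDerivAt_toLine φ, ae_hasDerivAt_toLine χ] with x h1 h2
  rw [(h1.fun_mul h2).deriv]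
  ring

/-- The form of `J* J` is that of the measure `υ`. -/
theorem inner_opJ_stringOf (h : (u, μ) ∈ classE) (φ χ : HalfLineL2) :
    inner ℝ ((stringOf h).opJ φ) ((stringOf h).opJ χ) =
      ∫ x, toLine φ x * toLine χ x ∂(upsilon u μ) := by
  rw [inner_Lp_eq_integral]
  have h1 : ∫ y, (stringOf h).opJ φ y * (stringOf h).opJ χ y ∂(stringOf h).ν =
      ∫ y, prim φ y * prim χ y ∂(stringOf h).ν := by
    refine integral_congr_ae ?_
    filter_upwards [(stringOf h).opJ_coeFn φ, (stringOf h).opJ_coeFn χ] with y h1 h2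
    rw [h1, h2]
  have hc : Continuous fun y => prim φ y * prim χ y := (continuous_prim φ).mul (continuous_prim χ)
  rw [h1]
  change ∫ y, prim φ y * prim χ y ∂(Measure.map Real.exp _) = _
  rw [integral_map Real.measurable_exp.aemeasurable hc.aestronglyMeasurable,
    integral_withDensity_eq_integral_toReal_smul (by fun_prop)
      (Eventually.of_forall fun x => ENNReal.ofReal_lt_top)]
  refine integral_congr_ae (Eventually.of_forall fun x => ?_)
  beta_reduce
  rw [ENNReal.toReal_ofReal (Real.exp_pos _).le, prim_exp, prim_exp, smul_eq_mul]
  have h3 : Real.exp (-x) * (Real.exp (x / 2) * Real.exp (x / 2)) = 1 := by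
    rw [← Real.exp_add, ← Real.exp_add]; simp
  linear_combination (toLine φ x * toLine χ x) * h3

end String

/-! ### Complex valued functions on the line -/

theorem absCont_of_dist_le {E F : Type*} [NormedAddCommGroup E] [NormedAddCommGroup F]
    {f : ℝ → E} {g : ℝ → F} {a b : ℝ} (hf : AbsolutelyContinuousOnInterval f a b)
    (h : ∀ x y, dist (g x) (g y) ≤ dist (f x) (f y)) : AbsolutelyContinuousOnInterval g a b :=
  squeeze_zero (fun _ => Finset.sum_nonneg fun _ _ => dist_nonneg)
    (fun _ => Finset.sum_le_sum fun _ _ => h _ _) hf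

/-- The complex valued function with the given real and imaginary parts. -/
noncomputable def ofParts (f g : ℝ → ℝ) (x : ℝ) : ℂ := f x + g x * Complex.I

theorem absCont_ofParts {f g : ℝ → ℝ} {a b : ℝ} (hf : AbsolutelyContinuousOnInterval f a b)
    (hg : AbsolutelyContinuousOnInterval g a b) :
    AbsolutelyContinuousOnInterval (ofParts f g) a b := by
  have h1 : AbsolutelyContinuousOnInterval (fun x => (f x : ℂ)) a b :=
    absCont_of_dist_le hf fun x y => (Complex.isometry_ofReal.dist_eq _ _).le
  have h2 : AbsolutelyContinuousOnInterval (fun x => (g x : ℂ) * Complex.I) a b := by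
    refine absCont_of_dist_le hg fun x y => ?_
    rw [dist_eq_norm, ← sub_mul, ← Complex.ofReal_sub, norm_mul, Complex.norm_I, mul_one,
      Complex.norm_real, dist_eq_norm]
  exact h1.add h2

theorem ae_deriv_ofParts {f g : ℝ → ℝ} (hf : ∀ a b, AbsolutelyContinuousOnInterval f a b)
    (hg : ∀ a b, AbsolutelyContinuousOnInterval g a b) :
    ∀ᵐ x, deriv (ofParts f g) x = ofParts (deriv f) (deriv g) x := by
  filter_upwards [ae_differentiableAt_of_absCont hf, ae_differentiableAt_of_absCont hg] with x h1 h2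
  exact (h1.hasDerivAt.ofReal_comp.add (h2.hasDerivAt.ofReal_comp.mul_const Complex.I)).deriv

theorem memLp_ofParts {f g : ℝ → ℝ} (hf : MemLp f 2 volume) (hg : MemLp g 2 volume) :
    MemLp (ofParts f g) 2 volume := by
  have h1 : MemLp (fun x => (f x : ℂ)) 2 volume := hf.ofReal
  have h2 : MemLp (fun x => (g x : ℂ)) 2 volume := hg.ofReal
  exact h1.add (h2.mul_const Complex.I)

theorem memH1_ofParts {f g : ℝ → ℝ} (hf : MemH1 f) (hg : MemH1 g) : MemH1 (ofParts f g) :=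
  ⟨fun a b => absCont_ofParts (hf.absCont a b) (hg.absCont a b), memLp_ofParts hf.memLp hg.memLp,
    (memLp_congr_ae (ae_deriv_ofParts hf.absCont hg.absCont)).2
      (memLp_ofParts hf.memLp_deriv hg.memLp_deriv)⟩

theorem ofParts_re_im (f : ℝ → ℂ) : ofParts (fun x => (f x).re) (fun x => (f x).im) = f :=
  funext fun x => Complex.re_add_im (f x)

theorem memH1_re_im {f : ℝ → ℂ} (hf : MemH1 f) :
    MemH1 (fun x => (f x).re) ∧ MemH1 fun x => (f x).im := by
  have h1 : ∀ a b, AbsolutelyContinuousOnInterval (fun x => (f x).re) a b := fun a b =>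
    absCont_of_dist_le (hf.absCont a b) fun x y => by
      rw [dist_eq_norm, dist_eq_norm, ← Complex.sub_re]
      exact Complex.abs_re_le_norm _
  have h2 : ∀ a b, AbsolutelyContinuousOnInterval (fun x => (f x).im) a b := fun a b =>
    absCont_of_dist_le (hf.absCont a b) fun x y => by
      rw [dist_eq_norm, dist_eq_norm, ← Complex.sub_im]
      exact Complex.abs_im_le_norm _
  have hd := ae_deriv_ofParts h1 h2
  rw [ofParts_re_im] at hd
  refine ⟨⟨h1, hf.memLp.re, (memLp_congr_ae (hd.mono fun x hx => ?_)).2 hf.memLp_deriv.re⟩,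
    ⟨h2, hf.memLp.im, (memLp_congr_ae (hd.mono fun x hx => ?_)).2 hf.memLp_deriv.im⟩⟩
  · simp [hx, ofParts]
  · simp [hx, ofParts]

theorem integral_ofParts {m : Measure ℝ} {r s : ℝ → ℝ} (hr : Integrable r m) (hs : Integrable s m) :
    ∫ x, ofParts r s x ∂m = (∫ x, r x ∂m : ℝ) + (∫ x, s x ∂m : ℝ) * Complex.I := by
  unfold ofParts
  rw [integral_add hr.ofReal (hs.ofReal.mul_const _), integral_mul_const]
  exact congrArg₂ (· + ·) integral_ofReal (congrArg (· * Complex.I) integral_ofReal)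

theorem ofParts_mul_ofReal (f g h : ℝ → ℝ) (x : ℝ) :
    ofParts f g x * (h x : ℂ) = ofParts (fun x => f x * h x) (fun x => g x * h x) x := by
  simp only [ofParts, Complex.ofReal_mul]
  ring

theorem ofReal_mul_ofParts (f g h : ℝ → ℝ) (x : ℝ) :
    (h x : ℂ) * ofParts f g x = ofParts (fun x => h x * f x) (fun x => h x * g x) x := by
  simp only [ofParts, Complex.ofReal_mul]
  ring

theorem ae_deriv_ofReal {h : ℝ → ℝ} (hh : ∀ a b, AbsolutelyContinuousOnInterval h a b) :
    ∀ᵐ x, deriv (fun x => (h x : ℂ)) x = (deriv h x : ℝ) := by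
  filter_upwards [ae_differentiableAt_of_absCont hh] with x h1
  exact h1.hasDerivAt.ofReal_comp.deriv

/-! ### The forms of the equation for a complex and a real function -/

section Forms

variable {u : ℝ → ℝ} {μ : Measure ℝ} (h : (u, μ) ∈ classE) (φ₁ φ₂ χ : HalfLineL2)

theorem energy_ofParts :
    (∫ x, deriv (ofParts (toLine φ₁) (toLine φ₂)) x * deriv (fun x => (toLine χ x : ℂ)) x) +
      (1 / 4 : ℂ) * (∫ x, ofParts (toLine φ₁) (toLine φ₂) x * (toLine χ x : ℂ)) =
    (inner ℝ φ₁ χ : ℝ) + (inner ℝ φ₂ χ : ℝ) * Complex.I := by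
  have h1 := memH1_toLine φ₁
  have h2 := memH1_toLine φ₂
  have hq := memH1_toLine χ
  have e1 : ∫ x, deriv (ofParts (toLine φ₁) (toLine φ₂)) x * deriv (fun x => (toLine χ x : ℂ)) x =
      ∫ x, ofParts (fun x => deriv (toLine φ₁) x * deriv (toLine χ) x)
        (fun x => deriv (toLine φ₂) x * deriv (toLine χ) x) x := by
    refine integral_congr_ae ?_
    filter_upwards [ae_deriv_ofParts h1.absCont h2.absCont, ae_deriv_ofReal hq.absCont] with x e1 e2
    rw [e1, e2, ofParts_mul_ofReal]
  simp only [e1, ofParts_mul_ofReal]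
  rw [integral_ofParts (h1.integrable_deriv_mul_deriv hq) (h2.integrable_deriv_mul_deriv hq),
    integral_ofParts (h1.integrable_mul hq) (h2.integrable_mul hq), inner_eq_integral_toLine,
    inner_eq_integral_toLine]
  push_cast
  ring

include h

theorem omega_ofParts :
    omega u (fun x => ofParts (toLine φ₁) (toLine φ₂) x * (toLine χ x : ℂ)) =
    (inner ℝ ((stringOf h).opL φ₁) χ + inner ℝ φ₁ ((stringOf h).opL χ) : ℝ) +
      (inner ℝ ((stringOf h).opL φ₂) χ + inner ℝ φ₂ ((stringOf h).opL χ) : ℝ) * Complex.I := by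
  have hu := memH1_of_mem h
  have h1 := (memH1_toLine φ₁).mul (memH1_toLine χ)
  have h2 := (memH1_toLine φ₂).mul (memH1_toLine χ)
  simp only [ofParts_mul_ofReal, omega, ofReal_mul_ofParts]
  have e1 : ∫ x, ((deriv u x : ℝ) : ℂ) * deriv (ofParts (fun x => toLine φ₁ x * toLine χ x)
      (fun x => toLine φ₂ x * toLine χ x)) x =
      ∫ x, ofParts (fun x => deriv u x * deriv (fun x => toLine φ₁ x * toLine χ x) x)
        (fun x => deriv u x * deriv (fun x => toLine φ₂ x * toLine χ x) x) x := by
    refine integral_congr_ae ?_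
    filter_upwards [ae_deriv_ofParts h1.absCont h2.absCont] with x e1
    rw [e1, ofReal_mul_ofParts]
  have e2 := integral_ofParts (hu.integrable_mul h1) (hu.integrable_mul h2)
  have e3 := integral_ofParts (hu.integrable_deriv_mul_deriv h1) (hu.integrable_deriv_mul_deriv h2)
  rw [inner_opL_add_stringOf, inner_opL_add_stringOf]
  refine (congrArg₂ (· + ·) e2 (e1.trans e3)).trans ?_
  push_cast
  ring

theorem integrable_toLine_mul_upsilon (φ χ : HalfLineL2) :
    Integrable (fun x => toLine φ x * toLine χ x) (upsilon u μ) := by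
  have := isFiniteMeasure_upsilon h
  refine Integrable.of_bound (((continuous_toLine φ).mul (continuous_toLine χ)).aestronglyMeasurable)
    (‖φ‖ * ‖χ‖) (Eventually.of_forall fun x => ?_)
  rw [norm_mul]
  gcongr
  · exact abs_le_of_sq_le_sq (sq_toLine_le φ x) (norm_nonneg φ)
  · exact abs_le_of_sq_le_sq (sq_toLine_le χ x) (norm_nonneg χ)

theorem integral_upsilon_ofParts :
    ∫ x, ofParts (toLine φ₁) (toLine φ₂) x * (toLine χ x : ℂ) ∂(upsilon u μ) =
    (inner ℝ ((stringOf h).opJ φ₁) ((stringOf h).opJ χ) : ℝ) +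
      (inner ℝ ((stringOf h).opJ φ₂) ((stringOf h).opJ χ) : ℝ) * Complex.I := by
  simp only [ofParts_mul_ofReal]
  rw [integral_ofParts (integrable_toLine_mul_upsilon h φ₁ χ)
    (integrable_toLine_mul_upsilon h φ₂ χ), inner_opJ_stringOf, inner_opJ_stringOf]

end Forms

/-! ### Compactly supported test functions -/

/-- The derivative of the piecewise linear function that rises from `0` to `1` on `[a, b]` and falls
back to `0` on `[b, c]`. -/
noncomputable def tent (a b c : ℝ) : HalfLineL2 := (b - a)⁻¹ • indIoc a b - (c - b)⁻¹ • indIoc b c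

theorem prim_tent {a b c : ℝ} (ha : 0 ≤ a) (hab : a < b) (hbc : b < c) {y : ℝ} (hy : y ≤ a ∨ c ≤ y) :
    prim (tent a b c) y = 0 := by
  have h1 : prim (tent a b c) y =
      (b - a)⁻¹ * prim (indIoc a b) y - (c - b)⁻¹ * prim (indIoc b c) y := by
    have := map_sub (primL y) ((b - a)⁻¹ • indIoc a b) ((c - b)⁻¹ • indIoc b c)
    rwa [map_smul, map_smul] at this
  rw [h1, prim_indIoc ha, prim_indIoc (ha.trans hab.le)]
  rcases hy with hy | hy
  · rw [min_eq_left (by linarith), min_eq_left (by linarith), max_eq_right (by linarith),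
      max_eq_right (by linarith), mul_zero, mul_zero, sub_zero]
  · rw [min_eq_right (by linarith), min_eq_right (by linarith), max_eq_left (by linarith),
      max_eq_left (by linarith), inv_mul_cancel₀ (by linarith), inv_mul_cancel₀ (by linarith),
      sub_self]

theorem hasCompactSupport_toLine_tent {a b c : ℝ} (ha : 0 < a) (hab : a < b) (hbc : b < c) :
    HasCompactSupport (toLine (tent a b c)) := by
  refine HasCompactSupport.intro (isCompact_Icc (a := Real.log a) (b := Real.log c)) fun x hx => ?_
  rw [toLine, prim_tent ha.le hab hbc, mul_zero]
  rw [Set.mem_Icc, not_and_or, not_le, not_le] at hx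
  refine hx.imp (fun h => ?_) fun h => ?_
  · exact ((Real.lt_log_iff_exp_lt ha).1 h).le
  · exact ((Real.log_lt_iff_lt_exp (by linarith)).1 h).le

/-- Letting `c → ∞` shows that a function orthogonal to all tents has vanishing integral over every
interval. -/
theorem eq_zero_of_inner_tent {ξ : HalfLineL2}
    (h : ∀ a b c, 0 < a → a < b → b < c → inner ℝ (tent a b c) ξ = 0) : ξ = 0 := by
  have h1 : ∀ a b c, 0 < a → a < b → b < c →
      (b - a)⁻¹ * (∫ t in Set.Ioc a b, ξ t) = (c - b)⁻¹ * ∫ t in Set.Ioc b c, ξ t := by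
    intro a b c ha hab hbc
    have := h a b c ha hab hbc
    rw [tent, inner_sub_left, inner_smul_left, inner_smul_left, inner_indIoc ha.le,
      inner_indIoc (ha.trans hab).le] at this
    exact sub_eq_zero.1 this
  have h2 : ∀ a b, 0 < a → a < b → ∫ t in Set.Ioc a b, ξ t = 0 := by
    intro a b ha hab
    set A := (b - a)⁻¹ * ∫ t in Set.Ioc a b, ξ t with hA
    -- The mean `A` of `ξ` over `(a, b]` is also its mean over `(b, b + d]` for every `d`, which is at most
    -- `‖ξ‖ / √d` in modulus.
    have hA2 : ∀ d : ℝ, 0 < d → A ^ 2 * d ≤ ‖ξ‖ ^ 2 := by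
      intro d hd
      have e1 := h1 a b (b + d) ha hab (by linarith)
      have hb : 0 ≤ b := (ha.trans hab).le
      have e2 := sq_prim_sub_le ξ hb (by linarith : b ≤ b + d)
      rw [prim_sub_prim ξ hb (by linarith)] at e2
      rw [add_sub_cancel_left] at e1 e2
      have e3 : ∫ t in Set.Ioc b (b + d), ξ t ^ 2 ≤ ‖ξ‖ ^ 2 := by
        rw [← real_inner_self_eq_norm_sq, inner_eq_integral]
        simp only [← sq]
        exact setIntegral_mono_set (Lp.memLp ξ).integrable_sq
          (Eventually.of_forall fun _ => sq_nonneg _) (Ioc_subset_Ioi_zero hb).eventuallyLE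
      have e4 : ∫ t in Set.Ioc b (b + d), ξ t = d * A := by
        rw [hA, e1, mul_inv_cancel_left₀ hd.ne']
      rw [e4] at e2
      have e5 : d * (A ^ 2 * d) ≤ d * ‖ξ‖ ^ 2 := by nlinarith
      exact le_of_mul_le_mul_left e5 hd
    have hA0 : A = 0 := by
      by_contra hne
      have hpos : 0 < A ^ 2 := by positivity
      have := hA2 ((‖ξ‖ ^ 2 + 1) / A ^ 2) (by positivity)
      rw [mul_div_cancel₀ _ hpos.ne'] at this
      linarith
    exact (mul_eq_zero.1 hA0).resolve_left (inv_ne_zero (by linarith))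
  refine eq_zero_of_prim_eq_zero fun y => ?_
  rcases le_or_gt y 0 with hy | hy
  · exact prim_of_nonpos ξ hy
  have h3 : ∀ a ∈ Set.Ioo 0 y, prim ξ a = prim ξ y := by
    intro a ha
    have := prim_sub_prim ξ ha.1.le ha.2.le
    rw [h2 a y ha.1 ha.2] at this
    linarith
  have h4 : Tendsto (prim ξ) (𝓝[>] 0) (𝓝 (prim ξ 0)) :=
    ((continuous_prim ξ).tendsto 0).mono_left nhdsWithin_le_nhds
  have h5 : Tendsto (prim ξ) (𝓝[>] 0) (𝓝 (prim ξ y)) :=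
    tendsto_const_nhds.congr' (by
      filter_upwards [Ioo_mem_nhdsGT hy] with a ha
      exact (h3 a ha).symm)
  rw [tendsto_nhds_unique h5 h4, prim_of_nonpos ξ le_rfl]

theorem dense_span_tent : Dense (Submodule.span ℝ
    {χ : HalfLineL2 | ∃ a b c, 0 < a ∧ a < b ∧ b < c ∧ χ = tent a b c} : Set HalfLineL2) := by
  rw [Submodule.dense_iff_topologicalClosure_eq_top, Submodule.topologicalClosure_eq_top_iff,
    Submodule.eq_bot_iff]
  intro ξ hξ
  refine eq_zero_of_inner_tent fun a b c ha hab hbc => ?_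
  exact (Submodule.mem_orthogonal _ _).1 hξ _ (Submodule.subset_span ⟨a, b, c, ha, hab, hbc, rfl⟩)

/-! ### The spectrum -/

/-- A quadratic equation `z² j + z k = c` with `c > 0` and `j ≥ 0` has real roots only. -/
theorem im_eq_zero_of_quadratic {z : ℂ} {c k j : ℝ} (hc : 0 < c) (hj : 0 ≤ j)
    (h : (c : ℂ) = z * k + z ^ 2 * j) : z.im = 0 ∧ z ≠ 0 := by
  constructor
  · have hre := congrArg Complex.re h
    have him := congrArg Complex.im h
    simp only [sq, Complex.ofReal_re, Complex.add_re, Complex.mul_re, Complex.ofReal_im,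
      Complex.add_im, Complex.mul_im, mul_zero, sub_zero, zero_add] at hre him
    by_contra hne
    have h1 : k = -2 * z.re * j := by
      have : z.im * (k + 2 * z.re * j) = 0 := by linarith
      linarith [(mul_eq_zero.1 this).resolve_left hne]
    rw [h1] at hre
    nlinarith [mul_nonneg hj (mul_self_nonneg z.re), mul_nonneg hj (mul_self_nonneg z.im)]
  · rintro rfl
    simp [hc.ne'] at h

/-- The functional `χ ↦ ⟨ψ₁, χ⟩ + i ⟨ψ₂, χ⟩`. -/
noncomputable def complexPairing (ψ₁ ψ₂ : HalfLineL2) : HalfLineL2 →L[ℝ] ℂ :=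
  Complex.ofRealCLM ∘L innerSL ℝ ψ₁ + Complex.I • (Complex.ofRealCLM ∘L innerSL ℝ ψ₂)

theorem complexPairing_apply (ψ₁ ψ₂ χ : HalfLineL2) : complexPairing ψ₁ ψ₂ χ =
    (inner ℝ ψ₁ χ : ℝ) + (inner ℝ ψ₂ χ : ℝ) * Complex.I := by
  rw [mul_comm]
  rfl

section Spectrum

variable {u : ℝ → ℝ} {μ : Measure ℝ} (h : (u, μ) ∈ classE)

namespace HalfLineString

variable (S : HalfLineString)

/-- A nonzero `φ` with `φ = t (L + L*) φ + t² J* J φ` gives the eigenvector `(φ, t J φ)`. -/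
theorem mem_charValues {t : ℝ} (ht : t ≠ 0) {φ : HalfLineL2} (hφ : φ ≠ 0)
    (heq : φ = t • (S.opL φ + S.opL.adjoint φ) + t ^ 2 • S.opJ.adjoint (S.opJ φ)) :
    t ∈ S.charValues := by
  refine ⟨ht, WithLp.toLp 2 (φ, t • S.opJ φ), fun h0 => hφ ?_, ?_⟩
  · exact congrArg WithLp.fst h0
  · have h1 : (t • S.op (WithLp.toLp 2 (φ, t • S.opJ φ))).fst = φ := by
      change t • (S.op (WithLp.toLp 2 (φ, t • S.opJ φ))).fst = φ
      rw [op_fst]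
      change t • (S.opL φ + S.opL.adjoint φ + S.opJ.adjoint (t • S.opJ φ)) = φ
      rw [map_smul, smul_add, smul_smul, ← sq]
      exact heq.symm
    have h2 : (t • S.op (WithLp.toLp 2 (φ, t • S.opJ φ))).snd = t • S.opJ φ := rfl
    exact WithLp.ofLp_injective 2 (Prod.ext h1 h2)

theorem exists_of_mem_charValues {t : ℝ} (ht : t ∈ S.charValues) : ∃ φ : HalfLineL2, φ ≠ 0 ∧
    φ = t • (S.opL φ + S.opL.adjoint φ) + t ^ 2 • S.opJ.adjoint (S.opJ φ) := by
  obtain ⟨ht0, x, hx, hxt⟩ := ht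
  have h1 : t • (S.op x).fst = x.fst := congrArg WithLp.fst hxt
  have h2 : t • (S.op x).snd = x.snd := congrArg WithLp.snd hxt
  rw [op_snd] at h2
  rw [op_fst, ← h2, map_smul, smul_add, smul_smul, ← sq] at h1
  refine ⟨x.fst, fun h0 => hx ?_, h1.symm⟩
  rw [h0, map_zero, smul_zero] at h2
  exact WithLp.ofLp_injective 2 (Prod.ext h0 h2.symm)

theorem inner_symm_opL (φ χ : HalfLineL2) : inner ℝ (S.opL φ + S.opL.adjoint φ) χ =
    inner ℝ (S.opL φ) χ + inner ℝ φ (S.opL χ) := by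
  rw [inner_add_left, ContinuousLinearMap.adjoint_inner_left]

theorem inner_adjoint_opJ (φ χ : HalfLineL2) : inner ℝ (S.opJ.adjoint (S.opJ φ)) χ =
    inner ℝ (S.opJ φ) (S.opJ χ) := ContinuousLinearMap.adjoint_inner_left _ _ _

end HalfLineString

/-- Testing with tents turns the weak equation into an equation between functionals on
`L²(0, ∞)`. -/
theorem complexPairing_eq_of_isSolution {z : ℂ} {φ₁ φ₂ : HalfLineL2}
    (hsol : IsSolution u μ z (ofParts (toLine φ₁) (toLine φ₂))) :
    complexPairing φ₁ φ₂ =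
      z • complexPairing ((stringOf h).opL φ₁ + (stringOf h).opL.adjoint φ₁)
        ((stringOf h).opL φ₂ + (stringOf h).opL.adjoint φ₂) +
      z ^ 2 • complexPairing ((stringOf h).opJ.adjoint ((stringOf h).opJ φ₁))
        ((stringOf h).opJ.adjoint ((stringOf h).opJ φ₂)) := by
  refine ContinuousLinearMap.ext_on dense_span_tent ?_
  rintro χ ⟨a, b, c, ha, hab, hbc, rfl⟩
  have hH1 : MemH1 (fun x => (toLine (tent a b c) x : ℂ)) := by
    have h0 : MemH1 (0 : ℝ → ℝ) := by
      have := memH1_toLine 0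
      rwa [toLine_eq_zero_iff.2 rfl] at this
    have := memH1_ofParts (memH1_toLine (tent a b c)) h0
    have e : ofParts (toLine (tent a b c)) 0 = fun x => (toLine (tent a b c) x : ℂ) := by
      funext x
      simp [ofParts]
    rwa [e] at this
  have hsupp : HasCompactSupport (fun x => (toLine (tent a b c) x : ℂ)) :=
    (hasCompactSupport_toLine_tent ha hab hbc).comp_left Complex.ofReal_zero
  have := hsol.2 _ ⟨hH1, hsupp⟩
  rw [energy_ofParts, omega_ofParts h, integral_upsilon_ofParts h] at this
  change _ = z • complexPairing _ _ _ + z ^ 2 • complexPairing _ _ _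
  rw [complexPairing_apply, complexPairing_apply, complexPairing_apply, smul_eq_mul, smul_eq_mul,
    (stringOf h).inner_symm_opL, (stringOf h).inner_symm_opL, (stringOf h).inner_adjoint_opJ,
    (stringOf h).inner_adjoint_opJ]
  exact this

/-- Pairing the equation with the complex conjugate of a solution gives a quadratic equation for `z`,
which shows that `z` is real; then the real and the imaginary part of the solution both solve the
equation, and one of them is nonzero. -/
theorem exists_charValue_of_mem_spectrumSet {z : ℂ} (hz : z ∈ spectrumSet u μ) :
    ∃ t ∈ (stringOf h).charValues, (t : ℂ) = z := by
  obtain ⟨f, hsol, hf, hf0⟩ := hz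
  set S := stringOf h with hS
  obtain ⟨φ₁, h1⟩ := exists_toLine_eq (memH1_re_im hf).1
  obtain ⟨φ₂, h2⟩ := exists_toLine_eq (memH1_re_im hf).2
  have hfφ : f = ofParts (toLine φ₁) (toLine φ₂) := by rw [h1, h2, ofParts_re_im]
  rw [hfφ] at hsol
  have hE := complexPairing_eq_of_isSolution h hsol
  have hne : φ₁ ≠ 0 ∨ φ₂ ≠ 0 := by
    by_contra! hno
    refine hf0 ?_
    rw [hfφ, toLine_eq_zero_iff.2 hno.1, toLine_eq_zero_iff.2 hno.2]
    funext x
    simp [ofParts]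
  have hEχ : ∀ χ, (inner ℝ φ₁ χ : ℝ) + (inner ℝ φ₂ χ : ℝ) * Complex.I =
      z * ((inner ℝ (S.opL φ₁ + S.opL.adjoint φ₁) χ : ℝ) +
        (inner ℝ (S.opL φ₂ + S.opL.adjoint φ₂) χ : ℝ) * Complex.I) +
      z ^ 2 * ((inner ℝ (S.opJ.adjoint (S.opJ φ₁)) χ : ℝ) +
        (inner ℝ (S.opJ.adjoint (S.opJ φ₂)) χ : ℝ) * Complex.I) := by
    intro χ
    have := DFunLike.congr_fun hE χ
    change _ = z • complexPairing _ _ _ + z ^ 2 • complexPairing _ _ _ at this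
    rwa [complexPairing_apply, complexPairing_apply, complexPairing_apply, smul_eq_mul,
      smul_eq_mul] at this
  -- pair the equation with the complex conjugate of the solution
  have hquad : ((‖φ₁‖ ^ 2 + ‖φ₂‖ ^ 2 : ℝ) : ℂ) =
      z * ((2 * inner ℝ (S.opL φ₁) φ₁ + 2 * inner ℝ (S.opL φ₂) φ₂ : ℝ) : ℂ) +
        z ^ 2 * ((‖S.opJ φ₁‖ ^ 2 + ‖S.opJ φ₂‖ ^ 2 : ℝ) : ℂ) := by
    have e1 := hEχ φ₁
    have e2 := hEχ φ₂
    simp only [S.inner_symm_opL, S.inner_adjoint_opJ, real_inner_self_eq_norm_sq] at e1 e2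
    rw [real_inner_comm (S.opL φ₁) φ₁, real_inner_comm (S.opL φ₁) φ₂, real_inner_comm φ₁ φ₂,
      real_inner_comm (S.opJ φ₁) (S.opJ φ₂)] at e1
    rw [real_inner_comm (S.opL φ₂) φ₂, real_inner_comm (S.opL φ₂) φ₁] at e2
    push_cast at e1 e2 ⊢
    linear_combination e1 - Complex.I * e2 +
      ((‖φ₂‖ : ℂ) ^ 2 - z * (2 * (inner ℝ (S.opL φ₂) φ₂ : ℝ)) - z ^ 2 * (‖S.opJ φ₂‖ : ℂ) ^ 2) *
        Complex.I_sq
  have hpos : 0 < ‖φ₁‖ ^ 2 + ‖φ₂‖ ^ 2 := by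
    rcases hne with h0 | h0
    · have := norm_pos_iff.2 h0
      positivity
    · have := norm_pos_iff.2 h0
      positivity
  obtain ⟨him, hz0⟩ := im_eq_zero_of_quadratic hpos (by positivity) hquad
  obtain ⟨t, rfl⟩ : ∃ t : ℝ, (t : ℂ) = z := ⟨z.re, Complex.ext (by simp) (by simp [him])⟩
  have ht0 : t ≠ 0 := fun h0 => hz0 (by rw [h0, Complex.ofReal_zero])
  refine ⟨t, ?_, rfl⟩
  have hparts : ∀ χ,
      inner ℝ φ₁ χ = inner ℝ (t • (S.opL φ₁ + S.opL.adjoint φ₁) +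
        t ^ 2 • S.opJ.adjoint (S.opJ φ₁)) χ ∧
      inner ℝ φ₂ χ = inner ℝ (t • (S.opL φ₂ + S.opL.adjoint φ₂) +
        t ^ 2 • S.opJ.adjoint (S.opJ φ₂)) χ := by
    intro χ
    have e := hEχ χ
    rw [inner_add_left, inner_add_left, inner_smul_left, inner_smul_left, inner_smul_left,
      inner_smul_left]
    have hre := congrArg Complex.re e
    have him := congrArg Complex.im e
    simp [sq] at hre him
    simp only [conj_trivial, sq]
    exact ⟨hre, him⟩
  rcases hne with h0 | h0
  · exact S.mem_charValues ht0 h0 (ext_inner_right ℝ fun χ => (hparts χ).1)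
  · exact S.mem_charValues ht0 h0 (ext_inner_right ℝ fun χ => (hparts χ).2)

theorem ofReal_mem_spectrumSet {t : ℝ} (ht : t ∈ (stringOf h).charValues) :
    (t : ℂ) ∈ spectrumSet u μ := by
  set S := stringOf h with hS
  obtain ⟨φ, hφ0, hφ⟩ := S.exists_of_mem_charValues ht
  have h0 : MemH1 (0 : ℝ → ℝ) := by
    have := memH1_toLine 0
    rwa [toLine_eq_zero_iff.2 rfl] at this
  have e0 : (fun x => (toLine φ x : ℂ)) = ofParts (toLine φ) 0 := by
    funext x
    simp [ofParts]
  have hH1 : MemH1 (fun x => (toLine φ x : ℂ)) := by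
    rw [e0]
    exact memH1_ofParts (memH1_toLine φ) h0
  refine ⟨fun x => (toLine φ x : ℂ), ⟨⟨hH1.absCont, fun a b =>
    hH1.memLp_deriv.mono_measure Measure.restrict_le_self⟩, fun q hq => ?_⟩, hH1, fun hf => ?_⟩
  · obtain ⟨χ₁, h1⟩ := exists_toLine_eq (memH1_re_im hq.1).1
    obtain ⟨χ₂, h2⟩ := exists_toLine_eq (memH1_re_im hq.1).2
    have hqχ : q = ofParts (toLine χ₁) (toLine χ₂) := by rw [h1, h2, ofParts_re_im]
    have hχ : ∀ χ : HalfLineL2, (inner ℝ χ φ : ℝ) =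
        t * (inner ℝ (S.opL χ) φ + inner ℝ χ (S.opL φ)) +
          t ^ 2 * inner ℝ (S.opJ χ) (S.opJ φ) := by
      intro χ
      nth_rw 1 [hφ]
      rw [real_inner_comm, inner_add_left, inner_smul_left, inner_smul_left, S.inner_symm_opL,
        S.inner_adjoint_opJ, real_inner_comm (S.opL χ) φ, real_inner_comm (S.opL φ) χ,
        real_inner_comm (S.opJ χ) (S.opJ φ)]
      simp only [conj_trivial]
      ring
    subst hqχ
    simp only [mul_comm (deriv (fun x => (toLine φ x : ℂ)) _), mul_comm (toLine φ _ : ℂ)]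
    rw [energy_ofParts, omega_ofParts h, integral_upsilon_ofParts h, hχ χ₁, hχ χ₂]
    push_cast
    ring
  · refine hφ0 (toLine_eq_zero_iff.1 (funext fun x => ?_))
    have := congrFun hf x
    simpa using this

/-- The spectrum consists of the characteristic values of the block operator. -/
theorem spectrumSet_eq : spectrumSet u μ = (fun t : ℝ => (t : ℂ)) '' (stringOf h).charValues := by
  ext z
  constructor
  · intro hz
    obtain ⟨t, ht, rfl⟩ := exists_charValue_of_mem_spectrumSet h hz
    exact ⟨t, ht, rfl⟩
  · rintro ⟨t, ht, rfl⟩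
    exact ofReal_mem_spectrumSet h ht

theorem spectrumSet_inter_ball (r : ℝ) : {z ∈ spectrumSet u μ | ‖z‖ ≤ r} =
    (fun t : ℝ => (t : ℂ)) '' {t ∈ (stringOf h).charValues | |t| ≤ r} := by
  rw [spectrumSet_eq h]
  ext z
  constructor
  · rintro ⟨⟨t, ht, rfl⟩, hr⟩
    exact ⟨t, ⟨ht, by simpa using hr⟩, rfl⟩
  · rintro ⟨t, ⟨ht, hr⟩, rfl⟩
    exact ⟨⟨t, ht, rfl⟩, by simpa using hr⟩

include h

theorem isDiscreteNonzeroReal_spectrumSet : IsDiscreteNonzeroReal (spectrumSet u μ) := by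
  refine ⟨fun z hz => ?_, fun r => ?_⟩
  · rw [spectrumSet_eq h] at hz
    obtain ⟨t, ht, rfl⟩ := hz
    exact ⟨Complex.ofReal_im t, Complex.ofReal_ne_zero.2 ht.1⟩
  · rw [spectrumSet_inter_ball h]
    exact ((stringOf h).finite_charValues r).image _

theorem hasPrincipalSum_spectrumSet :
    HasPrincipalSum (spectrumSet u μ) ((∫ x, u x : ℝ) : ℂ) := by
  have h1 := (Complex.continuous_ofReal.tendsto _).comp (stringOf h).tendsto_finsum_charValues
  rw [integral_κ_stringOf] at h1
  refine h1.congr fun r => ?_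
  have hfin := (stringOf h).finite_charValues r
  rw [spectrumSet_inter_ball h, finsum_mem_image Complex.ofReal_injective.injOn, Function.comp,
    finsum_mem_eq_finite_toFinset_sum _ hfin, finsum_mem_eq_finite_toFinset_sum _ hfin]
  push_cast
  rfl

theorem hasSum_spectrumSet :
    HasSum (fun z : spectrumSet u μ => 1 / (z : ℂ) ^ 2) (2 * ((μ Set.univ).toReal : ℂ)) := by
  have h1 := (stringOf h).hasSum_charValues
  rw [moment_stringOf] at h1
  have hbij : Set.BijOn (fun t : ℝ => (t : ℂ)) (stringOf h).charValues (spectrumSet u μ) := by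
    rw [spectrumSet_eq h]
    exact Complex.ofReal_injective.injOn.bijOn_image
  rw [← hbij.equiv.hasSum_iff]
  have h2 := Complex.hasSum_ofReal.2 h1
  push_cast at h2
  exact h2

end Spectrum

end CamassaHolm

theorem mainTheorem5 (u : ℝ → ℝ) (μ : MeasureTheory.Measure ℝ)
    (h : (u, μ) ∈ CamassaHolm.classE) :
    CamassaHolm.IsDiscreteNonzeroReal (CamassaHolm.spectrumSet u μ) ∧
    MeasureTheory.Integrable u ∧
    CamassaHolm.HasPrincipalSum (CamassaHolm.spectrumSet u μ) ((∫ x, u x : ℝ) : ℂ) ∧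
    Summable (fun z : CamassaHolm.spectrumSet u μ => 1 / (z : ℂ) ^ 2) ∧
    (1 / 2 : ℂ) * ∑' z : CamassaHolm.spectrumSet u μ, 1 / (z : ℂ) ^ 2 =
      ((μ Set.univ).toReal : ℂ) := by
  have hsum := CamassaHolm.hasSum_spectrumSet h
  refine ⟨CamassaHolm.isDiscreteNonzeroReal_spectrumSet h, CamassaHolm.integrable_of_mem h,
    CamassaHolm.hasPrincipalSum_spectrumSet h, hsum.summable, ?_⟩
  rw [hsum.tsum_eq]
  ring
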